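/- Let $e>0$, $L>0$, $k_n=2\pi n/L$. *Fock space.* Let $\mathcal F$ be the complex vector space with basis $\Omega_{\mathbf m,\mathbf n}$ indexed by pairs of finite subsets of $\mathbb Z$, with fermion operators $b_n,b_n^\dagger$ and anti-fermion operators $c_n,c_n^\dagger$ satisfying $\{b_n,b_{n'}^\dagger\}=\{c_n,c_{n'}^\dagger\}=\delta_{nn'}$ (other anticommutators zero), $b_n\Omega_0=c_n\Omega_0=0$ for $\Omega_0=\Omega_{\emptyset,\emptyset}$, and $\Omega_{\mathbf m,\mathbf n}=\prod b^\dagger_{m_i}\prod c^\dagger_{n_j}\Omega_0$ (indices increasing from left to right). Let $\mathcal F_0$ be the span of those with $|\mathbf m|=|\mathbf n|$, $\mathcal H_0$ its completion for the inner product in which these vectors are orthonormal, and $\mathcal K=L^2([0,\frac{2\pi}L];\mathcal H_0)$. *Large gauge transformation.* $\Gamma$ is the operator with $\Gamma\Omega_0=b_{-1}^\dagger c_1^\dagger\Omega_0$, $\Gamma b_n^\dagger\Gamma^{-1}=b_{n-1}^\dagger$ and $\Gamma c_n^\dagger\Gamma^{-1}=c_{n+1}^\dagger$ for $n\ne0$,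 $\Gamma b_0^\dagger\Gamma^{-1}=c_1$, $\Gamma c_0^\dagger\Gamma^{-1}=b_{-1}$. Let $\mathcal D\subset\mathcal K$ be the space of restrictions to $[0,\frac{2\pi}L]$ of the smooth functions $\Psi:\mathbb R\to\mathcal F_0$ with $\Psi(a+\frac{2\pi}L)=\Gamma^{-1}\Psi(a)$ for all $a$; here smooth means that near each point $\Psi$ is a finite linear combination of the $\Omega_{\mathbf m,\mathbf n}$ with $C^\infty$ coefficients. *Hamiltonian.* Let $Q^5=\sum_{n\ge0}b_n^\dagger b_n-\sum_{n<0}b_n^\dagger b_n-\sum_{n>0}c_n^\dagger c_n+\sum_{n\le0}c_n^\dagger c_n$ and $Q^{5,reg}=Q^5-\frac{aL}\pi-1$. For $m\ge1$ let $$\varrho^R(m)=-\sum_{k>m}c_k^\dagger c_{k-m}+\sum_{0<k\le m}b_{m-k}^\dagger c_k^\dagger+\sum_{k\ge0}b_{k+m}^\dagger b_k,$$ $$\varrho^L(m)=\sum_{k<-m}b_{k+m}^\dagger b_k+\sum_{-m\le k<0}c_{-k-m}b_k-\sum_{k\le0}c_k^\dagger c_{k-m},$$ and let $\varrho^{R}(-m),\varrho^L(-m)$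 be their formal adjoints. Let $H=H_0+{:}H_{coul}{:}$ on $\mathcal D$, where $$H_0=-\frac{e^2}{2L}\frac{d^2}{da^2}+\sum_{m\in\mathbb Z}|k_m|(b_m^\dagger b_m+c_m^\dagger c_m)-\frac{a^2L}{2\pi}-aQ^{5,reg},$$ $${:}H_{coul}{:}=\frac{e^2}{2L}\sum_{m\ne0}\frac1{k_m^2}\,{:}(\varrho^R(m)+\varrho^L(m))(\varrho^R(-m)+\varrho^L(-m)){:}\,,$$ normal ordering putting the annihilators $\varrho^R(-m),\varrho^L(m)$ ($m\ge1$) to the right. *Bogoliubov transformation.* Let $\zeta(m)\in\mathbb R$ be given by $\tanh2\zeta(m)=-\frac{\lambda V_m}{\lambda V_m+\pi}$ with $\lambda=\frac{e^2}2$, $V_m=k_m^{-2}$, and let $Z=\frac{2\pi i}L\sum_{m\ne0}\frac{\zeta(m)}{k_m}\varrho^R(m)\varrho^L(-m)$ on $\mathcal F_0\subset\mathcal H_0$. **Theorem.** There is a unique strongly continuous one-parameter group of unitary operators $e^{itZ}$ on $\mathcal H_0$ whose generator is $i$ times the closure of $Z$. Put $U=e^{iZ}$, acting pointwise on $\mathcal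 K$, and $\mathbf H=UHU^{-1}$, where $H$ denotes the closure of the operator given on $\mathcal D$. Then $\mathcal D$ is contained in the domain of $\mathbf H$, and $\mathbf H$ is essentially self-adjoint on $\mathcal D$: its restriction to $\mathcal D$ is densely defined and symmetric, and the closure of that restriction is self-adjoint. -/

import Mathlib

open MeasureTheory
open scoped ContDiff Topology InnerProductSpace

noncomputable section

namespace Schwinger

/-! ### Unbounded operators on a Hilbert space -/

section Operators

variable {E : Type*} [NormedAddCommGroup E] [InnerProductSpace ℂ E] [CompleteSpace E]

/-- `A` is essentially self-adjoint (on its own domain): it is densely defined and symmetric, and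
its closure is self-adjoint. -/
def IsEssentiallySelfAdjoint (A : E →ₗ.[ℂ] E) : Prop :=
  Dense (A.domain : Set E) ∧ A.IsFormalAdjoint A ∧ IsSelfAdjoint A.closure

/-- `V t = exp (i t A)`: `V` is a strongly continuous one-parameter group of unitary operators
whose infinitesimal generator is exactly `i A`. -/
structure IsUnitaryGroupGeneratedBy (A : E →ₗ.[ℂ] E) (V : ℝ → E ≃ₗᵢ[ℂ] E) : Prop where
  map_zero : V 0 = LinearIsometryEquiv.refl ℂ E
  map_add : ∀ s t : ℝ, V (s + t) = (V t).trans (V s)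
  continuous : ∀ x : E, Continuous fun t : ℝ => V t x
  generator : ∀ x y : E,
    (x, y) ∈ A.graph ↔ HasDerivAt (fun t : ℝ => V t x) (Complex.I • y) 0

/-- The operator `W A W⁻¹`, with domain `W (dom A)`. -/
def conjugate (W : E ≃ₗᵢ[ℂ] E) (A : E →ₗ.[ℂ] E) : E →ₗ.[ℂ] E where
  domain := A.domain.comap (W.symm.toLinearEquiv : E →ₗ[ℂ] E)
  toFun := (W.toLinearEquiv : E →ₗ[ℂ] E) ∘ₗ A.toFun ∘ₗ
    (W.symm.toLinearEquiv : E →ₗ[ℂ] E).restrict (fun _ hx => hx)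

/-- The operator `j v ↦ A v` with domain the range of `j`. -/
def operatorOnRange {X F : Type*} [AddCommGroup X] [Module ℂ X] [AddCommGroup F] [Module ℂ F]
    (j A : X →ₗ[ℂ] F)
    (h : ∀ x, j x = 0 → A x = 0) : F →ₗ.[ℂ] F where
  domain := LinearMap.range j
  toFun := (LinearMap.ker j).liftQ A h ∘ₗ j.quotKerEquivRange.symm.toLinearMap

end Operators

/-! ### The fermionic Fock space -/

/-- A basis state `Ω_{m,n}` is labelled by the finite set `m` of occupied fermion modes and the
finite set `n` of occupied anti-fermion modes. -/
abbrev Occ : Type := Finset ℤ × Finset ℤ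

/-- The space `𝓕` of finite particle states, with basis the `Ω_{m,n}`. -/
abbrev Fin𝓕 : Type := Occ →₀ ℂ

/-- `Ω_{m,n} = ∏ b†_{m_i} ∏ c†_{n_j} Ω₀`, each product being ordered with the indices increasing
from left to right. -/
def Ω (s : Occ) : Fin𝓕 := Finsupp.single s 1

/-- The linear operator on `𝓕`, or from `𝓕` to another space, with given values on the basis. -/
def ofBasis {M : Type*} [AddCommGroup M] [Module ℂ M] (f : Occ → M) : Fin𝓕 →ₗ[ℂ] M :=
  Finsupp.linearCombination ℂ f

/-- Fermion creation operator `b†_k`. -/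
def bDag (k : ℤ) : Module.End ℂ Fin𝓕 := ofBasis fun s =>
  if k ∈ s.1 then 0 else (-1 : ℂ) ^ (s.1.filter (· < k)).card • Ω (insert k s.1, s.2)

/-- Fermion annihilation operator `b_k`. -/
def bAnn (k : ℤ) : Module.End ℂ Fin𝓕 := ofBasis fun s =>
  if k ∈ s.1 then (-1 : ℂ) ^ (s.1.filter (· < k)).card • Ω (s.1.erase k, s.2) else 0

/-- Anti-fermion creation operator `c†_k`. -/
def cDag (k : ℤ) : Module.End ℂ Fin𝓕 := ofBasis fun s =>
  if k ∈ s.2 then 0 else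
    (-1 : ℂ) ^ (s.1.card + (s.2.filter (· < k)).card) • Ω (s.1, insert k s.2)

/-- Anti-fermion annihilation operator `c_k`. -/
def cAnn (k : ℤ) : Module.End ℂ Fin𝓕 := ofBasis fun s =>
  if k ∈ s.2 then
    (-1 : ℂ) ^ (s.1.card + (s.2.filter (· < k)).card) • Ω (s.1, s.2.erase k) else 0

/-- Zero charge: equally many fermions and anti-fermions. -/
abbrev Neutral : Type := {s : Occ // s.1.card = s.2.card}

/-- The zero charge finite particle states `𝓕₀`. -/
def 𝓕₀ : Submodule ℂ Fin𝓕 := Finsupp.supported ℂ ℂ {s : Occ | s.1.card = s.2.card}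

/-- The zero charge Fock space: the Hilbert space with orthonormal basis the neutral
`Ω_{m,n}`. -/
abbrev ℋ₀ : Type := lp (fun _ : Neutral => ℂ) 2

/-- The inclusion of `𝓕₀` in `ℋ₀` (charged components, absent in `𝓕₀`, are discarded). -/
def toℋ₀ : Fin𝓕 →ₗ[ℂ] ℋ₀ := ofBasis fun s =>
  if h : s.1.card = s.2.card then lp.single 2 (⟨s, h⟩ : Neutral) (1 : ℂ) else 0

/-- The sum of a family of operators on `𝓕` of which only finitely many are nonzero on any given
basis state. -/
def opSum {ι : Type*} (A : ι → Module.End ℂ Fin𝓕) : Module.End ℂ Fin𝓕 :=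
  ofBasis fun s => ∑ᶠ i, A i (Ω s)

/-- The momenta `k_n = 2πn/L`. -/
def mom (L : ℝ) (n : ℤ) : ℝ := 2 * n * Real.pi / L

/-- The free Dirac Hamiltonian `∑ |k_m| (b†_m b_m + c†_m c_m)`. -/
def diracHam (L : ℝ) : Module.End ℂ Fin𝓕 :=
  opSum fun m : ℤ => ((|mom L m| : ℝ) : ℂ) • (bDag m * bAnn m + cDag m * cAnn m)

/-- The axial charge `Q⁵`. -/
def axialCharge : Module.End ℂ Fin𝓕 :=
  opSum fun n : ℤ => (if 0 ≤ n then (1 : ℂ) else -1) • (bDag n * bAnn n) +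
    (if 0 < n then (-1 : ℂ) else 1) • (cDag n * cAnn n)

/-- The regularized axial charge `Q⁵ - aL/π - 1`. -/
def axialChargeReg (L a : ℝ) : Module.End ℂ Fin𝓕 :=
  axialCharge - ((a * L / Real.pi + 1 : ℝ) : ℂ) • 1

/-! ### The large gauge transformation -/

/-- `Γ b†_n Γ⁻¹`. -/
def gaugeB (n : ℤ) : Module.End ℂ Fin𝓕 := if n = 0 then cAnn 1 else bDag (n - 1)

/-- `Γ c†_n Γ⁻¹`. -/
def gaugeC (n : ℤ) : Module.End ℂ Fin𝓕 := if n = 0 then bAnn (-1) else cDag (n + 1)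

/-- The generator `Γ` of the large gauge transformations: `Γ Ω₀ = b†_{-1} c†_1 Ω₀`, and `Γ`
conjugates the creation operators into `gaugeB` and `gaugeC`. -/
def gauge : Module.End ℂ Fin𝓕 := ofBasis fun s =>
  (((s.1.sort (· ≤ ·)).map gaugeB).prod * ((s.2.sort (· ≤ ·)).map gaugeC).prod)
    (bDag (-1) (cDag 1 (Ω (∅, ∅))))

/-! ### Density operators -/

/-- `ϱᴿ(m)` for `m > 0`. -/
def rhoRPos (m : ℤ) : Module.End ℂ Fin𝓕 :=
  -opSum (fun k : Set.Ioi m => cDag k * cAnn (k - m))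
    + opSum (fun k : Set.Ioc 0 m => bDag (-k + m) * cDag k)
    + opSum (fun k : Set.Ici (0 : ℤ) => bDag (k + m) * bAnn k)

/-- `ϱᴿ(-m)` for `m > 0`. -/
def rhoRNeg (m : ℤ) : Module.End ℂ Fin𝓕 :=
  -opSum (fun k : Set.Ioi m => cDag (k - m) * cAnn k)
    + opSum (fun k : Set.Ioc 0 m => cAnn k * bAnn (-k + m))
    + opSum (fun k : Set.Ici (0 : ℤ) => bDag k * bAnn (k + m))

/-- `ϱᴸ(m)` for `m > 0`. -/
def rhoLPos (m : ℤ) : Module.End ℂ Fin𝓕 :=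
  opSum (fun k : Set.Iio (-m) => bDag (k + m) * bAnn k)
    + opSum (fun k : Set.Ico (-m) 0 => cAnn (-k - m) * bAnn k)
    - opSum (fun k : Set.Iic (0 : ℤ) => cDag k * cAnn (k - m))

/-- `ϱᴸ(-m)` for `m > 0`. -/
def rhoLNeg (m : ℤ) : Module.End ℂ Fin𝓕 :=
  opSum (fun k : Set.Iio (-m) => bDag k * bAnn (k + m))
    + opSum (fun k : Set.Ico (-m) 0 => bDag k * cDag (-k - m))
    - opSum (fun k : Set.Iic (0 : ℤ) => cDag (k - m) * cAnn k)

/-- `ϱᴿ(m)` for a nonzero integer `m`. -/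
def rhoR (m : ℤ) : Module.End ℂ Fin𝓕 := if 0 < m then rhoRPos m else rhoRNeg (-m)

/-- `ϱᴸ(m)` for a nonzero integer `m`. -/
def rhoL (m : ℤ) : Module.End ℂ Fin𝓕 := if 0 < m then rhoLPos m else rhoLNeg (-m)

/-! ### The Coulomb energy and the Bogoliubov transformation -/

/-- `:ȷ⁰(-m) ȷ⁰(m):`, the annihilators being `ϱᴿ(-m)` and `ϱᴸ(m)` with `m > 0`. -/
def currentSq (L : ℝ) (m : ℤ) : Module.End ℂ Fin𝓕 :=
  ((1 / L ^ 2 : ℝ) : ℂ) •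
    ((if 0 < m then rhoR m * rhoR (-m) else rhoR (-m) * rhoR m)
      + rhoL m * rhoR (-m) + rhoR m * rhoL (-m)
      + (if 0 < m then rhoL (-m) * rhoL m else rhoL m * rhoL (-m)))

/-- `:H_coul: = (e²L/2) ∑_{m ≠ 0} k_m⁻² :ȷ⁰(-m) ȷ⁰(m):`, the series converging in `ℋ₀` on finite
particle states. -/
def coulomb (e L : ℝ) : Fin𝓕 →ₗ[ℂ] ℋ₀ := ofBasis fun s =>
  ((e ^ 2 * L / 2 : ℝ) : ℂ) • ∑' m : {m : ℤ // m ≠ 0},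
    ((1 / mom L m ^ 2 : ℝ) : ℂ) • toℋ₀ (currentSq L m (Ω s))

/-- The real solution `ζ(m)` of `λ V_m / (λ V_m + π) = - tanh (2 ζ(m))`, where `λ = e²/2` and
`V_m = k_m⁻²`. -/
def zeta (e L : ℝ) (m : ℤ) : ℝ :=
  -(1 / 2) * Real.artanh
    (e ^ 2 / 2 * (1 / mom L m ^ 2) / (e ^ 2 / 2 * (1 / mom L m ^ 2) + Real.pi))

/-- `(2πi/L) ∑_{m ≠ 0} (ζ(m)/k_m) ϱᴿ(m) ϱᴸ(-m)`, the series converging in `ℋ₀` on finite particle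
states. -/
def bogoliubovSum (e L : ℝ) : Fin𝓕 →ₗ[ℂ] ℋ₀ := ofBasis fun s =>
  (((2 * Real.pi / L : ℝ) : ℂ) * Complex.I) • ∑' m : {m : ℤ // m ≠ 0},
    ((zeta e L m / mom L m : ℝ) : ℂ) • toℋ₀ ((rhoR m * rhoL (-m)) (Ω s))

lemma toℋ₀_apply (f : Fin𝓕) (s : Neutral) : (toℋ₀ f : Neutral → ℂ) s = f s := by
  induction f using Finsupp.induction_linear with
  | zero => simp
  | add f g hf hg => simp [map_add, hf, hg]
  | single t c =>
    by_cases h : t.1.card = t.2.card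
    · simp only [toℋ₀, ofBasis, Finsupp.linearCombination_single, h, dif_pos, lp.coeFn_smul,
        Pi.smul_apply, lp.single_apply, Finsupp.single_apply]
      by_cases hs : t = (s : Occ)
      · have : s = ⟨t, h⟩ := Subtype.ext hs.symm
        subst this
        simp
      · have : s ≠ ⟨t, h⟩ := fun h' => hs (by rw [h'])
        simp [this, hs]
    · have : t ≠ (s : Occ) := fun h' => h (by rw [h']; exact s.2)
      simp [toℋ₀, ofBasis, h, this]

lemma eq_zero_of_toℋ₀ {f : Fin𝓕} (hf : f ∈ 𝓕₀) (h : toℋ₀ f = 0) : f = 0 := by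
  ext s
  by_cases hs : s.1.card = s.2.card
  · have := toℋ₀_apply f ⟨s, hs⟩
    rw [h] at this
    simpa using this.symm
  · by_contra h0
    exact hs ((Finsupp.mem_supported ℂ f).1 hf (Finsupp.mem_support_iff.2 h0))

/-- The operator `Z` with domain `𝓕₀`. -/
def bogoliubovZ (e L : ℝ) : ℋ₀ →ₗ.[ℂ] ℋ₀ :=
  operatorOnRange (X := 𝓕₀) (toℋ₀ ∘ₗ 𝓕₀.subtype) (bogoliubovSum e L ∘ₗ 𝓕₀.subtype) (by
    intro f hf
    have : (f : Fin𝓕) = 0 := eq_zero_of_toℋ₀ f.2 (by simpa using hf)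
    simp [this])

/-! ### The Hilbert space of the model and the domain `𝒟` -/

/-- The measure underlying `𝒦`: Lebesgue measure on `[0, 2π/L]`. -/
abbrev circleMeasure (L : ℝ) : Measure ℝ := volume.restrict (Set.Icc 0 (2 * Real.pi / L))

/-- `𝒦 = L²([0, 2π/L]; ℋ₀)`. -/
abbrev 𝒦 (L : ℝ) : Type := Lp ℋ₀ 2 (circleMeasure L)

/-- A smooth `𝓕₀`-valued function. Smoothness refers to `𝓕₀` as the union of its finite-dimensional
coordinate subspaces: near each point the function is a finite linear combination of basis states,
with smooth coefficients. -/
structure IsSmooth (Ψ : ℝ → Fin𝓕) : Prop where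
  mem : ∀ a, Ψ a ∈ 𝓕₀
  locally_finite : ∀ a, ∃ S : Finset Occ, ∀ᶠ b in 𝓝 a, (Ψ b).support ⊆ S
  contDiff : ∀ s, ContDiff ℝ ∞ fun a => Ψ a s

/-- The smooth `𝓕₀`-valued functions with `Ψ(a + 2π/L) = Γ⁻¹ Ψ(a)` for all `a`. -/
def 𝒟 (L : ℝ) : Submodule ℂ (ℝ → Fin𝓕) where
  carrier := {Ψ | IsSmooth Ψ ∧ ∀ a, gauge (Ψ (a + 2 * Real.pi / L)) = Ψ a}
  zero_mem' := ⟨⟨fun _ => 𝓕₀.zero_mem, fun _ => ⟨∅, by simp⟩, fun _ => contDiff_const⟩,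
    fun _ => by simp⟩
  add_mem' := by
    rintro Ψ Φ ⟨h, h'⟩ ⟨k, k'⟩
    refine ⟨⟨fun a => 𝓕₀.add_mem (h.mem a) (k.mem a), fun a => ?_,
      fun s => (h.contDiff s).add (k.contDiff s)⟩, fun a => by simp [h', k']⟩
    obtain ⟨S, hS⟩ := h.locally_finite a
    obtain ⟨R, hR⟩ := k.locally_finite a
    classical
    refine ⟨S ∪ R, ?_⟩
    filter_upwards [hS, hR] with b h1 h2
    exact Finsupp.support_add.trans (Finset.union_subset_union h1 h2)
  smul_mem' := by
    rintro c Ψ ⟨h, h'⟩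
    refine ⟨⟨fun a => 𝓕₀.smul_mem c (h.mem a), fun a => ?_,
      fun s => contDiff_const.mul (h.contDiff s)⟩, fun a => by simp [h']⟩
    obtain ⟨S, hS⟩ := h.locally_finite a
    refine ⟨S, ?_⟩
    filter_upwards [hS] with b h1
    exact Finsupp.support_smul.trans h1

lemma IsSmooth.contDiff_comp {Ψ : ℝ → Fin𝓕} (h : IsSmooth Ψ) (A : Fin𝓕 →ₗ[ℂ] ℋ₀) :
    ContDiff ℝ ∞ fun a => A (Ψ a) := by
  rw [contDiff_iff_contDiffAt]
  intro a
  obtain ⟨S, hS⟩ := h.locally_finite a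
  have key : (fun b => A (Ψ b)) =ᶠ[𝓝 a] fun b => ∑ s ∈ S, Ψ b s • A (Ω s) := by
    filter_upwards [hS] with b hb
    conv_lhs => rw [← Finsupp.sum_single (Ψ b)]
    rw [Finsupp.sum_of_support_subset _ hb _ (by simp), map_sum]
    refine Finset.sum_congr rfl fun s _ => ?_
    rw [Ω, ← map_smul, Finsupp.smul_single, smul_eq_mul, mul_one]
  refine ContDiffAt.congr_of_eventuallyEq ?_ key
  exact ContDiffAt.sum fun s _ => ((h.contDiff s).contDiffAt).smul contDiffAt_const

lemma IsSmooth.contDiffAt_two {Ψ : ℝ → Fin𝓕} (h : IsSmooth Ψ) (a : ℝ) :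
    ContDiffAt ℝ (2 : ℕ) (fun a => toℋ₀ (Ψ a)) a :=
  ((contDiff_infty.1 (h.contDiff_comp toℋ₀)) 2).contDiffAt

lemma memLp_of_continuous (L : ℝ) {f : ℝ → ℋ₀} (hf : Continuous f) :
    MemLp f 2 (circleMeasure L) := by
  obtain ⟨C, hC⟩ := isCompact_Icc.exists_bound_of_continuousOn
    (s := Set.Icc 0 (2 * Real.pi / L)) hf.continuousOn
  refine MemLp.of_bound hf.aestronglyMeasurable C ?_
  filter_upwards [ae_restrict_mem measurableSet_Icc] with a ha using hC a ha

/-- The inclusion of `𝒟` in `𝒦`: restriction to `[0, 2π/L]`. -/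
def incl (L : ℝ) : 𝒟 L →ₗ[ℂ] 𝒦 L where
  toFun Ψ := (memLp_of_continuous L (Ψ.2.1.contDiff_comp toℋ₀).continuous).toLp
  map_add' Ψ Φ := by
    rw [← MemLp.toLp_add]
    congr 1
    funext a
    simp
  map_smul' c Ψ := by
    rw [RingHom.id_apply, ← MemLp.toLp_const_smul]
    congr 1
    funext a
    simp

/-! ### The Hamiltonian -/

/-- The part of `H = H₀ + :H_coul:` which acts on `𝓕₀` at fixed `a`, that is
`∑ |k_m| (b†_m b_m + c†_m c_m) - a²L/(2π) - a Q^{5,reg} + :H_coul:`. -/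
def potential (e L a : ℝ) : Fin𝓕 →ₗ[ℂ] ℋ₀ :=
  toℋ₀ ∘ₗ (diracHam L - ((a ^ 2 * L / (2 * Real.pi) : ℝ) : ℂ) • 1
    - (a : ℂ) • axialChargeReg L a) + coulomb e L

/-- `(HΨ)(a) = -(e²/2L) Ψ''(a) + potential(a) Ψ(a)`. -/
def hamFun (e L : ℝ) (Ψ : ℝ → Fin𝓕) (a : ℝ) : ℋ₀ :=
  -(((e ^ 2 / (2 * L) : ℝ) : ℂ) • iteratedDeriv 2 (fun b => toℋ₀ (Ψ b)) a) +
    potential e L a (Ψ a)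

lemma continuous_hamFun (e L : ℝ) {Ψ : ℝ → Fin𝓕} (h : IsSmooth Ψ) :
    Continuous (hamFun e L Ψ) := by
  have h1 : Continuous (iteratedDeriv 2 fun b => toℋ₀ (Ψ b)) :=
    ((contDiff_infty.1 (h.contDiff_comp toℋ₀)) 2).continuous_iteratedDeriv 2 le_rfl
  have h2 : ∀ A : Fin𝓕 →ₗ[ℂ] ℋ₀, Continuous fun a => A (Ψ a) :=
    fun A => (h.contDiff_comp A).continuous
  have e1 := h2 toℋ₀
  have e2 := h2 (toℋ₀ ∘ₗ diracHam L)
  have e3 := h2 (toℋ₀ ∘ₗ axialCharge)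
  have e4 := h2 (coulomb e L)
  simp only [LinearMap.comp_apply] at e2 e3
  suffices h3 : Continuous fun a => potential e L a (Ψ a) from
    ((h1.const_smul ((e ^ 2 / (2 * L) : ℝ) : ℂ)).neg.add h3 :)
  simp only [potential, axialChargeReg, LinearMap.add_apply, LinearMap.comp_apply,
    LinearMap.sub_apply, LinearMap.smul_apply, map_sub, map_smul, Module.End.one_apply]
  fun_prop

/-- `H` as a map from `𝒟` to `𝒦`. -/
def hamMap (e L : ℝ) : 𝒟 L →ₗ[ℂ] 𝒦 L where
  toFun Ψ := (memLp_of_continuous L (continuous_hamFun e L Ψ.2.1)).toLp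
  map_add' Ψ Φ := by
    rw [← MemLp.toLp_add]
    congr 1
    funext a
    have := iteratedDeriv_fun_add (Ψ.2.1.contDiffAt_two a) (Φ.2.1.contDiffAt_two a)
    simp only [hamFun, Submodule.coe_add, Pi.add_apply, map_add, this, smul_add]
    abel
  map_smul' c Ψ := by
    rw [RingHom.id_apply, ← MemLp.toLp_const_smul]
    congr 1
    funext a
    have := iteratedDeriv_fun_const_smul (Ψ.2.1.contDiffAt_two a) c
    simp only [hamFun, Submodule.coe_smul, Pi.smul_apply, map_smul, this, smul_add, smul_neg]
    rw [smul_comm]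

lemma hamMap_eq_zero (e L : ℝ) (Ψ : 𝒟 L) (hΨ : incl L Ψ = 0) : hamMap e L Ψ = 0 := by
  have hc : Continuous fun a => toℋ₀ (Ψ.1 a) := (Ψ.2.1.contDiff_comp toℋ₀).continuous
  have h0 : (fun a => toℋ₀ (Ψ.1 a)) =ᵐ[circleMeasure L] 0 := by
    have h := (memLp_of_continuous L hc).coeFn_toLp
    have h' : (memLp_of_continuous L hc).toLp = 0 := hΨ
    rw [h'] at h
    exact h.symm.trans (Lp.coeFn_zero ℋ₀ 2 (circleMeasure L))
  have h1 : (fun a => toℋ₀ (Ψ.1 a)) =ᵐ[volume.restrict (Set.Ioo 0 (2 * Real.pi / L))] 0 :=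
    ae_mono (Measure.restrict_mono Set.Ioo_subset_Icc_self le_rfl) h0
  have h2 : Set.EqOn (fun a => toℋ₀ (Ψ.1 a)) 0 (Set.Ioo 0 (2 * Real.pi / L)) :=
    Measure.eqOn_open_of_ae_eq h1 isOpen_Ioo hc.continuousOn continuousOn_const
  have h3 : hamFun e L Ψ.1 =ᵐ[circleMeasure L] 0 := by
    rw [circleMeasure, ← restrict_Ioo_eq_restrict_Icc]
    filter_upwards [ae_restrict_mem measurableSet_Ioo] with a ha
    have hz : Ψ.1 a = 0 := eq_zero_of_toℋ₀ (Ψ.2.1.mem a) (h2 ha)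
    have hd : iteratedDeriv 2 (fun b => toℋ₀ (Ψ.1 b)) a = 0 := by
      have : (fun b => toℋ₀ (Ψ.1 b)) =ᶠ[𝓝 a] fun _ => 0 := by
        filter_upwards [isOpen_Ioo.mem_nhds ha] with b hb using h2 hb
      rw [this.iteratedDeriv_eq]
      simp
    simp [hamFun, hz, hd]
  refine Lp.ext ?_
  exact ((memLp_of_continuous L (continuous_hamFun e L Ψ.2.1)).coeFn_toLp.trans h3).trans
    (Lp.coeFn_zero ℋ₀ 2 (circleMeasure L)).symm

/-- The Hamiltonian `H = H₀ + :H_coul:` as an operator in `𝒦` with domain `𝒟`. -/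
def hamiltonian (e L : ℝ) : 𝒦 L →ₗ.[ℂ] 𝒦 L :=
  operatorOnRange (X := 𝒟 L) (F := 𝒦 L) (incl L) (hamMap e L) (hamMap_eq_zero e L)

/-- A unitary operator on `ℋ₀` acting pointwise on `𝒦`. -/
def pointwise (L : ℝ) (U : ℋ₀ ≃ₗᵢ[ℂ] ℋ₀) : 𝒦 L ≃ₗᵢ[ℂ] 𝒦 L where
  toLinearEquiv := LinearEquiv.ofLinearMap
    ((U.toContinuousLinearEquiv : ℋ₀ →L[ℂ] ℋ₀).compLpL 2 (circleMeasure L)).toLinearMap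
    ((U.symm.toContinuousLinearEquiv : ℋ₀ →L[ℂ] ℋ₀).compLpL 2 (circleMeasure L)).toLinearMap
    (by
      ext1 F
      refine Lp.ext ?_
      have h1 := (U.toContinuousLinearEquiv : ℋ₀ →L[ℂ] ℋ₀).coeFn_compLpL
        ((U.symm.toContinuousLinearEquiv : ℋ₀ →L[ℂ] ℋ₀).compLpL 2 (circleMeasure L) F)
      have h2 := (U.symm.toContinuousLinearEquiv : ℋ₀ →L[ℂ] ℋ₀).coeFn_compLpL F
      filter_upwards [h1, h2] with a e1 e2
      refine e1.trans ?_
      rw [e2]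
      simp)
    (by
      ext1 F
      refine Lp.ext ?_
      have h1 := (U.symm.toContinuousLinearEquiv : ℋ₀ →L[ℂ] ℋ₀).coeFn_compLpL
        ((U.toContinuousLinearEquiv : ℋ₀ →L[ℂ] ℋ₀).compLpL 2 (circleMeasure L) F)
      have h2 := (U.toContinuousLinearEquiv : ℋ₀ →L[ℂ] ℋ₀).coeFn_compLpL F
      filter_upwards [h1, h2] with a e1 e2
      refine e1.trans ?_
      rw [e2]
      simp)
  norm_map' F := by
    have h1 := (U.toContinuousLinearEquiv : ℋ₀ →L[ℂ] ℋ₀).coeFn_compLpL F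
    rw [Lp.norm_def, Lp.norm_def]
    congr 1
    refine eLpNorm_congr_norm_ae ?_
    filter_upwards [h1] with a e1
    simpa using congrArg norm e1

/-- `U H U⁻¹` with its natural domain, `H` being the closure of the Hamiltonian given on `𝒟`. -/
def dressed (e L : ℝ) (U : ℋ₀ ≃ₗᵢ[ℂ] ℋ₀) : 𝒦 L →ₗ.[ℂ] 𝒦 L :=
  conjugate (pointwise L U) (hamiltonian e L).closure

end Schwinger

end

open MeasureTheory
open scoped ContDiff Topology InnerProductSpace

noncomputable section

namespace Schwinger


/-! ### Creation and annihilation operators -/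

/-! Write `E` for the energy in units of `2π/L`. Once the left movers are numbered by the opposite
of their momentum, both chiral fields are families of fermion components over a Dirac sea, and the
densities become the bilinears `dens σ m`. Commuting two of them is a translation of a sum over
sites; since the sea is infinite, the translation leaves a Schwinger term, so that `dens σ (-m)` and
`dens σ m` obey the commutation relations of a boson (`dens_neg_dens`), while densities of different
chirality, or with indices not summing to zero, commute. Three more facts about them are used: `dens
σ m` raises `E` by `m`, `E` dominates the quadratic forms of the annihilation parts
(`IsHom.sum_norm_sq_dens_le`), and `Γ`, which translates the sites of each sea by one, commutes with
every density (`gauge_dens`).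

The generator. The energy bound shows that `∑ g a ϱᴿ(a) ϱᴸ(-a)` is bounded relative to `E + 1` as
soon as `a * g a` is square summable (`norm_sum_pairOp_le`). As `ζ(a)` is `O(a⁻²)`, this applies
both to `Z` and to the commutator of `E` with `Z`, which is the setting of the commutator theorem
for essential self-adjointness. The group is constructed by hand: cut `Z` off at energy `n`,
exponentiate, bound the growth of the energy by Grönwall uniformly in `n`
(`RelBounded.norm_B_flow_le`), and deduce that the cutoff groups converge strongly. The limit
preserves the domain of `E`, so its generator is exactly the closure of `Z` (`RelBounded.gen_iff`);
a symmetric generator determines its group (`eq_of_gen`).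

Diagonalization. For each `m > 0`, commutation with `Z` exchanges the operators `numOp m + m` and
`mixOp m`, up to the factor `2ζ(m)`. Their matrix elements along the group therefore undergo a
hyperbolic rotation, and the value of `tanh 2ζ(m)` is the one that removes `mixOp m` at time one.
Hence `U` turns `(2π/L) E + :H_coul:` into `(2π/L) E + ∑ (ω_m - 2π/L) numOp m` plus a constant
(`dressed_eq`). On energy `N` only the modes `m ≤ N` contribute, so the result acts on
finite-dimensional energy spaces and is diagonalizable there.

Unwrapping. `Γ` lowers the axial charge, which is even on neutral states, by... the fixed step two
measured as in `axial_gauge`, so every neutral state is uniquely carried by a power of `Γ` into the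
sector without axial charge. A gauge covariant function on the circle thus corresponds to a
compactly supported function on the whole line with values in that sector (`fold`,
`exists_eq_sum_fold`). The energy changes quadratically under the powers of `Γ`, and together with
the terms in `a` this completes a square: on unwrapped functions `H` is a harmonic oscillator in `a`
plus the operator `(2π/L) E + :H_coul:` on the sector (`potential_zpow_gauge`, `hamFun_fold`).
Because `Γ` commutes with the pair operators, `U` acts on the sector alone.

Conclusion. Symmetry of `H` is integration by parts with boundary terms cancelled by covariance. The
vector `U⁻¹ v` is in general not a finite particle state, but it is a limit of such states along
which `H` converges too, so elementary covariant functions lie in the domain of the dressed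
operator. A deficiency vector is tested against `g ⊗ u`, with `u` an eigenvector in the sector;
there the dressed operator is a shifted oscillator, and an oscillator minus a nonreal number maps
test functions onto a dense subspace (`exists_osc_sub_close`). So the deficiency vector is
orthogonal to a total set and vanishes. -/

@[simp] lemma ofBasis_Ω {M : Type*} [AddCommGroup M] [Module ℂ M] (f : Occ → M) (s : Occ) :
    ofBasis f (Ω s) = f s := by
  simp [ofBasis, Ω]

lemma ext_Ω {M : Type*} [AddCommGroup M] [Module ℂ M] {A B : Fin𝓕 →ₗ[ℂ] M}
    (h : ∀ s, A (Ω s) = B (Ω s)) : A = B := by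
  refine Finsupp.lhom_ext fun s c => ?_
  have : (Finsupp.single s c : Fin𝓕) = c • Ω s := by simp [Ω]
  rw [this, map_smul, map_smul, h]

lemma sum_Ω (f : Fin𝓕) : f = ∑ s ∈ f.support, f s • Ω s := by
  conv_lhs => rw [← Finsupp.sum_single f]
  simp [Finsupp.sum, Ω]

lemma induction_Ω {P : Fin𝓕 → Prop} (h0 : P 0) (hadd : ∀ f g, P f → P g → P (f + g))
    (hsmul : ∀ (c : ℂ) f, P f → P (c • f)) (hΩ : ∀ s, P (Ω s)) (f : Fin𝓕) : P f := by
  induction f using Finsupp.induction_linear with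
  | zero => exact h0
  | add f g hf hg => exact hadd f g hf hg
  | single s c =>
    have : (Finsupp.single s c : Fin𝓕) = c • Ω s := by simp [Ω]
    rw [this]
    exact hsmul c _ (hΩ s)

/-- The one-particle modes: fermions (`inl`) before anti-fermions (`inr`). -/
abbrev Mode : Type := ℤ ⊕ ℤ

/-- The order in which the creation operators stand in `Ω s`. -/
def Below : Mode → Mode → Prop
  | .inl a, .inl b => a < b
  | .inl _, .inr _ => True
  | .inr _, .inl _ => False
  | .inr a, .inr b => a < b

instance (i j : Mode) : Decidable (Below i j) := by
  cases i <;> cases j <;> simp only [Below] <;> infer_instance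

/-- The mode `i` is occupied in the state `s`. -/
def Has : Mode → Occ → Prop
  | .inl k, s => k ∈ s.1
  | .inr k, s => k ∈ s.2

instance (i : Mode) (s : Occ) : Decidable (Has i s) := by
  cases i <;> simp only [Has] <;> infer_instance

/-- The state `s` with the mode `i` filled. -/
def fill : Mode → Occ → Occ
  | .inl k, s => (insert k s.1, s.2)
  | .inr k, s => (s.1, insert k s.2)

/-- The state `s` with the mode `i` emptied. -/
def clear : Mode → Occ → Occ
  | .inl k, s => (s.1.erase k, s.2)
  | .inr k, s => (s.1, s.2.erase k)

/-- The number of occupied modes before `i`. -/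
def countBelow : Mode → Occ → ℕ
  | .inl k, s => (s.1.filter (· < k)).card
  | .inr k, s => s.1.card + (s.2.filter (· < k)).card

/-- The creation operator of a mode. -/
def cre : Mode → Module.End ℂ Fin𝓕
  | .inl k => bDag k
  | .inr k => cDag k

/-- The annihilation operator of a mode. -/
def ann : Mode → Module.End ℂ Fin𝓕
  | .inl k => bAnn k
  | .inr k => cAnn k

lemma cre_Ω (i : Mode) (s : Occ) :
    cre i (Ω s) = if Has i s then 0 else (-1 : ℂ) ^ countBelow i s • Ω (fill i s) := by
  cases i <;> simp only [cre, bDag, cDag, ofBasis_Ω, Has, countBelow, fill]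

lemma ann_Ω (i : Mode) (s : Occ) :
    ann i (Ω s) = if Has i s then (-1 : ℂ) ^ countBelow i s • Ω (clear i s) else 0 := by
  cases i <;> simp only [ann, bAnn, cAnn, ofBasis_Ω, Has, countBelow, clear]

lemma has_fill {i j : Mode} {s : Occ} : Has j (fill i s) ↔ j = i ∨ Has j s := by
  cases i <;> cases j <;> simp [Has, fill]

lemma has_clear {i j : Mode} {s : Occ} : Has j (clear i s) ↔ j ≠ i ∧ Has j s := by
  cases i <;> cases j <;> simp [Has, clear]

lemma fill_comm (i j : Mode) (s : Occ) : fill i (fill j s) = fill j (fill i s) := by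
  cases i <;> cases j <;> simp [fill, Finset.insert_comm]

lemma clear_comm (i j : Mode) (s : Occ) : clear i (clear j s) = clear j (clear i s) := by
  cases i <;> cases j <;> simp [clear, Finset.erase_right_comm]

lemma fill_clear_comm {i j : Mode} (h : i ≠ j) (s : Occ) :
    fill i (clear j s) = clear j (fill i s) := by
  cases i <;> cases j <;> simp [fill, clear]
  all_goals
    rw [Finset.erase_insert_of_ne]
    simpa using h

lemma clear_fill {i : Mode} {s : Occ} (h : ¬ Has i s) : clear i (fill i s) = s := by
  cases i <;> simp [Has, fill, clear] at h ⊢ <;> simp [h]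

lemma fill_clear {i : Mode} {s : Occ} (h : Has i s) : fill i (clear i s) = s := by
  cases i <;> simp [Has, fill, clear] at h ⊢ <;> simp [h]

lemma below_irrefl (i : Mode) : ¬ Below i i := by
  cases i <;> simp [Below]

lemma below_trichotomy {i j : Mode} (h : i ≠ j) :
    (Below i j ∧ ¬ Below j i) ∨ (¬ Below i j ∧ Below j i) := by
  cases i <;> cases j <;> simp [Below] at h ⊢ <;> omega

lemma countBelow_fill {i j : Mode} {s : Occ} (h : ¬ Has i s) :
    countBelow j (fill i s) = countBelow j s + if Below i j then 1 else 0 := by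
  cases i with
  | inl a =>
    cases j with
    | inl b =>
      simp only [Has] at h
      by_cases hab : a < b
      · simp [countBelow, fill, Below, hab, Finset.filter_insert, h]
      · simp [countBelow, fill, Below, hab, Finset.filter_insert]
    | inr b =>
      simp only [Has] at h
      simp [countBelow, fill, Below, h]
      omega
  | inr a =>
    cases j with
    | inl b => simp [countBelow, fill, Below]
    | inr b =>
      simp only [Has] at h
      by_cases hab : a < b
      · simp [countBelow, fill, Below, hab, Finset.filter_insert, h]
        omega
      · simp [countBelow, fill, Below, hab, Finset.filter_insert]

lemma countBelow_clear {i j : Mode} {s : Occ} (h : Has i s) :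
    countBelow j s = countBelow j (clear i s) + if Below i j then 1 else 0 := by
  conv_lhs => rw [← fill_clear h]
  exact countBelow_fill (by simp [has_clear])

/-- For two distinct empty modes exactly one lies below the other. Filling that one first adds one
to the number of occupied modes counted by the other, while the opposite order does not; this is the
relative sign. The other anticommutators come from the same comparison. -/
lemma cre_cre (i j : Mode) : cre i * cre j = -(cre j * cre i) := by
  refine ext_Ω fun s => ?_
  simp only [Module.End.mul_apply, LinearMap.neg_apply, cre_Ω]
  by_cases hij : i = j
  · subst hij
    by_cases hi : Has i s <;> simp [hi, cre_Ω, has_fill]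
  by_cases hi : Has i s <;> by_cases hj : Has j s <;>
    simp [hi, hj, cre_Ω, has_fill, hij, Ne.symm hij]
  rw [countBelow_fill hj, countBelow_fill hi, fill_comm]
  rcases below_trichotomy hij with ⟨h1, h2⟩ | ⟨h1, h2⟩ <;>
    simp [h1, h2, smul_smul, pow_succ, mul_comm]

lemma ann_ann (i j : Mode) : ann i * ann j = -(ann j * ann i) := by
  refine ext_Ω fun s => ?_
  simp only [Module.End.mul_apply, LinearMap.neg_apply, ann_Ω]
  by_cases hij : i = j
  · subst hij
    by_cases hi : Has i s <;> simp [hi, ann_Ω, has_clear]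
  by_cases hi : Has i s <;> by_cases hj : Has j s <;>
    simp [hi, hj, ann_Ω, has_clear, hij, Ne.symm hij]
  rw [countBelow_clear (j := i) hj, countBelow_clear (j := j) hi, clear_comm]
  rcases below_trichotomy hij with ⟨h1, h2⟩ | ⟨h1, h2⟩ <;>
    simp [h1, h2, smul_smul, pow_succ, mul_comm]

lemma ann_cre_self (i : Mode) : ann i * cre i = 1 - cre i * ann i := by
  refine ext_Ω fun s => ?_
  simp only [Module.End.mul_apply, LinearMap.sub_apply, cre_Ω, ann_Ω, Module.End.one_apply]
  by_cases hi : Has i s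
  · simp [hi, cre_Ω, has_clear, fill_clear hi, smul_smul, countBelow_clear (j := i) hi,
      below_irrefl, ← pow_add, ← two_mul]
  · simp [hi, ann_Ω, has_fill, clear_fill hi, smul_smul, countBelow_fill (j := i) hi,
      below_irrefl, ← pow_add, ← two_mul]

lemma ann_cre_of_ne {i j : Mode} (hij : i ≠ j) : ann i * cre j = -(cre j * ann i) := by
  refine ext_Ω fun s => ?_
  simp only [Module.End.mul_apply, LinearMap.neg_apply, cre_Ω, ann_Ω]
  by_cases hi : Has i s <;> by_cases hj : Has j s <;>
    simp [hi, hj, ann_Ω, cre_Ω, has_clear, has_fill, hij, Ne.symm hij]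
  rw [countBelow_clear (j := j) hi, countBelow_fill (j := i) hj, fill_clear_comm (Ne.symm hij)]
  rcases below_trichotomy hij with ⟨h1, h2⟩ | ⟨h1, h2⟩ <;>
    simp [h1, h2, smul_smul, pow_succ, mul_comm]

lemma cre_sq (i : Mode) : cre i * cre i = 0 := by
  refine ext_Ω fun s => ?_
  by_cases hi : Has i s <;> simp [hi, cre_Ω, has_fill]

lemma ann_sq (i : Mode) : ann i * ann i = 0 := by
  refine ext_Ω fun s => ?_
  by_cases hi : Has i s <;> simp [hi, ann_Ω, has_clear]

lemma cre_mul_ann_Ω (i : Mode) (s : Occ) :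
    (cre i * ann i) (Ω s) = if Has i s then Ω s else 0 := by
  by_cases hi : Has i s
  · simp [ann_Ω, hi, cre_Ω, has_clear, fill_clear hi, smul_smul, countBelow_clear (j := i) hi,
      below_irrefl, ← pow_add, ← two_mul]
  · simp [ann_Ω, hi]

lemma finite_has (s : Occ) : {i | Has i s}.Finite := by
  have : {i | Has i s} = Sum.inl '' (s.1 : Set ℤ) ∪ Sum.inr '' (s.2 : Set ℤ) := by
    ext i; cases i <;> simp [Has]
  rw [this]
  exact (s.1.finite_toSet.image _).union (s.2.finite_toSet.image _)

/-! ### The inner product of finite particle states -/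

/-- The inner product in which the basis states are orthonormal. -/
def ip (f g : Fin𝓕) : ℂ := f.sum fun s c => (starRingEnd ℂ) c * g s

lemma ip_eq_sum {f : Fin𝓕} {S : Finset Occ} (h : f.support ⊆ S) (g : Fin𝓕) :
    ip f g = ∑ s ∈ S, (starRingEnd ℂ) (f s) * g s :=
  Finsupp.sum_of_support_subset _ h _ (by simp)

lemma ip_add_left (f f' g : Fin𝓕) : ip (f + f') g = ip f g + ip f' g :=
  Finsupp.sum_add_index' (by simp) (by intros; simp [add_mul])

lemma ip_add_right (f g g' : Fin𝓕) : ip f (g + g') = ip f g + ip f g' := by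
  simp [ip, mul_add, Finsupp.sum_add]

lemma ip_smul_left (c : ℂ) (f g : Fin𝓕) : ip (c • f) g = (starRingEnd ℂ) c * ip f g := by
  rw [ip, Finsupp.sum_smul_index' (by simp), ip, Finsupp.mul_sum]
  simp [mul_assoc]

lemma ip_smul_right (c : ℂ) (f g : Fin𝓕) : ip f (c • g) = c * ip f g := by
  rw [ip, ip, Finsupp.mul_sum]
  simp [mul_left_comm]

@[simp] lemma ip_zero_left (g : Fin𝓕) : ip 0 g = 0 := by simp [ip]

@[simp] lemma ip_zero_right (f : Fin𝓕) : ip f 0 = 0 := by simp [ip]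

lemma ip_sum_left {ι : Type*} (S : Finset ι) (f : ι → Fin𝓕) (g : Fin𝓕) :
    ip (∑ i ∈ S, f i) g = ∑ i ∈ S, ip (f i) g := by
  classical
  induction S using Finset.induction_on with
  | empty => simp
  | insert a S ha ih => rw [Finset.sum_insert ha, Finset.sum_insert ha, ip_add_left, ih]

lemma ip_sum_right {ι : Type*} (S : Finset ι) (f : Fin𝓕) (g : ι → Fin𝓕) :
    ip f (∑ i ∈ S, g i) = ∑ i ∈ S, ip f (g i) := by
  classical
  induction S using Finset.induction_on with
  | empty => simp
  | insert a S ha ih => rw [Finset.sum_insert ha, Finset.sum_insert ha, ip_add_right, ih]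

lemma ip_Ω_left (s : Occ) (g : Fin𝓕) : ip (Ω s) g = g s := by
  simp [ip, Ω]

lemma ip_Ω_Ω (s t : Occ) : ip (Ω s) (Ω t) = if s = t then 1 else 0 := by
  rw [ip_Ω_left]
  simp [Ω, Finsupp.single_apply, eq_comm]

lemma ip_conj (f g : Fin𝓕) : (starRingEnd ℂ) (ip f g) = ip g f := by
  classical
  rw [ip_eq_sum (S := f.support ∪ g.support) Finset.subset_union_left,
    ip_eq_sum (S := f.support ∪ g.support) Finset.subset_union_right, map_sum]
  simp [mul_comm]

/-- `B` is the formal adjoint of `A`. -/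
def IsAdj (A B : Module.End ℂ Fin𝓕) : Prop := ∀ f g, ip (A f) g = ip f (B g)

lemma IsAdj.symm {A B : Module.End ℂ Fin𝓕} (h : IsAdj A B) : IsAdj B A := fun f g => by
  rw [← ip_conj, ← h, ip_conj]

lemma IsAdj.mul {A B A' B' : Module.End ℂ Fin𝓕} (h : IsAdj A B) (h' : IsAdj A' B') :
    IsAdj (A * A') (B' * B) := fun f g => by
  simp only [Module.End.mul_apply, h _ _, h' _ _]

lemma IsAdj.add {A B A' B' : Module.End ℂ Fin𝓕} (h : IsAdj A B) (h' : IsAdj A' B') :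
    IsAdj (A + A') (B + B') := fun f g => by
  simp only [LinearMap.add_apply, ip_add_left, ip_add_right, h _ _, h' _ _]

lemma IsAdj.of_basis {A B : Module.End ℂ Fin𝓕}
    (h : ∀ s t, ip (A (Ω s)) (Ω t) = ip (Ω s) (B (Ω t))) : IsAdj A B := by
  intro f g
  induction f using induction_Ω with
  | h0 => simp
  | hadd f f' h h' => rw [map_add, ip_add_left, ip_add_left, h, h']
  | hsmul c f h => rw [map_smul, ip_smul_left, ip_smul_left, h]
  | hΩ s =>
    induction g using induction_Ω with
    | h0 => simp
    | hadd f f' h h' => rw [map_add, ip_add_right, ip_add_right, h, h']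
    | hsmul c f h => rw [map_smul, ip_smul_right, ip_smul_right, h]
    | hΩ t => exact h s t

lemma isAdj_cre_ann (i : Mode) : IsAdj (cre i) (ann i) := by
  refine IsAdj.of_basis fun s t => ?_
  rw [cre_Ω, ann_Ω]
  by_cases hs : Has i s <;> by_cases ht : Has i t
  · have : s ≠ clear i t := fun h => by rw [h, has_clear] at hs; exact hs.1 rfl
    simp [hs, ht, ip_smul_right, ip_Ω_Ω, this]
  · simp [hs, ht]
  · by_cases h : fill i s = t
    · subst h
      simp [hs, ht, ip_smul_left, ip_smul_right, ip_Ω_Ω, clear_fill hs,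
        countBelow_fill (j := i) hs, below_irrefl]
    · have : s ≠ clear i t := fun h' => h (by rw [h', fill_clear ht])
      simp [hs, ht, ip_smul_left, ip_smul_right, ip_Ω_Ω, h, this]
  · have : fill i s ≠ t := fun h => ht (by rw [← h, has_fill]; exact Or.inl rfl)
    simp [hs, ht, ip_smul_left, ip_Ω_Ω, this]

/-! ### Sums of operators -/

/-- Only finitely many of the operators are nonzero on any given vector. -/
def LocFin {ι : Type*} (A : ι → Module.End ℂ Fin𝓕) : Prop := ∀ v, {i | A i v ≠ 0}.Finite

lemma LocFin.of_Ω {ι : Type*} {A : ι → Module.End ℂ Fin𝓕}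
    (h : ∀ s, {i | A i (Ω s) ≠ 0}.Finite) : LocFin A := by
  intro v
  induction v using induction_Ω with
  | h0 => simp
  | hadd f g hf hg =>
    refine (hf.union hg).subset fun i hi => ?_
    by_contra hc
    simp only [Set.mem_union, Set.mem_ofPred_eq, not_or, not_not] at hc hi
    exact hi (by rw [map_add, hc.1, hc.2, add_zero])
  | hsmul c f hf =>
    refine hf.subset fun i hi h0 => hi ?_
    rw [map_smul, h0, smul_zero]
  | hΩ s => exact h s

lemma LocFin.opSum_apply {ι : Type*} {A : ι → Module.End ℂ Fin𝓕} (h : LocFin A) (v : Fin𝓕) :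
    opSum A v = ∑ᶠ i, A i v := by
  induction v using induction_Ω with
  | h0 => simp
  | hadd f g hf hg =>
    rw [map_add, hf, hg, ← finsum_add_distrib (h f) (h g)]
    simp
  | hsmul c f hf =>
    rw [map_smul, hf, smul_finsum' c (h f)]
    simp
  | hΩ s => simp [opSum]

lemma LocFin.opSum_apply_sum {ι : Type*} {A : ι → Module.End ℂ Fin𝓕} (h : LocFin A) (v : Fin𝓕)
    {S : Finset ι} (hS : ∀ i, A i v ≠ 0 → i ∈ S) : opSum A v = ∑ i ∈ S, A i v := by
  rw [h.opSum_apply, finsum_eq_sum_of_support_subset]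
  intro i hi
  exact hS i hi

lemma LocFin.isAdj {ι : Type*} {A B : ι → Module.End ℂ Fin𝓕} (hA : LocFin A) (hB : LocFin B)
    (h : ∀ i, IsAdj (A i) (B i)) : IsAdj (opSum A) (opSum B) := by
  classical
  intro f g
  rw [hA.opSum_apply_sum f (S := (hA f).toFinset ∪ (hB g).toFinset) (by simp; tauto),
    hB.opSum_apply_sum g (S := (hA f).toFinset ∪ (hB g).toFinset) (by simp; tauto),
    ip_sum_left, ip_sum_right]
  exact Finset.sum_congr rfl fun i _ => h i f g

/-! ### Chiral fields -/

/-- The mode on which the `n`-th component of the right (`true`) or left (`false`) moving field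
acts. Left movers are numbered by the opposite of their momentum. -/
def modeOf : Bool → ℤ → Mode
  | true, n => if 0 ≤ n then .inl n else .inr (-n)
  | false, n => if 0 < n then .inl (-n) else .inr n

/-- Whether the `n`-th component of the field annihilates a fermion. -/
def IsPart : Bool → ℤ → Prop
  | true, n => 0 ≤ n
  | false, n => 0 < n

instance (σ : Bool) (n : ℤ) : Decidable (IsPart σ n) := by
  cases σ <;> simp only [IsPart] <;> infer_instance

/-- The components of the chiral fields. -/
def ψ (σ : Bool) (n : ℤ) : Module.End ℂ Fin𝓕 :=
  if IsPart σ n then ann (modeOf σ n) else cre (modeOf σ n)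

/-- The adjoints of the components of the chiral fields. -/
def ψd (σ : Bool) (n : ℤ) : Module.End ℂ Fin𝓕 :=
  if IsPart σ n then cre (modeOf σ n) else ann (modeOf σ n)

lemma modeOf_inj {σ τ : Bool} {n k : ℤ} (h : modeOf σ n = modeOf τ k) : σ = τ ∧ n = k := by
  cases σ <;> cases τ <;> simp only [modeOf] at h <;> split_ifs at h <;> simp at h ⊢ <;> omega

lemma modeOf_ne {σ τ : Bool} {n k : ℤ} (h : (σ, n) ≠ (τ, k)) : modeOf σ n ≠ modeOf τ k :=
  fun h' => h (by rw [(modeOf_inj h').1, (modeOf_inj h').2])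

lemma modeOf_ne_of_isPart {σ τ : Bool} {n k : ℤ} (h : IsPart σ n) (h' : ¬ IsPart τ k) :
    modeOf σ n ≠ modeOf τ k := by
  intro he
  obtain ⟨rfl, rfl⟩ := modeOf_inj he
  exact h' h

lemma end_neg_neg (A : Module.End ℂ Fin𝓕) : -(-A) = A := LinearMap.ext fun v => by simp

lemma ψ_ψ (σ τ : Bool) (n k : ℤ) : ψ σ n * ψ τ k = -(ψ τ k * ψ σ n) := by
  by_cases h : IsPart σ n <;> by_cases h' : IsPart τ k <;> simp only [ψ, h, h', if_true, if_false]
  · exact ann_ann _ _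
  · exact ann_cre_of_ne (modeOf_ne_of_isPart h h')
  · rw [ann_cre_of_ne (modeOf_ne_of_isPart h' h), end_neg_neg]
  · exact cre_cre _ _

lemma ψd_ψd (σ τ : Bool) (n k : ℤ) : ψd σ n * ψd τ k = -(ψd τ k * ψd σ n) := by
  by_cases h : IsPart σ n <;> by_cases h' : IsPart τ k <;>
    simp only [ψd, h, h', if_true, if_false]
  · exact cre_cre _ _
  · rw [ann_cre_of_ne (modeOf_ne_of_isPart h h').symm, end_neg_neg]
  · exact ann_cre_of_ne (modeOf_ne_of_isPart h' h).symm
  · exact ann_ann _ _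

lemma ψ_ψd_self (σ : Bool) (n : ℤ) : ψ σ n * ψd σ n = 1 - ψd σ n * ψ σ n := by
  by_cases h : IsPart σ n <;> simp only [ψ, ψd, h, if_true, if_false]
  · exact ann_cre_self _
  · rw [ann_cre_self]
    abel

lemma ψ_ψd_ne {σ τ : Bool} {n k : ℤ} (hne : (σ, n) ≠ (τ, k)) :
    ψ σ n * ψd τ k = -(ψd τ k * ψ σ n) := by
  have hm := modeOf_ne hne
  by_cases h : IsPart σ n <;> by_cases h' : IsPart τ k <;>
    simp only [ψ, ψd, h, h', if_true, if_false]
  · exact ann_cre_of_ne hm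
  · exact ann_ann _ _
  · exact cre_cre _ _
  · rw [ann_cre_of_ne hm.symm, end_neg_neg]

lemma isAdj_ψd_ψ (σ : Bool) (n : ℤ) : IsAdj (ψd σ n) (ψ σ n) := by
  by_cases h : IsPart σ n <;> simp only [ψ, ψd, h, if_true, if_false]
  · exact isAdj_cre_ann _
  · exact (isAdj_cre_ann _).symm

/-- A term containing an annihilator survives only if its mode is occupied; since `m ≠ 0`, an
annihilator on the left may be anticommuted to the right first. The terms made of two creators have
`n` and `n + m` on opposite sides of the surface of the sea, which confines `n` to a finite
interval. For `m = 0` the whole sea would contribute. -/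
lemma locFin_pair (σ : Bool) {m : ℤ} (hm : m ≠ 0) :
    LocFin fun n => ψd σ (n + m) * ψ σ n := by
  refine LocFin.of_Ω fun s => ?_
  have hinj : Function.Injective (modeOf σ) := fun a b h => (modeOf_inj h).2
  have h1 : {n | Has (modeOf σ n) s}.Finite := (finite_has s).preimage hinj.injOn
  have h2 : {n | Has (modeOf σ (n + m)) s}.Finite :=
    (finite_has s).preimage (f := fun n => modeOf σ (n + m))
      (fun a _ b _ h => by simpa using hinj h)
  refine ((h1.union h2).union (Set.finite_Icc (-m) 0)).subset fun n hn => ?_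
  have e1 : ψ σ n (Ω s) ≠ 0 := fun h => hn (by simp [h])
  have e2 : ψd σ (n + m) (Ω s) ≠ 0 := fun h => hn (by
    have := ψ_ψd_ne (σ := σ) (τ := σ) (n := n) (k := n + m) (by simpa using hm)
    have h' := congrArg (fun A => A (Ω s)) this
    simp only [Module.End.mul_apply, LinearMap.neg_apply, h, map_zero] at h'
    exact neg_eq_zero.1 h'.symm)
  by_cases p1 : IsPart σ n
  · left; left
    by_contra hc
    exact e1 (by simp only [Set.mem_ofPred_eq] at hc; simp [ψ, p1, ann_Ω, hc])
  by_cases p2 : IsPart σ (n + m)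
  · right
    cases σ <;> simp only [IsPart] at p1 p2 <;> simp only [Set.mem_Icc] <;> omega
  · left; right
    by_contra hc
    exact e2 (by simp only [Set.mem_ofPred_eq] at hc; simp [ψd, p2, ann_Ω, hc])

/-! ### Density operators -/

/-- The Fourier components of the chiral densities. -/
def dens (σ : Bool) (m : ℤ) : Module.End ℂ Fin𝓕 := opSum fun n => ψd σ (n + m) * ψ σ n

lemma isAdj_dens (σ : Bool) {m : ℤ} (hm : m ≠ 0) : IsAdj (dens σ m) (dens σ (-m)) := by
  have h1 := locFin_pair σ hm
  have h2 := locFin_pair σ (neg_ne_zero.2 hm)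
  have h3 : LocFin fun n => ψd σ n * ψ σ (n + m) := fun v => by
    have := (h2 v).preimage (f := fun n => n + m) (fun a _ b _ h => by simpa using h)
    simpa using this
  have e : dens σ (-m) = opSum fun n => ψd σ n * ψ σ (n + m) := by
    refine LinearMap.ext fun v => ?_
    rw [dens, h2.opSum_apply, h3.opSum_apply, ← finsum_comp_equiv (Equiv.addRight m)]
    simp
  rw [e, dens]
  exact h1.isAdj h3 fun n => (isAdj_ψd_ψ σ (n + m)).mul (isAdj_ψd_ψ σ n).symm

/-- Moving `ψd σ n` to the left through `ψd σ (k + m) * ψ σ k` costs two signs and the contraction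
of `ψ σ k` with `ψd σ n`, which is present for `k = n` only. -/
lemma dens_ψd (σ : Bool) {m : ℤ} (hm : m ≠ 0) (n : ℤ) :
    dens σ m * ψd σ n = ψd σ n * dens σ m + ψd σ (n + m) := by
  classical
  have h := locFin_pair σ hm
  refine LinearMap.ext fun v => ?_
  -- The index of the contraction is added by hand, because both products may vanish there on the
  -- given vectors.
  set S := (h v).toFinset ∪ (h (ψd σ n v)).toFinset ∪ {n} with hS
  simp only [Module.End.mul_apply, LinearMap.add_apply, dens]
  rw [h.opSum_apply_sum v (S := S) (by simp [hS]; tauto),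
    h.opSum_apply_sum (ψd σ n v) (S := S) (by simp [hS]; tauto), map_sum]
  have key : ∀ k, (ψd σ (k + m) * ψ σ k) (ψd σ n v) =
      ψd σ n ((ψd σ (k + m) * ψ σ k) v) + if k = n then ψd σ (n + m) v else 0 := by
    intro k
    have a1 := congrArg (fun A => A (ψ σ k v)) (ψd_ψd σ σ n (k + m))
    simp only [Module.End.mul_apply, LinearMap.neg_apply] at a1 ⊢
    rw [a1]
    split_ifs with hk
    · subst hk
      have a2 := congrArg (fun A => A v) (ψ_ψd_self σ k)
      simp only [Module.End.mul_apply, LinearMap.sub_apply, Module.End.one_apply] at a2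
      rw [a2, map_sub]
      abel
    · have a2 := congrArg (fun A => A v) (ψ_ψd_ne (σ := σ) (τ := σ) (n := k) (k := n) (by simpa))
      simp only [Module.End.mul_apply, LinearMap.neg_apply] at a2
      rw [a2, map_neg, add_zero]
  rw [Finset.sum_congr rfl fun k _ => key k, Finset.sum_add_distrib]
  simp [hS]

lemma dens_ψ (σ : Bool) {m : ℤ} (hm : m ≠ 0) (n : ℤ) :
    dens σ m * ψ σ n = ψ σ n * dens σ m - ψ σ (n - m) := by
  classical
  have h := locFin_pair σ hm
  refine LinearMap.ext fun v => ?_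
  set S := (h v).toFinset ∪ (h (ψ σ n v)).toFinset ∪ {n - m} with hS
  simp only [Module.End.mul_apply, LinearMap.sub_apply, dens]
  rw [h.opSum_apply_sum v (S := S) (by simp [hS]; tauto),
    h.opSum_apply_sum (ψ σ n v) (S := S) (by simp [hS]; tauto), map_sum]
  have key : ∀ k, (ψd σ (k + m) * ψ σ k) (ψ σ n v) =
      ψ σ n ((ψd σ (k + m) * ψ σ k) v) - if k = n - m then ψ σ (n - m) v else 0 := by
    intro k
    have a1 := congrArg (fun A => A v) (ψ_ψ σ σ k n)
    simp only [Module.End.mul_apply, LinearMap.neg_apply] at a1 ⊢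
    rw [a1]
    split_ifs with hk
    · obtain rfl : n = k + m := by omega
      have a2 := congrArg (fun A => A (ψ σ k v)) (ψ_ψd_self σ (k + m))
      simp only [Module.End.mul_apply, LinearMap.sub_apply, Module.End.one_apply] at a2
      rw [a2, map_neg, add_sub_cancel_right]
      abel
    · have a2 := congrArg (fun A => A (ψ σ k v))
        (ψ_ψd_ne (σ := σ) (τ := σ) (n := n) (k := k + m) (by simp; omega))
      simp only [Module.End.mul_apply, LinearMap.neg_apply] at a2
      rw [a2, map_neg, sub_zero]
  rw [Finset.sum_congr rfl fun k _ => key k, Finset.sum_sub_distrib]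
  simp [hS]

/-- Bilinears are even: the two signs from the two field components cancel. This yields the
independence of the two chiralities. -/
lemma dens_comm_of_anticomm {σ : Bool} {m : ℤ} (hm : m ≠ 0) {A : Module.End ℂ Fin𝓕}
    (h1 : ∀ n, ψ σ n * A = -(A * ψ σ n)) (h2 : ∀ n, ψd σ n * A = -(A * ψd σ n)) :
    dens σ m * A = A * dens σ m := by
  classical
  have h := locFin_pair σ hm
  refine LinearMap.ext fun v => ?_
  set S := (h v).toFinset ∪ (h (A v)).toFinset with hS
  simp only [Module.End.mul_apply, dens]
  rw [h.opSum_apply_sum v (S := S) (by simp [hS]; tauto),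
    h.opSum_apply_sum (A v) (S := S) (by simp [hS]; tauto), map_sum]
  refine Finset.sum_congr rfl fun k _ => ?_
  have a1 := congrArg (fun A => A v) (h1 k)
  have a2 := congrArg (fun A => A (ψ σ k v)) (h2 (k + m))
  simp only [Module.End.mul_apply, LinearMap.neg_apply] at a1 a2 ⊢
  rw [a1, map_neg, a2, neg_neg]

lemma dens_ψd_of_ne {σ τ : Bool} (hστ : σ ≠ τ) {m : ℤ} (hm : m ≠ 0) (n : ℤ) :
    dens σ m * ψd τ n = ψd τ n * dens σ m :=
  dens_comm_of_anticomm hm (fun _ => ψ_ψd_ne (by simp [hστ])) fun _ => ψd_ψd _ _ _ _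

lemma dens_ψ_of_ne {σ τ : Bool} (hστ : σ ≠ τ) {m : ℤ} (hm : m ≠ 0) (n : ℤ) :
    dens σ m * ψ τ n = ψ τ n * dens σ m :=
  dens_comm_of_anticomm hm (fun _ => ψ_ψ _ _ _ _) fun k => by
    rw [ψ_ψd_ne (by simp [hστ.symm]), end_neg_neg]

lemma dens_dens_of_ne {σ τ : Bool} (hστ : σ ≠ τ) {a b : ℤ} (ha : a ≠ 0) (hb : b ≠ 0) :
    dens σ a * dens τ b = dens τ b * dens σ a := by
  classical
  have h := locFin_pair τ hb
  refine LinearMap.ext fun v => ?_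
  set S := (h v).toFinset ∪ (h (dens σ a v)).toFinset with hS
  simp only [Module.End.mul_apply]
  rw [show dens τ b = opSum _ from rfl, h.opSum_apply_sum v (S := S) (by simp [hS]; tauto),
    h.opSum_apply_sum (dens σ a v) (S := S) (by simp [hS]; tauto), map_sum]
  refine Finset.sum_congr rfl fun k _ => ?_
  have a1 := congrArg (fun A => A (ψ τ k v)) (dens_ψd_of_ne hστ ha (k + b))
  have a2 := congrArg (fun A => A v) (dens_ψ_of_ne hστ ha k)
  simp only [Module.End.mul_apply] at a1 a2 ⊢
  rw [a1, a2]

/-- Finite support is essential: the Schwinger term arises precisely from a sequence for which this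
telescoping fails. -/
lemma finsum_sub_shift {M : Type*} [AddCommGroup M] {t : ℤ → M} (h : (Function.support t).Finite)
    (c : ℤ) : ∑ᶠ n, (t n - t (n + c)) = 0 := by
  have h' : (Function.support fun n => t (n + c)).Finite :=
    h.preimage (f := fun n => n + c) (fun a _ b _ h => by simpa using h)
  rw [finsum_sub_distrib h h', sub_eq_zero]
  exact (finsum_comp_equiv (Equiv.addRight c)).symm

/-- The origin of the Schwinger term. The occupation of the sea is a step function, not finitely
supported, so its difference with a translate sums to the length of the translation. -/
lemma finsum_step_sub (b : ℕ) :
    ∑ᶠ n : ℤ, ((if n < 0 then (1 : ℂ) else 0) - if n + b < 0 then 1 else 0) = b := by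
  rw [finsum_eq_sum_of_support_subset (s := Finset.Ico (-(b : ℤ)) 0)]
  · rw [Finset.sum_congr rfl (g := fun _ => (1 : ℂ))]
    · simp
    · intro n hn
      rw [Finset.mem_Ico] at hn
      rw [if_pos hn.2, if_neg (by omega), sub_zero]
  · intro n hn
    simp only [Function.mem_support] at hn
    rw [Finset.coe_Ico, Set.mem_Ico]
    by_contra hc
    apply hn
    by_cases h0 : n < 0
    · rw [if_pos h0, if_pos (by omega), sub_self]
    · rw [if_neg h0, if_neg (by omega), sub_self]

/-- Whether the `n`-th site of the sea of the field is filled. -/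
def seaOcc (σ : Bool) (s : Occ) (n : ℤ) : ℂ :=
  if IsPart σ n then (if Has (modeOf σ n) s then 1 else 0)
  else (if Has (modeOf σ n) s then 0 else 1)

lemma ψd_mul_ψ_Ω (σ : Bool) (n : ℤ) (s : Occ) :
    (ψd σ n * ψ σ n) (Ω s) = seaOcc σ s n • Ω s := by
  by_cases h : IsPart σ n <;> by_cases hi : Has (modeOf σ n) s <;>
    simp only [ψ, ψd, seaOcc, h, if_true, if_false, hi, ann_cre_self, LinearMap.sub_apply,
      cre_mul_ann_Ω, Module.End.one_apply, one_smul, zero_smul, sub_zero, sub_self]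

/-- A finite particle state differs from the step function at finitely many sites. That finite
difference telescopes away, so the sum is the same in every state. -/
lemma finsum_seaOcc (σ : Bool) (s : Occ) (b : ℕ) :
    ∑ᶠ n : ℤ, (seaOcc σ s n - seaOcc σ s (n + b)) = b := by
  set g : ℤ → ℂ := fun n => seaOcc σ s n - if n < 0 then 1 else 0 with hg
  have hinj : Function.Injective (modeOf σ) := fun a b h => (modeOf_inj h).2
  have hfin : (Function.support g).Finite := by
    have h1 : {n | Has (modeOf σ n) s}.Finite := (finite_has s).preimage hinj.injOn
    -- The sea of the left movers also contains the site `0`, which the comparison step function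
    -- omits.
    refine (h1.union (Set.finite_singleton 0)).subset fun n hn => ?_
    by_contra hc
    simp only [Set.mem_union, Set.mem_ofPred_eq, Set.mem_singleton_iff, not_or] at hc
    apply hn
    cases σ <;> simp only [hg, seaOcc, hc.1, IsPart, if_false]
    · rcases lt_or_gt_of_ne hc.2 with h | h
      · simp [h, h.not_gt]
      · simp [h, h.not_gt]
    · rcases lt_or_gt_of_ne hc.2 with h | h
      · simp [h, h.not_ge]
      · simp [h.le, h.not_gt]
  have e : ∀ n, seaOcc σ s n - seaOcc σ s (n + b) =
      ((if n < 0 then (1 : ℂ) else 0) - if n + b < 0 then 1 else 0) + (g n - g (n + b)) := by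
    intro n
    simp only [hg]
    ring
  rw [finsum_congr e, finsum_add_distrib, finsum_step_sub, finsum_sub_shift hfin, add_zero]
  · refine (Set.finite_Ico (-(b : ℤ)) 0).subset fun n hn => ?_
    rw [Set.mem_Ico]
    by_contra hc
    apply hn
    dsimp only
    by_cases h0 : n < 0
    · rw [if_pos h0, if_pos (by omega), sub_self]
    · rw [if_neg h0, if_neg (by omega), sub_self]
  · have h' : (Function.support fun n => g (n + b)).Finite :=
      hfin.preimage (f := fun n : ℤ => n + b) (fun a _ b _ h => by simpa using h)
    refine (hfin.union h').subset fun n hn => ?_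
    by_contra hc
    simp only [Set.mem_union, Function.mem_support, not_or, not_not] at hc
    exact hn (by simp only [hc.1, hc.2, sub_zero])

/-- The two families of bilinears produced by the reordering are kept inside one sum. When `a + b =
0` they are occupation numbers, neither of which is locally finite alone. -/
lemma dens_dens_apply (σ : Bool) {a b : ℤ} (ha : a ≠ 0) (hb : b ≠ 0) (v : Fin𝓕)
    (hfin : (Function.support fun n =>
      (ψd σ (n + b + a) * ψ σ n) v - (ψd σ (n + b) * ψ σ (n - a)) v).Finite) :
    dens σ a (dens σ b v) = dens σ b (dens σ a v) +
      ∑ᶠ n, ((ψd σ (n + b + a) * ψ σ n) v - (ψd σ (n + b) * ψ σ (n - a)) v) := by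
  classical
  have h := locFin_pair σ hb
  set S := (h v).toFinset ∪ (h (dens σ a v)).toFinset ∪ hfin.toFinset with hS
  rw [show dens σ b = opSum _ from rfl, h.opSum_apply_sum v (S := S) (by simp [hS]; tauto),
    h.opSum_apply_sum (dens σ a v) (S := S) (by simp [hS]; tauto), map_sum,
    finsum_eq_sum_of_support_subset (s := S) _ (by
      intro n hn
      simp only [hS, Finset.coe_union, Set.Finite.coe_toFinset]
      exact Or.inr hn), ← Finset.sum_add_distrib]
  refine Finset.sum_congr rfl fun k _ => ?_
  have a1 := congrArg (fun A => A (ψ σ k v)) (dens_ψd σ ha (k + b))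
  have a2 := congrArg (fun A => A v) (dens_ψ σ ha k)
  simp only [Module.End.mul_apply, LinearMap.add_apply, LinearMap.sub_apply] at a1 a2 ⊢
  rw [a1, a2, map_sub]
  abel

/-- Here both families are locally finite separately and are translates of each other, so their
difference telescopes to zero. -/
lemma dens_dens_of_add_ne (σ : Bool) {a b : ℤ} (ha : a ≠ 0) (hb : b ≠ 0) (hab : a + b ≠ 0) :
    dens σ a * dens σ b = dens σ b * dens σ a := by
  refine LinearMap.ext fun v => ?_
  have h := locFin_pair σ hab v
  set t : ℤ → Fin𝓕 := fun n => (ψd σ (n + (a + b)) * ψ σ n) v with ht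
  have e : ∀ n, (ψd σ (n + b + a) * ψ σ n) v - (ψd σ (n + b) * ψ σ (n - a)) v =
      t n - t (n + -a) := by
    intro n
    simp only [ht]
    rw [show n + b + a = n + (a + b) by ring, show n + -a + (a + b) = n + b by ring,
      show n + -a = n - a by ring]
  have hfin : (Function.support t).Finite := h
  have hfin' : (Function.support fun n => t (n + -a)).Finite :=
    hfin.preimage (f := fun n => n + -a) (fun a _ b _ h => by simpa using h)
  simp only [Module.End.mul_apply]
  rw [dens_dens_apply σ ha hb v, finsum_congr e, finsum_sub_shift hfin, add_zero]
  simp only [e]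
  refine (hfin.union hfin').subset fun n hn => ?_
  by_contra hc
  simp only [Set.mem_union, Function.mem_support, not_or, not_not] at hc
  exact hn (by simp only [hc.1, hc.2, sub_zero])

lemma dens_neg_dens (σ : Bool) {b : ℤ} (hb : 0 < b) :
    dens σ (-b) * dens σ b = dens σ b * dens σ (-b) + (b : ℂ) • 1 := by
  refine ext_Ω fun s => ?_
  have e : ∀ n, (ψd σ (n + b + -b) * ψ σ n) (Ω s) - (ψd σ (n + b) * ψ σ (n - -b)) (Ω s) =
      (seaOcc σ s n - seaOcc σ s (n + b)) • Ω s := by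
    intro n
    rw [add_neg_cancel_right, sub_neg_eq_add, ψd_mul_ψ_Ω, ψd_mul_ψ_Ω, sub_smul]
  obtain ⟨b, rfl⟩ := Int.eq_ofNat_of_zero_le hb.le
  -- A `finsum` with infinite support is `0` by convention, whereas this one is known to be
  -- positive.
  have hfin : (Function.support fun n : ℤ => seaOcc σ s n - seaOcc σ s (n + b)).Finite := by
    by_contra hc
    have := finsum_seaOcc σ s b
    rw [finsum_of_infinite_support hc] at this
    norm_cast at this
    omega
  simp only [Module.End.mul_apply, LinearMap.add_apply, LinearMap.smul_apply,
    Module.End.one_apply]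
  rw [dens_dens_apply σ (by omega) (by omega) (Ω s), finsum_congr e, ← finsum_smul' hfin,
    finsum_seaOcc]
  · simp
  · simp only [e]
    exact hfin.subset fun n hn h0 => hn (by
      simp only at h0
      simp only [h0, zero_smul])

/-! ### Additive quantum numbers -/

/-- The total of a quantum number `f` of the modes in the state `s`. -/
def wt (f : Mode → ℤ) (s : Occ) : ℤ := ∑ n ∈ s.1, f (.inl n) + ∑ n ∈ s.2, f (.inr n)

/-- The diagonal operator with given eigenvalues. -/
def diagOp (w : Occ → ℂ) : Module.End ℂ Fin𝓕 := ofBasis fun s => w s • Ω s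

/-- The operator of an additive quantum number. -/
def wtOp (f : Mode → ℤ) : Module.End ℂ Fin𝓕 := diagOp fun s => wt f s

@[simp] lemma diagOp_Ω (w : Occ → ℂ) (s : Occ) : diagOp w (Ω s) = w s • Ω s := by
  simp [diagOp]

lemma diagOp_apply (w : Occ → ℂ) (v : Fin𝓕) (s : Occ) : diagOp w v s = w s * v s := by
  induction v using induction_Ω with
  | h0 => simp
  | hadd f g hf hg => simp [hf, hg, mul_add]
  | hsmul c f hf => simp [hf, mul_left_comm]
  | hΩ t =>
    rw [diagOp_Ω, Finsupp.smul_apply, smul_eq_mul, Ω, Finsupp.single_apply]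
    split_ifs with h <;> simp [h]

lemma wtOp_Ω (f : Mode → ℤ) (s : Occ) : wtOp f (Ω s) = (wt f s : ℂ) • Ω s := diagOp_Ω _ _

lemma wtOp_apply (f : Mode → ℤ) (v : Fin𝓕) (s : Occ) : wtOp f v s = wt f s * v s :=
  diagOp_apply _ _ _

lemma wt_fill (f : Mode → ℤ) {i : Mode} {s : Occ} (h : ¬ Has i s) :
    wt f (fill i s) = wt f s + f i := by
  cases i <;> simp only [Has] at h <;> simp [wt, fill, h] <;> ring

lemma wt_clear (f : Mode → ℤ) {i : Mode} {s : Occ} (h : Has i s) :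
    wt f (clear i s) = wt f s - f i := by
  conv_rhs => rw [← fill_clear h]
  rw [wt_fill f (by simp [has_clear])]
  ring

/-- The operator `A` raises the quantum number `f` by `d`. -/
def Shifts (f : Mode → ℤ) (A : Module.End ℂ Fin𝓕) (d : ℤ) : Prop :=
  ∀ v, wtOp f (A v) = A (wtOp f v) + (d : ℂ) • A v

lemma Shifts.of_Ω {f : Mode → ℤ} {A : Module.End ℂ Fin𝓕} {d : ℤ}
    (h : ∀ s, wtOp f (A (Ω s)) = ((wt f s + d : ℤ) : ℂ) • A (Ω s)) : Shifts f A d := by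
  intro v
  induction v using induction_Ω with
  | h0 => simp
  | hadd x y hx hy =>
    simp only [map_add, hx, hy, smul_add]
    abel
  | hsmul c x hx => simp only [map_smul, hx, smul_add, smul_comm c]
  | hΩ s => rw [h, wtOp_Ω, map_smul, ← add_smul]; push_cast; rfl

lemma shifts_cre (f : Mode → ℤ) (i : Mode) : Shifts f (cre i) (f i) := by
  refine Shifts.of_Ω fun s => ?_
  by_cases h : Has i s
  · simp [cre_Ω, h]
  · simp only [cre_Ω, h, if_false, map_smul, wtOp_Ω, wt_fill f h]
    rw [smul_comm]

lemma shifts_ann (f : Mode → ℤ) (i : Mode) : Shifts f (ann i) (-f i) := by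
  refine Shifts.of_Ω fun s => ?_
  by_cases h : Has i s
  · simp only [ann_Ω, h, if_true, map_smul, wtOp_Ω, wt_clear f h, sub_eq_add_neg]
    rw [smul_comm]
  · simp [ann_Ω, h]

lemma Shifts.mul {f : Mode → ℤ} {A B : Module.End ℂ Fin𝓕} {a b : ℤ} (hA : Shifts f A a)
    (hB : Shifts f B b) : Shifts f (A * B) (a + b) := by
  intro v
  simp only [Module.End.mul_apply, hA (B v), hB v, map_add, map_smul]
  push_cast
  rw [add_smul]
  abel

lemma Shifts.add {f : Mode → ℤ} {A B : Module.End ℂ Fin𝓕} {a : ℤ} (hA : Shifts f A a)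
    (hB : Shifts f B a) : Shifts f (A + B) a := by
  intro v
  simp only [LinearMap.add_apply, hA v, hB v, map_add, smul_add]
  abel

lemma Shifts.opSum {ι : Type*} {f : Mode → ℤ} {A : ι → Module.End ℂ Fin𝓕} {d : ℤ}
    (hL : LocFin A) (h : ∀ i, Shifts f (A i) d) : Shifts f (opSum A) d := by
  classical
  intro v
  set S := (hL v).toFinset ∪ (hL (wtOp f v)).toFinset with hS
  rw [hL.opSum_apply_sum v (S := S) (by simp [hS]; tauto),
    hL.opSum_apply_sum (wtOp f v) (S := S) (by simp [hS]; tauto), map_sum, Finset.smul_sum,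
    ← Finset.sum_add_distrib]
  exact Finset.sum_congr rfl fun i _ => h i v

/-- The energy of the modes, in units of `2π/L`. -/
def energyWt : Mode → ℤ
  | .inl n => |n|
  | .inr n => |n|

/-- The axial charge of the modes. -/
def axialWt : Mode → ℤ
  | .inl n => if 0 ≤ n then 1 else -1
  | .inr n => if 0 < n then -1 else 1

/-- The electric charge of the modes. -/
def chargeWt : Mode → ℤ
  | .inl _ => 1
  | .inr _ => -1

lemma wt_chargeWt (s : Occ) : wt chargeWt s = s.1.card - s.2.card := by
  simp [wt, chargeWt, sub_eq_add_neg]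

lemma wt_energyWt_nonneg (s : Occ) : 0 ≤ wt energyWt s :=
  add_nonneg (Finset.sum_nonneg fun _ _ => abs_nonneg _) (Finset.sum_nonneg fun _ _ => abs_nonneg _)

lemma mem_𝓕₀_iff {v : Fin𝓕} : v ∈ 𝓕₀ ↔ wtOp chargeWt v = 0 := by
  rw [𝓕₀, Finsupp.mem_supported]
  constructor
  · intro h
    ext s
    rw [wtOp_apply, wt_chargeWt]
    by_cases hs : v s = 0
    · simp [hs]
    · have : s.1.card = s.2.card := h (Finsupp.mem_support_iff.2 hs)
      simp [this]
  · intro h s hs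
    have := DFunLike.congr_fun h s
    rw [wtOp_apply, wt_chargeWt] at this
    have h0 : v s ≠ 0 := Finsupp.mem_support_iff.1 hs
    simp only [Finsupp.coe_zero, Pi.zero_apply, mul_eq_zero, h0, or_false] at this
    have h1 : ((s.1.card : ℤ) - s.2.card) = 0 := by exact_mod_cast this
    change s.1.card = s.2.card
    omega

lemma Ω_mem_𝓕₀ {s : Occ} : Ω s ∈ 𝓕₀ ↔ s.1.card = s.2.card := by
  have h0 : Ω s ≠ 0 := by simp [Ω]
  rw [mem_𝓕₀_iff, wtOp_Ω, wt_chargeWt, smul_eq_zero]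
  simp only [h0, or_false, Int.cast_eq_zero]
  omega

lemma Shifts.map_𝓕₀ {A : Module.End ℂ Fin𝓕} (h : Shifts chargeWt A 0) {v : Fin𝓕} (hv : v ∈ 𝓕₀) :
    A v ∈ 𝓕₀ := by
  rw [mem_𝓕₀_iff] at hv ⊢
  simp [h v, hv]

lemma shifts_ψd (f : Mode → ℤ) (σ : Bool) (n : ℤ) :
    Shifts f (ψd σ n) (if IsPart σ n then f (modeOf σ n) else -f (modeOf σ n)) := by
  by_cases h : IsPart σ n <;> simp only [ψd, h, if_true, if_false]
  · exact shifts_cre f _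
  · exact shifts_ann f _

lemma shifts_ψ (f : Mode → ℤ) (σ : Bool) (n : ℤ) :
    Shifts f (ψ σ n) (-(if IsPart σ n then f (modeOf σ n) else -f (modeOf σ n))) := by
  by_cases h : IsPart σ n <;> simp only [ψ, h, if_true, if_false, neg_neg]
  · exact shifts_ann f _
  · exact shifts_cre f _

/-- Both fields are numbered so that `ψd σ n` raises the energy by `n`: it creates a fermion of
energy `n`, or removes an antifermion of energy `-n`. -/
lemma shifts_dens_energy (σ : Bool) {m : ℤ} (hm : m ≠ 0) : Shifts energyWt (dens σ m) m := by
  refine Shifts.opSum (locFin_pair σ hm) fun n => ?_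
  have h : ∀ n, (if IsPart σ n then energyWt (modeOf σ n) else -energyWt (modeOf σ n)) = n := by
    intro n
    cases σ <;> simp only [IsPart, modeOf] <;> split_ifs with h <;> simp only [energyWt]
    · rw [abs_neg, abs_of_pos h]
    · rw [abs_of_nonpos (by omega), neg_neg]
    · exact abs_of_nonneg h
    · rw [abs_neg, abs_of_nonpos (by omega), neg_neg]
  have := (shifts_ψd energyWt σ (n + m)).mul (shifts_ψ energyWt σ n)
  rw [h, h] at this
  simpa using this

/-- Every component `ψd σ n` carries the same axial charge, `1` for right movers and `-1` for left
movers, so bilinears of one chirality carry none. -/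
lemma shifts_dens_axial (σ : Bool) {m : ℤ} (hm : m ≠ 0) : Shifts axialWt (dens σ m) 0 := by
  refine Shifts.opSum (locFin_pair σ hm) fun n => ?_
  have h : ∀ n, (if IsPart σ n then axialWt (modeOf σ n) else -axialWt (modeOf σ n)) =
      if σ then 1 else -1 := by
    intro n
    cases σ
    · by_cases h : 0 < n
      · simp [IsPart, modeOf, axialWt, h, h.not_ge]
      · simp [IsPart, modeOf, axialWt, h]
    · by_cases h : 0 ≤ n
      · simp [IsPart, modeOf, axialWt, h]
      · simp [IsPart, modeOf, axialWt, h, not_le.1 h]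
  have := (shifts_ψd axialWt σ (n + m)).mul (shifts_ψ axialWt σ n)
  rw [h, h] at this
  simpa using this

lemma shifts_dens_charge (σ : Bool) {m : ℤ} (hm : m ≠ 0) : Shifts chargeWt (dens σ m) 0 := by
  refine Shifts.opSum (locFin_pair σ hm) fun n => ?_
  have h : ∀ n, (if IsPart σ n then chargeWt (modeOf σ n) else -chargeWt (modeOf σ n)) = 1 := by
    intro n
    cases σ <;> simp only [IsPart, modeOf] <;> split_ifs with h <;> simp [chargeWt]
  have := (shifts_ψd chargeWt σ (n + m)).mul (shifts_ψ chargeWt σ n)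
  rw [h, h] at this
  simpa using this

lemma opSum_number_Ω (c d : ℤ → ℂ) (s : Occ) :
    opSum (fun n : ℤ => c n • (bDag n * bAnn n) + d n • (cDag n * cAnn n)) (Ω s) =
      (∑ n ∈ s.1, c n + ∑ n ∈ s.2, d n) • Ω s := by
  classical
  have h1 : ∀ n, (bDag n * bAnn n) (Ω s) = if n ∈ s.1 then Ω s else 0 :=
    fun n => cre_mul_ann_Ω (.inl n) s
  have h2 : ∀ n, (cDag n * cAnn n) (Ω s) = if n ∈ s.2 then Ω s else 0 :=
    fun n => cre_mul_ann_Ω (.inr n) s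
  simp only [opSum, ofBasis_Ω, LinearMap.add_apply, LinearMap.smul_apply, h1, h2]
  rw [finsum_eq_sum_of_support_subset (s := s.1 ∪ s.2)]
  · simp only [smul_ite, smul_zero, Finset.sum_add_distrib, Finset.sum_ite_mem, add_smul,
      Finset.sum_smul]
    simp
  · intro n hn
    rw [Finset.coe_union]
    by_contra hc
    simp only [Set.mem_union, Finset.mem_coe, not_or] at hc
    exact hn (by simp [hc.1, hc.2])

lemma diracHam_eq {L : ℝ} (hL : 0 < L) :
    diracHam L = ((2 * Real.pi / L : ℝ) : ℂ) • wtOp energyWt := by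
  refine ext_Ω fun s => ?_
  simp only [diracHam, smul_add]
  rw [opSum_number_Ω (fun n => ((|mom L n| : ℝ) : ℂ)) (fun n => ((|mom L n| : ℝ) : ℂ)),
    LinearMap.smul_apply, wtOp_Ω, smul_smul]
  congr 1
  have h : ∀ n : ℤ, ((|mom L n| : ℝ) : ℂ) = ((2 * Real.pi / L : ℝ) : ℂ) * ((|n| : ℤ) : ℂ) := by
    intro n
    have : |mom L n| = 2 * Real.pi / L * ((|n| : ℤ) : ℝ) := by
      rw [mom, show 2 * (n : ℝ) * Real.pi / L = 2 * Real.pi / L * n by ring, abs_mul,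
        abs_of_pos (by positivity), Int.cast_abs]
    rw [this, Complex.ofReal_mul, Complex.ofReal_intCast]
  simp only [h, wt, energyWt, ← Finset.mul_sum, ← mul_add]
  push_cast
  ring

lemma axialCharge_eq : axialCharge = wtOp axialWt := by
  refine ext_Ω fun s => ?_
  rw [axialCharge, opSum_number_Ω, wtOp_Ω]
  congr 1
  simp [wt, axialWt]

/-! ### Identification of the densities -/

lemma finsum_subtype_reindex {M : Type*} [AddCommMonoid M] (S : Set ℤ) (e : ℤ ≃ ℤ) (p : ℤ → Prop)
    [DecidablePred p] (hp : ∀ k, k ∈ S ↔ p (e k)) (F t : ℤ → M) (h : ∀ k ∈ S, F k = t (e k)) :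
    ∑ᶠ k : S, F k = ∑ᶠ n, if p n then t n else 0 := by
  rw [finsum_set_coe_eq_finsum_mem, finsum_mem_def, ← finsum_comp_equiv (f := fun n => if p n then t n else 0) e]
  refine finsum_congr fun k => ?_
  by_cases hk : k ∈ S
  · rw [Set.indicator_of_mem hk, if_pos ((hp k).1 hk), h k hk]
  · rw [Set.indicator_of_notMem hk, if_neg fun h' => hk ((hp k).2 h')]

/-- Used to cut the sum over sites according to which of the two field components creates and which
annihilates. The three combinations that occur are the three sums defining the densities. -/
lemma finsum_split_three {M : Type*} [AddCommMonoid M] {t : ℤ → M}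
    (ht : (Function.support t).Finite) (p q r : ℤ → Prop) [DecidablePred p] [DecidablePred q]
    [DecidablePred r]
    (h : ∀ n, (p n ∧ ¬ q n ∧ ¬ r n) ∨ (¬ p n ∧ q n ∧ ¬ r n) ∨ (¬ p n ∧ ¬ q n ∧ r n)) :
    ∑ᶠ n, t n = (∑ᶠ n, if p n then t n else 0) + (∑ᶠ n, if q n then t n else 0)
      + ∑ᶠ n, if r n then t n else 0 := by
  have hs : ∀ (p : ℤ → Prop) [DecidablePred p],
      (Function.support fun n => if p n then t n else 0).Finite := by
    intro p _
    refine ht.subset fun n hn h0 => hn ?_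
    simp [h0]
  rw [← finsum_add_distrib (hs p) (hs q), ← finsum_add_distrib _ (hs r)]
  · refine finsum_congr fun n => ?_
    rcases h n with ⟨h1, h2, h3⟩ | ⟨h1, h2, h3⟩ | ⟨h1, h2, h3⟩ <;> simp [h1, h2, h3]
  · refine ht.subset fun n hn h0 => hn ?_
    simp [h0]

lemma cAnn_mul_cDag_of_ne {j k : ℤ} (h : j ≠ k) (v : Fin𝓕) :
    cAnn j (cDag k v) = -cDag k (cAnn j v) :=
  congrArg (fun A => A v) (ann_cre_of_ne (i := .inr j) (j := .inr k) (by simpa using h))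

lemma finsum_neg {ι M : Type*} [AddCommGroup M] (f : ι → M) : -∑ᶠ i, f i = ∑ᶠ i, -f i :=
  (finsum_neg_distrib f).symm

lemma rhoRPos_eq {m : ℤ} (hm : 0 < m) : rhoRPos m = dens true m := by
  refine ext_Ω fun s => ?_
  have ht := locFin_pair true hm.ne' (Ω s)
  rw [dens, (locFin_pair true hm.ne').opSum_apply, finsum_split_three ht (fun n => n < -m)
    (fun n => -m ≤ n ∧ n < 0) (fun n => 0 ≤ n) (by intro n; omega)]
  simp only [rhoRPos, LinearMap.add_apply, LinearMap.neg_apply, opSum, ofBasis_Ω, finsum_neg]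
  congr 1
  · congr 1
    · refine finsum_subtype_reindex (Set.Ioi m) (Equiv.neg ℤ) _ (by intro k; simp)
        (fun k => -(cDag k * cAnn (k - m)) (Ω s)) _ fun k hk => ?_
      rw [Set.mem_Ioi] at hk
      simp only [Equiv.neg_apply, Module.End.mul_apply, ψ, ψd, IsPart, modeOf,
        show ¬ (0 ≤ -k) by omega, show ¬ (0 ≤ -k + m) by omega, if_false, cre, ann, neg_neg,
        show -(-k + m) = k - m by ring]
      -- The antifermion term arrives with its annihilator on the left. The two modes differ because
      -- `m ≠ 0`, and reordering them gives the minus sign in the definition.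
      rw [cAnn_mul_cDag_of_ne (by omega)]
    · refine finsum_subtype_reindex (Set.Ioc 0 m) (Equiv.neg ℤ) _
        (by intro k; simp only [Equiv.neg_apply, Set.mem_Ioc]; omega)
        (fun k => (bDag (-k + m) * cDag k) (Ω s)) _ fun k hk => ?_
      rw [Set.mem_Ioc] at hk
      simp only [Equiv.neg_apply, Module.End.mul_apply, ψ, ψd, IsPart, modeOf,
        show ¬ (0 ≤ -k) by omega, show (0 ≤ -k + m) by omega, if_false, if_true, cre, neg_neg]
  · refine finsum_subtype_reindex (Set.Ici 0) (Equiv.refl ℤ) _ (by intro k; simp)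
      (fun k => (bDag (k + m) * bAnn k) (Ω s)) _ fun k hk => ?_
    rw [Set.mem_Ici] at hk
    simp only [Equiv.refl_apply, Module.End.mul_apply, ψ, ψd, IsPart, modeOf, hk,
      show (0 ≤ k + m) by omega, if_true, cre, ann]

lemma rhoRNeg_eq {m : ℤ} (hm : 0 < m) : rhoRNeg m = dens true (-m) := by
  refine ext_Ω fun s => ?_
  have hm' : -m ≠ 0 := by omega
  have ht := locFin_pair true hm' (Ω s)
  rw [dens, (locFin_pair true hm').opSum_apply, finsum_split_three ht (fun n => n < 0)
    (fun n => 0 ≤ n ∧ n < m) (fun n => m ≤ n) (by intro n; omega)]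
  simp only [rhoRNeg, LinearMap.add_apply, LinearMap.neg_apply, opSum, ofBasis_Ω, finsum_neg]
  congr 1
  · congr 1
    · refine finsum_subtype_reindex (Set.Ioi m) (Equiv.subLeft m) _ (by intro k; simp)
        (fun k => -(cDag (k - m) * cAnn k) (Ω s)) _ fun k hk => ?_
      rw [Set.mem_Ioi] at hk
      simp only [Equiv.subLeft_apply, Module.End.mul_apply, ψ, ψd, IsPart, modeOf,
        show ¬ (0 ≤ m - k) by omega, show ¬ (0 ≤ m - k + -m) by omega, if_false, cre, ann,
        neg_sub, show -(m - k + -m) = k by ring]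
      rw [cAnn_mul_cDag_of_ne (by omega)]
    · refine finsum_subtype_reindex (Set.Ioc 0 m) (Equiv.subLeft m) _
        (by intro k; simp only [Equiv.subLeft_apply, Set.mem_Ioc]; omega)
        (fun k => (cAnn k * bAnn (-k + m)) (Ω s)) _ fun k hk => ?_
      rw [Set.mem_Ioc] at hk
      simp only [Equiv.subLeft_apply, Module.End.mul_apply, ψ, ψd, IsPart, modeOf,
        show (0 ≤ m - k) by omega, show ¬ (0 ≤ m - k + -m) by omega, if_false, if_true, ann,
        show -(m - k + -m) = k by ring, show -k + m = m - k by ring]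
  · refine finsum_subtype_reindex (Set.Ici 0) (Equiv.addRight m) _ (by intro k; simp)
      (fun k => (bDag k * bAnn (k + m)) (Ω s)) _ fun k hk => ?_
    rw [Set.mem_Ici] at hk
    simp only [Equiv.coe_addRight, Module.End.mul_apply, ψ, ψd, IsPart, modeOf, hk,
      show (0 ≤ k + m) by omega, if_true, cre, ann, add_neg_cancel_right]

lemma rhoLPos_eq {m : ℤ} (hm : 0 < m) : rhoLPos m = dens false (-m) := by
  refine ext_Ω fun s => ?_
  have hm' : -m ≠ 0 := by omega
  have ht := locFin_pair false hm' (Ω s)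
  rw [dens, (locFin_pair false hm').opSum_apply, finsum_split_three ht (fun n => m < n)
    (fun n => 0 < n ∧ n ≤ m) (fun n => n ≤ 0) (by intro n; omega)]
  simp only [rhoLPos, LinearMap.add_apply, LinearMap.sub_apply, opSum, ofBasis_Ω, sub_eq_add_neg,
    finsum_neg]
  congr 1
  · congr 1
    · refine finsum_subtype_reindex (Set.Iio (-m)) (Equiv.neg ℤ) _
        (by intro k; simp only [Equiv.neg_apply, Set.mem_Iio]; omega)
        (fun k => (bDag (k + m) * bAnn k) (Ω s)) _ fun k hk => ?_
      rw [Set.mem_Iio] at hk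
      simp only [Equiv.neg_apply, Module.End.mul_apply, ψ, ψd, IsPart, modeOf,
        show (0 < -k) by omega, show (0 < -k + -m) by omega, if_true, cre, ann, neg_neg,
        show -(-k + -m) = k + m by ring]
    · refine finsum_subtype_reindex (Set.Ico (-m) 0) (Equiv.neg ℤ) _
        (by intro k; simp only [Equiv.neg_apply, Set.mem_Ico]; omega)
        (fun k => (cAnn (-k + -m) * bAnn k) (Ω s)) _ fun k hk => ?_
      rw [Set.mem_Ico] at hk
      simp only [Equiv.neg_apply, Module.End.mul_apply, ψ, ψd, IsPart, modeOf,
        show (0 < -k) by omega, show ¬ (0 < -k + -m) by omega, if_false, if_true, ann, neg_neg]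
  · refine finsum_subtype_reindex (Set.Iic 0) (Equiv.refl ℤ) _ (by intro k; simp)
      (fun k => -(cDag k * cAnn (k + -m)) (Ω s)) _ fun k hk => ?_
    rw [Set.mem_Iic] at hk
    simp only [Equiv.refl_apply, Module.End.mul_apply, ψ, ψd, IsPart, modeOf,
      show ¬ (0 < k) by omega, show ¬ (0 < k + -m) by omega, if_false, cre, ann]
    rw [cAnn_mul_cDag_of_ne (by omega)]

lemma rhoLNeg_eq {m : ℤ} (hm : 0 < m) : rhoLNeg m = dens false m := by
  refine ext_Ω fun s => ?_
  have ht := locFin_pair false hm.ne' (Ω s)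
  rw [dens, (locFin_pair false hm.ne').opSum_apply, finsum_split_three ht (fun n => 0 < n)
    (fun n => -m < n ∧ n ≤ 0) (fun n => n ≤ -m) (by intro n; omega)]
  simp only [rhoLNeg, LinearMap.add_apply, LinearMap.sub_apply, opSum, ofBasis_Ω, sub_eq_add_neg,
    finsum_neg]
  congr 1
  · congr 1
    · refine finsum_subtype_reindex (Set.Iio (-m)) (Equiv.subLeft (-m)) _
        (by intro k; simp only [Equiv.subLeft_apply, Set.mem_Iio]; omega)
        (fun k => (bDag k * bAnn (k + m)) (Ω s)) _ fun k hk => ?_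
      rw [Set.mem_Iio] at hk
      simp only [Equiv.subLeft_apply, Module.End.mul_apply, ψ, ψd, IsPart, modeOf,
        show (0 < -m - k) by omega, show (0 < -m - k + m) by omega, if_true, cre, ann,
        show -(-m - k + m) = k by ring, show -(-m - k) = k + m by ring]
    · refine finsum_subtype_reindex (Set.Ico (-m) 0) (Equiv.subLeft (-m)) _
        (by intro k; simp only [Equiv.subLeft_apply, Set.mem_Ico]; omega)
        (fun k => (bDag k * cDag (-k + -m)) (Ω s)) _ fun k hk => ?_
      rw [Set.mem_Ico] at hk
      simp only [Equiv.subLeft_apply, Module.End.mul_apply, ψ, ψd, IsPart, modeOf,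
        show ¬ (0 < -m - k) by omega, show (0 < -m - k + m) by omega, if_false, if_true, cre,
        show -(-m - k + m) = k by ring]
      rw [show -m - k = -k + -m by ring]
  · refine finsum_subtype_reindex (Set.Iic 0) (Equiv.addRight (-m)) _
      (by intro k; simp only [Equiv.coe_addRight, Set.mem_Iic]; omega)
      (fun k => -(cDag (k + -m) * cAnn k) (Ω s)) _ fun k hk => ?_
    rw [Set.mem_Iic] at hk
    simp only [Equiv.coe_addRight, Module.End.mul_apply, ψ, ψd, IsPart, modeOf,
      show ¬ (0 < k + -m) by omega, neg_add_cancel_right, show ¬ (0 < k) by omega, if_false, cre,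
      ann]
    rw [cAnn_mul_cDag_of_ne (by omega)]

lemma rhoR_eq {m : ℤ} (hm : m ≠ 0) : rhoR m = dens true m := by
  rcases lt_or_gt_of_ne hm with h | h
  · rw [rhoR, if_neg (by omega), rhoRNeg_eq (by omega), neg_neg]
  · rw [rhoR, if_pos h, rhoRPos_eq h]

/-- The opposite sign of the index comes from numbering the left movers by the opposite momentum; it
is what makes the two chiral algebras identical. -/
lemma rhoL_eq {m : ℤ} (hm : m ≠ 0) : rhoL m = dens false (-m) := by
  rcases lt_or_gt_of_ne hm with h | h
  · rw [rhoL, if_neg (by omega), rhoLNeg_eq (by omega)]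
  · rw [rhoL, if_pos h, rhoLPos_eq h]

/-! ### The large gauge transformation -/

/-- The mode on which the gauge transform of the creation operator of a mode acts. -/
def gaugeMode : Mode → Mode
  | .inl n => if n = 0 then .inr 1 else .inl (n - 1)
  | .inr n => if n = 0 then .inl (-1) else .inr (n + 1)

/-- The zero modes, whose creation operators are transformed into annihilation operators. -/
def IsZeroMode (i : Mode) : Prop := i = .inl 0 ∨ i = .inr 0

instance (i : Mode) : Decidable (IsZeroMode i) := by
  unfold IsZeroMode; infer_instance

/-- The gauge transform of the creation operator of a mode. -/
def gaugeCre (i : Mode) : Module.End ℂ Fin𝓕 :=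
  if IsZeroMode i then ann (gaugeMode i) else cre (gaugeMode i)

/-- The gauge transform of the annihilation operator of a mode. -/
def gaugeAnn (i : Mode) : Module.End ℂ Fin𝓕 :=
  if IsZeroMode i then cre (gaugeMode i) else ann (gaugeMode i)

lemma gaugeCre_inl (n : ℤ) : gaugeCre (.inl n) = gaugeB n := by
  by_cases h : n = 0 <;> simp [gaugeCre, IsZeroMode, gaugeMode, gaugeB, h, cre, ann]

lemma gaugeCre_inr (n : ℤ) : gaugeCre (.inr n) = gaugeC n := by
  by_cases h : n = 0 <;> simp [gaugeCre, IsZeroMode, gaugeMode, gaugeC, h, cre, ann]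

lemma gaugeMode_inj {i j : Mode} (h : gaugeMode i = gaugeMode j) : i = j := by
  cases i <;> cases j <;> simp only [gaugeMode] at h <;> split_ifs at h <;> simp at h ⊢ <;> omega

lemma gaugeMode_ne {i j : Mode} (h : i ≠ j) : gaugeMode i ≠ gaugeMode j :=
  fun h' => h (gaugeMode_inj h')

lemma gaugeMode_ne_of_isZeroMode {i j : Mode} (h : IsZeroMode i) (h' : ¬ IsZeroMode j) :
    gaugeMode i ≠ gaugeMode j :=
  gaugeMode_ne fun he => h' (he ▸ h)

lemma gaugeCre_gaugeCre (i j : Mode) :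
    gaugeCre i * gaugeCre j = -(gaugeCre j * gaugeCre i) := by
  by_cases h : IsZeroMode i <;> by_cases h' : IsZeroMode j <;>
    simp only [gaugeCre, h, h', if_true, if_false]
  · exact ann_ann _ _
  · exact ann_cre_of_ne (gaugeMode_ne_of_isZeroMode h h')
  · rw [ann_cre_of_ne (gaugeMode_ne_of_isZeroMode h' h), end_neg_neg]
  · exact cre_cre _ _

lemma gaugeCre_sq (i : Mode) : gaugeCre i * gaugeCre i = 0 := by
  by_cases h : IsZeroMode i <;> simp only [gaugeCre, h, if_true, if_false]
  · exact ann_sq _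
  · exact cre_sq _

lemma gaugeAnn_gaugeCre_self (i : Mode) :
    gaugeAnn i * gaugeCre i = 1 - gaugeCre i * gaugeAnn i := by
  by_cases h : IsZeroMode i <;> simp only [gaugeCre, gaugeAnn, h, if_true, if_false]
  · rw [ann_cre_self]
    abel
  · exact ann_cre_self _

lemma gaugeAnn_gaugeCre_of_ne {i j : Mode} (hij : i ≠ j) :
    gaugeAnn i * gaugeCre j = -(gaugeCre j * gaugeAnn i) := by
  have hm := gaugeMode_ne hij
  by_cases h : IsZeroMode i <;> by_cases h' : IsZeroMode j <;>
    simp only [gaugeCre, gaugeAnn, h, h', if_true, if_false]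
  · rw [ann_cre_of_ne hm.symm, end_neg_neg]
  · exact cre_cre _ _
  · exact ann_ann _ _
  · exact ann_cre_of_ne hm

lemma isAdj_gaugeCre (i : Mode) : IsAdj (gaugeCre i) (gaugeAnn i) := by
  by_cases h : IsZeroMode i <;> simp only [gaugeCre, gaugeAnn, h, if_true, if_false]
  · exact (isAdj_cre_ann _).symm
  · exact isAdj_cre_ann _

/-- The product of the operators `β n`, `n ∈ s`, in increasing order. -/
def orderedProd (β : ℤ → Module.End ℂ Fin𝓕) (s : Finset ℤ) : Module.End ℂ Fin𝓕 :=
  ((s.sort (· ≤ ·)).map β).prod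

lemma orderedProd_insert_min {β : ℤ → Module.End ℂ Fin𝓕} {a : ℤ} {s : Finset ℤ}
    (h : ∀ b ∈ s, a < b) : orderedProd β (insert a s) = β a * orderedProd β s := by
  rw [orderedProd, Finset.sort_insert _ (fun b hb => (h b hb).le) fun ha => (h a ha).ne rfl]
  simp [orderedProd]

lemma anticomm_orderedProd {β : ℤ → Module.End ℂ Fin𝓕} {A : Module.End ℂ Fin𝓕}
    (h : ∀ n, A * β n = -(β n * A)) (s : Finset ℤ) (v : Fin𝓕) :
    A (orderedProd β s v) = (-1 : ℂ) ^ s.card • orderedProd β s (A v) := by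
  induction s using Finset.induction_on_min with
  | empty => simp [orderedProd]
  | insert a s ha ih =>
    have h' := congrArg (fun B => B (orderedProd β s v)) (h a)
    simp only [Module.End.mul_apply, LinearMap.neg_apply] at h'
    rw [orderedProd_insert_min ha, Module.End.mul_apply, Module.End.mul_apply, h', ih,
      Finset.card_insert_of_notMem fun h => (ha a h).ne rfl]
    simp [pow_succ]

lemma mul_orderedProd_of_mem {β : ℤ → Module.End ℂ Fin𝓕}
    (h : ∀ n k, β n * β k = -(β k * β n)) (h2 : ∀ n, β n * β n = 0) {k : ℤ} {s : Finset ℤ}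
    (hk : k ∈ s) (v : Fin𝓕) : β k (orderedProd β s v) = 0 := by
  induction s using Finset.induction_on_min with
  | empty => simp at hk
  | insert a s ha ih =>
    rw [orderedProd_insert_min ha, Module.End.mul_apply]
    rcases Finset.mem_insert.1 hk with rfl | hk
    · exact congrArg (fun B => B (orderedProd β s v)) (h2 k)
    · have h' := congrArg (fun B => B (orderedProd β s v)) (h k a)
      simp only [Module.End.mul_apply, LinearMap.neg_apply] at h'
      rw [h', ih hk, map_zero, neg_zero]

lemma mul_orderedProd_of_notMem {β : ℤ → Module.End ℂ Fin𝓕}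
    (h : ∀ n k, β n * β k = -(β k * β n)) {k : ℤ} {s : Finset ℤ} (hk : k ∉ s) (v : Fin𝓕) :
    β k (orderedProd β s v) =
      (-1 : ℂ) ^ (s.filter (· < k)).card • orderedProd β (insert k s) v := by
  induction s using Finset.induction_on_min with
  | empty => simp [orderedProd]
  | insert a s ha ih =>
    have has : a ∉ s := fun h => (ha a h).ne rfl
    rw [Finset.mem_insert, not_or] at hk
    rcases lt_or_gt_of_ne hk.1 with hka | hka
    · rw [orderedProd_insert_min (a := k) (s := insert a s)]
      · have : (insert a s).filter (· < k) = ∅ := by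
          rw [Finset.filter_eq_empty_iff]
          intro b hb
          rcases Finset.mem_insert.1 hb with rfl | hb
          · exact hka.not_gt
          · exact (hka.trans (ha b hb)).not_gt
        simp [this]
      · intro b hb
        rcases Finset.mem_insert.1 hb with rfl | hb
        · exact hka
        · exact hka.trans (ha b hb)
    · have h' := congrArg (fun B => B (orderedProd β s v)) (h k a)
      simp only [Module.End.mul_apply, LinearMap.neg_apply] at h'
      rw [orderedProd_insert_min ha, Module.End.mul_apply, h', ih hk.2, Finset.insert_comm,
        orderedProd_insert_min (a := a) (s := insert k s), Finset.filter_insert, if_pos hka,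
        Finset.card_insert_of_notMem (by simp [has])]
      · simp [pow_succ]
      · intro b hb
        rcases Finset.mem_insert.1 hb with rfl | hb
        · exact hka
        · exact ha b hb

/-- `Γ Ω₀`. -/
def gaugeVac : Fin𝓕 := bDag (-1) (cDag 1 (Ω (∅, ∅)))

lemma gauge_Ω (s : Occ) :
    gauge (Ω s) = orderedProd gaugeB s.1 (orderedProd gaugeC s.2 gaugeVac) := by
  simp [gauge, orderedProd, gaugeVac]

/-- On basis states `Γ` is an ordered product of the transformed creators. These anticommute and
square to zero like the original ones, so a further factor is sorted into its place with the same
sign. -/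
lemma gauge_cre (i : Mode) (v : Fin𝓕) : gauge (cre i v) = gaugeCre i (gauge v) := by
  have hB : ∀ n k, gaugeB n * gaugeB k = -(gaugeB k * gaugeB n) := fun n k => by
    simpa only [gaugeCre_inl] using gaugeCre_gaugeCre (.inl n) (.inl k)
  have hC : ∀ n k, gaugeC n * gaugeC k = -(gaugeC k * gaugeC n) := fun n k => by
    simpa only [gaugeCre_inr] using gaugeCre_gaugeCre (.inr n) (.inr k)
  have hCB : ∀ n k, gaugeC n * gaugeB k = -(gaugeB k * gaugeC n) := fun n k => by
    simpa only [gaugeCre_inr, gaugeCre_inl] using gaugeCre_gaugeCre (.inr n) (.inl k)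
  have hB2 : ∀ n, gaugeB n * gaugeB n = 0 := fun n => by
    simpa only [gaugeCre_inl] using gaugeCre_sq (.inl n)
  have hC2 : ∀ n, gaugeC n * gaugeC n = 0 := fun n => by
    simpa only [gaugeCre_inr] using gaugeCre_sq (.inr n)
  suffices gauge * cre i = gaugeCre i * gauge from congrArg (fun A => A v) this
  refine ext_Ω fun s => ?_
  simp only [Module.End.mul_apply, cre_Ω]
  cases i with
  | inl k =>
    rw [gaugeCre_inl, gauge_Ω]
    by_cases hk : k ∈ s.1
    · simp only [Has, hk, if_true, map_zero]
      exact (mul_orderedProd_of_mem hB hB2 hk _).symm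
    · simp only [Has, hk, if_false, map_smul, gauge_Ω, fill, countBelow]
      exact (mul_orderedProd_of_notMem hB hk _).symm
  | inr k =>
    rw [gaugeCre_inr, gauge_Ω, anticomm_orderedProd (hCB k)]
    by_cases hk : k ∈ s.2
    · simp only [Has, hk, if_true, map_zero]
      rw [mul_orderedProd_of_mem hC hC2 hk, map_zero, smul_zero]
    · simp only [Has, hk, if_false, map_smul, gauge_Ω, fill, countBelow]
      rw [mul_orderedProd_of_notMem hC hk, map_smul, smul_smul, pow_add]

lemma Occ.induction_fill {P : Occ → Prop} (h0 : P (∅, ∅))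
    (h : ∀ i s, ¬ Has i s → P s → P (fill i s)) (s : Occ) : P s := by
  obtain ⟨x, y⟩ := s
  induction y using Finset.induction_on with
  | empty =>
    induction x using Finset.induction_on with
    | empty => exact h0
    | insert a x ha ih => exact h (.inl a) (x, ∅) ha ih
  | insert a y ha ih => exact h (.inr a) (x, y) ha ih

lemma Ω_fill {i : Mode} {s : Occ} (h : ¬ Has i s) :
    Ω (fill i s) = (-1 : ℂ) ^ countBelow i s • cre i (Ω s) := by
  rw [cre_Ω, if_neg h, smul_smul, ← pow_add, ← two_mul]
  simp

/-- A property of vectors which is linear, holds for the vacuum and is stable under the creation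
operators holds for all vectors. -/
lemma induction_cre {P : Fin𝓕 → Prop} (h0 : P 0) (hadd : ∀ f g, P f → P g → P (f + g))
    (hsmul : ∀ (c : ℂ) f, P f → P (c • f)) (hvac : P (Ω (∅, ∅)))
    (hcre : ∀ i f, P f → P (cre i f)) (f : Fin𝓕) : P f := by
  refine induction_Ω h0 hadd hsmul (fun s => ?_) f
  induction s using Occ.induction_fill with
  | h0 => exact hvac
  | h i s hi ih =>
    rw [Ω_fill hi]
    exact hsmul _ _ (hcre i _ ih)

lemma ann_vac (i : Mode) : ann i (Ω (∅, ∅)) = 0 := by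
  rw [ann_Ω, if_neg]
  cases i <;> simp [Has]

lemma gauge_vac : gauge (Ω (∅, ∅)) = gaugeVac := by simp [gauge_Ω, orderedProd]

lemma gaugeVac_eq_Ω : gaugeVac = Ω ({-1}, {1}) := by
  simp [gaugeVac, bDag, cDag]

/-- Thus `gaugeVac` is the vacuum of the transformed operators, which is what lets `Γ` intertwine
annihilators as well as creators. -/
lemma gaugeAnn_gaugeVac (i : Mode) : gaugeAnn i gaugeVac = 0 := by
  rw [gaugeVac_eq_Ω]
  by_cases h : IsZeroMode i
  · rcases h with rfl | rfl <;> simp [gaugeAnn, IsZeroMode, gaugeMode, cre_Ω, Has]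
  · simp only [gaugeAnn, h, if_false, ann_Ω]
    rw [if_neg]
    cases i <;> simp only [IsZeroMode, Sum.inl.injEq, Sum.inr.injEq, reduceCtorEq, or_false,
      false_or] at h <;> simp [gaugeMode, h, Has]

lemma gauge_ann (i : Mode) (v : Fin𝓕) : gauge (ann i v) = gaugeAnn i (gauge v) := by
  induction v using induction_cre with
  | h0 => simp
  | hadd f g hf hg => simp [hf, hg]
  | hsmul c f hf => simp [hf]
  | hvac => rw [ann_vac, gauge_vac, gaugeAnn_gaugeVac, map_zero]
  | hcre j f hf =>
    by_cases hij : i = j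
    · subst hij
      have h1 := congrArg (fun A => A f) (ann_cre_self i)
      have h2 := congrArg (fun A => A (gauge f)) (gaugeAnn_gaugeCre_self i)
      simp only [Module.End.mul_apply, LinearMap.sub_apply, Module.End.one_apply] at h1 h2
      rw [h1, gauge_cre, h2, map_sub, gauge_cre, hf]
    · have h1 := congrArg (fun A => A f) (ann_cre_of_ne hij)
      have h2 := congrArg (fun A => A (gauge f)) (gaugeAnn_gaugeCre_of_ne hij)
      simp only [Module.End.mul_apply, LinearMap.neg_apply] at h1 h2
      rw [h1, gauge_cre, h2, map_neg, gauge_cre, hf]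

/-- The inner product is determined by the vacuum and the adjointness of creators and annihilators.
The transformed operators with `gaugeVac` satisfy the same relations. -/
lemma ip_gauge (f g : Fin𝓕) : ip (gauge f) (gauge g) = ip f g := by
  induction f using induction_cre generalizing g with
  | h0 => simp
  | hadd f f' h h' => rw [map_add, ip_add_left, ip_add_left, h, h']
  | hsmul c f h => rw [map_smul, ip_smul_left, ip_smul_left, h]
  | hvac =>
    rw [gauge_vac]
    induction g using induction_cre with
    | h0 => simp
    | hadd f f' h h' => rw [map_add, ip_add_right, ip_add_right, h, h']
    | hsmul c f h => rw [map_smul, ip_smul_right, ip_smul_right, h]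
    | hvac => rw [gauge_vac, gaugeVac_eq_Ω, ip_Ω_Ω, ip_Ω_Ω]; simp
    | hcre j f _ =>
      rw [gauge_cre, ← (isAdj_gaugeCre j).symm, gaugeAnn_gaugeVac, ← (isAdj_cre_ann j).symm,
        ann_vac, ip_zero_left, ip_zero_left]
  | hcre i f hf => rw [gauge_cre, isAdj_gaugeCre i, ← gauge_ann, hf, isAdj_cre_ann i]

lemma eq_zero_of_ip_self {f : Fin𝓕} (h : ip f f = 0) : f = 0 := by
  rw [ip, Finsupp.sum] at h
  have h' : ∑ s ∈ f.support, ‖f s‖ ^ 2 = 0 := by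
    have : ((∑ s ∈ f.support, ‖f s‖ ^ 2 : ℝ) : ℂ) = 0 := by
      rw [← h]
      push_cast
      exact Finset.sum_congr rfl fun s _ => (Complex.conj_mul' (f s)).symm
    exact_mod_cast this
  ext s
  by_contra hs
  have := (Finset.sum_eq_zero_iff_of_nonneg (fun s _ => by positivity)).1 h' s
    (Finsupp.mem_support_iff.2 hs)
  simp at this
  exact hs this

lemma gauge_injective : Function.Injective gauge := by
  rw [← LinearMap.ker_eq_bot, LinearMap.ker_eq_bot']
  intro v hv
  refine eq_zero_of_ip_self ?_
  rw [← ip_gauge, hv, ip_zero_left]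

lemma gauge_surjective : Function.Surjective gauge := by
  intro v
  induction v using induction_cre with
  | h0 => exact ⟨0, map_zero _⟩
  | hadd f g hf hg =>
    obtain ⟨x, rfl⟩ := hf
    obtain ⟨y, rfl⟩ := hg
    exact ⟨x + y, map_add _ _ _⟩
  | hsmul c f hf =>
    obtain ⟨x, rfl⟩ := hf
    exact ⟨c • x, map_smul _ _ _⟩
  | hvac =>
    -- The zero-mode creators become the annihilators that empty the two modes occupied in
    -- `gaugeVac`.
    refine ⟨cre (.inl 0) (cre (.inr 0) (Ω (∅, ∅))), ?_⟩
    rw [gauge_cre, gauge_cre, gauge_vac, gaugeVac_eq_Ω]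
    simp [gaugeCre, IsZeroMode, gaugeMode, ann_Ω, Has, clear, countBelow, Finset.filter_singleton]
  | hcre i f hf =>
    obtain ⟨x, rfl⟩ := hf
    cases i with
    | inl k =>
      by_cases hk : k = -1
      · refine ⟨ann (.inr 0) x, ?_⟩
        rw [gauge_ann]
        simp [gaugeAnn, IsZeroMode, gaugeMode, hk]
      · refine ⟨cre (.inl (k + 1)) x, ?_⟩
        rw [gauge_cre]
        simp [gaugeCre, IsZeroMode, gaugeMode, show k + 1 ≠ 0 by omega]
    | inr k =>
      by_cases hk : k = 1
      · refine ⟨ann (.inl 0) x, ?_⟩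
        rw [gauge_ann]
        simp [gaugeAnn, IsZeroMode, gaugeMode, hk]
      · refine ⟨cre (.inr (k - 1)) x, ?_⟩
        rw [gauge_cre]
        simp [gaugeCre, IsZeroMode, gaugeMode, show k - 1 ≠ 0 by omega]

/-- `Γ` as an invertible operator. -/
def gaugeEquiv : Fin𝓕 ≃ₗ[ℂ] Fin𝓕 :=
  LinearEquiv.ofBijective gauge ⟨gauge_injective, gauge_surjective⟩

@[simp] lemma gaugeEquiv_apply (v : Fin𝓕) : gaugeEquiv v = gauge v := rfl

/-- Creators generate everything from the vacuum, so it is enough to compare the charges of the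
transformed creators and of `gaugeVac`. -/
lemma wtOp_gauge {f g : Mode → ℤ} {c : ℤ} (h : ∀ i, Shifts f (gaugeCre i) (g i))
    (h0 : wtOp f gaugeVac = (c : ℂ) • gaugeVac) (v : Fin𝓕) :
    wtOp f (gauge v) = gauge (wtOp g v) + (c : ℂ) • gauge v := by
  induction v using induction_cre with
  | h0 => simp
  | hadd x y hx hy =>
    simp only [map_add, hx, hy, smul_add]
    abel
  | hsmul a x hx => simp only [map_smul, hx, smul_add, smul_comm a]
  | hvac => simp [gauge_vac, h0, wtOp_Ω, wt]
  | hcre i x hx =>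
    rw [gauge_cre, h i, hx, shifts_cre g i, map_add, map_smul, map_add, map_smul, gauge_cre,
      gauge_cre]
    abel

lemma shifts_gaugeCre (f : Mode → ℤ) (i : Mode) :
    Shifts f (gaugeCre i) (if IsZeroMode i then -f (gaugeMode i) else f (gaugeMode i)) := by
  by_cases h : IsZeroMode i <;> simp only [gaugeCre, h, if_true, if_false]
  · exact shifts_ann f _
  · exact shifts_cre f _

lemma axial_gauge (v : Fin𝓕) :
    wtOp axialWt (gauge v) = gauge (wtOp axialWt v) - (2 : ℂ) • gauge v := by
  have := wtOp_gauge (f := axialWt) (g := axialWt) (c := -2) (fun i => ?_) ?_ v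
  · rw [this]
    push_cast
    rw [neg_smul, sub_eq_add_neg]
  · convert shifts_gaugeCre axialWt i using 1
    rcases i with n | n
    · by_cases h : n = 0
      · simp [IsZeroMode, gaugeMode, h, axialWt]
      · simp only [IsZeroMode, Sum.inl.injEq, h, reduceCtorEq, or_self, if_false, gaugeMode,
          axialWt]
        split_ifs <;> omega
    · by_cases h : n = 0
      · simp [IsZeroMode, gaugeMode, h, axialWt]
      · simp only [IsZeroMode, Sum.inr.injEq, h, reduceCtorEq, or_self, if_false, gaugeMode,
          axialWt]
        split_ifs <;> omega
  · rw [gaugeVac_eq_Ω, wtOp_Ω]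
    simp [wt, axialWt]

lemma charge_gauge (v : Fin𝓕) : wtOp chargeWt (gauge v) = gauge (wtOp chargeWt v) := by
  have := wtOp_gauge (f := chargeWt) (g := chargeWt) (c := 0) (fun i => ?_) ?_ v
  · simpa using this
  · convert shifts_gaugeCre chargeWt i using 1
    rcases i with n | n <;> by_cases h : n = 0 <;> simp [IsZeroMode, gaugeMode, h, chargeWt]
  · rw [gaugeVac_eq_Ω, wtOp_Ω]
    simp [wt, chargeWt]

/-- Each transformed creator carries the energy of the original one minus its axial charge,
including the two zero modes; the `2` is the energy of `gaugeVac`. -/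
lemma energy_gauge (v : Fin𝓕) :
    wtOp energyWt (gauge v) =
      gauge (wtOp energyWt v) - gauge (wtOp axialWt v) + (2 : ℂ) • gauge v := by
  have hsub : wtOp (fun i => energyWt i - axialWt i) = wtOp energyWt - wtOp axialWt := by
    refine ext_Ω fun s => ?_
    rw [LinearMap.sub_apply, wtOp_Ω, wtOp_Ω, wtOp_Ω, ← sub_smul]
    congr 1
    simp only [wt, Finset.sum_sub_distrib]
    push_cast
    ring
  have := wtOp_gauge (f := energyWt) (g := fun i => energyWt i - axialWt i) (c := 2)
    (fun i => ?_) ?_ v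
  · rw [this, hsub, LinearMap.sub_apply, map_sub]
    norm_num
  · convert shifts_gaugeCre energyWt i using 1
    rcases i with n | n
    · by_cases h : n = 0
      · simp [IsZeroMode, gaugeMode, h, axialWt, energyWt]
      · simp only [IsZeroMode, Sum.inl.injEq, h, reduceCtorEq, or_self, if_false, gaugeMode,
          axialWt, energyWt]
        split_ifs <;> grind
    · by_cases h : n = 0
      · simp [IsZeroMode, gaugeMode, h, axialWt, energyWt]
      · simp only [IsZeroMode, Sum.inr.injEq, h, reduceCtorEq, or_self, if_false, gaugeMode,
          axialWt, energyWt]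
        split_ifs <;> grind
  · rw [gaugeVac_eq_Ω, wtOp_Ω]
    simp [wt, energyWt]

/-! ### Spectral flow: the action of `Γ` on the chiral fields -/

lemma ψ_true_of_nonneg {n : ℤ} (h : 0 ≤ n) : ψ true n = ann (.inl n) := by
  simp [ψ, IsPart, modeOf, h]

lemma ψ_true_of_neg {n : ℤ} (h : n < 0) : ψ true n = cre (.inr (-n)) := by
  simp [ψ, IsPart, modeOf, h.not_ge]

lemma ψ_false_of_pos {n : ℤ} (h : 0 < n) : ψ false n = ann (.inl (-n)) := by
  simp [ψ, IsPart, modeOf, h]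

lemma ψ_false_of_nonpos {n : ℤ} (h : n ≤ 0) : ψ false n = cre (.inr n) := by
  simp [ψ, IsPart, modeOf, h.not_gt]

lemma ψd_true_of_nonneg {n : ℤ} (h : 0 ≤ n) : ψd true n = cre (.inl n) := by
  simp [ψd, IsPart, modeOf, h]

lemma ψd_true_of_neg {n : ℤ} (h : n < 0) : ψd true n = ann (.inr (-n)) := by
  simp [ψd, IsPart, modeOf, h.not_ge]

lemma ψd_false_of_pos {n : ℤ} (h : 0 < n) : ψd false n = cre (.inl (-n)) := by
  simp [ψd, IsPart, modeOf, h]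

lemma ψd_false_of_nonpos {n : ℤ} (h : n ≤ 0) : ψd false n = ann (.inr n) := by
  simp [ψd, IsPart, modeOf, h.not_gt]

/-- Right-moving sites move down by one and left-moving sites up by one. At the surface of the sea a
creator is exchanged with an annihilator, which is why the zero modes are exceptional in the
definition of `Γ`. -/
lemma gauge_ψ (σ : Bool) (n : ℤ) (v : Fin𝓕) :
    gauge (ψ σ n v) = ψ σ (if σ then n - 1 else n + 1) (gauge v) := by
  cases σ with
  | true =>
    rw [if_pos rfl]
    rcases lt_trichotomy n 0 with h | rfl | h
    · rw [ψ_true_of_neg h, ψ_true_of_neg (by omega), gauge_cre]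
      simp [gaugeCre, IsZeroMode, gaugeMode, h.ne, sub_eq_add_neg, add_comm]
    · rw [ψ_true_of_nonneg le_rfl, ψ_true_of_neg (by omega), gauge_ann]
      simp [gaugeAnn, IsZeroMode, gaugeMode]
    · rw [ψ_true_of_nonneg h.le, ψ_true_of_nonneg (by omega), gauge_ann]
      simp [gaugeAnn, IsZeroMode, gaugeMode, h.ne']
  | false =>
    rw [if_neg (by simp)]
    rcases lt_trichotomy n 0 with h | rfl | h
    · rw [ψ_false_of_nonpos h.le, ψ_false_of_nonpos (by omega), gauge_cre]
      simp [gaugeCre, IsZeroMode, gaugeMode, h.ne]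
    · rw [ψ_false_of_nonpos le_rfl, ψ_false_of_pos (by omega), gauge_cre]
      simp [gaugeCre, IsZeroMode, gaugeMode]
    · rw [ψ_false_of_pos h, ψ_false_of_pos (by omega), gauge_ann]
      simp [gaugeAnn, IsZeroMode, gaugeMode, h.ne', sub_eq_add_neg, add_comm]

lemma gauge_ψd (σ : Bool) (n : ℤ) (v : Fin𝓕) :
    gauge (ψd σ n v) = ψd σ (if σ then n - 1 else n + 1) (gauge v) := by
  cases σ with
  | true =>
    rw [if_pos rfl]
    rcases lt_trichotomy n 0 with h | rfl | h
    · rw [ψd_true_of_neg h, ψd_true_of_neg (by omega), gauge_ann]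
      simp [gaugeAnn, IsZeroMode, gaugeMode, h.ne, sub_eq_add_neg, add_comm]
    · rw [ψd_true_of_nonneg le_rfl, ψd_true_of_neg (by omega), gauge_cre]
      simp [gaugeCre, IsZeroMode, gaugeMode]
    · rw [ψd_true_of_nonneg h.le, ψd_true_of_nonneg (by omega), gauge_cre]
      simp [gaugeCre, IsZeroMode, gaugeMode, h.ne']
  | false =>
    rw [if_neg (by simp)]
    rcases lt_trichotomy n 0 with h | rfl | h
    · rw [ψd_false_of_nonpos h.le, ψd_false_of_nonpos (by omega), gauge_ann]
      simp [gaugeAnn, IsZeroMode, gaugeMode, h.ne]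
    · rw [ψd_false_of_nonpos le_rfl, ψd_false_of_pos (by omega), gauge_ann]
      simp [gaugeAnn, IsZeroMode, gaugeMode]
    · rw [ψd_false_of_pos h, ψd_false_of_pos (by omega), gauge_cre]
      simp [gaugeCre, IsZeroMode, gaugeMode, h.ne', sub_eq_add_neg, add_comm]

/-- A density sums over all sites, so translating both of its factors by the same site only
reindexes the sum. -/
lemma gauge_dens (σ : Bool) {m : ℤ} (hm : m ≠ 0) (v : Fin𝓕) :
    gauge (dens σ m v) = dens σ m (gauge v) := by
  have h := locFin_pair σ hm
  let ε : ℤ := if σ then -1 else 1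
  have hε : ∀ n : ℤ, (if σ then n - 1 else n + 1) = n + ε := by
    intro n
    cases σ <;> simp [ε, sub_eq_add_neg]
  rw [dens, h.opSum_apply_sum v (S := (h v).toFinset) (by simp), map_sum, h.opSum_apply,
    ← finsum_comp_equiv (Equiv.addRight ε), finsum_eq_sum_of_support_subset (s := (h v).toFinset)]
  · refine Finset.sum_congr rfl fun n _ => ?_
    simp only [Module.End.mul_apply, gauge_ψ, gauge_ψd, hε, Equiv.coe_addRight]
    rw [add_right_comm]
  · intro n hn
    rw [Set.Finite.coe_toFinset]
    intro h0
    apply hn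
    have := congrArg gauge h0
    simp only [Module.End.mul_apply, gauge_ψ, gauge_ψd, hε, map_zero] at this
    simp only [Module.End.mul_apply, Equiv.coe_addRight]
    rw [add_right_comm, this]

/-! ### Estimates for the density operators -/

lemma toℋ₀_Ω_of_neutral {s : Occ} (h : s.1.card = s.2.card) :
    toℋ₀ (Ω s) = lp.single 2 (⟨s, h⟩ : Neutral) (1 : ℂ) := by
  simp [toℋ₀, h]

lemma inner_toℋ₀ {f : Fin𝓕} (hf : f ∈ 𝓕₀) (g : Fin𝓕) : ⟪toℋ₀ f, toℋ₀ g⟫_ℂ = ip f g := by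
  have h1 : ∀ s ∈ f.support, s.1.card = s.2.card := fun s hs =>
    (Finsupp.mem_supported ℂ f).1 hf hs
  conv_lhs => rw [sum_Ω f]
  rw [map_sum, sum_inner, ip_eq_sum subset_rfl]
  refine Finset.sum_congr rfl fun s hs => ?_
  rw [map_smul, inner_smul_left, toℋ₀_Ω_of_neutral (h1 s hs), lp.inner_single_left, toℋ₀_apply]
  simp

lemma norm_sq_toℋ₀ {f : Fin𝓕} (hf : f ∈ 𝓕₀) : ((‖toℋ₀ f‖ ^ 2 : ℝ) : ℂ) = ip f f := by
  rw [← inner_toℋ₀ hf, inner_self_eq_norm_sq_to_K]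
  simp

lemma inner_self_ofReal {E : Type*} [NormedAddCommGroup E] [InnerProductSpace ℂ E] (x : E) :
    ⟪x, x⟫_ℂ = ((‖x‖ ^ 2 : ℝ) : ℂ) := by
  rw [inner_self_eq_norm_sq_to_K]
  simp

lemma Shifts.mul_of_eq {f : Mode → ℤ} {A B : Module.End ℂ Fin𝓕} {a b c : ℤ} (hA : Shifts f A a)
    (hB : Shifts f B b) (h : a + b = c) : Shifts f (A * B) c :=
  h ▸ hA.mul hB

/-- The operator `A` has a formal adjoint and preserves neutrality. -/
structure IsNice (A B : Module.End ℂ Fin𝓕) : Prop where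
  adj : IsAdj A B
  left : Shifts chargeWt A 0
  right : Shifts chargeWt B 0

lemma IsNice.symm {A B : Module.End ℂ Fin𝓕} (h : IsNice A B) : IsNice B A :=
  ⟨h.adj.symm, h.right, h.left⟩

lemma IsNice.mul {A B A' B' : Module.End ℂ Fin𝓕} (h : IsNice A B) (h' : IsNice A' B') :
    IsNice (A * A') (B' * B) :=
  ⟨h.adj.mul h'.adj, h.left.mul_of_eq h'.left (add_zero 0), h'.right.mul_of_eq h.right (add_zero 0)⟩

lemma IsNice.add {A B A' B' : Module.End ℂ Fin𝓕} (h : IsNice A B) (h' : IsNice A' B') :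
    IsNice (A + A') (B + B') :=
  ⟨h.adj.add h'.adj, h.left.add h'.left, h.right.add h'.right⟩

lemma isNice_dens (σ : Bool) {m : ℤ} (hm : m ≠ 0) : IsNice (dens σ m) (dens σ (-m)) :=
  ⟨isAdj_dens σ hm, shifts_dens_charge σ hm, shifts_dens_charge σ (neg_ne_zero.2 hm)⟩

lemma IsNice.inner {A B : Module.End ℂ Fin𝓕} (h : IsNice A B) {f : Fin𝓕} (hf : f ∈ 𝓕₀)
    (g : Fin𝓕) : ⟪toℋ₀ (A f), toℋ₀ g⟫_ℂ = ⟪toℋ₀ f, toℋ₀ (B g)⟫_ℂ := by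
  rw [inner_toℋ₀ (h.left.map_𝓕₀ hf), inner_toℋ₀ hf, h.adj]

lemma isAdj_diagOp_real (w : Occ → ℝ) : IsAdj (diagOp fun s => (w s : ℂ)) (diagOp fun s => w s) := by
  refine IsAdj.of_basis fun s t => ?_
  rw [diagOp_Ω, diagOp_Ω, ip_smul_left, ip_smul_right, ip_Ω_Ω]
  by_cases h : s = t <;> simp [h]

lemma isAdj_wtOp (f : Mode → ℤ) : IsAdj (wtOp f) (wtOp f) := by
  have := isAdj_diagOp_real fun s => (wt f s : ℝ)
  simpa [wtOp] using this

lemma diagOp_comm (w w' : Occ → ℂ) (v : Fin𝓕) : diagOp w (diagOp w' v) = diagOp w' (diagOp w v) := by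
  ext s
  simp only [diagOp_apply]
  ring

lemma shifts_diagOp (f : Mode → ℤ) (w : Occ → ℂ) : Shifts f (diagOp w) 0 := fun v => by
  rw [wtOp, diagOp_comm]
  simp

lemma isNice_wtOp (f : Mode → ℤ) : IsNice (wtOp f) (wtOp f) :=
  ⟨isAdj_wtOp f, shifts_diagOp _ _, shifts_diagOp _ _⟩

/-- `v` is a neutral state of energy `n`. -/
structure IsHom (n : ℤ) (v : Fin𝓕) : Prop where
  mem : v ∈ 𝓕₀
  energy : wtOp energyWt v = (n : ℂ) • v

lemma IsHom.eq_zero_of_neg {n : ℤ} {v : Fin𝓕} (h : IsHom n v) (hn : n < 0) : v = 0 := by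
  ext s
  have := DFunLike.congr_fun h.energy s
  rw [wtOp_apply, Finsupp.smul_apply, smul_eq_mul, ← sub_eq_zero, ← sub_mul, mul_eq_zero] at this
  rcases this with h' | h'
  · have h2 : wt energyWt s = n := by
      rw [sub_eq_zero] at h'
      exact_mod_cast h'
    have := wt_energyWt_nonneg s
    omega
  · simpa using h'

lemma IsHom.map {n d : ℤ} {v : Fin𝓕} {A : Module.End ℂ Fin𝓕} (h : IsHom n v)
    (hA : Shifts energyWt A d) (hA' : Shifts chargeWt A 0) : IsHom (n + d) (A v) := by
  refine ⟨hA'.map_𝓕₀ h.mem, ?_⟩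
  rw [hA v, h.energy, map_smul, ← add_smul]
  push_cast
  rfl

lemma IsHom.dens {n m : ℤ} {v : Fin𝓕} (h : IsHom n v) (σ : Bool) (hm : m ≠ 0) :
    IsHom (n + m) (dens σ m v) :=
  h.map (shifts_dens_energy σ hm) (shifts_dens_charge σ hm)

lemma IsHom.inner_eq_zero {n k : ℤ} {v w : Fin𝓕} (hv : IsHom n v) (hw : IsHom k w) (hnk : n ≠ k) :
    ⟪toℋ₀ v, toℋ₀ w⟫_ℂ = 0 := by
  have h := (isNice_wtOp energyWt).inner hv.mem w
  rw [hv.energy, hw.energy, map_smul, map_smul, inner_smul_left, inner_smul_right] at h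
  rw [← sub_eq_zero, ← sub_mul, mul_eq_zero] at h
  refine h.resolve_left fun h' => hnk ?_
  rw [sub_eq_zero] at h'
  simpa using h'

lemma dens_neg_dens_apply (σ τ : Bool) {a b : ℤ} (ha : 0 < a) (hb : 0 < b) (v : Fin𝓕) :
    dens σ (-a) (dens τ b v) =
      dens τ b (dens σ (-a) v) + if (σ, a) = (τ, b) then (a : ℂ) • v else 0 := by
  by_cases hστ : σ = τ
  · subst hστ
    by_cases hab : a = b
    · subst hab
      have := congrArg (fun A => A v) (dens_neg_dens σ ha)
      simp only [Module.End.mul_apply, LinearMap.add_apply, LinearMap.smul_apply,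
        Module.End.one_apply] at this
      simpa using this
    · have := congrArg (fun A => A v)
        (dens_dens_of_add_ne σ (a := -a) (b := b) (by omega) (by omega) (by omega))
      simpa [hab] using this
  · have := congrArg (fun A => A v)
      (dens_dens_of_ne hστ (a := -a) (b := b) (by omega) (by omega))
    simpa [hστ] using this

lemma dens_neg_dens_neg_apply (σ τ : Bool) {a b : ℤ} (ha : 0 < a) (hb : 0 < b) (v : Fin𝓕) :
    dens σ (-a) (dens τ (-b) v) = dens τ (-b) (dens σ (-a) v) := by
  by_cases hστ : σ = τ
  · subst hστ
    exact congrArg (fun A => A v)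
      (dens_dens_of_add_ne σ (a := -a) (b := -b) (by omega) (by omega) (by omega))
  · exact congrArg (fun A => A v)
      (dens_dens_of_ne hστ (a := -a) (b := -b) (by omega) (by omega))

lemma norm_sq_dens_pos (σ : Bool) {m : ℤ} (hm : 0 < m) {v : Fin𝓕} (hv : v ∈ 𝓕₀) :
    ‖toℋ₀ (dens σ m v)‖ ^ 2 = ‖toℋ₀ (dens σ (-m) v)‖ ^ 2 + m * ‖toℋ₀ v‖ ^ 2 := by
  have h1 := (isNice_dens σ hm.ne').inner hv (dens σ m v)
  rw [dens_neg_dens_apply σ σ hm hm, if_pos rfl, map_add, inner_add_right, map_smul,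
    inner_smul_right] at h1
  have h2 := (isNice_dens σ hm.ne').symm.inner hv (dens σ (-m) v)
  rw [← h2] at h1
  simp only [inner_self_ofReal] at h1
  exact_mod_cast (h1 : ((‖toℋ₀ (dens σ m v)‖ ^ 2 : ℝ) : ℂ) = ((‖toℋ₀ (dens σ (-m) v)‖ ^ 2 : ℝ) : ℂ)
    + (((m : ℝ) : ℂ)) * ((‖toℋ₀ v‖ ^ 2 : ℝ) : ℂ))

/-- The energy bound for the annihilation parts of the densities. -/
lemma IsHom.sum_norm_sq_dens_le {S : Finset (Bool × ℤ)} (hS : ∀ x ∈ S, 0 < x.2) {n : ℕ}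
    {v : Fin𝓕} (hv : IsHom n v) :
    ∑ x ∈ S, ‖toℋ₀ (Schwinger.dens x.1 (-x.2) v)‖ ^ 2 ≤ n * ‖toℋ₀ v‖ ^ 2 := by
  classical
  induction n using Nat.strong_induction_on generalizing v with
  | _ n ih =>
    -- `T` is the boson energy of the selected modes and `q` is its expectation in `v`. The plan is
    -- to bound `‖T v‖² ≤ n q` by induction on the energy and then to use Cauchy–Schwarz, `q² ≤ ‖v‖²
    -- ‖T v‖²`.
    set T : Fin𝓕 → Fin𝓕 := fun w => ∑ x ∈ S, Schwinger.dens x.1 x.2 (Schwinger.dens x.1 (-x.2) w)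
      with hT
    set q := ∑ x ∈ S, ‖toℋ₀ (Schwinger.dens x.1 (-x.2) v)‖ ^ 2 with hq
    have hform : ∀ w ∈ 𝓕₀, ⟪toℋ₀ w, toℋ₀ (T w)⟫_ℂ =
        ((∑ x ∈ S, ‖toℋ₀ (Schwinger.dens x.1 (-x.2) w)‖ ^ 2 : ℝ) : ℂ) := by
      intro w hw
      rw [hT, map_sum, inner_sum]
      push_cast
      refine Finset.sum_congr rfl fun x hx => ?_
      rw [← (isNice_dens x.1 (m := x.2) (hS x hx).ne').symm.inner hw, inner_self_eq_norm_sq_to_K]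
      rfl
    have hcomm : ∀ x ∈ S, Schwinger.dens x.1 (-x.2) (T v) =
        T (Schwinger.dens x.1 (-x.2) v) + (x.2 : ℂ) • Schwinger.dens x.1 (-x.2) v := by
      intro x hx
      simp only [hT, map_sum]
      have : ∀ y ∈ S, Schwinger.dens x.1 (-x.2) (Schwinger.dens y.1 y.2
          (Schwinger.dens y.1 (-y.2) v)) = Schwinger.dens y.1 y.2 (Schwinger.dens y.1 (-y.2)
            (Schwinger.dens x.1 (-x.2) v)) +
          if x = y then (x.2 : ℂ) • Schwinger.dens x.1 (-x.2) v else 0 := by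
        intro y hy
        rw [dens_neg_dens_apply _ _ (hS x hx) (hS y hy),
          dens_neg_dens_neg_apply _ _ (hS x hx) (hS y hy)]
        by_cases hxy : x = y
        · subst hxy; simp
        · simp [hxy]
      rw [Finset.sum_congr rfl this, Finset.sum_add_distrib]
      simp [hx]
    have hT2 : ‖toℋ₀ (T v)‖ ^ 2 ≤ n * q := by
      have h1 : ((‖toℋ₀ (T v)‖ ^ 2 : ℝ) : ℂ) =
          ((∑ x ∈ S, ((∑ y ∈ S, ‖toℋ₀ (Schwinger.dens y.1 (-y.2)
            (Schwinger.dens x.1 (-x.2) v))‖ ^ 2) +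
            x.2 * ‖toℋ₀ (Schwinger.dens x.1 (-x.2) v)‖ ^ 2) : ℝ) : ℂ) := by
        have : ((‖toℋ₀ (T v)‖ ^ 2 : ℝ) : ℂ) = ⟪toℋ₀ (T v), toℋ₀ (T v)⟫_ℂ := by
          rw [inner_self_eq_norm_sq_to_K]; push_cast; rfl
        rw [this]
        conv_lhs => rw [hT]
        simp only [map_sum, sum_inner]
        rw [Complex.ofReal_sum]
        refine Finset.sum_congr rfl fun x hx => ?_
        have hx0 := (hS x hx).ne'
        have hw := hv.dens x.1 (neg_ne_zero.2 hx0)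
        have e := (isNice_dens x.1 hx0).inner hw.mem (T v)
        rw [hcomm x hx, map_add, inner_add_right, hform _ hw.mem, map_smul, inner_smul_right,
          inner_self_eq_norm_sq_to_K] at e
        rw [← map_sum, show (∑ y ∈ S, Schwinger.dens y.1 y.2 (Schwinger.dens y.1 (-y.2) v)) = T v
          from rfl, e]
        push_cast
        rfl
      have h2 : ‖toℋ₀ (T v)‖ ^ 2 = _ := Complex.ofReal_injective h1
      rw [h2, hq, Finset.mul_sum]
      refine Finset.sum_le_sum fun x hx => ?_
      have hx0 := (hS x hx)
      have hw := hv.dens x.1 (neg_ne_zero.2 hx0.ne')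
      by_cases hneg : (n : ℤ) + -x.2 < 0
      · simp [hw.eq_zero_of_neg hneg]
      · obtain ⟨k, hk⟩ := Int.eq_ofNat_of_zero_le (not_lt.1 hneg)
        rw [hk] at hw
        -- After one annihilator of index `x.2` the energy is `n - x.2`. The induction hypothesis
        -- contributes this factor and the commutator with `T` contributes `x.2`, so the total is
        -- again `n`.
        have := ih k (by omega) hw
        have hk' : (n : ℝ) = k + x.2 := by
          have : (n : ℤ) = k + x.2 := by omega
          exact_mod_cast this
        rw [hk', add_mul]
        gcongr
    have hq0 : 0 ≤ q := Finset.sum_nonneg fun _ _ => by positivity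
    have hq1 : q ≤ ‖toℋ₀ v‖ * ‖toℋ₀ (T v)‖ := by
      have := norm_inner_le_norm (𝕜 := ℂ) (toℋ₀ v) (toℋ₀ (T v))
      rwa [hform v hv.mem, Complex.norm_real, Real.norm_of_nonneg hq0] at this
    rcases hq0.eq_or_lt with h0 | h0
    · rw [← h0]; positivity
    · have h3 : q ^ 2 ≤ ‖toℋ₀ v‖ ^ 2 * (n * q) := by
        calc q ^ 2 ≤ (‖toℋ₀ v‖ * ‖toℋ₀ (T v)‖) ^ 2 := by gcongr
          _ = ‖toℋ₀ v‖ ^ 2 * ‖toℋ₀ (T v)‖ ^ 2 := by ring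
          _ ≤ _ := by gcongr
      nlinarith

/-! Decomposition by energy -/

/-- The component of energy `n`. -/
def comp (n : ℕ) : Module.End ℂ Fin𝓕 := diagOp fun s => if wt energyWt s = n then 1 else 0

lemma isHom_comp (n : ℕ) {v : Fin𝓕} (hv : v ∈ 𝓕₀) : IsHom n (comp n v) := by
  refine ⟨(shifts_diagOp _ _).map_𝓕₀ hv, ?_⟩
  ext s
  rw [wtOp_apply, Finsupp.smul_apply, comp, diagOp_apply]
  split_ifs with h <;> simp [h]

lemma exists_sum_comp (v : Fin𝓕) : ∃ N, v = ∑ n ∈ Finset.range N, comp n v := by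
  refine ⟨(v.support.sup fun s => (wt energyWt s).toNat) + 1, ?_⟩
  ext s
  rw [Finsupp.finsetSum_apply]
  by_cases hs : v s = 0
  · simp [comp, diagOp_apply, hs]
  · rw [Finset.sum_eq_single (wt energyWt s).toNat]
    · rw [comp, diagOp_apply, if_pos (by rw [Int.toNat_of_nonneg (wt_energyWt_nonneg s)]), one_mul]
    · intro n _ hn
      rw [comp, diagOp_apply, if_neg (by intro h; apply hn; omega), zero_mul]
    · intro h
      refine absurd (Finset.mem_range.2 (Nat.lt_succ_of_le ?_)) h
      exact Finset.le_sup (f := fun s => (wt energyWt s).toNat) (Finsupp.mem_support_iff.2 hs)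

lemma norm_sq_sum_isHom {N : ℕ} {d : ℤ} {w : ℕ → Fin𝓕} (hw : ∀ n : ℕ, IsHom (n + d) (w n)) :
    ‖toℋ₀ (∑ n ∈ Finset.range N, w n)‖ ^ 2 = ∑ n ∈ Finset.range N, ‖toℋ₀ (w n)‖ ^ 2 := by
  have : ((‖toℋ₀ (∑ n ∈ Finset.range N, w n)‖ ^ 2 : ℝ) : ℂ) =
      ((∑ n ∈ Finset.range N, ‖toℋ₀ (w n)‖ ^ 2 : ℝ) : ℂ) := by
    have h1 : ((‖toℋ₀ (∑ n ∈ Finset.range N, w n)‖ ^ 2 : ℝ) : ℂ) =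
        ⟪toℋ₀ (∑ n ∈ Finset.range N, w n), toℋ₀ (∑ n ∈ Finset.range N, w n)⟫_ℂ := by
      rw [inner_self_eq_norm_sq_to_K]; push_cast; rfl
    rw [h1, map_sum, sum_inner]
    push_cast
    refine Finset.sum_congr rfl fun n hn => ?_
    rw [inner_sum, Finset.sum_eq_single n]
    · rw [inner_self_eq_norm_sq_to_K]; rfl
    · intro k _ hk
      exact (hw n).inner_eq_zero (hw k) (by omega)
    · exact fun h => absurd hn h
  exact_mod_cast this

/-- `E + 1`. -/
def energyOne : Module.End ℂ Fin𝓕 := wtOp energyWt + 1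

/-- Each `B i` changes the energy by a fixed amount, so it keeps components of different energy
orthogonal, and a quadratic bound need only be checked at a single energy. -/
lemma sum_norm_sq_le_of_isHom {ι : Type*} {I : Finset ι} {B : ι → Module.End ℂ Fin𝓕} {d : ι → ℤ}
    (hB : ∀ i ∈ I, Shifts energyWt (B i) (d i)) (hB' : ∀ i ∈ I, Shifts chargeWt (B i) 0) {C : ℝ}
    (h : ∀ (n : ℕ) (v : Fin𝓕), IsHom n v →
      ∑ i ∈ I, ‖toℋ₀ (B i v)‖ ^ 2 ≤ C * ((n + 1) ^ 2 * ‖toℋ₀ v‖ ^ 2))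
    {v : Fin𝓕} (hv : v ∈ 𝓕₀) :
    ∑ i ∈ I, ‖toℋ₀ (B i v)‖ ^ 2 ≤ C * ‖toℋ₀ (energyOne v)‖ ^ 2 := by
  obtain ⟨N, hN⟩ := exists_sum_comp v
  have h1 : ∀ i ∈ I, ‖toℋ₀ (B i v)‖ ^ 2 = ∑ n ∈ Finset.range N, ‖toℋ₀ (B i (comp n v))‖ ^ 2 := by
    intro i hi
    conv_lhs => rw [hN, map_sum]
    exact norm_sq_sum_isHom fun n => (isHom_comp n hv).map (hB i hi) (hB' i hi)
  have h2 : ‖toℋ₀ (energyOne v)‖ ^ 2 =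
      ∑ n ∈ Finset.range N, ((n : ℝ) + 1) ^ 2 * ‖toℋ₀ (comp n v)‖ ^ 2 := by
    have h3 : ∀ n, energyOne (comp n v) = ((n : ℂ) + 1) • comp n v := by
      intro n
      rw [energyOne, LinearMap.add_apply, (isHom_comp n hv).energy, Module.End.one_apply, add_smul,
        one_smul]
      rfl
    conv_lhs => rw [hN, map_sum]
    rw [norm_sq_sum_isHom (d := 0)]
    · refine Finset.sum_congr rfl fun n _ => ?_
      rw [h3, map_smul, norm_smul, mul_pow]
      congr 2
      rw [show (n : ℂ) + 1 = ((n + 1 : ℝ) : ℂ) by push_cast; rfl, Complex.norm_real,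
        Real.norm_of_nonneg (by positivity)]
    · intro n
      rw [h3]
      have := isHom_comp n hv
      exact ⟨𝓕₀.smul_mem _ this.mem, by rw [map_smul, this.energy, smul_comm, add_zero]⟩
  rw [Finset.sum_congr rfl h1, Finset.sum_comm, h2, Finset.mul_sum]
  exact Finset.sum_le_sum fun n _ => h n _ (isHom_comp n hv)

/-! ### Pair and number operators -/

/-- `ϱᴿ(m) ϱᴸ(-m)`. -/
def pairOp (m : ℤ) : Module.End ℂ Fin𝓕 := dens true m * dens false m

/-- `ϱᴿ(m) ϱᴿ(-m) + ϱᴸ(-m) ϱᴸ(m)` for `m > 0`. -/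
def numOp (m : ℤ) : Module.End ℂ Fin𝓕 :=
  dens true m * dens true (-m) + dens false m * dens false (-m)

lemma isNice_pairOp {m : ℤ} (hm : m ≠ 0) : IsNice (pairOp m) (pairOp (-m)) := by
  have := (isNice_dens true hm).mul (isNice_dens false hm)
  rwa [dens_dens_of_ne (by simp) (neg_ne_zero.2 hm) (neg_ne_zero.2 hm)] at this

lemma shifts_pairOp {m : ℤ} (hm : m ≠ 0) : Shifts energyWt (pairOp m) (2 * m) := by
  have := (shifts_dens_energy true hm).mul (shifts_dens_energy false hm)
  rwa [← two_mul] at this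

lemma isNice_numOp {m : ℤ} (hm : m ≠ 0) : IsNice (numOp m) (numOp m) := by
  have h : ∀ σ, IsNice (dens σ m * dens σ (-m)) (dens σ m * dens σ (-m)) := fun σ => by
    have := (isNice_dens σ hm).mul (isNice_dens σ hm).symm
    exact this
  exact (h true).add (h false)

lemma shifts_numOp {m : ℤ} (hm : m ≠ 0) : Shifts energyWt (numOp m) 0 := by
  have h : ∀ σ, Shifts energyWt (dens σ m * dens σ (-m)) 0 := fun σ => by
    have := (shifts_dens_energy σ hm).mul (shifts_dens_energy σ (neg_ne_zero.2 hm))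
    simpa using this
  exact (h true).add (h false)

lemma IsHom.norm_sq_dens_neg_le {n : ℤ} {v : Fin𝓕} (hv : IsHom n v) (σ : Bool) {m : ℤ}
    (hm : 0 < m) : ‖toℋ₀ (Schwinger.dens σ (-m) v)‖ ^ 2 ≤ n * ‖toℋ₀ v‖ ^ 2 := by
  rcases lt_or_ge n 0 with hn | hn
  · simp [hv.eq_zero_of_neg hn]
  · obtain ⟨k, rfl⟩ := Int.eq_ofNat_of_zero_le hn
    have := hv.sum_norm_sq_dens_le (S := {(σ, m)}) (by simpa using hm)
    simpa using this

/-- Two annihilators in succession. The outer one is estimated by the energy mode by mode, the inner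
ones by the energy bound for the whole sum over modes. -/
lemma sum_norm_sq_pairOp_neg_le {T : Finset ℤ} (hT : ∀ m ∈ T, 0 < m) {v : Fin𝓕} (hv : v ∈ 𝓕₀) :
    ∑ m ∈ T, ‖toℋ₀ (pairOp (-m) v)‖ ^ 2 ≤ ‖toℋ₀ (energyOne v)‖ ^ 2 := by
  have h0 : ∀ m ∈ T, -m ≠ 0 := fun m hm => by have := hT m hm; omega
  rw [← one_mul (‖toℋ₀ (energyOne v)‖ ^ 2)]
  refine sum_norm_sq_le_of_isHom (B := fun m => pairOp (-m)) (d := fun m => 2 * -m)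
    (fun m hm => shifts_pairOp (h0 m hm)) (fun m hm => (isNice_pairOp (h0 m hm)).left) ?_ hv
  intro n w hw
  have h1 : ∀ m ∈ T, ‖toℋ₀ (pairOp (-m) w)‖ ^ 2 ≤ n * ‖toℋ₀ (dens false (-m) w)‖ ^ 2 := by
    intro m hm
    have hm0 := hT m hm
    refine ((hw.dens false (h0 m hm)).norm_sq_dens_neg_le true hm0).trans ?_
    gcongr
    push_cast
    have : (0 : ℝ) < m := by exact_mod_cast hm0
    linarith
  have h2 := hw.sum_norm_sq_dens_le (S := T.image fun m => (false, m)) (by simpa using hT)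
  rw [Finset.sum_image (by simp)] at h2
  calc _ ≤ ∑ m ∈ T, (n : ℝ) * ‖toℋ₀ (dens false (-m) w)‖ ^ 2 := Finset.sum_le_sum h1
    _ ≤ n * (n * ‖toℋ₀ w‖ ^ 2) := by rw [← Finset.mul_sum]; gcongr
    _ ≤ 1 * ((n + 1) ^ 2 * ‖toℋ₀ w‖ ^ 2) := by
      rw [← mul_assoc, one_mul]
      gcongr
      nlinarith [(Nat.cast_nonneg n : (0 : ℝ) ≤ n)]

lemma norm_toℋ₀_le_energyOne {v : Fin𝓕} (hv : v ∈ 𝓕₀) : ‖toℋ₀ v‖ ≤ ‖toℋ₀ (energyOne v)‖ := by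
  have := sum_norm_sq_le_of_isHom (I := {()}) (B := fun _ => (1 : Module.End ℂ Fin𝓕))
    (d := fun _ => 0) (fun _ _ v => by simp) (fun _ _ v => by simp) (C := 1)
    (fun n w hw => ?_) hv
  · simp only [Finset.sum_singleton, Module.End.one_apply, one_mul] at this
    exact le_of_sq_le_sq this (norm_nonneg _)
  · rw [Finset.sum_singleton, one_mul, Module.End.one_apply]
    exact le_mul_of_one_le_left (by positivity)
      (one_le_pow₀ (by linarith [(Nat.cast_nonneg n : (0 : ℝ) ≤ n)]))

lemma norm_numOp_le {m : ℤ} (hm : 0 < m) {v : Fin𝓕} (hv : v ∈ 𝓕₀) :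
    ‖toℋ₀ (numOp m v)‖ ≤ 2 * ‖toℋ₀ (energyOne v)‖ := by
  have hm' : -m ≠ 0 := by omega
  have key : ∀ σ, ‖toℋ₀ ((dens σ m * dens σ (-m)) v)‖ ≤ ‖toℋ₀ (energyOne v)‖ := by
    intro σ
    have := sum_norm_sq_le_of_isHom (I := {()}) (B := fun _ => dens σ m * dens σ (-m))
      (d := fun _ => m + -m)
      (fun _ _ => (shifts_dens_energy σ hm.ne').mul (shifts_dens_energy σ hm'))
      (fun _ _ => (shifts_dens_charge σ hm.ne').mul_of_eq (shifts_dens_charge σ hm') (add_zero 0))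
      (C := 1)
      (fun n w hw => ?_) hv
    · simp only [Finset.sum_singleton, one_mul] at this
      exact le_of_sq_le_sq this (norm_nonneg _)
    · have hw' := hw.dens σ hm'
      -- The creator costs a Schwinger term `m`, compensated by the energy `m` that the annihilator
      -- has removed; hence a bound independent of `m`.
      rw [Finset.sum_singleton, one_mul, Module.End.mul_apply, norm_sq_dens_pos σ hm hw'.mem]
      have h1 := hw'.norm_sq_dens_neg_le σ hm
      have h2 := hw.norm_sq_dens_neg_le σ hm
      push_cast at h1 h2
      calc _ ≤ ((n : ℝ) + -m) * ‖toℋ₀ (dens σ (-m) w)‖ ^ 2 + m * ‖toℋ₀ (dens σ (-m) w)‖ ^ 2 := by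
            gcongr
        _ = n * ‖toℋ₀ (dens σ (-m) w)‖ ^ 2 := by ring
        _ ≤ n * (n * ‖toℋ₀ w‖ ^ 2) := by gcongr
        _ ≤ _ := by
          rw [← mul_assoc]
          gcongr
          nlinarith [(Nat.cast_nonneg n : (0 : ℝ) ≤ n)]
  rw [numOp, LinearMap.add_apply, map_add, two_mul]
  exact (norm_add_le _ _).trans (add_le_add (key true) (key false))

/-! ### Commutators of the quadratic operators -/

lemma dens_dens_apply_comm (σ τ : Bool) {a b : ℤ} (ha : a ≠ 0) (hb : b ≠ 0) (v : Fin𝓕) :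
    dens σ a (dens τ b v) =
      dens τ b (dens σ a v) + if σ = τ ∧ a + b = 0 then (b : ℂ) • v else 0 := by
  by_cases hστ : σ = τ
  · subst hστ
    by_cases hab : a + b = 0
    · obtain rfl : a = -b := by omega
      rcases lt_or_gt_of_ne hb with h | h
      · have := congrArg (fun A => A v) (dens_neg_dens σ (b := -b) (by omega))
        simp only [Module.End.mul_apply, LinearMap.add_apply, LinearMap.smul_apply,
          Module.End.one_apply, neg_neg] at this
        rw [this]
        simp
      · have := congrArg (fun A => A v) (dens_neg_dens σ h)
        simpa using this
    · have := congrArg (fun A => A v) (dens_dens_of_add_ne σ ha hb hab)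
      simpa [hab] using this
  · have := congrArg (fun A => A v) (dens_dens_of_ne hστ ha hb)
    simpa [hστ] using this

lemma pairOp_comm_energy {a : ℤ} (ha : a ≠ 0) (v : Fin𝓕) :
    pairOp a (wtOp energyWt v) - wtOp energyWt (pairOp a v) = -(2 * a : ℂ) • pairOp a v := by
  rw [shifts_pairOp ha v]
  push_cast
  rw [neg_smul]
  abel

lemma dens_comm_num (σ τ : Bool) {a m : ℤ} (ha : a ≠ 0) (hm : 0 < m) (v : Fin𝓕) :
    dens σ m (dens σ (-m) (dens τ a v)) = dens τ a (dens σ m (dens σ (-m) v)) +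
      if σ = τ ∧ (a = m ∨ a = -m) then (a : ℂ) • dens τ a v else 0 := by
  have hm' : -m ≠ 0 := by omega
  rw [dens_dens_apply_comm σ τ hm' ha, map_add, dens_dens_apply_comm σ τ hm.ne' ha]
  by_cases hστ : σ = τ
  · subst hστ
    rcases eq_or_ne a m with rfl | h1
    · have : a + a ≠ 0 := by omega
      simp [this]
    · rcases eq_or_ne a (-m) with rfl | h2
      · have : -m + -m ≠ 0 := by omega
        simp [this]
      · have h3 : -m + a ≠ 0 := by omega
        have h4 : m + a ≠ 0 := by omega
        simp [h1, h2, h3, h4]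
  · simp [hστ]

/-- `numOp m` weighs each boson of the mode `m` of either chirality by `m`, and a pair operator with
`a = ±m` creates or destroys two of them. -/
lemma pairOp_comm_numOp {a m : ℤ} (ha : a ≠ 0) (hm : 0 < m) (v : Fin𝓕) :
    pairOp a (numOp m v) - numOp m (pairOp a v) =
      if a = m ∨ a = -m then -(2 * a : ℂ) • pairOp a v else 0 := by
  have h1 : ∀ w, dens true m (dens true (-m) (dens false a w)) =
      dens false a (dens true m (dens true (-m) w)) := fun w => by
    simpa using dens_comm_num true false ha hm w
  have h2 : ∀ w, dens false m (dens false (-m) (dens true a w)) =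
      dens true a (dens false m (dens false (-m) w)) := fun w => by
    simpa using dens_comm_num false true ha hm w
  simp only [pairOp, numOp, Module.End.mul_apply, LinearMap.add_apply, map_add]
  rw [dens_comm_num true true ha hm, h1, h2, dens_comm_num false false ha hm]
  by_cases h : a = m ∨ a = -m
  · simp only [h, and_self, if_true, map_add, map_smul]
    rw [neg_smul, two_mul, add_smul]
    abel
  · simp [h]

lemma pairOp_comm_of_add_ne {a b : ℤ} (ha : a ≠ 0) (hb : b ≠ 0) (hab : a + b ≠ 0) (v : Fin𝓕) :
    pairOp a (pairOp b v) = pairOp b (pairOp a v) := by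
  have h : ∀ σ τ w, dens σ a (dens τ b w) = dens τ b (dens σ a w) := fun σ τ w => by
    simpa [hab] using dens_dens_apply_comm σ τ ha hb w
  simp only [pairOp, Module.End.mul_apply, h]

/-- Each chirality contributes a Schwinger term `m`: one contraction yields `m` times `numOp m`,
both together yield the zero point constant `m ^ 2`. -/
lemma pairOp_neg_pairOp {m : ℤ} (hm : 0 < m) (v : Fin𝓕) :
    pairOp (-m) (pairOp m v) =
      pairOp m (pairOp (-m) v) + (m : ℂ) • numOp m v + ((m : ℂ) ^ 2) • v := by
  have hm' : -m ≠ 0 := by omega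
  have h1 : ∀ w, dens false (-m) (dens true m w) = dens true m (dens false (-m) w) := fun w => by
    simpa using dens_dens_apply_comm false true hm' hm.ne' w
  have h2 : ∀ w, dens true (-m) (dens false m w) = dens false m (dens true (-m) w) := fun w => by
    simpa using dens_dens_apply_comm true false hm' hm.ne' w
  have h3 : ∀ σ w, dens σ (-m) (dens σ m w) = dens σ m (dens σ (-m) w) + (m : ℂ) • w :=
    fun σ w => by simpa using dens_dens_apply_comm σ σ hm' hm.ne' w
  simp only [pairOp, numOp, Module.End.mul_apply, LinearMap.add_apply, map_add, h1, h3, h2,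
    map_smul, smul_add, smul_smul, ← pow_two]
  abel

/-- `ϱᴿ(m) ϱᴸ(-m) + ϱᴿ(-m) ϱᴸ(m)`. -/
def mixOp (m : ℤ) : Module.End ℂ Fin𝓕 := pairOp m + pairOp (-m)

lemma isNice_mixOp {m : ℤ} (hm : m ≠ 0) : IsNice (mixOp m) (mixOp m) := by
  have := (isNice_pairOp hm).add (isNice_pairOp hm).symm
  rwa [add_comm (pairOp (-m))] at this

/-- Together with `pairOp_comm_numOp` this closes the algebra: commutation with the pair operators
exchanges `mixOp m` with `numOp m` shifted by `m`, which makes the Heisenberg equations a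
two-dimensional linear system for each mode. -/
lemma pairOp_comm_mixOp {a m : ℤ} (ha : a ≠ 0) (hm : 0 < m) (v : Fin𝓕) :
    pairOp a (mixOp m v) - mixOp m (pairOp a v) =
      if a = m ∨ a = -m then -(a : ℂ) • (numOp m v + (m : ℂ) • v) else 0 := by
  have hm' : -m ≠ 0 := by omega
  simp only [mixOp, LinearMap.add_apply, map_add]
  rcases eq_or_ne a m with rfl | h1
  · rw [pairOp_neg_pairOp hm, if_pos (Or.inl rfl), neg_smul, smul_add, smul_smul, ← pow_two]
    abel
  · rcases eq_or_ne a (-m) with rfl | h2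
    · rw [pairOp_neg_pairOp hm, if_pos (Or.inr rfl), smul_add, smul_smul]
      push_cast
      rw [neg_neg, ← pow_two]
      abel
    · rw [pairOp_comm_of_add_ne ha hm.ne' (by omega), pairOp_comm_of_add_ne ha hm' (by omega),
        if_neg (by tauto)]
      abel

lemma norm_sum_smul_sq_le {E ι : Type*} [NormedAddCommGroup E] [NormedSpace ℂ E] (T : Finset ι)
    (g : ι → ℂ) (x : ι → E) :
    ‖∑ i ∈ T, g i • x i‖ ^ 2 ≤ (∑ i ∈ T, ‖g i‖ ^ 2) * ∑ i ∈ T, ‖x i‖ ^ 2 := by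
  calc ‖∑ i ∈ T, g i • x i‖ ^ 2 ≤ (∑ i ∈ T, ‖g i‖ * ‖x i‖) ^ 2 := by
        gcongr
        exact (norm_sum_le _ _).trans_eq (Finset.sum_congr rfl fun i _ => norm_smul _ _)
    _ ≤ _ := Finset.sum_mul_sq_le_sq_mul_sq _ _ _

lemma norm_sq_sum_pairOp_neg_le {T : Finset ℤ} (hT : ∀ m ∈ T, 0 < m) (g : ℤ → ℂ) {v : Fin𝓕}
    (hv : v ∈ 𝓕₀) :
    ‖∑ m ∈ T, g m • toℋ₀ (pairOp (-m) v)‖ ^ 2 ≤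
      (∑ m ∈ T, ‖g m‖ ^ 2 * (m : ℝ) ^ 2) * ‖toℋ₀ (energyOne v)‖ ^ 2 := by
  refine (norm_sum_smul_sq_le _ _ _).trans ?_
  gcongr with m hm
  · refine le_mul_of_one_le_right (by positivity) (one_le_pow₀ ?_)
    exact_mod_cast hT m hm
  · exact sum_norm_sq_pairOp_neg_le hT hv

lemma inner_sum_smul_sum_smul {ι : Type*} (T : Finset ι) (g h : ι → ℂ) (x y : ι → ℋ₀) :
    ⟪∑ m ∈ T, g m • x m, ∑ m ∈ T, h m • y m⟫_ℂ =
      ∑ m ∈ T, ∑ k ∈ T, (starRingEnd ℂ) (g m) * h k * ⟪x m, y k⟫_ℂ := by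
  rw [sum_inner]
  refine Finset.sum_congr rfl fun m _ => ?_
  rw [inner_sum]
  refine Finset.sum_congr rfl fun k _ => ?_
  rw [inner_smul_left, inner_smul_right, mul_assoc]

lemma inner_pairOp_pairOp {m k : ℤ} (hm : 0 < m) (hk : 0 < k) {v : Fin𝓕} (hv : v ∈ 𝓕₀) :
    ⟪toℋ₀ (pairOp m v), toℋ₀ (pairOp k v)⟫_ℂ =
      ⟪toℋ₀ (pairOp (-k) v), toℋ₀ (pairOp (-m) v)⟫_ℂ + if m = k then
        (m * ⟪toℋ₀ v, toℋ₀ (numOp m v)⟫_ℂ + m ^ 2 * ⟪toℋ₀ v, toℋ₀ v⟫_ℂ) else 0 := by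
  rw [(isNice_pairOp hm.ne').inner hv, (isNice_pairOp (m := -k) (by omega)).inner hv, neg_neg]
  by_cases hmk : m = k
  · subst hmk
    rw [if_pos rfl, pairOp_neg_pairOp hm, map_add, map_add, inner_add_right, inner_add_right,
      map_smul, map_smul, inner_smul_right, inner_smul_right]
    ring
  · rw [if_neg hmk, pairOp_comm_of_add_ne (by omega) (by omega) (by omega), add_zero]

/-- A sum of pair creators is not controlled term by term. Its norm is traded for that of the
adjoint annihilators; different creators commute with the annihilators, so the correction is
diagonal and carries the weights `‖g m‖ ^ 2`. -/
lemma inner_sum_pairOp_self {T : Finset ℤ} (hT : ∀ m ∈ T, 0 < m) (g : ℤ → ℂ) {v : Fin𝓕}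
    (hv : v ∈ 𝓕₀) :
    ⟪∑ m ∈ T, g m • toℋ₀ (pairOp m v), ∑ m ∈ T, g m • toℋ₀ (pairOp m v)⟫_ℂ =
      ⟪∑ m ∈ T, (starRingEnd ℂ) (g m) • toℋ₀ (pairOp (-m) v),
        ∑ m ∈ T, (starRingEnd ℂ) (g m) • toℋ₀ (pairOp (-m) v)⟫_ℂ +
      ∑ m ∈ T, (‖g m‖ ^ 2 : ℂ) *
        (m * ⟪toℋ₀ v, toℋ₀ (numOp m v)⟫_ℂ + m ^ 2 * ⟪toℋ₀ v, toℋ₀ v⟫_ℂ) := by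
  rw [inner_sum_smul_sum_smul, inner_sum_smul_sum_smul, Finset.sum_comm (s := T) (t := T)
    (f := fun m k => (starRingEnd ℂ) ((starRingEnd ℂ) (g m)) * (starRingEnd ℂ) (g k) *
      ⟪toℋ₀ (pairOp (-m) v), toℋ₀ (pairOp (-k) v)⟫_ℂ), ← Finset.sum_add_distrib]
  refine Finset.sum_congr rfl fun m hm => ?_
  have h1 : ∀ k ∈ T, (starRingEnd ℂ) (g m) * g k * ⟪toℋ₀ (pairOp m v), toℋ₀ (pairOp k v)⟫_ℂ =
      (starRingEnd ℂ) ((starRingEnd ℂ) (g k)) * (starRingEnd ℂ) (g m) *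
        ⟪toℋ₀ (pairOp (-k) v), toℋ₀ (pairOp (-m) v)⟫_ℂ + if m = k then (‖g m‖ ^ 2 : ℂ) *
        (m * ⟪toℋ₀ v, toℋ₀ (numOp m v)⟫_ℂ + m ^ 2 * ⟪toℋ₀ v, toℋ₀ v⟫_ℂ) else 0 := by
    intro k hk
    rw [inner_pairOp_pairOp (hT m hm) (hT k hk) hv, Complex.conj_conj, mul_add]
    congr 1
    · ring
    · split_ifs with h
      · rw [← h, Complex.conj_mul']
      · rw [mul_zero]
  rw [Finset.sum_congr rfl h1, Finset.sum_add_distrib, Finset.sum_ite_eq, if_pos hm]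

lemma norm_numOp_expectation_le {m : ℤ} (hm : 0 < m) {v : Fin𝓕} (hv : v ∈ 𝓕₀) :
    ‖m * ⟪toℋ₀ v, toℋ₀ (numOp m v)⟫_ℂ + m ^ 2 * ⟪toℋ₀ v, toℋ₀ v⟫_ℂ‖ ≤
      3 * (m : ℝ) ^ 2 * ‖toℋ₀ (energyOne v)‖ ^ 2 := by
  have hE := norm_toℋ₀_le_energyOne hv
  have hm1 : (1 : ℝ) ≤ m := by exact_mod_cast hm
  have hm2 : ‖(m : ℂ)‖ = m := by
    rw [show (m : ℂ) = ((m : ℝ) : ℂ) by simp, Complex.norm_real,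
      Real.norm_of_nonneg (by linarith)]
  refine (norm_add_le _ _).trans ?_
  rw [norm_mul, norm_mul, norm_pow, inner_self_ofReal, Complex.norm_real,
    Real.norm_of_nonneg (by positivity), hm2]
  have h2 : ‖⟪toℋ₀ v, toℋ₀ (numOp m v)⟫_ℂ‖ ≤ 2 * ‖toℋ₀ (energyOne v)‖ ^ 2 := by
    refine (norm_inner_le_norm _ _).trans ?_
    calc _ ≤ ‖toℋ₀ (energyOne v)‖ * (2 * ‖toℋ₀ (energyOne v)‖) := by
          gcongr
          exact norm_numOp_le hm hv
      _ = _ := by ring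
  have h3 : ‖toℋ₀ v‖ ^ 2 ≤ ‖toℋ₀ (energyOne v)‖ ^ 2 := by gcongr
  calc _ ≤ (m : ℝ) * (2 * ‖toℋ₀ (energyOne v)‖ ^ 2) + (m : ℝ) ^ 2 * ‖toℋ₀ (energyOne v)‖ ^ 2 := by
        gcongr
    _ ≤ (m : ℝ) ^ 2 * (2 * ‖toℋ₀ (energyOne v)‖ ^ 2) +
        (m : ℝ) ^ 2 * ‖toℋ₀ (energyOne v)‖ ^ 2 := by
        gcongr
        nlinarith
    _ = _ := by ring

lemma norm_inner_self (x : ℋ₀) : ‖⟪x, x⟫_ℂ‖ = ‖x‖ ^ 2 := by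
  rw [inner_self_ofReal, Complex.norm_real, Real.norm_of_nonneg (by positivity)]

lemma norm_sq_sum_pairOp_pos_le {T : Finset ℤ} (hT : ∀ m ∈ T, 0 < m) (g : ℤ → ℂ) {v : Fin𝓕}
    (hv : v ∈ 𝓕₀) :
    ‖∑ m ∈ T, g m • toℋ₀ (pairOp m v)‖ ^ 2 ≤
      4 * (∑ m ∈ T, ‖g m‖ ^ 2 * (m : ℝ) ^ 2) * ‖toℋ₀ (energyOne v)‖ ^ 2 := by
  have key := congrArg norm (inner_sum_pairOp_self hT g hv)
  rw [norm_inner_self] at key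
  have h4 := norm_sq_sum_pairOp_neg_le hT (fun m => (starRingEnd ℂ) (g m)) hv
  simp only [RCLike.norm_conj] at h4
  rw [key]
  refine (norm_add_le _ _).trans ?_
  rw [norm_inner_self]
  have h5 : ‖∑ m ∈ T, (‖g m‖ ^ 2 : ℂ) *
        (m * ⟪toℋ₀ v, toℋ₀ (numOp m v)⟫_ℂ + m ^ 2 * ⟪toℋ₀ v, toℋ₀ v⟫_ℂ)‖ ≤
      ∑ m ∈ T, ‖g m‖ ^ 2 * (3 * (m : ℝ) ^ 2 * ‖toℋ₀ (energyOne v)‖ ^ 2) := by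
    refine (norm_sum_le _ _).trans (Finset.sum_le_sum fun m hm => ?_)
    rw [norm_mul, norm_pow, Complex.norm_real, norm_norm]
    exact mul_le_mul_of_nonneg_left (norm_numOp_expectation_le (hT m hm) hv) (by positivity)
  refine (add_le_add h4 h5).trans (le_of_eq ?_)
  rw [Finset.sum_mul, ← Finset.sum_add_distrib, Finset.mul_sum, Finset.sum_mul]
  exact Finset.sum_congr rfl fun m _ => by ring

/-- The nonzero integers. -/
abbrev NZ : Type := {m : ℤ // m ≠ 0}

/-- The central estimate. Positive indices create pairs and contribute the constant `√4 = 2`,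
negative ones annihilate and contribute `1`. -/
lemma norm_sum_pairOp_le (T : Finset NZ) (g : NZ → ℂ) {v : Fin𝓕} (hv : v ∈ 𝓕₀) :
    ‖∑ m ∈ T, g m • toℋ₀ (pairOp m v)‖ ≤
      3 * √(∑ m ∈ T, ‖g m‖ ^ 2 * ((m : ℤ) : ℝ) ^ 2) * ‖toℋ₀ (energyOne v)‖ := by
  classical
  set G := ∑ m ∈ T, ‖g m‖ ^ 2 * ((m : ℤ) : ℝ) ^ 2 with hG
  let g' : ℤ → ℂ := fun m => if h : m ≠ 0 then g ⟨m, h⟩ else 0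
  have hg' : ∀ m : NZ, g' m = g m := fun m => by simp [g', m.2]
  set Tp := (T.filter fun m : NZ => 0 < (m : ℤ)).image (fun m : NZ => (m : ℤ)) with hTp
  set Tn := (T.filter fun m : NZ => ¬ 0 < (m : ℤ)).image (fun m : NZ => -(m : ℤ)) with hTn
  have hp : ∀ m ∈ Tp, 0 < m := by
    intro m hm
    simp only [hTp, Finset.mem_image, Finset.mem_filter] at hm
    obtain ⟨k, ⟨_, hk⟩, rfl⟩ := hm
    exact hk
  have hn : ∀ m ∈ Tn, 0 < m := by
    intro m hm
    simp only [hTn, Finset.mem_image, Finset.mem_filter] at hm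
    obtain ⟨k, ⟨_, hk⟩, rfl⟩ := hm
    have := k.2
    omega
  have ip : Set.InjOn (fun m : NZ => (m : ℤ)) (T.filter fun m : NZ => 0 < (m : ℤ)) :=
    fun a _ b _ h => Subtype.ext h
  have inn : Set.InjOn (fun m : NZ => -(m : ℤ)) (T.filter fun m : NZ => ¬ 0 < (m : ℤ)) :=
    fun a _ b _ h => Subtype.ext (neg_injective h)
  have b1 := norm_sq_sum_pairOp_pos_le hp g' hv
  have b2 := norm_sq_sum_pairOp_neg_le hn (fun m => g' (-m)) hv
  rw [hTp, Finset.sum_image ip, Finset.sum_image ip] at b1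
  rw [hTn, Finset.sum_image inn, Finset.sum_image inn] at b2
  simp only [hg', neg_neg] at b1 b2
  have hle : ∀ (p : NZ → Prop) [DecidablePred p],
      ∑ m ∈ T.filter p, ‖g m‖ ^ 2 * ((m : ℤ) : ℝ) ^ 2 ≤ G := fun p _ =>
    Finset.sum_le_sum_of_subset_of_nonneg (Finset.filter_subset _ _) fun _ _ _ => by positivity
  have hG0 : 0 ≤ G := Finset.sum_nonneg fun _ _ => by positivity
  have c1 : ‖∑ m ∈ T.filter fun m : NZ => 0 < (m : ℤ), g m • toℋ₀ (pairOp m v)‖ ≤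
      2 * √G * ‖toℋ₀ (energyOne v)‖ := by
    refine le_of_sq_le_sq (b1.trans ?_) (by positivity)
    rw [mul_pow, mul_pow, Real.sq_sqrt hG0]
    norm_num
    gcongr
    exact hle _
  have c2 : ‖∑ m ∈ T.filter fun m : NZ => ¬ 0 < (m : ℤ), g m • toℋ₀ (pairOp m v)‖ ≤
      √G * ‖toℋ₀ (energyOne v)‖ := by
    refine le_of_sq_le_sq (b2.trans ?_) (by positivity)
    rw [mul_pow, Real.sq_sqrt hG0]
    push_cast
    simp only [neg_sq]
    gcongr
    exact hle _
  have e : ∑ m ∈ T, g m • toℋ₀ (pairOp m v) =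
      ∑ m ∈ T.filter fun m : NZ => 0 < (m : ℤ), g m • toℋ₀ (pairOp m v) +
      ∑ m ∈ T.filter fun m : NZ => ¬ 0 < (m : ℤ), g m • toℋ₀ (pairOp m v) := by
    rw [Finset.sum_filter_add_sum_filter_not]
  rw [e]
  calc _ ≤ 2 * √G * ‖toℋ₀ (energyOne v)‖ + √G * ‖toℋ₀ (energyOne v)‖ :=
        (norm_add_le _ _).trans (add_le_add c1 c2)
    _ = _ := by ring

/-! ### Differential inequalities in a Hilbert space -/

section Abstract

open Filter

variable {H : Type*} [NormedAddCommGroup H] [InnerProductSpace ℂ H]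

lemma hasDerivAt_norm_sq {u : ℝ → H} {z : H} {t : ℝ} (h : HasDerivAt u (Complex.I • z) t) :
    HasDerivAt (fun s => ‖u s‖ ^ 2) (-2 * (⟪u t, z⟫_ℂ).im) t := by
  have h1 := (h.inner ℂ h)
  have h2 := Complex.reCLM.hasFDerivAt.comp_hasDerivAt t h1
  have h3 : (fun s => ‖u s‖ ^ 2) = Complex.reCLM ∘ fun s => ⟪u s, u s⟫_ℂ := by
    funext s
    simp only [Function.comp, inner_self_ofReal]
    exact (Complex.ofReal_re _).symm
  rw [h3]
  refine h2.congr_deriv ?_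
  rw [← inner_conj_symm (Complex.I • z), inner_smul_right]
  simp only [Complex.reCLM_apply, Complex.add_re, Complex.conj_re, Complex.mul_re, Complex.I_re,
    Complex.I_im]
  ring

/-- Grönwall for `u' = i z`: only the imaginary part of `⟪u, z⟫` changes the norm, so an operator
whose antisymmetric part is bounded produces at most exponential growth. -/
lemma norm_le_exp_of_nonneg {u z : ℝ → H} {w : ℝ} (h : ∀ t, HasDerivAt u (Complex.I • z t) t)
    (hw : ∀ t, |(⟪u t, z t⟫_ℂ).im| ≤ w * ‖u t‖ ^ 2) {t : ℝ} (ht : 0 ≤ t) :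
    ‖u t‖ ≤ Real.exp (w * t) * ‖u 0‖ := by
  have hd : ∀ s, HasDerivAt (fun s => Real.exp (-2 * w * s) * ‖u s‖ ^ 2)
      (Real.exp (-2 * w * s) * (-2 * w) * ‖u s‖ ^ 2 +
        Real.exp (-2 * w * s) * (-2 * (⟪u s, z s⟫_ℂ).im)) s := fun s => by
    refine HasDerivAt.mul ?_ (hasDerivAt_norm_sq (h s))
    have := ((hasDerivAt_id s).const_mul (-2 * w)).exp
    simpa using this
  have hanti : Antitone fun s => Real.exp (-2 * w * s) * ‖u s‖ ^ 2 := by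
    refine antitone_of_deriv_nonpos (fun s => (hd s).differentiableAt) fun s => ?_
    rw [(hd s).deriv]
    have := (abs_le.1 (hw s)).1
    have h0 := Real.exp_pos (-2 * w * s)
    have h1 : Real.exp (-2 * w * s) * (-2 * w) * ‖u s‖ ^ 2 +
        Real.exp (-2 * w * s) * (-2 * (⟪u s, z s⟫_ℂ).im) =
        -2 * (Real.exp (-2 * w * s) * (w * ‖u s‖ ^ 2 + (⟪u s, z s⟫_ℂ).im)) := by ring
    rw [h1]
    have : 0 ≤ Real.exp (-2 * w * s) * (w * ‖u s‖ ^ 2 + (⟪u s, z s⟫_ℂ).im) :=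
      mul_nonneg h0.le (by linarith)
    linarith
  have h1 := hanti ht
  simp only [mul_zero, Real.exp_zero, one_mul] at h1
  refine le_of_sq_le_sq ?_ (by positivity)
  rw [mul_pow, ← Real.exp_nat_mul]
  have h2 : Real.exp ((2 : ℕ) * (w * t)) * (Real.exp (-2 * w * t) * ‖u t‖ ^ 2) = ‖u t‖ ^ 2 := by
    rw [← mul_assoc, ← Real.exp_add]
    have : (2 : ℕ) * (w * t) + -2 * w * t = 0 := by push_cast; ring
    rw [this, Real.exp_zero, one_mul]
  rw [← h2]
  gcongr

lemma norm_le_exp {u z : ℝ → H} {w : ℝ} (h : ∀ t, HasDerivAt u (Complex.I • z t) t)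
    (hw : ∀ t, |(⟪u t, z t⟫_ℂ).im| ≤ w * ‖u t‖ ^ 2) (t : ℝ) :
    ‖u t‖ ≤ Real.exp (w * |t|) * ‖u 0‖ := by
  rcases le_total 0 t with ht | ht
  · rw [abs_of_nonneg ht]
    exact norm_le_exp_of_nonneg h hw ht
  · rw [abs_of_nonpos ht]
    have h1 : ∀ s, HasDerivAt (fun s => u (-s)) (Complex.I • -z (-s)) s := fun s => by
      refine (HasDerivAt.scomp s (h (-s)) (hasDerivAt_neg s)).congr_deriv ?_
      simp
    have := norm_le_exp_of_nonneg h1 (fun s => by simpa using hw (-s)) (t := -t) (by linarith)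
    simpa using this

lemma norm_sq_le_mul_abs {u z : ℝ → H} {C T : ℝ} (h : ∀ t, HasDerivAt u (Complex.I • z t) t)
    (h0 : u 0 = 0) (hC : ∀ t, |t| ≤ T → |(⟪u t, z t⟫_ℂ).im| ≤ C) {t : ℝ} (ht : |t| ≤ T) :
    ‖u t‖ ^ 2 ≤ 2 * C * |t| := by
  have h1 := (convex_Icc (-T) T).norm_image_sub_le_of_norm_hasDerivWithin_le
    (f := fun s => ‖u s‖ ^ 2) (f' := fun s => -2 * (⟪u s, z s⟫_ℂ).im) (C := 2 * C) (x := 0) (y := t)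
    (fun s _ => (hasDerivAt_norm_sq (h s)).hasDerivWithinAt) (fun s hs => ?_)
    (Set.mem_Icc.2 ⟨by linarith [abs_nonneg t], by linarith [abs_nonneg t]⟩)
    (Set.mem_Icc.2 (abs_le.1 ht))
  · simp only [h0, norm_zero, sub_zero, Real.norm_eq_abs] at h1
    refine (le_abs_self _).trans (h1.trans_eq' ?_)
    norm_num
  · rw [norm_mul, Real.norm_eq_abs, Real.norm_eq_abs]
    have := hC s (abs_le.2 hs)
    norm_num
    exact this

/-- A mean value inequality with constants explicit enough to be uniform in a cutoff and to survive
passage to the limit. -/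
lemma norm_sub_sub_smul_le {u : ℝ → H} {z : ℝ → H} {y : H} {C T : ℝ}
    (h : ∀ t, HasDerivAt u (z t) t) (hC : ∀ t, |t| ≤ T → ‖z t - y‖ ≤ C) {t : ℝ} (ht : |t| ≤ T) :
    ‖u t - u 0 - t • y‖ ≤ C * |t| := by
  have h1 := (convex_Icc (-T) T).norm_image_sub_le_of_norm_hasDerivWithin_le
    (f := fun s => u s - s • y) (f' := fun s => z s - y) (C := C) (x := 0) (y := t)
    (fun s _ => ?_) (fun s hs => hC s (abs_le.2 hs))
    (Set.mem_Icc.2 ⟨by linarith [abs_nonneg t], by linarith [abs_nonneg t]⟩)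
    (Set.mem_Icc.2 (abs_le.1 ht))
  · simp only [zero_smul, sub_zero, Real.norm_eq_abs] at h1
    rwa [sub_right_comm]
  · refine HasDerivAt.hasDerivWithinAt (((h s).sub ((hasDerivAt_id s).smul_const y)).congr_deriv ?_)
    simp

lemma inner_im_eq_zero_of_symm {x y : H} (h : ⟪x, y⟫_ℂ = ⟪y, x⟫_ℂ) : (⟪x, y⟫_ℂ).im = 0 := by
  rw [← inner_conj_symm y x] at h
  exact Complex.conj_eq_iff_im.1 h.symm

/-! ### Cutoffs -/

/-- A bounded operator `D` (the inverse of a positive operator), with spectral cutoffs `P n` and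
truncated inverses `B n`. -/
structure EnergyScale (H : Type*) [NormedAddCommGroup H] [InnerProductSpace ℂ H] where
  D : H →L[ℂ] H
  P : ℕ → H →L[ℂ] H
  B : ℕ → H →L[ℂ] H
  inner_D : ∀ x y, ⟪D x, y⟫_ℂ = ⟪x, D y⟫_ℂ
  inner_P : ∀ n x y, ⟪P n x, y⟫_ℂ = ⟪x, P n y⟫_ℂ
  inner_B : ∀ n x y, ⟪B n x, y⟫_ℂ = ⟪x, B n y⟫_ℂ
  P_P : ∀ {n m}, n ≤ m → ∀ x, P n (P m x) = P n x
  P_P' : ∀ {n m}, n ≤ m → ∀ x, P m (P n x) = P n x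
  D_B : ∀ n x, D (B n x) = P n x
  B_D : ∀ n x, B n (D x) = P n x
  P_B : ∀ {n m}, n ≤ m → ∀ x, P n (B m x) = B n x
  B_P : ∀ {n m}, n ≤ m → ∀ x, B m (P n x) = B n x
  tail : ∀ n x, ‖D x - P n (D x)‖ ≤ ‖x‖ / (n + 1)
  tendsto_P : ∀ x, Tendsto (fun n => P n x) atTop (𝓝 x)

namespace EnergyScale

variable (S : EnergyScale H)

lemma norm_P_le (n : ℕ) (x : H) : ‖S.P n x‖ ≤ ‖x‖ := by
  have h : ‖S.P n x‖ ^ 2 ≤ ‖S.P n x‖ * ‖x‖ := by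
    have h1 : ((‖S.P n x‖ ^ 2 : ℝ) : ℂ) = ⟪S.P n x, x⟫_ℂ := by
      rw [← inner_self_ofReal, ← S.inner_P, S.P_P le_rfl]
    have h2 := congrArg norm h1
    rw [Complex.norm_real, Real.norm_of_nonneg (by positivity)] at h2
    rw [h2]
    exact norm_inner_le_norm _ _
  rcases (norm_nonneg (S.P n x)).eq_or_lt with h0 | h0
  · rw [← h0]
    exact norm_nonneg x
  · rw [pow_two] at h
    exact le_of_mul_le_mul_left h h0

lemma D_P (n : ℕ) (x : H) : S.D (S.P n x) = S.P n (S.D x) := by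
  rw [← S.B_D, S.D_B]

lemma denseRange_D : DenseRange S.D := by
  intro y
  refine mem_closure_of_tendsto (S.tendsto_P y) (Eventually.of_forall fun n => ?_)
  exact ⟨S.B n y, S.D_B n y⟩

variable [CompleteSpace H]

/-- An element with bounded truncated energies lies in the range of `D`. -/
lemma exists_D_eq {y : H} {C : ℝ} (h : ∀ k, ‖S.B k y‖ ≤ C) : ∃ x, S.D x = y ∧ ‖x‖ ≤ C := by
  -- The increments of `S.B k y` are orthogonal to what precedes them, so the squared norms
  -- increase. Being bounded they converge, and this makes the vectors themselves Cauchy.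
  have horth : ∀ {k m}, k ≤ m → ‖S.B m y‖ ^ 2 = ‖S.B k y‖ ^ 2 + ‖S.B m y - S.B k y‖ ^ 2 := by
    intro k m hkm
    have : ⟪S.B k y, S.B m y - S.B k y⟫_ℂ = 0 := by
      rw [inner_sub_right, ← S.P_B le_rfl y, S.inner_P, S.inner_P, S.P_B hkm, S.P_B le_rfl,
        S.P_B le_rfl, sub_self]
    have h2 := norm_add_sq_eq_norm_sq_add_norm_sq_of_inner_eq_zero _ _ this
    rw [add_sub_cancel] at h2
    rw [pow_two, h2]
    ring
  have hmono : Monotone fun k => ‖S.B k y‖ ^ 2 := fun k m hkm => by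
    simp only [horth hkm]
    linarith [sq_nonneg ‖S.B m y - S.B k y‖]
  have hb : BddAbove (Set.range fun k => ‖S.B k y‖ ^ 2) := by
    refine ⟨C ^ 2, ?_⟩
    rintro _ ⟨k, rfl⟩
    exact pow_le_pow_left₀ (norm_nonneg _) (h k) 2
  have hc : CauchySeq fun k => ‖S.B k y‖ ^ 2 := (tendsto_atTop_ciSup hmono hb).cauchySeq
  have hc' : CauchySeq fun k => S.B k y := by
    rw [Metric.cauchySeq_iff'] at hc ⊢
    intro ε hε
    obtain ⟨N, hN⟩ := hc (ε ^ 2) (by positivity)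
    refine ⟨N, fun n hn => ?_⟩
    have h1 := hN n hn
    rw [Real.dist_eq, horth hn, add_sub_cancel_left, abs_of_nonneg (by positivity)] at h1
    rw [dist_eq_norm]
    exact lt_of_pow_lt_pow_left₀ 2 hε.le h1
  obtain ⟨x, hx⟩ := cauchySeq_tendsto_of_complete hc'
  refine ⟨x, ?_, le_of_tendsto hx.norm (Eventually.of_forall h)⟩
  have h1 : Tendsto (fun k => S.D (S.B k y)) atTop (𝓝 (S.D x)) :=
    (S.D.continuous.tendsto x).comp hx
  simp only [S.D_B] at h1
  exact tendsto_nhds_unique h1 (S.tendsto_P y)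

end EnergyScale

end Abstract

/-! ### The unitary group as a limit of cutoff groups -/

section Abstract

open Filter

variable {H : Type*} [NormedAddCommGroup H] [InnerProductSpace ℂ H]

/-- A symmetric operator `Z` on the range of an `EnergyScale`, bounded relative to the energy and
with energy-bounded commutator with the energy: `Z` stands for `Z D` and `W` for `[D⁻¹, Z] D`. -/
structure RelBounded (S : EnergyScale H) where
  Z : H →L[ℂ] H
  W : H →L[ℂ] H
  symm : ∀ x y, ⟪Z x, S.D y⟫_ℂ = ⟪S.D x, Z y⟫_ℂ
  comm : ∀ x y, ⟪x, Z y⟫_ℂ - ⟪Z x, y⟫_ℂ = ⟪S.D x, W y⟫_ℂ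

namespace RelBounded

variable {S : EnergyScale H} (A : RelBounded S)

/-- The truncated operator `P n Z P n`. -/
def trunc (n : ℕ) : H →L[ℂ] H := S.P n ∘L A.Z ∘L S.B n

lemma trunc_apply (n : ℕ) (x : H) : A.trunc n x = S.P n (A.Z (S.B n x)) := rfl

/-- The unitary group generated by the truncated operator. -/
def flow (n : ℕ) (t : ℝ) : H →L[ℂ] H := NormedSpace.exp (t • (Complex.I • A.trunc n))

lemma inner_Z_D_im (x : H) : (⟪S.D x, A.Z x⟫_ℂ).im = 0 :=
  inner_im_eq_zero_of_symm (A.symm x x).symm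

lemma inner_trunc_im (n : ℕ) (x : H) : (⟪x, A.trunc n x⟫_ℂ).im = 0 := by
  rw [trunc_apply, ← S.inner_P, ← S.D_B]
  exact A.inner_Z_D_im _

lemma flow_zero (n : ℕ) (y : H) : A.flow n 0 y = y := by
  simp [flow]

variable [CompleteSpace H]

lemma hasDerivAt_flow (n : ℕ) (y : H) (t : ℝ) :
    HasDerivAt (fun s => A.flow n s y) (Complex.I • A.trunc n (A.flow n t y)) t := by
  have h := hasDerivAt_exp_smul_const' (𝕂 := ℝ) (Complex.I • A.trunc n) t
  have h2 := ((ContinuousLinearMap.apply ℂ H y).restrictScalars ℝ).hasFDerivAt.comp_hasDerivAt t h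
  exact h2

lemma flow_add (n : ℕ) (s t : ℝ) (y : H) : A.flow n (s + t) y = A.flow n s (A.flow n t y) := by
  let _ : NormedAlgebra ℚ (H →L[ℂ] H) := NormedAlgebra.restrictScalars ℚ ℂ _
  rw [flow, add_smul, NormedSpace.exp_add_of_commute]
  · rfl
  · exact ((Commute.refl _).smul_left s).smul_right t

lemma norm_flow_le (n : ℕ) (t : ℝ) (y : H) : ‖A.flow n t y‖ ≤ ‖y‖ := by
  have := norm_le_exp (w := 0) (A.hasDerivAt_flow n y) (fun s => by simp [A.inner_trunc_im]) t
  simpa [flow_zero] using this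

lemma norm_flow (n : ℕ) (t : ℝ) (y : H) : ‖A.flow n t y‖ = ‖y‖ := by
  refine le_antisymm (A.norm_flow_le n t y) ?_
  have := A.norm_flow_le n (-t) (A.flow n t y)
  rwa [← flow_add, neg_add_cancel, flow_zero] at this

/-- Propagation of the truncated energy. -/
lemma norm_B_flow_le (n : ℕ) (t : ℝ) (y : H) :
    ‖S.B n (A.flow n t y)‖ ≤ Real.exp (‖A.W‖ * |t|) * ‖S.B n y‖ := by
  have hd : ∀ s, HasDerivAt (fun s => S.B n (A.flow n s y))
      (Complex.I • S.B n (A.Z (S.B n (A.flow n s y)))) s := fun s => by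
    have := ((S.B n).restrictScalars ℝ).hasFDerivAt.comp_hasDerivAt s (A.hasDerivAt_flow n y s)
    refine this.congr_deriv ?_
    simp [trunc_apply, S.B_P le_rfl]
  have := norm_le_exp (w := ‖A.W‖) hd (fun s => ?_) t
  · simpa [flow_zero] using this
  · set x := S.B n (A.flow n s y) with hx
    have hPx : S.P n x = x := S.P_B le_rfl _
    -- Moving the energy across `Z` leaves a real number, by symmetry, and the commutator. Only the
    -- latter contributes to the growth, at the rate `‖A.W‖` independently of the cutoff.
    have h1 := A.comm (S.B n x) x
    rw [S.D_B, hPx] at h1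
    have h2 : ⟪A.Z (S.B n x), x⟫_ℂ = ⟪S.D (S.B n x), A.Z (S.B n x)⟫_ℂ := by
      rw [← A.symm, S.D_B, hPx]
    rw [← S.inner_B, ← sub_add_cancel ⟪S.B n x, A.Z x⟫_ℂ ⟪A.Z (S.B n x), x⟫_ℂ, h1, h2,
      Complex.add_im, A.inner_Z_D_im, add_zero]
    refine (Complex.abs_im_le_norm _).trans ((norm_inner_le_norm _ _).trans ?_)
    calc ‖x‖ * ‖A.W x‖ ≤ ‖x‖ * (‖A.W‖ * ‖x‖) := by gcongr; exact A.W.le_opNorm x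
      _ = _ := by ring

lemma P_flow {n : ℕ} {y : H} (hy : S.P n y = y) (t : ℝ) : S.P n (A.flow n t y) = A.flow n t y := by
  have hd : ∀ s, HasDerivAt (fun s => A.flow n s y - S.P n (A.flow n s y))
      (Complex.I • (0 : H)) s := fun s => by
    have := (A.hasDerivAt_flow n y s).sub
      (((S.P n).restrictScalars ℝ).hasFDerivAt.comp_hasDerivAt s (A.hasDerivAt_flow n y s))
    refine this.congr_deriv ?_
    simp [trunc_apply, S.P_P le_rfl]
  have := norm_le_exp (w := 0) hd (fun s => by simp) t
  rw [flow_zero, hy, sub_self, norm_zero, mul_zero] at this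
  exact (sub_eq_zero.1 (norm_le_zero_iff.1 this)).symm

/-- The difference of two truncated evolutions. -/
lemma norm_sq_flow_sub_flow_le {k n m : ℕ} (hkn : k ≤ n) (hnm : n ≤ m) {x : H}
    (hx : S.P k x = x) {t T : ℝ} (ht : |t| ≤ T) :
    ‖A.flow n t (S.D x) - A.flow m t (S.D x)‖ ^ 2 ≤
      2 * (‖A.Z‖ * (Real.exp (‖A.W‖ * T) * ‖x‖) ^ 2 / (n + 1)) * |t| := by
  have hP : ∀ j, k ≤ j → S.P j (S.D x) = S.D x := fun j hj => by
    rw [← S.D_P, ← hx, S.P_P' hj]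
  set u := fun s => A.flow n s (S.D x) with hu
  set v := fun s => A.flow m s (S.D x) with hv
  have hPu : ∀ s, S.P n (u s) = u s := fun s => A.P_flow (hP n hkn) s
  have hPv : ∀ s, S.P m (v s) = v s := fun s => A.P_flow (hP m (hkn.trans hnm)) s
  have hb : ∀ j, ∀ s, |s| ≤ T → ‖S.B j (A.flow j s (S.D x))‖ ≤ Real.exp (‖A.W‖ * T) * ‖x‖ := by
    intro j s hs
    refine (A.norm_B_flow_le j s _).trans ?_
    rw [S.B_D]
    gcongr
    exact S.norm_P_le j x
  refine norm_sq_le_mul_abs (u := fun s => u s - v s) (z := fun s => A.trunc n (u s) - A.trunc m (v s))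
    (T := T) (fun s => ?_) (by simp [hu, hv, flow_zero]) (fun s hs => ?_) ht
  · rw [smul_sub]
    exact (A.hasDerivAt_flow n _ s).sub (A.hasDerivAt_flow m _ s)
  · set a := S.B n (u s) with ha
    set b := S.B m (v s) with hb'
    have hDa : S.D a = u s := by rw [ha, S.D_B, hPu]
    have hDb : S.D b = v s := by rw [hb', S.D_B, hPv]
    have e1 : ⟪u s, A.trunc n (u s)⟫_ℂ = ⟪S.D a, A.Z a⟫_ℂ := by
      rw [trunc_apply, ← S.inner_P, hPu, hDa]
    have e2 : ⟪v s, A.trunc m (v s)⟫_ℂ = ⟪S.D b, A.Z b⟫_ℂ := by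
      rw [trunc_apply, ← S.inner_P, hPv, hDb]
    have e3 : ⟪u s, A.trunc m (v s)⟫_ℂ = ⟪A.Z a, S.D b⟫_ℂ := by
      rw [trunc_apply, ← S.inner_P, ← hPu s, S.P_P' hnm, hPu, A.symm, hDa]
    have e4 : ⟪v s, A.trunc n (u s)⟫_ℂ =
        ⟪S.D b, A.Z a⟫_ℂ - ⟪S.D b - S.P n (S.D b), A.Z a⟫_ℂ := by
      rw [trunc_apply, ← S.inner_P, inner_sub_left, hDb]
      ring
    -- Symmetry of `Z` cancels everything except the part of `v s` above the cutoff `n`. Since the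
    -- energy of `v s` is bounded uniformly, that part is of order `1 / (n + 1)`.
    have e5 : (⟪u s - v s, A.trunc n (u s) - A.trunc m (v s)⟫_ℂ).im =
        (⟪S.D b - S.P n (S.D b), A.Z a⟫_ℂ).im := by
      rw [inner_sub_left, inner_sub_right, inner_sub_right, e1, e2, e3, e4,
        ← inner_conj_symm (A.Z a)]
      simp only [Complex.sub_im, A.inner_Z_D_im, Complex.conj_im]
      ring
    rw [e5]
    refine (Complex.abs_im_le_norm _).trans ((norm_inner_le_norm _ _).trans ?_)
    calc _ ≤ (Real.exp (‖A.W‖ * T) * ‖x‖) / (n + 1) * (‖A.Z‖ * (Real.exp (‖A.W‖ * T) * ‖x‖)) := by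
          gcongr
          · refine (S.tail n b).trans ?_
            gcongr
            exact hb m s hs
          · refine (A.Z.le_opNorm a).trans ?_
            gcongr
            exact hb n s hs
      _ = _ := by ring

/-- On vectors of bounded energy two cutoff evolutions differ by a quantity tending to zero. These
vectors are dense and the evolutions are isometric, so the general case is an approximation. -/
lemma cauchySeq_flow (t : ℝ) (y : H) : CauchySeq fun n => A.flow n t y := by
  rw [Metric.cauchySeq_iff']
  intro ε hε
  obtain ⟨k, hk⟩ := ((tendsto_iff_norm_sub_tendsto_zero.1 (S.tendsto_P y)).eventually
    (gt_mem_nhds (show (0 : ℝ) < ε / 4 by positivity))).exists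
  set x := S.B k y
  have hx : S.P k x = x := S.P_B le_rfl y
  have hDx : S.D x = S.P k y := S.D_B k y
  set C := 2 * (‖A.Z‖ * (Real.exp (‖A.W‖ * |t|) * ‖x‖) ^ 2) * |t| with hC
  have hlim : Tendsto (fun n : ℕ => C / ((n : ℝ) + 1)) atTop (𝓝 0) := by
    simpa [div_eq_mul_inv] using (tendsto_one_div_add_atTop_nhds_zero_nat (𝕜 := ℝ)).const_mul C
  obtain ⟨N, hN, hkN⟩ := ((hlim.eventually
    (gt_mem_nhds (show (0 : ℝ) < (ε / 4) ^ 2 by positivity))).and (eventually_ge_atTop k)).exists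
  refine ⟨N, fun n hn => ?_⟩
  have h1 := A.norm_sq_flow_sub_flow_le hkN hn hx (le_refl |t|)
  have h2 : ‖A.flow N t (S.D x) - A.flow n t (S.D x)‖ < ε / 4 := by
    refine lt_of_pow_lt_pow_left₀ 2 (by positivity) (h1.trans_lt ((le_of_eq ?_).trans_lt hN))
    rw [hC]
    ring
  rw [hDx] at h2
  rw [dist_eq_norm]
  have e : A.flow n t y - A.flow N t y = -A.flow n t (S.P k y - y) + A.flow N t (S.P k y - y)
      - (A.flow N t (S.P k y) - A.flow n t (S.P k y)) := by
    simp only [map_sub]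
    abel
  rw [e]
  refine (norm_sub_le _ _).trans_lt ?_
  refine (add_le_add_left (norm_add_le _ _) _).trans_lt ?_
  rw [norm_neg, norm_flow, norm_flow]
  linarith

/-- The limit of the truncated evolutions. -/
def limFlow (t : ℝ) (y : H) : H := limUnder atTop fun n => A.flow n t y

lemma tendsto_flow (t : ℝ) (y : H) : Tendsto (fun n => A.flow n t y) atTop (𝓝 (A.limFlow t y)) :=
  (A.cauchySeq_flow t y).tendsto_limUnder

lemma limFlow_eq {t : ℝ} {y z : H} (h : Tendsto (fun n => A.flow n t y) atTop (𝓝 z)) :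
    A.limFlow t y = z := tendsto_nhds_unique (A.tendsto_flow t y) h

lemma limFlow_zero (y : H) : A.limFlow 0 y = y := by
  refine A.limFlow_eq ?_
  simp only [flow_zero]
  exact tendsto_const_nhds

lemma limFlow_add (s t : ℝ) (y : H) : A.limFlow (s + t) y = A.limFlow s (A.limFlow t y) := by
  refine A.limFlow_eq ?_
  simp only [flow_add]
  have h1 := A.tendsto_flow s (A.limFlow t y)
  have h2 : Tendsto (fun n => A.flow n s (A.flow n t y) - A.flow n s (A.limFlow t y)) atTop
      (𝓝 0) := by
    rw [tendsto_zero_iff_norm_tendsto_zero]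
    simp only [← map_sub, norm_flow]
    exact tendsto_iff_norm_sub_tendsto_zero.1 (A.tendsto_flow t y)
  simpa using h2.add h1

/-- The one-parameter unitary group generated by `A`. -/
def group (t : ℝ) : H ≃ₗᵢ[ℂ] H where
  toFun := A.limFlow t
  invFun := A.limFlow (-t)
  left_inv y := by rw [← limFlow_add, neg_add_cancel, limFlow_zero]
  right_inv y := by rw [← limFlow_add, add_neg_cancel, limFlow_zero]
  map_add' x y := A.limFlow_eq (by
    simpa only [map_add] using (A.tendsto_flow t x).add (A.tendsto_flow t y))
  map_smul' c x := A.limFlow_eq (by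
    simpa only [map_smul, RingHom.id_apply] using (A.tendsto_flow t x).const_smul c)
  norm_map' x := by
    refine tendsto_nhds_unique (A.tendsto_flow t x).norm ?_
    simp only [norm_flow]
    exact tendsto_const_nhds

lemma tendsto_group (t : ℝ) (y : H) : Tendsto (fun n => A.flow n t y) atTop (𝓝 (A.group t y)) :=
  A.tendsto_flow t y

lemma group_zero (y : H) : A.group 0 y = y := A.limFlow_zero y

lemma group_add (s t : ℝ) (y : H) : A.group (s + t) y = A.group s (A.group t y) :=
  A.limFlow_add s t y

/-- The unitary group preserves the range of `D`. -/
lemma exists_group_D (t : ℝ) (x : H) :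
    ∃ χ, S.D χ = A.group t (S.D x) ∧ ‖χ‖ ≤ Real.exp (‖A.W‖ * |t|) * ‖x‖ := by
  refine S.exists_D_eq fun k => ?_
  refine le_of_tendsto (((S.B k).continuous.tendsto _).comp (A.tendsto_group t (S.D x))).norm ?_
  filter_upwards [eventually_ge_atTop k] with n hn
  simp only [Function.comp]
  rw [← S.P_B hn]
  refine (S.norm_P_le _ _).trans ((A.norm_B_flow_le n t _).trans ?_)
  rw [S.B_D]
  gcongr
  exact S.norm_P_le n x

lemma norm_flow_D_sub_le (n : ℕ) (x : H) {t : ℝ} (ht : |t| ≤ 1) :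
    ‖A.flow n t (S.D x) - S.D x‖ ≤ ‖A.Z‖ * (Real.exp ‖A.W‖ * ‖x‖) * |t| := by
  have := norm_sub_sub_smul_le (y := 0) (A.hasDerivAt_flow n (S.D x)) (T := 1)
    (C := ‖A.Z‖ * (Real.exp ‖A.W‖ * ‖x‖)) (fun s hs => ?_) ht
  · simpa [flow_zero] using this
  · rw [sub_zero, norm_smul, Complex.norm_I, one_mul, trunc_apply]
    refine (S.norm_P_le _ _).trans ((A.Z.le_opNorm _).trans ?_)
    gcongr
    refine (A.norm_B_flow_le n s _).trans ?_
    rw [S.B_D]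
    gcongr
    · exact mul_le_of_le_one_right (norm_nonneg _) hs
    · exact S.norm_P_le n x

/-- Continuity at time zero uniformly in the cutoff, so that it passes to the limit; convergence of
the flows is only known at each fixed time. It is reduced to the range of `D`, where the speed is
bounded. -/
lemma equicontinuous_flow (z : H) {ε : ℝ} (hε : 0 < ε) :
    ∃ δ > 0, δ ≤ 1 ∧ ∀ n, ∀ t : ℝ, |t| ≤ δ → ‖A.flow n t z - z‖ ≤ ε := by
  obtain ⟨_, ⟨x, rfl⟩, hx⟩ := Metric.mem_closure_iff.1 (S.denseRange_D z) (ε / 4) (by positivity)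
  rw [dist_eq_norm] at hx
  set C := ‖A.Z‖ * (Real.exp ‖A.W‖ * ‖x‖)
  have hC : 0 ≤ C := by positivity
  refine ⟨min 1 (ε / (2 * (C + 1))), by positivity, min_le_left _ _, fun n t ht => ?_⟩
  have h1 := A.norm_flow_D_sub_le n x (ht.trans (min_le_left _ _))
  have h2 : C * |t| ≤ ε / 2 := by
    calc C * |t| ≤ (C + 1) * (ε / (2 * (C + 1))) := by
          gcongr
          · linarith
          · exact ht.trans (min_le_right _ _)
      _ = ε / 2 := by field_simp
  have e : A.flow n t z - z = A.flow n t (z - S.D x) + (A.flow n t (S.D x) - S.D x)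
      - (z - S.D x) := by
    simp only [map_sub]
    abel
  rw [e]
  refine (norm_sub_le _ _).trans ((add_le_add_left (norm_add_le _ _) _).trans ?_)
  rw [norm_flow]
  linarith

lemma continuous_group (y : H) : Continuous fun t => A.group t y := by
  rw [Metric.continuous_iff]
  intro s ε hε
  obtain ⟨δ, hδ, -, h⟩ := A.equicontinuous_flow y (half_pos hε)
  refine ⟨δ, hδ, fun t ht => ?_⟩
  rw [Real.dist_eq] at ht
  have h1 : ‖A.group (t - s) y - y‖ ≤ ε / 2 :=
    le_of_tendsto ((A.tendsto_group (t - s) y).sub_const y).norm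
      (Eventually.of_forall fun n => h n _ ht.le)
  have h2 : A.group t y - A.group s y = A.group s (A.group (t - s) y - y) := by
    rw [map_sub, ← group_add, add_sub_cancel]
  rw [dist_eq_norm, h2, LinearIsometryEquiv.norm_map]
  linarith

/-- The remainder of the difference quotient is estimated for the cutoff flows on an interval
independent of the cutoff, and the estimate passes to the limit. -/
lemma hasDerivAt_group_D_zero (x : H) :
    HasDerivAt (fun t => A.group t (S.D x)) (Complex.I • A.Z x) 0 := by
  rw [hasDerivAt_iff_isLittleO_nhds_zero, Asymptotics.isLittleO_iff]
  intro ε hε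
  set z := A.Z x
  obtain ⟨δ, hδ, hδ1, h⟩ := A.equicontinuous_flow z (half_pos hε)
  have hz : Tendsto (fun n => A.trunc n (S.D x)) atTop (𝓝 z) := by
    have h1 : Tendsto (fun n => A.Z (S.P n x)) atTop (𝓝 z) :=
      (A.Z.continuous.tendsto x).comp (S.tendsto_P x)
    have h2 : Tendsto (fun n => S.P n (A.Z (S.P n x) - z) + S.P n z) atTop (𝓝 (0 + z)) := by
      refine Tendsto.add ?_ (S.tendsto_P z)
      exact squeeze_zero_norm (fun n => S.norm_P_le n _)
        (tendsto_iff_norm_sub_tendsto_zero.1 h1)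
    rw [zero_add] at h2
    refine h2.congr fun n => ?_
    rw [trunc_apply, S.B_D, map_sub, sub_add_cancel]
  have key : ∀ t : ℝ, |t| ≤ δ →
      ‖A.group t (S.D x) - S.D x - t • (Complex.I • z)‖ ≤ ε * |t| := by
    intro t ht
    have hn : ∀ᶠ n in atTop, ‖A.trunc n (S.D x) - z‖ < ε / 4 :=
      (tendsto_iff_norm_sub_tendsto_zero.1 hz).eventually (gt_mem_nhds (by positivity))
    refine le_of_tendsto (((A.tendsto_group t (S.D x)).sub_const _).sub_const _).norm ?_
    filter_upwards [hn] with n hn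
    -- The generator is put to the right of the exponential: the velocity is then the flow of a
    -- vector converging to `z`, to which equicontinuity applies.
    have hd : ∀ s, HasDerivAt (fun s => A.flow n s (S.D x))
        (Complex.I • A.flow n s (A.trunc n (S.D x))) s := fun s => by
      have h1 := hasDerivAt_exp_smul_const (𝕂 := ℝ) (Complex.I • A.trunc n) s
      have h2 := ((ContinuousLinearMap.apply ℂ H (S.D x)).restrictScalars ℝ).hasFDerivAt.comp_hasDerivAt
        s h1
      refine h2.congr_deriv ?_
      simp [flow]
    have := norm_sub_sub_smul_le (y := Complex.I • z) hd (T := δ) (C := ε) (fun s hs => ?_) ht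
    · rwa [flow_zero] at this
    · rw [← smul_sub, norm_smul, Complex.norm_I, one_mul]
      have e : A.flow n s (A.trunc n (S.D x)) - z =
          A.flow n s (A.trunc n (S.D x) - z) + (A.flow n s z - z) := by
        rw [map_sub]
        abel
      rw [e]
      refine (norm_add_le _ _).trans ?_
      rw [norm_flow]
      linarith [h n s hs]
  filter_upwards [Metric.ball_mem_nhds (0 : ℝ) hδ] with t ht
  rw [mem_ball_zero_iff] at ht
  rw [zero_add, group_zero]
  exact key t ht.le

end RelBounded

end Abstract

section Abstract

open Filter

variable {H : Type*} [NormedAddCommGroup H] [InnerProductSpace ℂ H]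

/-! ### Generators of unitary groups -/

/-- A strongly continuous one-parameter unitary group. -/
structure IsUnitaryGroup (V : ℝ → H ≃ₗᵢ[ℂ] H) : Prop where
  map_zero : ∀ x, V 0 x = x
  map_add : ∀ s t x, V (s + t) x = V s (V t x)
  continuous : ∀ x, Continuous fun t => V t x

/-- `(x, y)` belongs to the graph of the generator (up to the factor `i`) of `V`. -/
def Gen (V : ℝ → H ≃ₗᵢ[ℂ] H) (x y : H) : Prop := HasDerivAt (fun t => V t x) (Complex.I • y) 0

variable {V : ℝ → H ≃ₗᵢ[ℂ] H}

lemma Gen.hasDerivAt (hV : IsUnitaryGroup V) {x y : H} (h : Gen V x y) (t : ℝ) :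
    HasDerivAt (fun t => V t x) (Complex.I • V t y) t := by
  have h1 : HasDerivAt (fun s => V (s - t) x) (Complex.I • y) t := by
    have h2 : HasDerivAt (fun s => V s x) (Complex.I • y) (t - t) := by rwa [sub_self]
    exact h2.comp_sub_const t t
  have h3 := (((V t).toContinuousLinearEquiv : H →L[ℂ] H).restrictScalars ℝ).hasFDerivAt.comp_hasDerivAt
    t h1
  have h4 : (fun s => V s x) =
      ((((V t).toContinuousLinearEquiv : H →L[ℂ] H).restrictScalars ℝ) ∘ fun s => V (s - t) x) := by
    funext s
    have := hV.map_add t (s - t) x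
    rw [add_sub_cancel] at this
    exact this
  rw [h4]
  refine h3.congr_deriv ?_
  simp

lemma Gen.map (hV : IsUnitaryGroup V) {x y : H} (h : Gen V x y) (s : ℝ) :
    Gen V (V s x) (V s y) := by
  have h1 : HasDerivAt (fun t => V (t + s) x) (Complex.I • V s y) 0 := by
    have h2 := h.hasDerivAt hV (0 + s)
    have h3 := h2.comp_add_const 0 s
    rwa [zero_add] at h3
  simp only [hV.map_add] at h1
  exact h1

lemma Gen.sub {x y x' y' : H} (h : Gen V x y) (h' : Gen V x' y') : Gen V (x - x') (y - y') := by
  have := HasDerivAt.sub h h'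
  rw [← smul_sub] at this
  have e : (fun t => V t (x - x')) = ((fun t => V t x) - fun t => V t x') := by
    funext t
    simp
  rw [Gen, e]
  exact this

/-- Differentiate the constant function `⟪V t x, V t x'⟫` at zero. -/
lemma Gen.symm (hV : IsUnitaryGroup V) {x y x' y' : H} (h : Gen V x y) (h' : Gen V x' y') :
    ⟪x, y'⟫_ℂ = ⟪y, x'⟫_ℂ := by
  have h1 := HasDerivAt.inner ℂ h h'
  simp only [LinearIsometryEquiv.inner_map_map] at h1
  have h2 := h1.unique (hasDerivAt_const (0 : ℝ) _)
  simp only [hV.map_zero, inner_smul_left, inner_smul_right, Complex.conj_I] at h2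
  have h3 : Complex.I * (⟪x, y'⟫_ℂ - ⟪y, x'⟫_ℂ) = 0 := by linear_combination h2
  exact sub_eq_zero.1 ((mul_eq_zero.1 h3).resolve_left Complex.I_ne_zero)

/-- The difference from the group orbit solves the same equation, and a symmetric generator
conserves its norm, which starts at zero. -/
lemma eq_of_gen (hV : IsUnitaryGroup V) {u z : ℝ → H}
    (hu : ∀ t, HasDerivAt u (Complex.I • z t) t) (hg : ∀ t, Gen V (u t) (z t)) (t : ℝ) :
    u t = V t (u 0) := by
  have h0 : Gen V (u 0) (z 0) := hg 0
  have hgen : ∀ s, Gen V (u s - V s (u 0)) (z s - V s (z 0)) := fun s => (hg s).sub (h0.map hV s)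
  have := norm_le_exp (w := 0) (u := fun s => u s - V s (u 0)) (z := fun s => z s - V s (z 0))
    (fun s => by
      rw [smul_sub]
      exact (hu s).sub (h0.hasDerivAt hV s))
    (fun s => by
      rw [inner_im_eq_zero_of_symm ((hgen s).symm hV (hgen s))]
      simp) t
  simp only [hV.map_zero, sub_self, norm_zero, mul_zero] at this
  exact sub_eq_zero.1 (norm_le_zero_iff.1 this)

/-- The generator is closed: the remainder of the difference quotient is bounded by the oscillation
of the velocity, which is controlled by that of `y` uniformly along the approximating sequence. -/
lemma gen_of_mem_closure (hV : IsUnitaryGroup V) {x y : H} {G : Set (H × H)}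
    (hG : ∀ p ∈ G, Gen V p.1 p.2) (h : (x, y) ∈ closure G) : Gen V x y := by
  obtain ⟨p, hp, hlim⟩ := mem_closure_iff_seq_limit.1 h
  have hx : Tendsto (fun n => (p n).1) atTop (𝓝 x) := (continuous_fst.tendsto (x, y)).comp hlim
  have hy : Tendsto (fun n => (p n).2) atTop (𝓝 y) := (continuous_snd.tendsto (x, y)).comp hlim
  rw [Gen, hasDerivAt_iff_isLittleO_nhds_zero, Asymptotics.isLittleO_iff]
  intro ε hε
  obtain ⟨δ, hδ, hy0⟩ := Metric.continuousAt_iff.1 ((hV.continuous y).continuousAt (x := 0)) (ε / 2)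
    (half_pos hε)
  filter_upwards [Metric.ball_mem_nhds (0 : ℝ) hδ] with t ht
  rw [mem_ball_zero_iff] at ht
  rw [zero_add, hV.map_zero]
  refine le_of_tendsto ((((V t).continuous.tendsto x).comp hx).sub hx |>.sub
    ((hy.const_smul Complex.I).const_smul t)).norm ?_
  have hn : ∀ᶠ n in atTop, ‖(p n).2 - y‖ < ε / 4 :=
    (tendsto_iff_norm_sub_tendsto_zero.1 hy).eventually (gt_mem_nhds (by positivity))
  filter_upwards [hn] with n hn
  have hd := fun s => (hG _ (hp n)).hasDerivAt hV s
  have := norm_sub_sub_smul_le (y := Complex.I • (p n).2) hd (T := |t|) (C := ε)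
    (fun s hs => ?_) le_rfl
  · rwa [hV.map_zero] at this
  · rw [← smul_sub, norm_smul, Complex.norm_I, one_mul]
    have e : V s (p n).2 - (p n).2 = V s ((p n).2 - y) + (V s y - y) - ((p n).2 - y) := by
      rw [map_sub]
      abel
    have h1 : ‖V s y - y‖ < ε / 2 := by
      have := hy0 (x := s) (by
        rw [dist_zero_right]
        exact lt_of_le_of_lt hs ht)
      rwa [hV.map_zero, dist_eq_norm] at this
    rw [e]
    refine (norm_sub_le _ _).trans ((add_le_add_left (norm_add_le _ _) _).trans ?_)
    rw [LinearIsometryEquiv.norm_map]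
    linarith

/-! ### The generator of the limit group, and its Heisenberg equation -/

namespace RelBounded

variable [CompleteSpace H] {S : EnergyScale H} (A : RelBounded S)

lemma isUnitaryGroup : IsUnitaryGroup A.group :=
  ⟨A.group_zero, A.group_add, A.continuous_group⟩

lemma gen_D (x : H) : Gen A.group (S.D x) (A.Z x) := A.hasDerivAt_group_D_zero x

/-- `D⁻¹ exp(itZ) D`. -/
def evol (t : ℝ) (x : H) : H := (A.exists_group_D t x).choose

lemma D_evol (t : ℝ) (x : H) : S.D (A.evol t x) = A.group t (S.D x) :=
  (A.exists_group_D t x).choose_spec.1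

lemma norm_evol_le (t : ℝ) (x : H) : ‖A.evol t x‖ ≤ Real.exp (‖A.W‖ * |t|) * ‖x‖ :=
  (A.exists_group_D t x).choose_spec.2

lemma hasDerivAt_group_D (x : H) (t : ℝ) :
    HasDerivAt (fun t => A.group t (S.D x)) (Complex.I • A.Z (A.evol t x)) t := by
  have h1 := (A.gen_D x).hasDerivAt A.isUnitaryGroup t
  have h2 := (A.gen_D x).map A.isUnitaryGroup t
  have h3 := A.gen_D (A.evol t x)
  rw [D_evol] at h3
  have h4 := HasDerivAt.unique h2 h3
  rwa [h4] at h1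

/-- The overlap of `η` with an orbit in the range of `D` solves `f' = -f`, hence grows exponentially
as `t → -∞` unless it vanishes. But it is bounded, as the group is unitary. -/
lemma eq_zero_of_deficiency {η : H} (h : ∀ x, ⟪η, A.Z x⟫_ℂ = Complex.I * ⟪η, S.D x⟫_ℂ) :
    η = 0 := by
  have h0 : ∀ x, ⟪η, S.D x⟫_ℂ = 0 := by
    intro x
    have hd : ∀ t : ℝ, HasDerivAt (fun t => ⟪η, A.group t (S.D x)⟫_ℂ)
        (-⟪η, A.group t (S.D x)⟫_ℂ) t := by
      intro t
      have := (hasDerivAt_const t η).inner ℂ (A.hasDerivAt_group_D x t)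
      refine this.congr_deriv ?_
      rw [inner_zero_left, add_zero, inner_smul_right, h, D_evol, ← mul_assoc, Complex.I_mul_I,
        neg_one_mul]
    have hd2 : ∀ t : ℝ, HasDerivAt (fun t : ℝ => (Real.exp t : ℂ) * ⟪η, A.group t (S.D x)⟫_ℂ)
        0 t := by
      intro t
      refine (((Real.hasDerivAt_exp t).ofReal_comp).mul (hd t)).congr_deriv ?_
      ring
    have hc : ∀ t : ℝ, (Real.exp t : ℂ) * ⟪η, A.group t (S.D x)⟫_ℂ = ⟪η, S.D x⟫_ℂ := by
      intro t
      have := is_const_of_deriv_eq_zero (fun s => (hd2 s).differentiableAt)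
        (fun s => (hd2 s).deriv) t 0
      simpa [A.group_zero] using this
    have hle : ∀ t : ℝ, ‖⟪η, S.D x⟫_ℂ‖ ≤ Real.exp t * (‖η‖ * ‖S.D x‖) := by
      intro t
      rw [← hc t, norm_mul, Complex.norm_real, Real.norm_of_nonneg (Real.exp_pos t).le]
      gcongr
      refine (norm_inner_le_norm _ _).trans_eq ?_
      rw [LinearIsometryEquiv.norm_map]
    have hlim : Tendsto (fun t : ℝ => Real.exp t * (‖η‖ * ‖S.D x‖)) atBot (𝓝 0) := by
      simpa using Real.tendsto_exp_atBot.mul_const (‖η‖ * ‖S.D x‖)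
    exact norm_le_zero_iff.1 (ge_of_tendsto hlim (Eventually.of_forall hle))
  have h1 : ∀ y, ⟪η, y⟫_ℂ = 0 := fun y => by
    have hc : Continuous fun y => ⟪η, y⟫_ℂ := by fun_prop
    exact congrFun (S.denseRange_D.equalizer hc (continuous_const (y := (0 : ℂ))) (funext h0)) y
  exact inner_self_eq_zero.1 (h1 η)

/-- The generator is the closure of the operator given on the range of `D`. -/
lemma gen_iff {x y : H} :
    Gen A.group x y ↔ (x, y) ∈ closure (Set.range fun ξ => (S.D ξ, A.Z ξ)) := by
  refine ⟨fun hg => ?_, gen_of_mem_closure A.isUnitaryGroup ?_⟩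
  -- The range of `Z - i` on the core is dense, since a vector orthogonal to it is a deficiency
  -- vector.
  · let T : H →L[ℂ] H := A.Z - Complex.I • S.D
    have hdense : (LinearMap.range T.toLinearMap).topologicalClosure = ⊤ := by
      rw [Submodule.topologicalClosure_eq_top_iff, Submodule.eq_bot_iff]
      intro η hη
      refine A.eq_zero_of_deficiency fun ξ => ?_
      have := (Submodule.mem_orthogonal' _ _).1 hη (T ξ) ⟨ξ, rfl⟩
      simp only [T, sub_apply, smul_apply, inner_sub_right,
        inner_smul_right] at this
      exact sub_eq_zero.1 this
    have hmem : y - Complex.I • x ∈ closure (Set.range T) := by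
      have : y - Complex.I • x ∈ (LinearMap.range T.toLinearMap).topologicalClosure := by
        rw [hdense]
        trivial
      rwa [← SetLike.mem_coe, Submodule.topologicalClosure_coe, LinearMap.coe_range] at this
    rw [Metric.mem_closure_iff] at hmem ⊢
    intro ε hε
    obtain ⟨_, ⟨ξ, rfl⟩, hξ⟩ := hmem ε hε
    refine ⟨_, ⟨ξ, rfl⟩, ?_⟩
    have hg2 := hg.sub (A.gen_D ξ)
    set a := x - S.D ξ
    set b := y - A.Z ξ
    have him := inner_im_eq_zero_of_symm (hg2.symm A.isUnitaryGroup hg2)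
    have e : y - Complex.I • x - T ξ = b - Complex.I • a := by
      simp only [T, sub_apply, smul_apply, a, b, smul_sub]
      abel
    -- Symmetry of the generator makes `⟪a, b⟫` real, so approximating `y - i x` approximates both
    -- coordinates of the graph point at once.
    have hn : ‖b - Complex.I • a‖ ^ 2 = ‖b‖ ^ 2 + ‖a‖ ^ 2 := by
      rw [norm_sub_sq (𝕜 := ℂ), norm_smul, Complex.norm_I, one_mul, inner_smul_right]
      have : (⟪b, a⟫_ℂ).im = 0 := by
        rw [← inner_conj_symm, Complex.conj_im, him, neg_zero]
      simp [this]
    rw [dist_eq_norm, e] at hξ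
    rw [dist_eq_norm]
    have h1 : ‖a‖ < ε := lt_of_le_of_lt (le_of_sq_le_sq (by nlinarith [sq_nonneg ‖b‖])
      (norm_nonneg _)) hξ
    have h2 : ‖b‖ < ε := lt_of_le_of_lt (le_of_sq_le_sq (by nlinarith [sq_nonneg ‖a‖])
      (norm_nonneg _)) hξ
    rw [Prod.norm_def]
    exact max_lt h1 h2
  · rintro _ ⟨ξ, rfl⟩
    exact A.gen_D ξ

/-- Bounded operators which commute with `Z` on the range of `D` commute with the group. -/
lemma commute_group {T T' : H →L[ℂ] H} (hD : ∀ x, T (S.D x) = S.D (T' x))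
    (hZ : ∀ x, T (A.Z x) = A.Z (T' x)) (t : ℝ) (x : H) :
    T (A.group t x) = A.group t (T x) := by
  have h1 : ∀ y, T (A.group t (S.D y)) = A.group t (T (S.D y)) := by
    intro y
    -- The image under `T` of an orbit in the range of `D` stays in that range and obeys the same
    -- equation, so uniqueness identifies it.
    have := eq_of_gen A.isUnitaryGroup (u := fun t => T (A.group t (S.D y)))
      (z := fun t => T (A.Z (A.evol t y))) (fun s => ?_) (fun s => ?_) t
    · simpa [A.group_zero] using this
    · refine ((T.restrictScalars ℝ).hasFDerivAt.comp_hasDerivAt s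
        (A.hasDerivAt_group_D y s)).congr_deriv ?_
      simp
    · rw [← D_evol, hD, hZ]
      exact A.gen_D _
  exact congrFun (S.denseRange_D.equalizer (T.continuous.comp (A.group t).continuous)
    ((A.group t).continuous.comp T.continuous) (funext h1)) x

/-- Weak continuity is all that is proved about `evol`. With `b` cut off in energy, the factor `D⁻¹`
can be moved onto `b`, where it is bounded; the remainder is controlled by the local bound on
`evol`. -/
lemma tendsto_inner_evol (b y : H) (s : ℝ) :
    Tendsto (fun t => ⟪b, A.evol t y⟫_ℂ) (𝓝 s) (𝓝 ⟪b, A.evol s y⟫_ℂ) := by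
  rw [Metric.tendsto_nhds]
  intro ε hε
  set C := Real.exp (‖A.W‖ * (|s| + 1)) * ‖y‖ + 1 with hC
  have hC0 : 0 < C := by positivity
  obtain ⟨n, hn⟩ := ((tendsto_iff_norm_sub_tendsto_zero.1 (S.tendsto_P b)).eventually
    (gt_mem_nhds (show (0 : ℝ) < ε / (4 * C) by positivity))).exists
  have hb : ∀ t, |t| ≤ |s| + 1 → ‖⟪S.P n b - b, A.evol t y⟫_ℂ‖ ≤ ε / 4 := by
    intro t ht
    refine (norm_inner_le_norm _ _).trans ?_
    calc _ ≤ ε / (4 * C) * C := by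
          gcongr
          refine (A.norm_evol_le t y).trans ?_
          rw [hC]
          have : Real.exp (‖A.W‖ * |t|) * ‖y‖ ≤ Real.exp (‖A.W‖ * (|s| + 1)) * ‖y‖ := by gcongr
          linarith
      _ = ε / 4 := by field_simp
  have hP : ∀ t, ⟪S.P n b, A.evol t y⟫_ℂ = ⟪S.B n b, A.group t (S.D y)⟫_ℂ := fun t => by
    rw [← D_evol, ← S.inner_D, S.D_B]
  have hc : Tendsto (fun t => ⟪S.P n b, A.evol t y⟫_ℂ) (𝓝 s) (𝓝 ⟪S.P n b, A.evol s y⟫_ℂ) := by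
    simp only [hP]
    exact tendsto_const_nhds.inner ((A.continuous_group _).tendsto s)
  have hs : ∀ᶠ t in 𝓝 s, |t| ≤ |s| + 1 :=
    (continuous_abs.tendsto s).eventually_le_const (by linarith)
  filter_upwards [(Metric.tendsto_nhds.1 hc) (ε / 2) (half_pos hε), hs] with t h1 h2
  have e : ⟪b, A.evol t y⟫_ℂ - ⟪b, A.evol s y⟫_ℂ =
      (⟪S.P n b, A.evol t y⟫_ℂ - ⟪S.P n b, A.evol s y⟫_ℂ) - ⟪S.P n b - b, A.evol t y⟫_ℂ +
        ⟪S.P n b - b, A.evol s y⟫_ℂ := by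
    simp only [inner_sub_left]
    ring
  rw [dist_eq_norm] at h1 ⊢
  rw [e]
  refine (norm_add_le _ _).trans_lt ((add_le_add_left (norm_sub_le _ _) _).trans_lt ?_)
  linarith [hb t h2, hb s (by linarith)]

/-- The Heisenberg equation for an energy-bounded observable `K` with commutator `M`. -/
lemma hasDerivAt_inner_group {K M : H →L[ℂ] H} (hK : ∀ x y, ⟪K x, S.D y⟫_ℂ = ⟪S.D x, K y⟫_ℂ)
    (hM : ∀ x y, ⟪A.Z x, K y⟫_ℂ - ⟪K x, A.Z y⟫_ℂ = -Complex.I * ⟪S.D x, M y⟫_ℂ) (x y : H) (s : ℝ) :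
    HasDerivAt (fun t => ⟪A.group t (S.D x), K (A.evol t y)⟫_ℂ)
      (-⟪A.group s (S.D x), M (A.evol s y)⟫_ℂ) s := by
  rw [hasDerivAt_iff_tendsto_slope]
  have hx := hasDerivAt_iff_tendsto_slope.1 (A.hasDerivAt_group_D x s)
  have hy := hasDerivAt_iff_tendsto_slope.1 (A.hasDerivAt_group_D y s)
  -- No derivative of `evol` is available. Symmetry of `K` rewrites the increment so that both
  -- difference quotients fall on orbits in the range of `D`.
  have e : ∀ t, slope (fun t => ⟪A.group t (S.D x), K (A.evol t y)⟫_ℂ) s t =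
      ⟪slope (fun t => A.group t (S.D x)) s t, K (A.evol t y)⟫_ℂ +
        ⟪K (A.evol s x), slope (fun t => A.group t (S.D y)) s t⟫_ℂ := by
    intro t
    have e1 : ⟪A.group s (S.D x), K (A.evol s y)⟫_ℂ = ⟪K (A.evol s x), A.group s (S.D y)⟫_ℂ := by
      rw [← D_evol, ← D_evol, hK]
    have e2 : ⟪A.group s (S.D x), K (A.evol t y)⟫_ℂ = ⟪K (A.evol s x), A.group t (S.D y)⟫_ℂ := by
      rw [← D_evol, ← D_evol, hK]
    simp only [slope, vsub_eq_sub]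
    rw [← Complex.coe_smul, ← Complex.coe_smul, ← Complex.coe_smul, inner_smul_left,
      inner_smul_right, Complex.conj_ofReal, inner_sub_left, inner_sub_right, e1, e2, smul_eq_mul]
    ring
  have h2 : Tendsto (fun t => ⟪K (A.evol s x), slope (fun t => A.group t (S.D y)) s t⟫_ℂ)
      (𝓝[≠] s) (𝓝 ⟪K (A.evol s x), Complex.I • A.Z (A.evol s y)⟫_ℂ) :=
    tendsto_const_nhds.inner hy
  have h1 : Tendsto (fun t => ⟪slope (fun t => A.group t (S.D x)) s t, K (A.evol t y)⟫_ℂ)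
      (𝓝[≠] s) (𝓝 ⟪Complex.I • A.Z (A.evol s x), K (A.evol s y)⟫_ℂ) := by
    set a := Complex.I • A.Z (A.evol s x)
    -- The adjoint moves the bounded operator `K` onto the fixed vector, where weak continuity of
    -- `evol` is enough; the moving difference quotient is handled with the norm bound.
    have h3 : Tendsto (fun t => ⟪a, K (A.evol t y)⟫_ℂ) (𝓝[≠] s) (𝓝 ⟪a, K (A.evol s y)⟫_ℂ) := by
      have := (A.tendsto_inner_evol (K.adjoint a) y s).mono_left
        (nhdsWithin_le_nhds (s := {s}ᶜ))
      simpa only [ContinuousLinearMap.adjoint_inner_left] using this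
    have h4 : Tendsto (fun t => ⟪slope (fun t => A.group t (S.D x)) s t - a, K (A.evol t y)⟫_ℂ)
        (𝓝[≠] s) (𝓝 0) := by
      have hb : ∀ᶠ t in 𝓝[≠] s, |t| ≤ |s| + 1 := nhdsWithin_le_nhds
        ((continuous_abs.tendsto s).eventually_le_const (by linarith))
      refine squeeze_zero_norm' (a := fun t => ‖slope (fun t => A.group t (S.D x)) s t - a‖ *
        (‖K‖ * (Real.exp (‖A.W‖ * (|s| + 1)) * ‖y‖))) ?_ ?_
      · filter_upwards [hb] with t ht
        refine (norm_inner_le_norm _ _).trans ?_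
        gcongr
        refine (K.le_opNorm _).trans ?_
        gcongr
        refine (A.norm_evol_le t y).trans ?_
        gcongr
      · simpa using (tendsto_iff_norm_sub_tendsto_zero.1 hx).mul_const
          (‖K‖ * (Real.exp (‖A.W‖ * (|s| + 1)) * ‖y‖))
    refine (h4.add h3).congr' (Eventually.of_forall fun t => ?_) |>.trans (by rw [zero_add])
    rw [inner_sub_left, sub_add_cancel]
  refine ((h1.add h2).congr fun t => (e t).symm).trans (le_of_eq ?_)
  congr 1
  rw [inner_smul_left, inner_smul_right, Complex.conj_I, ← D_evol]
  linear_combination -Complex.I * hM (A.evol s x) (A.evol s y) +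
    ⟪S.D (A.evol s x), M (A.evol s y)⟫_ℂ * Complex.I_sq

end RelBounded

end Abstract

open Filter

/-! ### Bounded operators on the Fock space -/

/-- The bounded diagonal operator on `ℋ₀` with given eigenvalues. -/
def diagL (w : Neutral → ℝ) (C : ℝ) (hw : ∀ s, |w s| ≤ C) : ℋ₀ →L[ℂ] ℋ₀ :=
  have hmul : ∀ (x : ℋ₀) s, ‖(w s : ℂ) * x s‖ ≤ ‖((C : ℂ) • x : ℋ₀) s‖ := fun x s => by
    rw [lp.coeFn_smul, Pi.smul_apply, norm_mul, norm_smul, Complex.norm_real, Complex.norm_real,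
      Real.norm_eq_abs, Real.norm_eq_abs]
    exact mul_le_mul_of_nonneg_right ((hw s).trans (le_abs_self C)) (norm_nonneg _)
  LinearMap.mkContinuous
    { toFun := fun x => ⟨fun s => (w s : ℂ) * x s, (lp.memℓp ((C : ℂ) • x)).mono' (hmul x)⟩
      map_add' := fun x y => lp.ext (funext fun s => mul_add _ _ _)
      map_smul' := fun c x => lp.ext (funext fun s => mul_left_comm _ _ _) }
    |C| (fun x => by
      have := lp.norm_mono (p := 2) (by norm_num) (x := (⟨fun s => (w s : ℂ) * x s,
        (lp.memℓp ((C : ℂ) • x)).mono' (hmul x)⟩ : ℋ₀)) (hmul x)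
      rwa [norm_smul, Complex.norm_real, Real.norm_eq_abs] at this)

lemma diagL_apply (w : Neutral → ℝ) (C : ℝ) (hw : ∀ s, |w s| ≤ C) (x : ℋ₀) (s : Neutral) :
    diagL w C hw x s = w s * x s := rfl

lemma inner_diagL (w : Neutral → ℝ) (C : ℝ) (hw : ∀ s, |w s| ≤ C) (x y : ℋ₀) :
    ⟪diagL w C hw x, y⟫_ℂ = ⟪x, diagL w C hw y⟫_ℂ := by
  rw [lp.inner_eq_tsum, lp.inner_eq_tsum]
  refine tsum_congr fun s => ?_
  simp only [diagL_apply, RCLike.inner_apply, map_mul, Complex.conj_ofReal]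
  ring

lemma norm_diagL_le {w : Neutral → ℝ} {C : ℝ} {hw : ∀ s, |w s| ≤ C} {c : ℝ} (x : ℋ₀)
    (hc : ∀ s, |w s| ≤ c) (hc0 : 0 ≤ c) : ‖diagL w C hw x‖ ≤ c * ‖x‖ := by
  have := lp.norm_mono (p := 2) (by norm_num) (x := diagL w C hw x) (y := ((c : ℂ) • x : ℋ₀))
    (fun s => by
      rw [lp.coeFn_smul, Pi.smul_apply, diagL_apply, norm_mul, norm_smul, Complex.norm_real,
        Complex.norm_real, Real.norm_eq_abs, Real.norm_eq_abs]
      exact mul_le_mul_of_nonneg_right ((hc s).trans (le_abs_self c)) (norm_nonneg _))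
  rwa [norm_smul, Complex.norm_real, Real.norm_of_nonneg hc0] at this

/-- The energy of a basis state. -/
def nrg (s : Occ) : ℝ := wt energyWt s

lemma nrg_nonneg (s : Occ) : 0 ≤ nrg s := by
  rw [nrg]
  exact_mod_cast wt_energyWt_nonneg s

/-- An occupied mode has energy at most the total, so only finitely many basis states lie below a
given energy. Hence energy cutoffs produce finite particle states and the energy spaces are
finite-dimensional. -/
lemma mem_Icc_of_nrg_le {n : ℕ} {s : Occ} (h : nrg s ≤ n) :
    s ∈ (Finset.Icc (-(n : ℤ)) n).powerset ×ˢ (Finset.Icc (-(n : ℤ)) n).powerset := by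
  have h' : wt energyWt s ≤ n := by
    rw [nrg] at h
    exact_mod_cast h
  have e1 : ∀ k ∈ s.1, |k| ≤ ∑ k ∈ s.1, energyWt (.inl k) := fun k hk =>
    Finset.single_le_sum (f := fun k => energyWt (.inl k)) (fun i _ => abs_nonneg i) hk
  have e2 : ∀ k ∈ s.2, |k| ≤ ∑ k ∈ s.2, energyWt (.inr k) := fun k hk =>
    Finset.single_le_sum (f := fun k => energyWt (.inr k)) (fun i _ => abs_nonneg i) hk
  have f1 : 0 ≤ ∑ k ∈ s.1, energyWt (.inl k) := Finset.sum_nonneg fun i _ => abs_nonneg i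
  have f2 : 0 ≤ ∑ k ∈ s.2, energyWt (.inr k) := Finset.sum_nonneg fun i _ => abs_nonneg i
  rw [wt] at h'
  rw [Finset.mem_product, Finset.mem_powerset, Finset.mem_powerset]
  exact ⟨fun k hk => Finset.mem_Icc.2 (abs_le.1 (by linarith [e1 k hk])),
    fun k hk => Finset.mem_Icc.2 (abs_le.1 (by linarith [e2 k hk]))⟩

lemma energyOne_apply (v : Fin𝓕) (s : Occ) : energyOne v s = (nrg s + 1 : ℝ) * v s := by
  rw [energyOne, LinearMap.add_apply, Finsupp.add_apply, wtOp_apply, nrg]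
  push_cast
  simp [add_mul]

lemma diagOp_mem_𝓕₀ (w : Occ → ℂ) {v : Fin𝓕} (hv : v ∈ 𝓕₀) : diagOp w v ∈ 𝓕₀ :=
  (shifts_diagOp chargeWt w).map_𝓕₀ hv

/-- The inverse of `energyOne`. -/
def energyOneInv : Module.End ℂ Fin𝓕 := diagOp fun s => ((1 / (nrg s + 1) : ℝ) : ℂ)

lemma energyOne_energyOneInv (v : Fin𝓕) : energyOne (energyOneInv v) = v := by
  ext s
  have h : nrg s + 1 ≠ 0 := (by linarith [nrg_nonneg s] : 0 < nrg s + 1).ne'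
  rw [energyOne_apply, energyOneInv, diagOp_apply, ← mul_assoc, ← Complex.ofReal_mul,
    mul_one_div_cancel h]
  simp

lemma denseRange_toℋ₀ : DenseRange fun v : 𝓕₀ => toℋ₀ v := by
  intro x
  refine mem_closure_of_tendsto (lp.hasSum_single (by norm_num) x) (Eventually.of_forall fun T => ?_)
  refine (LinearMap.range (toℋ₀ ∘ₗ 𝓕₀.subtype)).sum_mem fun s _ => ?_
  refine ⟨x s • ⟨Ω s, Ω_mem_𝓕₀.2 s.2⟩, ?_⟩
  rw [map_smul, LinearMap.comp_apply, Submodule.subtype_apply, toℋ₀_Ω_of_neutral s.2,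
    ← lp.single_smul, smul_eq_mul, mul_one]

lemma denseRange_energyOne : DenseRange fun v : 𝓕₀ => toℋ₀ (energyOne v) := by
  refine denseRange_toℋ₀.mono ?_
  rintro _ ⟨v, rfl⟩
  refine ⟨⟨energyOneInv v, diagOp_mem_𝓕₀ _ v.2⟩, ?_⟩
  exact congrArg toℋ₀ (energyOne_energyOneInv v)

lemma abs_inv_nrg_le (s : Neutral) : |1 / (nrg s + 1)| ≤ 1 := by
  have := nrg_nonneg s
  rw [abs_of_nonneg (by positivity)]
  exact (div_le_one (by positivity)).2 (by linarith)

lemma abs_cutoff_le (n : ℕ) (s : Neutral) : |if nrg s ≤ n then (1 : ℝ) else 0| ≤ 1 := by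
  split_ifs <;> simp

/-- The energy and its cutoffs on `ℋ₀`. -/
def fockScale : EnergyScale ℋ₀ where
  D := diagL (fun s => 1 / (nrg s + 1)) 1 abs_inv_nrg_le
  P n := diagL (fun s => if nrg s ≤ n then 1 else 0) 1 (abs_cutoff_le n)
  B n := diagL (fun s => if nrg s ≤ n then nrg s + 1 else 0) (n + 1) fun s => by
    have := nrg_nonneg s
    split_ifs
    · rw [abs_of_nonneg (by positivity)]
      linarith
    · rw [abs_zero]
      positivity
  inner_D x y := inner_diagL _ _ _ x y
  inner_P n x y := inner_diagL _ _ _ x y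
  inner_B n x y := inner_diagL _ _ _ x y
  P_P {n m} h x := lp.ext <| funext fun s => by
    have : (n : ℝ) ≤ m := by exact_mod_cast h
    simp only [diagL_apply]
    split_ifs <;> first | (exfalso; linarith) | simp
  P_P' {n m} h x := lp.ext <| funext fun s => by
    have : (n : ℝ) ≤ m := by exact_mod_cast h
    simp only [diagL_apply]
    split_ifs <;> first | (exfalso; linarith) | simp
  D_B n x := lp.ext <| funext fun s => by
    have := nrg_nonneg s
    have h1 : (nrg s : ℂ) + 1 ≠ 0 := by
      exact_mod_cast (by linarith : (0 : ℝ) < nrg s + 1).ne'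
    simp only [diagL_apply]
    split_ifs <;> push_cast <;> field_simp <;> ring
  B_D n x := lp.ext <| funext fun s => by
    have := nrg_nonneg s
    have h1 : (nrg s : ℂ) + 1 ≠ 0 := by
      exact_mod_cast (by linarith : (0 : ℝ) < nrg s + 1).ne'
    simp only [diagL_apply]
    split_ifs <;> push_cast <;> field_simp <;> ring
  P_B {n m} h x := lp.ext <| funext fun s => by
    have : (n : ℝ) ≤ m := by exact_mod_cast h
    simp only [diagL_apply]
    split_ifs <;> first | (exfalso; linarith) | simp
  B_P {n m} h x := lp.ext <| funext fun s => by
    have : (n : ℝ) ≤ m := by exact_mod_cast h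
    simp only [diagL_apply]
    split_ifs <;> first | (exfalso; linarith) | simp
  tail n x := by
    have h0 : (0 : ℝ) ≤ 1 / ((n : ℝ) + 1) := by positivity
    have key := lp.norm_mono (p := 2) (by norm_num) (x := diagL (fun s => 1 / (nrg s + 1)) 1 abs_inv_nrg_le x -
      diagL (fun s => if nrg s ≤ n then 1 else 0) 1 (abs_cutoff_le n) (diagL (fun s => 1 / (nrg s + 1)) 1 abs_inv_nrg_le x))
      (y := (((1 / ((n : ℝ) + 1) : ℝ) : ℂ) • x : ℋ₀)) (fun s => by
      have := nrg_nonneg s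
      have h1 : (diagL (fun s => 1 / (nrg s + 1)) 1 abs_inv_nrg_le x -
          diagL (fun s => if nrg s ≤ n then 1 else 0) 1 (abs_cutoff_le n)
            (diagL (fun s => 1 / (nrg s + 1)) 1 abs_inv_nrg_le x) : ℋ₀) s =
          (((if nrg s ≤ n then 0 else 1 / (nrg s + 1) : ℝ)) : ℂ) * x s := by
        rw [lp.coeFn_sub, Pi.sub_apply]
        simp only [diagL_apply]
        split_ifs <;> simp
      rw [h1, lp.coeFn_smul, Pi.smul_apply, norm_mul, norm_smul, Complex.norm_real,
        Complex.norm_real, Real.norm_of_nonneg h0]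
      refine mul_le_mul_of_nonneg_right ?_ (norm_nonneg _)
      split_ifs with h
      · simpa using h0
      · rw [Real.norm_of_nonneg (by positivity)]
        gcongr
        linarith)
    rw [norm_smul, Complex.norm_real, Real.norm_of_nonneg h0] at key
    exact key.trans_eq (by ring)
  tendsto_P x := by
    rw [Metric.tendsto_atTop]
    intro ε hε
    obtain ⟨_, ⟨v, rfl⟩, hv⟩ := Metric.mem_closure_iff.1 (denseRange_toℋ₀ x) (ε / 2) (by positivity)
    obtain ⟨N, hN⟩ : ∃ N : ℕ, ∀ s ∈ (v : Fin𝓕).support, nrg s ≤ N := by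
      obtain ⟨N, hN⟩ := exists_nat_ge (∑ s ∈ (v : Fin𝓕).support, nrg s)
      exact ⟨N, fun s hs => (Finset.single_le_sum (fun i _ => nrg_nonneg i) hs).trans hN⟩
    refine ⟨N, fun n hn => ?_⟩
    set P := diagL (fun s => if nrg s ≤ n then 1 else 0) 1 _
    have hP : P (toℋ₀ v) = toℋ₀ v := lp.ext <| funext fun s => by
      rw [diagL_apply, toℋ₀_apply]
      split_ifs with h
      · simp
      · have : (v : Fin𝓕) s = 0 := by
          by_contra h0
          refine h ((hN s (Finsupp.mem_support_iff.2 h0)).trans ?_)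
          exact_mod_cast hn
        simp [this]
    have hle : ‖P (x - toℋ₀ v)‖ ≤ 1 * ‖x - toℋ₀ v‖ :=
      norm_diagL_le _ (fun s => by split_ifs <;> simp) zero_le_one
    rw [dist_eq_norm] at hv ⊢
    have e : P x - x = P (x - toℋ₀ v) - (x - toℋ₀ v) := by
      rw [map_sub, hP]
      abel
    rw [e]
    refine (norm_sub_le _ _).trans_lt ?_
    have hv' : ‖x - toℋ₀ v‖ < ε / 2 := hv
    linarith

lemma fockScale_D_energyOne (v : Fin𝓕) : fockScale.D (toℋ₀ (energyOne v)) = toℋ₀ v := by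
  refine lp.ext <| funext fun s => ?_
  have h1 : (nrg s : ℂ) + 1 ≠ 0 := by
    exact_mod_cast (by linarith [nrg_nonneg s] : (0 : ℝ) < nrg s + 1).ne'
  simp only [fockScale, diagL_apply, toℋ₀_apply, energyOne_apply]
  push_cast
  field_simp

/-- The truncation of a state is a finite particle state. -/
lemma exists_fockScale_P (n : ℕ) (x : ℋ₀) : ∃ v ∈ 𝓕₀, fockScale.P n x = toℋ₀ v := by
  classical
  let T : Finset Occ := (Finset.Icc (-(n : ℤ)) n).powerset ×ˢ (Finset.Icc (-(n : ℤ)) n).powerset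
  let c : Occ → ℂ := fun s => if h : s.1.card = s.2.card then fockScale.P n x ⟨s, h⟩ else 0
  refine ⟨∑ s ∈ T, c s • Ω s, 𝓕₀.sum_mem fun s _ => ?_, lp.ext <| funext fun s => ?_⟩
  · by_cases h : s.1.card = s.2.card
    · exact 𝓕₀.smul_mem _ (Ω_mem_𝓕₀.2 h)
    · simp [c, h]
  · have h1 : (∑ t ∈ T, c t • Ω t) (s : Occ) = if (s : Occ) ∈ T then c s else 0 := by
      rw [Finsupp.finsetSum_apply]
      simp [Ω, Finsupp.single_apply]
    rw [toℋ₀_apply, h1]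
    split_ifs with h
    · simp [c, s.2]
    · have : ¬ nrg s ≤ n := fun h' => h (mem_Icc_of_nrg_le h')
      simp [fockScale, diagL_apply, this]

lemma exists_extension {M H : Type*} [AddCommGroup M] [Module ℂ M] [NormedAddCommGroup H]
    [NormedSpace ℂ H] [CompleteSpace H] (S : Submodule ℂ M) (e f : M →ₗ[ℂ] H)
    (he : DenseRange fun x : S => e x) {C : ℝ} (hC : 0 ≤ C) (h : ∀ x ∈ S, ‖f x‖ ≤ C * ‖e x‖) :
    ∃ T : H →L[ℂ] H, (∀ x ∈ S, T (e x) = f x) ∧ ‖T‖ ≤ C := by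
  let e' : S →ₗ[ℂ] H := e ∘ₗ S.subtype
  let f' : S →ₗ[ℂ] H := f ∘ₗ S.subtype
  exact ⟨f'.extendOfNorm e', fun x hx =>
    LinearMap.extendOfNorm_eq (f := f') (e := e') he ⟨C, fun x => h x x.2⟩ ⟨x, hx⟩,
    LinearMap.opNorm_extendOfNorm_le (f := f') (e := e') he hC fun x => h x x.2⟩

/-- `A` is bounded relative to the energy, with constant `C`. -/
def RelBdd (A : Fin𝓕 →ₗ[ℂ] ℋ₀) (C : ℝ) : Prop := ∀ v ∈ 𝓕₀, ‖A v‖ ≤ C * ‖toℋ₀ (energyOne v)‖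

lemma RelBdd.exists_extension {A : Fin𝓕 →ₗ[ℂ] ℋ₀} {C : ℝ} (h : RelBdd A C) (hC : 0 ≤ C) :
    ∃ T : ℋ₀ →L[ℂ] ℋ₀, (∀ v ∈ 𝓕₀, T (toℋ₀ (energyOne v)) = A v) ∧ ‖T‖ ≤ C :=
  Schwinger.exists_extension 𝓕₀ (toℋ₀ ∘ₗ energyOne) A denseRange_energyOne hC h

open Classical in
/-- The bounded operator `A (E + 1)⁻¹`, for an operator `A` on finite particle states which is
bounded relative to the energy. -/
def relL (A : Fin𝓕 →ₗ[ℂ] ℋ₀) : ℋ₀ →L[ℂ] ℋ₀ :=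
  if h : ∃ T : ℋ₀ →L[ℂ] ℋ₀, ∀ v ∈ 𝓕₀, T (toℋ₀ (energyOne v)) = A v then h.choose else 0

lemma ext_energyOne {F : Type*} [TopologicalSpace F] [T2Space F] {f g : ℋ₀ → F}
    (hf : Continuous f) (hg : Continuous g)
    (h : ∀ v ∈ 𝓕₀, f (toℋ₀ (energyOne v)) = g (toℋ₀ (energyOne v))) (x : ℋ₀) : f x = g x :=
  congrFun (denseRange_energyOne.equalizer hf hg (funext fun v => h v v.2)) x

lemma ext_toℋ₀ {F : Type*} [TopologicalSpace F] [T2Space F] {f g : ℋ₀ → F}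
    (hf : Continuous f) (hg : Continuous g) (h : ∀ v ∈ 𝓕₀, f (toℋ₀ v) = g (toℋ₀ v)) (x : ℋ₀) :
    f x = g x :=
  congrFun (denseRange_toℋ₀.equalizer hf hg (funext fun v => h v v.2)) x

lemma relL_energyOne {A : Fin𝓕 →ₗ[ℂ] ℋ₀} {C : ℝ} (h : RelBdd A C) (hC : 0 ≤ C) {v : Fin𝓕}
    (hv : v ∈ 𝓕₀) : relL A (toℋ₀ (energyOne v)) = A v := by
  obtain ⟨T, hT, -⟩ := h.exists_extension hC
  have hex : ∃ T : ℋ₀ →L[ℂ] ℋ₀, ∀ v ∈ 𝓕₀, T (toℋ₀ (energyOne v)) = A v := ⟨T, hT⟩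
  rw [relL, dif_pos hex]
  exact hex.choose_spec v hv

lemma norm_relL_le {A : Fin𝓕 →ₗ[ℂ] ℋ₀} {C : ℝ} (h : RelBdd A C) (hC : 0 ≤ C) : ‖relL A‖ ≤ C := by
  obtain ⟨T, hT, hn⟩ := h.exists_extension hC
  have : relL A = T := ContinuousLinearMap.ext <| ext_energyOne (relL A).continuous T.continuous
    fun v hv => by rw [relL_energyOne h hC hv, hT v hv]
  rwa [this]

/-! ### Series of quadratic operators -/

/-- The positive integers. -/
abbrev PN : Type := {m : ℤ // 0 < m}

/-- A positive integer as a nonzero integer. -/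
def PN.toNZ (m : PN) : NZ := ⟨m, ne_of_gt m.2⟩

/-- Minus a positive integer as a nonzero integer. -/
def PN.negNZ (m : PN) : NZ := ⟨-m, neg_ne_zero.2 m.2.ne'⟩

lemma PN.toNZ_injective : Function.Injective PN.toNZ := fun _ _ h =>
  Subtype.ext (congrArg (fun a : NZ => (a : ℤ)) h)

lemma PN.negNZ_injective : Function.Injective PN.negNZ := fun _ _ h =>
  Subtype.ext (neg_injective (congrArg (fun a : NZ => (a : ℤ)) h))

/-- Negation of nonzero integers. -/
def nzNeg : NZ ≃ NZ where
  toFun a := ⟨-a, neg_ne_zero.2 a.2⟩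
  invFun a := ⟨-a, neg_ne_zero.2 a.2⟩
  left_inv _ := Subtype.ext (neg_neg _)
  right_inv _ := Subtype.ext (neg_neg _)

lemma coe_nzNeg (a : NZ) : ((nzNeg a : NZ) : ℤ) = -a := rfl

/-- Unconditional convergence over the nonzero integers allows the two indices `±m`, which the
Heisenberg equations couple, to be grouped. -/
lemma hasSum_PN {G : Type*} [NormedAddCommGroup G] [CompleteSpace G] {f : NZ → G} {x : G}
    (hf : HasSum f x) : HasSum (fun m : PN => f m.toNZ + f m.negNZ) x := by
  have h1 := (hf.summable.comp_injective PN.toNZ_injective).hasSum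
  have h2 := (hf.summable.comp_injective PN.negNZ_injective).hasSum
  have hc : IsCompl (Set.range PN.toNZ) (Set.range PN.negNZ) := by
    refine ⟨Set.disjoint_left.2 ?_, codisjoint_iff.2 (Set.eq_univ_of_forall fun a => ?_)⟩
    · rintro _ ⟨m, rfl⟩ ⟨k, hk⟩
      have := congrArg (fun a : NZ => (a : ℤ)) hk
      simp only [PN.toNZ, PN.negNZ] at this
      have h1 := m.2
      have h2 := k.2
      omega
    · rcases lt_or_gt_of_ne a.2 with h | h
      · exact Or.inr ⟨⟨-a, by omega⟩, Subtype.ext (neg_neg _)⟩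
      · exact Or.inl ⟨⟨a, h⟩, rfl⟩
  have h3 := (PN.toNZ_injective.hasSum_range_iff.2 h1).add_isCompl hc
    (PN.negNZ_injective.hasSum_range_iff.2 h2)
  rw [hf.unique h3]
  exact h1.add h2

lemma summable_inv_sq_NZ : Summable fun a : NZ => 1 / ((a : ℤ) : ℝ) ^ 2 := by
  have h := (Real.summable_one_div_int_pow (p := 2)).2 (by norm_num)
  exact h.comp_injective Subtype.val_injective

/-- `ϱᴿ(a) ϱᴸ(-a) (E + 1)⁻¹`. -/
def pairL (a : ℤ) : ℋ₀ →L[ℂ] ℋ₀ := relL (toℋ₀ ∘ₗ pairOp a)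

lemma relBdd_pairOp {a : ℤ} (ha : a ≠ 0) : RelBdd (toℋ₀ ∘ₗ pairOp a) (3 * √(((a : ℤ) : ℝ) ^ 2)) := by
  intro v hv
  have := norm_sum_pairOp_le {⟨a, ha⟩} (fun _ => 1) hv
  simpa using this

lemma pairL_energyOne {a : ℤ} (ha : a ≠ 0) {v : Fin𝓕} (hv : v ∈ 𝓕₀) :
    pairL a (toℋ₀ (energyOne v)) = toℋ₀ (pairOp a v) :=
  relL_energyOne (relBdd_pairOp ha) (by positivity) hv

lemma opNorm_le_of_energyOne {T : ℋ₀ →L[ℂ] ℋ₀} {C : ℝ} (hC : 0 ≤ C)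
    (h : ∀ v ∈ 𝓕₀, ‖T (toℋ₀ (energyOne v))‖ ≤ C * ‖toℋ₀ (energyOne v)‖) : ‖T‖ ≤ C := by
  refine T.opNorm_le_bound hC fun x => ?_
  exact denseRange_energyOne.induction_on x
    (isClosed_le (by fun_prop) (by fun_prop)) fun v => h v v.2

lemma norm_sum_pairL_le (T : Finset NZ) (g : NZ → ℂ) :
    ‖∑ a ∈ T, g a • pairL a‖ ≤ 3 * √(∑ a ∈ T, ‖g a‖ ^ 2 * ((a : ℤ) : ℝ) ^ 2) := by
  refine opNorm_le_of_energyOne (by positivity) fun v hv => ?_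
  have : (∑ a ∈ T, g a • pairL a) (toℋ₀ (energyOne v)) = ∑ a ∈ T, g a • toℋ₀ (pairOp a v) := by
    rw [sum_apply]
    refine Finset.sum_congr rfl fun a _ => ?_
    rw [smul_apply, pairL_energyOne a.2 hv]
  rw [this]
  exact norm_sum_pairOp_le T g hv

/-- The coefficients for which `∑ g a ϱᴿ(a) ϱᴸ(-a)` is bounded relative to the energy. -/
def SqSummable (g : NZ → ℂ) : Prop := Summable fun a : NZ => ‖g a‖ ^ 2 * ((a : ℤ) : ℝ) ^ 2

lemma SqSummable.of_le {g : NZ → ℂ} {C : ℝ} (h : ∀ a : NZ, ‖g a‖ ≤ C / ((a : ℤ) : ℝ) ^ 2) :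
    SqSummable g := by
  refine Summable.of_nonneg_of_le (fun a => by positivity) (fun a => ?_)
    (summable_inv_sq_NZ.mul_left (C ^ 2))
  have ha : (0 : ℝ) < ((a : ℤ) : ℝ) ^ 2 := by
    have : ((a : ℤ) : ℝ) ≠ 0 := by exact_mod_cast a.2
    positivity
  calc ‖g a‖ ^ 2 * ((a : ℤ) : ℝ) ^ 2 ≤ (C / ((a : ℤ) : ℝ) ^ 2) ^ 2 * ((a : ℤ) : ℝ) ^ 2 := by
        gcongr
        exact h a
    _ = C ^ 2 * (1 / ((a : ℤ) : ℝ) ^ 2) := by field_simp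

/-- Convergence in operator norm comes from the estimate on finite blocks, a square root of a sum of
squares. The termwise bound `3 * |a|` would not give it for coefficients decaying like `a⁻²`. -/
lemma SqSummable.summable {g : NZ → ℂ} (h : SqSummable g) :
    Summable fun a : NZ => g a • pairL a := by
  rw [summable_iff_vanishing_norm]
  intro ε hε
  obtain ⟨s, hs⟩ := summable_iff_vanishing_norm.1 h ((ε / 3) ^ 2) (by positivity)
  refine ⟨s, fun t ht => (norm_sum_pairL_le t g).trans_lt ?_⟩
  have h1 := hs t ht
  have h0 : 0 ≤ ∑ a ∈ t, ‖g a‖ ^ 2 * ((a : ℤ) : ℝ) ^ 2 := Finset.sum_nonneg fun _ _ => by positivity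
  rw [Real.norm_of_nonneg h0] at h1
  have h2 : √(∑ a ∈ t, ‖g a‖ ^ 2 * ((a : ℤ) : ℝ) ^ 2) < ε / 3 := by
    rw [Real.sqrt_lt' (by positivity)]
    exact h1
  linarith

/-- `∑ g a ϱᴿ(a) ϱᴸ(-a) (E + 1)⁻¹`. -/
def pairSum (g : NZ → ℂ) : ℋ₀ →L[ℂ] ℋ₀ := ∑' a : NZ, g a • pairL a

lemma SqSummable.hasSum {g : NZ → ℂ} (h : SqSummable g) :
    HasSum (fun a : NZ => g a • pairL a) (pairSum g) := h.summable.hasSum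

lemma SqSummable.hasSum_apply {g : NZ → ℂ} (h : SqSummable g) (x : ℋ₀) :
    HasSum (fun a : NZ => g a • pairL a x) (pairSum g x) := by
  have := h.hasSum.mapL (ContinuousLinearMap.apply ℂ ℋ₀ x)
  simpa using this

lemma SqSummable.hasSum_inner_right {g : NZ → ℂ} (h : SqSummable g) (z x : ℋ₀) :
    HasSum (fun a : NZ => g a * ⟪z, pairL a x⟫_ℂ) ⟪z, pairSum g x⟫_ℂ := by
  have := (h.hasSum_apply x).mapL (innerSL ℂ z)
  simpa [inner_smul_right] using this

lemma SqSummable.hasSum_inner_left {g : NZ → ℂ} (h : SqSummable g) (x z : ℋ₀) :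
    HasSum (fun a : NZ => (starRingEnd ℂ) (g a) * ⟪pairL a x, z⟫_ℂ) ⟪pairSum g x, z⟫_ℂ := by
  have := (h.hasSum_inner_right z x).mapL Complex.conjCLE.toContinuousLinearMap
  simpa using this

/-- `(numOp m) (E + 1)⁻¹`. -/
def numL (m : ℤ) : ℋ₀ →L[ℂ] ℋ₀ := relL (toℋ₀ ∘ₗ numOp m)

lemma relBdd_numOp {m : ℤ} (hm : 0 < m) : RelBdd (toℋ₀ ∘ₗ numOp m) 2 := fun _ hv =>
  norm_numOp_le hm hv

lemma numL_energyOne {m : ℤ} (hm : 0 < m) {v : Fin𝓕} (hv : v ∈ 𝓕₀) :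
    numL m (toℋ₀ (energyOne v)) = toℋ₀ (numOp m v) :=
  relL_energyOne (relBdd_numOp hm) (by positivity) hv

lemma norm_numL_le {m : ℤ} (hm : 0 < m) : ‖numL m‖ ≤ 2 := norm_relL_le (relBdd_numOp hm) (by norm_num)

/-- `(mixOp m) (E + 1)⁻¹`. -/
def mixL (m : ℤ) : ℋ₀ →L[ℂ] ℋ₀ := pairL m + pairL (-m)

lemma mixL_energyOne {m : ℤ} (hm : m ≠ 0) {v : Fin𝓕} (hv : v ∈ 𝓕₀) :
    mixL m (toℋ₀ (energyOne v)) = toℋ₀ (mixOp m v) := by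
  rw [mixL, add_apply, pairL_energyOne hm hv, pairL_energyOne (neg_ne_zero.2 hm) hv, ← map_add]
  rfl

/-- Two bounded operators are adjoint as soon as the operators on finite particle states are. -/
lemma inner_D_of_isNice {A B : Module.End ℂ Fin𝓕} (h : IsNice A B) {S T : ℋ₀ →L[ℂ] ℋ₀}
    (hS : ∀ v ∈ 𝓕₀, S (toℋ₀ (energyOne v)) = toℋ₀ (A v))
    (hT : ∀ v ∈ 𝓕₀, T (toℋ₀ (energyOne v)) = toℋ₀ (B v)) (x y : ℋ₀) :
    ⟪S x, fockScale.D y⟫_ℂ = ⟪fockScale.D x, T y⟫_ℂ := by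
  refine ext_energyOne (f := fun x => ⟪S x, fockScale.D y⟫_ℂ)
    (g := fun x => ⟪fockScale.D x, T y⟫_ℂ) (by fun_prop) (by fun_prop) (fun u hu => ?_) x
  refine ext_energyOne (f := fun y => ⟪S (toℋ₀ (energyOne u)), fockScale.D y⟫_ℂ)
    (g := fun y => ⟪fockScale.D (toℋ₀ (energyOne u)), T y⟫_ℂ) (by fun_prop) (by fun_prop)
    (fun v hv => ?_) y
  simp only [hS u hu, hT v hv, fockScale_D_energyOne]
  exact h.inner hu v

/-! ### The Bogoliubov generator -/

/-- The strength `e² / (L k_m²)` of the Coulomb interaction of the modes `±m`. -/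
def cpl (e L : ℝ) (m : ℤ) : ℝ := e ^ 2 / (L * mom L m ^ 2)

lemma mom_ne_zero {L : ℝ} (hL : 0 < L) {m : ℤ} (hm : m ≠ 0) : mom L m ≠ 0 := by
  have : (m : ℝ) ≠ 0 := by exact_mod_cast hm
  have := Real.pi_pos
  unfold mom
  positivity

lemma zeta_neg (e L : ℝ) (m : ℤ) : zeta e L (-m) = zeta e L m := by
  have : mom L (-m) ^ 2 = mom L m ^ 2 := by
    unfold mom
    push_cast
    ring
  rw [zeta, zeta, this]

lemma cpl_neg (e L : ℝ) (m : ℤ) : cpl e L (-m) = cpl e L m := by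
  unfold cpl mom
  push_cast
  ring

lemma cpl_nonneg (e : ℝ) {L : ℝ} (hL : 0 < L) (m : ℤ) : 0 ≤ cpl e L m := by
  unfold cpl
  positivity

lemma cpl_eq {e L : ℝ} (hL : 0 < L) {m : ℤ} (hm : m ≠ 0) :
    cpl e L m = e ^ 2 * L / (4 * Real.pi ^ 2) / (m : ℝ) ^ 2 := by
  have : (m : ℝ) ≠ 0 := by exact_mod_cast hm
  have := Real.pi_pos
  unfold cpl mom
  field_simp
  ring

lemma zeta_arg {e L : ℝ} (hL : 0 < L) {m : ℤ} (hm : m ≠ 0) :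
    e ^ 2 / 2 * (1 / mom L m ^ 2) / (e ^ 2 / 2 * (1 / mom L m ^ 2) + Real.pi) =
      cpl e L m / (2 * Real.pi / L + cpl e L m) := by
  have := mom_ne_zero hL hm
  have h1 := Real.pi_pos
  have h2 : e ^ 2 / 2 * (1 / mom L m ^ 2) + Real.pi ≠ 0 := by positivity
  have h3 : 2 * Real.pi / L + cpl e L m ≠ 0 := by
    have := cpl_nonneg e hL m
    positivity
  rw [div_eq_div_iff h2 h3, cpl]
  field_simp
  ring

lemma zeta_arg_mem {e L : ℝ} (hL : 0 < L) {m : ℤ} :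
    cpl e L m / (2 * Real.pi / L + cpl e L m) ∈ Set.Ico (0 : ℝ) 1 := by
  have h1 := Real.pi_pos
  have h2 := cpl_nonneg e hL m
  have h3 : 0 < 2 * Real.pi / L := by positivity
  exact ⟨by positivity, (div_lt_one (by positivity)).2 (by linarith)⟩

lemma tanh_two_zeta {e L : ℝ} (hL : 0 < L) {m : ℤ} (hm : m ≠ 0) :
    Real.tanh (2 * zeta e L m) = -(cpl e L m / (2 * Real.pi / L + cpl e L m)) := by
  have h := zeta_arg_mem (e := e) (m := m) hL
  rw [zeta, zeta_arg hL hm]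
  have : ∀ x : ℝ, 2 * (-(1 / 2) * x) = -x := fun x => by ring
  rw [this, Real.tanh_neg, Real.tanh_artanh ⟨by linarith [h.1], h.2⟩]

/-- Uses `artanh t ≤ t / (1 - t)`; for the argument at hand the right side is proportional to the
Coulomb coupling, hence decays like `m⁻²`. -/
lemma abs_zeta_le {e L : ℝ} (hL : 0 < L) {m : ℤ} (hm : m ≠ 0) :
    |zeta e L m| ≤ cpl e L m * L := by
  have h := zeta_arg_mem (e := e) (m := m) hL
  rw [zeta, zeta_arg hL hm]
  set t := cpl e L m / (2 * Real.pi / L + cpl e L m) with ht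
  have hpi := Real.pi_gt_three
  have h0 : 0 ≤ Real.artanh t := Real.artanh_nonneg h.1
  have h1 : Real.artanh t ≤ t / (1 - t) := by
    rw [Real.artanh_eq_half_log ⟨by linarith [h.1], h.2.le⟩]
    have h2 : 0 < 1 - t := by linarith [h.2]
    have h3 := Real.log_le_sub_one_of_pos (x := (1 + t) / (1 - t)) (div_pos (by linarith [h.1]) h2)
    have h4 : (1 + t) / (1 - t) - 1 = 2 * (t / (1 - t)) := by
      field_simp
      ring
    rw [h4] at h3
    linarith
  have h5 : t / (1 - t) = cpl e L m * L / (2 * Real.pi) := by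
    have h2 := cpl_nonneg e hL m
    have h3 : 0 < 2 * Real.pi / L := by positivity
    have h6 : 2 * Real.pi / L + cpl e L m ≠ 0 := by positivity
    have h7 : 1 - t = (2 * Real.pi / L) / (2 * Real.pi / L + cpl e L m) := by
      rw [ht]
      field_simp
      ring
    rw [h7, ht]
    field_simp
  have h8 := cpl_nonneg e hL m
  have h9 : cpl e L m * L / (2 * Real.pi) ≤ cpl e L m * L := by
    apply div_le_self (by positivity)
    linarith
  rw [abs_mul, abs_of_nonneg h0]
  norm_num
  linarith

lemma abs_zeta_le_div {e L : ℝ} (hL : 0 < L) {m : ℤ} (hm : m ≠ 0) :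
    |zeta e L m| ≤ e ^ 2 * L / (4 * Real.pi ^ 2) * L / (m : ℝ) ^ 2 := by
  refine (abs_zeta_le hL hm).trans_eq ?_
  rw [cpl_eq hL hm]
  ring

/-- The coefficients of the Bogoliubov generator. -/
def bogCoef (e L : ℝ) (a : NZ) : ℂ := Complex.I * ((zeta e L a : ℝ) : ℂ) / ((a : ℤ) : ℂ)

lemma nz_cast_ne (a : NZ) : ((a : ℤ) : ℂ) ≠ 0 := by exact_mod_cast a.2

lemma one_le_abs_nz (a : NZ) : (1 : ℝ) ≤ |((a : ℤ) : ℝ)| := by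
  rw [← Int.cast_abs]
  exact_mod_cast Int.one_le_abs a.2

lemma sqSummable_bogCoef {e L : ℝ} (hL : 0 < L) : SqSummable (bogCoef e L) := by
  refine SqSummable.of_le (C := e ^ 2 * L / (4 * Real.pi ^ 2) * L) fun a => ?_
  rw [bogCoef, norm_div, norm_mul, Complex.norm_I, one_mul, Complex.norm_real, Real.norm_eq_abs]
  refine le_trans ?_ (abs_zeta_le_div hL a.2)
  refine div_le_self (abs_nonneg _) ?_
  rw [← Complex.ofReal_intCast, Complex.norm_real]
  exact one_le_abs_nz a

lemma sqSummable_zeta {e L : ℝ} (hL : 0 < L) :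
    SqSummable fun a => 2 * ((zeta e L a : ℝ) : ℂ) := by
  refine SqSummable.of_le (C := 2 * (e ^ 2 * L / (4 * Real.pi ^ 2) * L)) fun a => ?_
  rw [norm_mul, Complex.norm_real, Real.norm_eq_abs, mul_div_assoc]
  simp only [Complex.norm_ofNat]
  exact mul_le_mul_of_nonneg_left (abs_zeta_le_div hL a.2) zero_le_two

lemma sqSummable_cpl {e L : ℝ} (hL : 0 < L) : SqSummable fun a => ((cpl e L a : ℝ) : ℂ) := by
  refine SqSummable.of_le (C := e ^ 2 * L / (4 * Real.pi ^ 2)) fun a => ?_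
  rw [Complex.norm_real, Real.norm_of_nonneg (cpl_nonneg e hL _), cpl_eq hL a.2]

/-- Since `pairOp (-a)` is the formal adjoint of `pairOp a`, this is the symmetry of `Z`. -/
lemma conj_bogCoef_neg (e L : ℝ) (a : NZ) :
    (starRingEnd ℂ) (bogCoef e L (nzNeg a)) = bogCoef e L a := by
  have : (((nzNeg a : NZ) : ℤ) : ℂ) = -((a : ℤ) : ℂ) := by
    rw [coe_nzNeg]
    push_cast
    rfl
  rw [bogCoef, bogCoef, this, coe_nzNeg, zeta_neg]
  simp [map_div₀, neg_div_neg_eq]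

/-- A bounded operator `K` on `𝓕₀`, given as a relatively bounded operator, its commutators with the
pair operators, and the resulting commutator with the Bogoliubov generator. -/
lemma inner_bog_comm {e L : ℝ} (hL : 0 < L) {K : Module.End ℂ Fin𝓕} (hK : IsNice K K)
    {KL M : ℋ₀ →L[ℂ] ℋ₀} (hKL : ∀ v ∈ 𝓕₀, KL (toℋ₀ (energyOne v)) = toℋ₀ (K v))
    (hM : ∀ v ∈ 𝓕₀, HasSum (fun a : NZ => bogCoef e L a • toℋ₀ (pairOp a (K v) - K (pairOp a v)))
      (-Complex.I • M (toℋ₀ (energyOne v)))) (x y : ℋ₀) :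
    ⟪pairSum (bogCoef e L) x, KL y⟫_ℂ - ⟪KL x, pairSum (bogCoef e L) y⟫_ℂ =
      -Complex.I * ⟪fockScale.D x, M y⟫_ℂ := by
  refine ext_energyOne
    (f := fun x => ⟪pairSum (bogCoef e L) x, KL y⟫_ℂ - ⟪KL x, pairSum (bogCoef e L) y⟫_ℂ)
    (g := fun x => -Complex.I * ⟪fockScale.D x, M y⟫_ℂ) (by fun_prop) (by fun_prop)
    (fun u hu => ?_) x
  refine ext_energyOne
    (f := fun y => ⟪pairSum (bogCoef e L) (toℋ₀ (energyOne u)), KL y⟫_ℂ -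
      ⟪KL (toℋ₀ (energyOne u)), pairSum (bogCoef e L) y⟫_ℂ)
    (g := fun y => -Complex.I * ⟪fockScale.D (toℋ₀ (energyOne u)), M y⟫_ℂ) (by fun_prop)
    (by fun_prop) (fun v hv => ?_) y
  have h := sqSummable_bogCoef (e := e) hL
  have h1 := h.hasSum_inner_left (toℋ₀ (energyOne u)) (KL (toℋ₀ (energyOne v)))
  -- After the change `a ↦ -a` the adjoints on the left match the pair operators on the right, index
  -- by index.
  rw [← nzNeg.hasSum_iff] at h1
  have h2 := h.hasSum_inner_right (KL (toℋ₀ (energyOne u))) (toℋ₀ (energyOne v))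
  have h3 := (hM v hv).mapL (innerSL ℂ (toℋ₀ u))
  simp only [innerSL_apply_apply] at h3
  have h4 := h1.sub h2
  rw [inner_smul_right] at h3
  simp only [fockScale_D_energyOne]
  refine h4.unique (h3.congr_fun fun a => ?_)
  have ha : ((nzNeg a : NZ) : ℤ) ≠ 0 := (nzNeg a).2
  simp only [Function.comp]
  rw [conj_bogCoef_neg, pairL_energyOne ha hu, pairL_energyOne a.2 hv, hKL u hu, hKL v hv,
    hK.inner hu, coe_nzNeg, (isNice_pairOp a.2).symm.inner hu, map_sub, inner_smul_right,
    inner_sub_right]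
  ring

/-- The energy shift `2 * a` cancels the denominator of `bogCoef`. The coefficients of the
commutator are multiples of `ζ(a)`, which still decay fast enough to be relatively bounded. -/
lemma hasSum_bog_energy {e L : ℝ} (hL : 0 < L) {v : Fin𝓕} (hv : v ∈ 𝓕₀) :
    HasSum (fun a : NZ => bogCoef e L a •
      toℋ₀ (pairOp a (wtOp energyWt v) - wtOp energyWt (pairOp a v)))
      (-Complex.I • pairSum (fun a => 2 * ((zeta e L a : ℝ) : ℂ)) (toℋ₀ (energyOne v))) := by
  refine (((sqSummable_zeta (e := e) hL).hasSum_apply (toℋ₀ (energyOne v))).const_smul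
    (-Complex.I)).congr_fun fun a => ?_
  have := nz_cast_ne a
  rw [pairOp_comm_energy a.2, pairL_energyOne a.2 hv, map_smul, smul_smul, smul_smul, bogCoef]
  congr 1
  field_simp

lemma hasSum_ite_pm {G : Type*} [NormedAddCommGroup G] (m : PN) (f : NZ → G) :
    HasSum (fun a : NZ => if (a : ℤ) = m ∨ (a : ℤ) = -m then f a else 0)
      (f m.toNZ + f m.negNZ) := by
  classical
  have h := hasSum_sum_of_ne_finset_zero (L := .unconditional NZ) (s := {m.toNZ, m.negNZ})
    (f := fun a : NZ => if (a : ℤ) = m ∨ (a : ℤ) = -m then f a else 0) (fun a ha => by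
      rw [if_neg]
      rintro (h | h)
      · exact ha (by rw [show a = m.toNZ from Subtype.ext h]; simp)
      · exact ha (by rw [show a = m.negNZ from Subtype.ext h]; simp))
  have hne : m.toNZ ≠ m.negNZ := fun h => by
    have := congrArg (fun a : NZ => (a : ℤ)) h
    simp only [PN.toNZ, PN.negNZ] at this
    have := m.2
    omega
  rw [Finset.sum_pair hne] at h
  simpa [PN.toNZ, PN.negNZ] using h

lemma bogCoef_mul_cast (e L : ℝ) (a : NZ) :
    bogCoef e L a * ((a : ℤ) : ℂ) = Complex.I * ((zeta e L a : ℝ) : ℂ) := by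
  rw [bogCoef, div_mul_cancel₀ _ (nz_cast_ne a)]

lemma hasSum_bog_num (e L : ℝ) (m : PN) {v : Fin𝓕} (hv : v ∈ 𝓕₀) :
    HasSum (fun a : NZ => bogCoef e L a • toℋ₀ (pairOp a (numOp m v) - numOp m (pairOp a v)))
      (-Complex.I • ((2 * ((zeta e L m : ℝ) : ℂ)) • mixL m) (toℋ₀ (energyOne v))) := by
  have h := hasSum_ite_pm m fun a : NZ => (-(2 * Complex.I * ((zeta e L m : ℝ) : ℂ))) •
    toℋ₀ (pairOp a v)
  have e1 : (-Complex.I • ((2 * ((zeta e L m : ℝ) : ℂ)) • mixL m) (toℋ₀ (energyOne v))) =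
      (-(2 * Complex.I * ((zeta e L m : ℝ) : ℂ))) • toℋ₀ (pairOp m.toNZ v) +
      (-(2 * Complex.I * ((zeta e L m : ℝ) : ℂ))) • toℋ₀ (pairOp m.negNZ v) := by
    rw [smul_apply, mixL_energyOne m.2.ne' hv, smul_smul, ← smul_add, ← map_add]
    congr 1
    ring
  rw [e1]
  refine h.congr_fun fun a => ?_
  rw [pairOp_comm_numOp a.2 m.2]
  split_ifs with ha
  · rw [map_smul, smul_smul, mul_neg, mul_left_comm, bogCoef_mul_cast]
    have : zeta e L a = zeta e L m := by
      rcases ha with ha | ha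
      · rw [ha]
      · rw [ha, zeta_neg]
    rw [this]
    congr 1
    ring
  · rw [map_zero, smul_zero]

lemma hasSum_bog_mix (e L : ℝ) (m : PN) {v : Fin𝓕} (hv : v ∈ 𝓕₀) :
    HasSum (fun a : NZ => bogCoef e L a • toℋ₀ (pairOp a (mixOp m v) - mixOp m (pairOp a v)))
      (-Complex.I • ((2 * ((zeta e L m : ℝ) : ℂ)) • (numL m + ((m : ℤ) : ℂ) • fockScale.D))
        (toℋ₀ (energyOne v))) := by
  have h := hasSum_ite_pm m fun _ : NZ => (-(Complex.I * ((zeta e L m : ℝ) : ℂ))) •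
    toℋ₀ (numOp m v + ((m : ℤ) : ℂ) • v)
  have e1 : (-Complex.I • ((2 * ((zeta e L m : ℝ) : ℂ)) • (numL m + ((m : ℤ) : ℂ) • fockScale.D))
      (toℋ₀ (energyOne v))) =
      (-(Complex.I * ((zeta e L m : ℝ) : ℂ))) • toℋ₀ (numOp m v + ((m : ℤ) : ℂ) • v) +
      (-(Complex.I * ((zeta e L m : ℝ) : ℂ))) • toℋ₀ (numOp m v + ((m : ℤ) : ℂ) • v) := by
    rw [smul_apply, add_apply, smul_apply, numL_energyOne m.2 hv, fockScale_D_energyOne, ← map_smul,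
      ← map_add, smul_smul, ← add_smul]
    congr 1
    ring
  rw [e1]
  refine h.congr_fun fun a => ?_
  rw [pairOp_comm_mixOp a.2 m.2]
  split_ifs with ha
  · rw [map_smul, smul_smul, mul_neg, bogCoef_mul_cast]
    have : zeta e L a = zeta e L m := by
      rcases ha with ha | ha
      · rw [ha]
      · rw [ha, zeta_neg]
    rw [this]
  · rw [map_zero, smul_zero]

/-- Symmetry is the case of the commutator with the identity, which is represented by `D` in the
relatively bounded calculus. -/
lemma inner_pairSum_D {e L : ℝ} (hL : 0 < L) (x y : ℋ₀) :
    ⟪pairSum (bogCoef e L) x, fockScale.D y⟫_ℂ = ⟪fockScale.D x, pairSum (bogCoef e L) y⟫_ℂ := by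
  have h := inner_bog_comm (e := e) hL (K := 1) (KL := fockScale.D) (M := 0)
    ⟨fun _ _ => rfl, fun v => by simp, fun v => by simp⟩
    (fun v _ => fockScale_D_energyOne v) (fun v _ => by simp) x y
  simpa [sub_eq_zero] using h

/-- `1 - D` is `E (E + 1)⁻¹`, the bounded form of the energy. -/
lemma energyL_energyOne (v : Fin𝓕) :
    (1 - fockScale.D) (toℋ₀ (energyOne v)) = toℋ₀ (wtOp energyWt v) := by
  rw [sub_apply, fockScale_D_energyOne, one_apply_eq_self, ← map_sub, energyOne,
    LinearMap.add_apply, Module.End.one_apply, add_sub_cancel_right]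

/-- The Bogoliubov generator as a relatively bounded operator. -/
def bogRel (e : ℝ) {L : ℝ} (hL : 0 < L) : RelBounded fockScale where
  Z := pairSum (bogCoef e L)
  W := Complex.I • pairSum fun a => 2 * ((zeta e L a : ℝ) : ℂ)
  symm x y := inner_pairSum_D hL x y
  comm x y := by
    have h := inner_bog_comm (e := e) hL (isNice_wtOp energyWt) (fun v _ => energyL_energyOne v)
      (fun v hv => hasSum_bog_energy hL hv) x y
    simp only [sub_apply, one_apply_eq_self, inner_sub_left, inner_sub_right] at h
    rw [inner_pairSum_D hL x y] at h
    rw [smul_apply, inner_smul_right]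
    linear_combination -h

/-! ### The Coulomb energy as a relatively bounded operator -/

lemma summable_of_const_smul {ι G : Type*} [NormedAddCommGroup G] [NormedSpace ℂ G] {c : ℂ}
    (hc : c ≠ 0) {f : ι → G} (h : Summable fun i => c • f i) : Summable f := by
  simpa only [smul_smul, inv_mul_cancel₀ hc, one_smul] using h.const_smul c⁻¹

lemma ofBasis_tsum {ι : Type*} {g : ι → ℂ} {A : ι → Module.End ℂ Fin𝓕} (c : ℂ)
    (h : ∀ v ∈ 𝓕₀, Summable fun i => g i • toℋ₀ (A i v)) {v : Fin𝓕} (hv : v ∈ 𝓕₀) :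
    ofBasis (fun s => c • ∑' i, g i • toℋ₀ (A i (Ω s))) v = c • ∑' i, g i • toℋ₀ (A i v) := by
  have hs : ∀ s ∈ v.support, Ω s ∈ 𝓕₀ := fun s hs =>
    Ω_mem_𝓕₀.2 ((Finsupp.mem_supported ℂ v).1 hv hs)
  have e1 : ∀ i, g i • toℋ₀ (A i v) = ∑ s ∈ v.support, v s • (g i • toℋ₀ (A i (Ω s))) := fun i => by
    conv_lhs => rw [sum_Ω v]
    rw [map_sum, map_sum, Finset.smul_sum]
    refine Finset.sum_congr rfl fun s _ => ?_
    rw [map_smul, map_smul, smul_comm]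
  simp only [e1]
  rw [Summable.tsum_finsetSum fun s hs' => (h _ (hs s hs')).const_smul (v s)]
  conv_lhs => rw [sum_Ω v]
  rw [map_sum, Finset.smul_sum]
  refine Finset.sum_congr rfl fun s hs' => ?_
  rw [map_smul, ofBasis_Ω, Summable.tsum_const_smul _ (h _ (hs s hs')), smul_comm]

/-- Normal ordering puts the annihilators on the right for either sign of `a`, so the two diagonal
terms always form `numOp |a|`. -/
lemma currentSq_apply {L : ℝ} {a : ℤ} (ha : a ≠ 0) (v : Fin𝓕) :
    currentSq L a v = ((1 / L ^ 2 : ℝ) : ℂ) • (numOp |a| v + mixOp a v) := by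
  have hc : dens false (-a) * dens true (-a) = pairOp (-a) := by
    refine LinearMap.ext fun w => ?_
    simpa [pairOp] using dens_dens_apply_comm false true (neg_ne_zero.2 ha) (neg_ne_zero.2 ha) w
  rw [currentSq, rhoR_eq ha, rhoR_eq (neg_ne_zero.2 ha), rhoL_eq ha, rhoL_eq (neg_ne_zero.2 ha),
    neg_neg, hc, ← pairOp, LinearMap.smul_apply]
  congr 1
  rcases lt_or_gt_of_ne ha with h | h
  · rw [abs_of_neg h, if_neg (by omega), if_neg (by omega), numOp, mixOp, neg_neg]
    simp only [LinearMap.add_apply]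
    abel
  · rw [abs_of_pos h, if_pos h, if_pos h, numOp, mixOp]
    simp only [LinearMap.add_apply]
    abel

/-- The Coulomb energy of the modes `±a`, as a bounded operator. -/
def coulTerm (e L : ℝ) (a : NZ) : ℋ₀ →L[ℂ] ℋ₀ :=
  ((cpl e L a / 2 : ℝ) : ℂ) • (numL |(a : ℤ)| + mixL a)

/-- The number operators are uniformly bounded relative to the energy, so their series converges
absolutely. The mixed terms use the square-summable estimate for the pair operators. -/
lemma summable_coulTerm {e L : ℝ} (hL : 0 < L) : Summable (coulTerm e L) := by
  have h1 : Summable fun a : NZ => ((cpl e L a / 2 : ℝ) : ℂ) • numL |(a : ℤ)| := by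
    refine Summable.of_norm_bounded
      (summable_inv_sq_NZ.mul_left (e ^ 2 * L / (4 * Real.pi ^ 2))) fun a => ?_
    rw [norm_smul, Complex.norm_real, Real.norm_of_nonneg (by linarith [cpl_nonneg e hL a])]
    have h2 := norm_numL_le (abs_pos.2 a.2)
    have h3 := cpl_nonneg e hL a
    calc _ ≤ cpl e L a / 2 * 2 := by gcongr
      _ = _ := by rw [cpl_eq hL a.2]; ring
  have h2 := (sqSummable_cpl (e := e) hL).summable
  have h3 : Summable fun a : NZ => ((cpl e L a / 2 : ℝ) : ℂ) • mixL a := by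
    have h4 := (h2.add ((nzNeg.summable_iff).2 h2)).const_smul ((1 / 2 : ℝ) : ℂ)
    refine h4.congr fun a => ?_
    simp only [Function.comp, coe_nzNeg, cpl_neg]
    rw [← smul_add, smul_smul, mixL]
    congr 1
    push_cast
    ring
  refine (h1.add h3).congr fun a => ?_
  rw [coulTerm, smul_add]

/-- The Coulomb energy as a bounded operator, relative to the energy. -/
def coulL (e L : ℝ) : ℋ₀ →L[ℂ] ℋ₀ := ∑' a, coulTerm e L a

lemma hasSum_coulL {e L : ℝ} (hL : 0 < L) :
    HasSum (fun m : PN => ((cpl e L m : ℝ) : ℂ) • (numL m + mixL m)) (coulL e L) := by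
  refine (hasSum_PN (summable_coulTerm hL).hasSum).congr_fun fun m => ?_
  have h1 : mixL (-(m : ℤ)) = mixL m := by rw [mixL, mixL, neg_neg, add_comm]
  simp only [coulTerm, PN.toNZ, PN.negNZ, abs_neg, abs_of_pos m.2, cpl_neg, h1]
  rw [← add_smul]
  congr 1
  push_cast
  ring

lemma coulL_energyOne {e L : ℝ} (hL : 0 < L) {v : Fin𝓕} (hv : v ∈ 𝓕₀) :
    coulL e L (toℋ₀ (energyOne v)) = coulomb e L v := by
  have key : ∀ w ∈ 𝓕₀, ∀ a : NZ, coulTerm e L a (toℋ₀ (energyOne w)) =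
      ((e ^ 2 * L / 2 : ℝ) : ℂ) • (((1 / mom L a ^ 2 : ℝ) : ℂ) • toℋ₀ (currentSq L a w)) := by
    intro w hw a
    rw [currentSq_apply a.2, coulTerm, smul_apply, add_apply, numL_energyOne (abs_pos.2 a.2) hw,
      mixL_energyOne a.2 hw, ← map_add, map_smul, smul_smul, smul_smul, ← Complex.ofReal_mul,
      ← Complex.ofReal_mul]
    have h1 := mom_ne_zero hL a.2
    congr 2
    rw [cpl]
    field_simp
  have hs : ∀ w ∈ 𝓕₀, HasSum (fun a => coulTerm e L a (toℋ₀ (energyOne w)))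
      (coulL e L (toℋ₀ (energyOne w))) := fun w hw =>
    ((summable_coulTerm (e := e) hL).hasSum).mapL (ContinuousLinearMap.apply ℂ ℋ₀ (toℋ₀ (energyOne w)))
  -- For `e ≠ 0` summability of the undressed series is recovered by dividing by the prefactor; for
  -- `e = 0` the prefactor makes both sides zero.
  by_cases he : e = 0
  · subst he
    have h1 : coulomb 0 L v = 0 := by
      rw [coulomb, sum_Ω v, map_sum]
      refine Finset.sum_eq_zero fun s _ => ?_
      rw [map_smul, ofBasis_Ω]
      simp
    rw [h1, ← (hs v hv).tsum_eq]
    simp [coulTerm, cpl]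
  · have hne : ((e ^ 2 * L / 2 : ℝ) : ℂ) ≠ 0 := by
      rw [Complex.ofReal_ne_zero]
      positivity
    have hsum : ∀ w ∈ 𝓕₀, Summable fun a : NZ =>
        ((1 / mom L a ^ 2 : ℝ) : ℂ) • toℋ₀ (currentSq L a w) := fun w hw => by
      have h2 := (hs w hw).summable
      simp only [key w hw] at h2
      exact summable_of_const_smul hne h2
    rw [coulomb, ofBasis_tsum (A := fun a : NZ => currentSq L a) _ hsum hv, ← (hs v hv).tsum_eq]
    simp only [key v hv]
    exact (hsum v hv).tsum_const_smul _

lemma bogoliubovSum_eq {e L : ℝ} (hL : 0 < L) {v : Fin𝓕} (hv : v ∈ 𝓕₀) :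
    bogoliubovSum e L v = pairSum (bogCoef e L) (toℋ₀ (energyOne v)) := by
  set c : ℂ := ((2 * Real.pi / L : ℝ) : ℂ) * Complex.I with hc
  have hpi := Real.pi_pos
  have hne : c ≠ 0 := mul_ne_zero (Complex.ofReal_ne_zero.2 (by positivity)) Complex.I_ne_zero
  have key : ∀ w ∈ 𝓕₀, ∀ a : NZ, bogCoef e L a • pairL a (toℋ₀ (energyOne w)) =
      c • (((zeta e L a / mom L a : ℝ) : ℂ) • toℋ₀ ((rhoR a * rhoL (-a)) w)) := by
    intro w hw a
    have h1 := nz_cast_ne a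
    have h2 : (Real.pi : ℂ) ≠ 0 := Complex.ofReal_ne_zero.2 hpi.ne'
    have h3 : (L : ℂ) ≠ 0 := Complex.ofReal_ne_zero.2 hL.ne'
    rw [rhoR_eq a.2, rhoL_eq (neg_ne_zero.2 a.2), neg_neg, ← pairOp, pairL_energyOne a.2 hw,
      smul_smul]
    congr 1
    rw [hc, bogCoef, mom]
    push_cast
    field_simp
  have hs := fun w : Fin𝓕 => (sqSummable_bogCoef (e := e) hL).hasSum_apply (toℋ₀ (energyOne w))
  have hsum : ∀ w ∈ 𝓕₀, Summable fun a : NZ =>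
      ((zeta e L a / mom L a : ℝ) : ℂ) • toℋ₀ ((rhoR a * rhoL (-a)) w) := fun w hw => by
    have h2 := (hs w).summable
    simp only [key w hw] at h2
    exact summable_of_const_smul hne h2
  rw [bogoliubovSum, ofBasis_tsum (A := fun a : NZ => rhoR a * rhoL (-a)) _ hsum hv,
    ← (hs v).tsum_eq]
  simp only [key v hv]
  exact ((hsum v hv).tsum_const_smul _).symm

/-! ### Diagonalization of the Hamiltonian -/

lemma EnergyScale.D_injective {H : Type*} [NormedAddCommGroup H] [InnerProductSpace ℂ H]
    (S : EnergyScale H) : Function.Injective S.D := by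
  intro x y h
  refine tendsto_nhds_unique (S.tendsto_P x) ?_
  refine (S.tendsto_P y).congr fun n => ?_
  rw [← S.B_D, ← S.B_D, h]

lemma RelBounded.evol_zero {H : Type*} [NormedAddCommGroup H] [InnerProductSpace ℂ H]
    [CompleteSpace H] {S : EnergyScale H} (A : RelBounded S) (x : H) : A.evol 0 x = x :=
  S.D_injective (by rw [A.D_evol, A.group_zero])

/-- The frequencies of the diagonalized Hamiltonian. -/
def freq (e L : ℝ) (m : ℤ) : ℝ := (2 * Real.pi / L + cpl e L m) / Real.cosh (2 * zeta e L m)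

lemma freq_mul_cosh (e L : ℝ) (m : ℤ) :
    freq e L m * Real.cosh (2 * zeta e L m) = 2 * Real.pi / L + cpl e L m :=
  div_mul_cancel₀ _ (Real.cosh_pos _).ne'

/-- This is where the choice of `ζ` enters: the pair `(2π/L + cpl, -cpl)` is `freq` times `(cosh 2ζ,
sinh 2ζ)`. -/
lemma freq_mul_sinh {e L : ℝ} (hL : 0 < L) {m : ℤ} (hm : m ≠ 0) :
    freq e L m * Real.sinh (2 * zeta e L m) = -cpl e L m := by
  have h1 := tanh_two_zeta (e := e) hL hm
  have h2 := (Real.cosh_pos (2 * zeta e L m)).ne'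
  have h3 : 0 < 2 * Real.pi / L + cpl e L m := by
    have := cpl_nonneg e hL m
    have := Real.pi_pos
    positivity
  have h4 : Real.sinh (2 * zeta e L m) =
      -(cpl e L m / (2 * Real.pi / L + cpl e L m)) * Real.cosh (2 * zeta e L m) := by
    rw [← h1, Real.tanh_eq_sinh_div_cosh, div_mul_cancel₀ _ h2]
  rw [h4, freq]
  generalize 2 * Real.pi / L + cpl e L m = k at h3 ⊢
  have := h3.ne'
  field_simp

/-! ### Heisenberg equations and the transformed energy -/

section Heisenberg

variable (e : ℝ) {L : ℝ} (hL : 0 < L) (x y : ℋ₀)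

/-- Matrix elements of a relatively bounded operator in the evolved states. -/
def heis (T : ℋ₀ →L[ℂ] ℋ₀) (s : ℝ) : ℂ :=
  ⟪(bogRel e hL).group s (fockScale.D x), T ((bogRel e hL).evol s y)⟫_ℂ

lemma heis_zero (T : ℋ₀ →L[ℂ] ℋ₀) : heis e hL x y T 0 = ⟪fockScale.D x, T y⟫_ℂ := by
  rw [heis, RelBounded.group_zero, RelBounded.evol_zero]

lemma heis_D (s : ℝ) : heis e hL x y fockScale.D s = ⟪fockScale.D x, fockScale.D y⟫_ℂ := by
  rw [heis, RelBounded.D_evol, LinearIsometryEquiv.inner_map_map]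

lemma heis_add (S T : ℋ₀ →L[ℂ] ℋ₀) (s : ℝ) :
    heis e hL x y (S + T) s = heis e hL x y S s + heis e hL x y T s := by
  rw [heis, add_apply, inner_add_right]
  rfl

lemma heis_smul (c : ℂ) (T : ℋ₀ →L[ℂ] ℋ₀) (s : ℝ) :
    heis e hL x y (c • T) s = c * heis e hL x y T s := by
  rw [heis, smul_apply, inner_smul_right]
  rfl

lemma norm_heis_le (T : ℋ₀ →L[ℂ] ℋ₀) {s : ℝ} (hs : |s| ≤ 1) :
    ‖heis e hL x y T s‖ ≤ ‖T‖ * (‖fockScale.D x‖ * (Real.exp ‖(bogRel e hL).W‖ * ‖y‖)) := by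
  refine (norm_inner_le_norm _ _).trans ?_
  rw [LinearIsometryEquiv.norm_map]
  calc _ ≤ ‖fockScale.D x‖ * (‖T‖ * (Real.exp ‖(bogRel e hL).W‖ * ‖y‖)) := by
        gcongr
        refine (T.le_opNorm _).trans ?_
        gcongr
        refine ((bogRel e hL).norm_evol_le s y).trans ?_
        gcongr
        exact mul_le_of_le_one_right (norm_nonneg _) hs
    _ = _ := by ring

lemma hasDerivAt_heis_num (m : PN) (s : ℝ) :
    HasDerivAt (heis e hL x y (numL m))
      (-(2 * ((zeta e L m : ℝ) : ℂ) * heis e hL x y (mixL m) s)) s := by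
  have hm : ((m : ℤ)) ≠ 0 := m.2.ne'
  have h := (bogRel e hL).hasDerivAt_inner_group
    (inner_D_of_isNice (isNice_numOp hm) (fun v hv => numL_energyOne m.2 hv)
      (fun v hv => numL_energyOne m.2 hv))
    (inner_bog_comm hL (isNice_numOp hm) (fun v hv => numL_energyOne m.2 hv)
      (fun v hv => hasSum_bog_num e L m hv)) x y s
  refine h.congr_deriv ?_
  rw [smul_apply, inner_smul_right]
  rfl

lemma hasDerivAt_heis_mix (m : PN) (s : ℝ) :
    HasDerivAt (heis e hL x y (mixL m)) (-(2 * ((zeta e L m : ℝ) : ℂ) *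
      (heis e hL x y (numL m) s + ((m : ℤ) : ℂ) * ⟪fockScale.D x, fockScale.D y⟫_ℂ))) s := by
  have hm : ((m : ℤ)) ≠ 0 := m.2.ne'
  have h := (bogRel e hL).hasDerivAt_inner_group
    (inner_D_of_isNice (isNice_mixOp hm) (fun v hv => mixL_energyOne hm hv)
      (fun v hv => mixL_energyOne hm hv))
    (inner_bog_comm hL (isNice_mixOp hm) (fun v hv => mixL_energyOne hm hv)
      (fun v hv => hasSum_bog_mix e L m hv)) x y s
  refine h.congr_deriv ?_
  rw [← heis_D e hL x y s, ← heis_smul, ← heis_add, ← heis_smul]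
  rfl

lemma hasDerivAt_heis_energy (s : ℝ) :
    HasDerivAt (heis e hL x y (1 - fockScale.D))
      (-heis e hL x y (pairSum fun a => 2 * ((zeta e L a : ℝ) : ℂ)) s) s :=
  (bogRel e hL).hasDerivAt_inner_group
    (inner_D_of_isNice (isNice_wtOp energyWt) (fun v _ => energyL_energyOne v)
      (fun v _ => energyL_energyOne v))
    (inner_bog_comm hL (isNice_wtOp energyWt) (fun v _ => energyL_energyOne v)
      (fun v hv => hasSum_bog_energy hL hv)) x y s

/-- `numL m` shifted by its zero point energy. -/
def heisNum (m : PN) (s : ℝ) : ℂ :=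
  heis e hL x y (numL m) s + ((m : ℤ) : ℂ) * ⟪fockScale.D x, fockScale.D y⟫_ℂ

lemma hasDerivAt_heisNum (m : PN) (s : ℝ) :
    HasDerivAt (heisNum e hL x y m)
      (-(2 * ((zeta e L m : ℝ) : ℂ) * heis e hL x y (mixL m) s)) s :=
  (hasDerivAt_heis_num e hL x y m s).add_const _

/-- With `z = 2ζ(m)`, the shifted number term `X` and the mixed term `Y` satisfy `X' = -zY` and `Y'
= -zX`. So `cosh (z s) X + sinh (z s) Y` is constant, and it is compared at `s = -1` and `s = 0`. -/
lemma heisNum_conserved (m : PN) :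
    ((Real.cosh (2 * zeta e L m) : ℝ) : ℂ) * heisNum e hL x y m (-1) -
      ((Real.sinh (2 * zeta e L m) : ℝ) : ℂ) * heis e hL x y (mixL m) (-1) =
      heisNum e hL x y m 0 := by
  set z := 2 * zeta e L m with hz
  have hzc : (2 * ((zeta e L m : ℝ) : ℂ)) = (z : ℂ) := by
    rw [hz]
    push_cast
    rfl
  have hlin : ∀ s : ℝ, HasDerivAt (fun s : ℝ => z * s) z s := fun s => by
    simpa using (hasDerivAt_id s).const_mul z
  have hd : ∀ s : ℝ, HasDerivAt (fun s : ℝ => ((Real.cosh (z * s) : ℝ) : ℂ) * heisNum e hL x y m s +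
      ((Real.sinh (z * s) : ℝ) : ℂ) * heis e hL x y (mixL m) s) 0 s := by
    intro s
    have h1 := ((hlin s).cosh.ofReal_comp).mul (hasDerivAt_heisNum e hL x y m s)
    have h2 := ((hlin s).sinh.ofReal_comp).mul (hasDerivAt_heis_mix e hL x y m s)
    refine (h1.add h2).congr_deriv ?_
    rw [hzc, ← heisNum]
    push_cast
    ring
  have := is_const_of_deriv_eq_zero (fun s => (hd s).differentiableAt) (fun s => (hd s).deriv) (-1) 0
  simpa [sub_eq_add_neg] using this

lemma hasSum_mixL {e L : ℝ} (hL : 0 < L) :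
    HasSum (fun m : PN => (2 * ((zeta e L m : ℝ) : ℂ)) • mixL m)
      (pairSum fun a => 2 * ((zeta e L a : ℝ) : ℂ)) := by
  refine (hasSum_PN (sqSummable_zeta (e := e) hL).hasSum).congr_fun fun m => ?_
  simp only [PN.toNZ, PN.negNZ, zeta_neg]
  rw [← smul_add, mixL]

/-- The derivatives of the energy and of `∑ heisNum` agree term by term. The series of derivatives
converges in operator norm, hence uniformly on the time interval, so the changes of the number terms
add up to the change of the energy. -/
lemma hasSum_heis_energy :
    HasSum (fun m : PN => heisNum e hL x y m (-1) - heisNum e hL x y m 0)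
      (heis e hL x y (1 - fockScale.D) (-1) - heis e hL x y (1 - fockScale.D) 0) := by
  set C := ‖fockScale.D x‖ * (Real.exp ‖(bogRel e hL).W‖ * ‖y‖)
  set M := pairSum fun a => 2 * ((zeta e L a : ℝ) : ℂ) with hM
  have hlim : Tendsto (fun T : Finset PN => ‖∑ m ∈ T, (2 * ((zeta e L m : ℝ) : ℂ)) • mixL m - M‖ * C)
      atTop (𝓝 0) := by
    have := (tendsto_iff_norm_sub_tendsto_zero.1 (hasSum_mixL (e := e) hL)).mul_const C
    simpa using this
  rw [HasSum, SummationFilter.unconditional_filter, tendsto_iff_norm_sub_tendsto_zero]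
  refine squeeze_zero (fun _ => norm_nonneg _) (fun T => ?_) hlim
  have hd : ∀ s : ℝ, HasDerivAt (fun s => heis e hL x y (1 - fockScale.D) s -
      ∑ m ∈ T, heisNum e hL x y m s)
      (heis e hL x y (∑ m ∈ T, (2 * ((zeta e L m : ℝ) : ℂ)) • mixL m - M) s) s := by
    intro s
    refine ((hasDerivAt_heis_energy e hL x y s).sub
      (HasDerivAt.fun_sum fun m _ => hasDerivAt_heisNum e hL x y m s)).congr_deriv ?_
    have e1 : heis e hL x y (∑ m ∈ T, (2 * ((zeta e L m : ℝ) : ℂ)) • mixL m - M) s =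
        ∑ m ∈ T, (2 * ((zeta e L m : ℝ) : ℂ)) * heis e hL x y (mixL m) s - heis e hL x y M s := by
      rw [heis, sub_apply, sum_apply, inner_sub_right, inner_sum]
      simp only [smul_apply, inner_smul_right]
      rfl
    rw [e1, Finset.sum_neg_distrib]
    ring
  have h1 := (convex_Icc (-1 : ℝ) 0).norm_image_sub_le_of_norm_hasDerivWithin_le (x := 0) (y := -1)
    (C := ‖∑ m ∈ T, (2 * ((zeta e L m : ℝ) : ℂ)) • mixL m - M‖ * C)
    (fun s _ => (hd s).hasDerivWithinAt) (fun s hs => norm_heis_le e hL x y _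
      (abs_le.2 ⟨hs.1, by linarith [hs.2]⟩)) (by simp) (by simp)
  simp only [sub_zero, norm_neg, norm_one, mul_one] at h1
  refine le_trans (le_of_eq ?_) h1
  rw [← norm_neg]
  congr 1
  rw [Finset.sum_sub_distrib]
  ring

/-- In each mode `2π/L` times the number term plus the Coulomb term equals `freq` times the
conserved combination, in which no `mixL` remains at time zero. Undoing the shifts by `m` leaves the
zero point contribution. -/
lemma hasSum_heis_total :
    HasSum (fun m : PN => ((freq e L m - 2 * Real.pi / L : ℝ) : ℂ) * ⟪fockScale.D x, numL m y⟫_ℂ +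
      (((m : ℤ) * (freq e L m - 2 * Real.pi / L - cpl e L m) : ℝ) : ℂ) *
        ⟪fockScale.D x, fockScale.D y⟫_ℂ)
      (heis e hL x y (((2 * Real.pi / L : ℝ) : ℂ) • (1 - fockScale.D) + coulL e L) (-1) -
        ((2 * Real.pi / L : ℝ) : ℂ) * ⟪fockScale.D x, (1 - fockScale.D) y⟫_ℂ) := by
  have h1 := (hasSum_heis_energy e hL x y).mul_left ((2 * Real.pi / L : ℝ) : ℂ)
  have h2 : HasSum (fun m : PN => ((cpl e L m : ℝ) : ℂ) * (heis e hL x y (numL m) (-1) +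
      heis e hL x y (mixL m) (-1))) (heis e hL x y (coulL e L) (-1)) := by
    have := ((hasSum_coulL (e := e) hL).mapL (ContinuousLinearMap.apply ℂ ℋ₀
      ((bogRel e hL).evol (-1) y))).mapL (innerSL ℂ ((bogRel e hL).group (-1) (fockScale.D x)))
    refine this.congr_fun fun m => ?_
    rw [← heis_add, ← heis_smul]
    rfl
  have h3 := h1.add h2
  rw [heis_zero, mul_sub, sub_add_eq_add_sub, ← heis_smul, ← heis_add] at h3
  refine h3.congr_fun fun m => ?_
  have hc := heisNum_conserved e hL x y m
  have e1 : heis e hL x y (numL m) (-1) =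
      heisNum e hL x y m (-1) - ((m : ℤ) : ℂ) * ⟪fockScale.D x, fockScale.D y⟫_ℂ := by
    rw [heisNum]
    ring
  have e2 : ⟪fockScale.D x, numL m y⟫_ℂ =
      heisNum e hL x y m 0 - ((m : ℤ) : ℂ) * ⟪fockScale.D x, fockScale.D y⟫_ℂ := by
    rw [heisNum, heis_zero]
    ring
  have f1 : ((freq e L m : ℝ) : ℂ) * ((Real.cosh (2 * zeta e L m) : ℝ) : ℂ) =
      ((2 * Real.pi / L : ℝ) : ℂ) + ((cpl e L m : ℝ) : ℂ) := by
    exact_mod_cast congrArg (fun r : ℝ => (r : ℂ)) (freq_mul_cosh e L m)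
  have f2 : ((freq e L m : ℝ) : ℂ) * ((Real.sinh (2 * zeta e L m) : ℝ) : ℂ) =
      -((cpl e L m : ℝ) : ℂ) := by
    exact_mod_cast congrArg (fun r : ℝ => (r : ℂ)) (freq_mul_sinh (e := e) hL m.2.ne')
  rw [e1, e2]
  have i1 : (((m : ℤ) * (freq e L m - 2 * Real.pi / L - cpl e L m) : ℝ) : ℂ) =
      ((m : ℤ) : ℂ) * (((freq e L m : ℝ) : ℂ) - ((2 * Real.pi / L : ℝ) : ℂ) - ((cpl e L m : ℝ) : ℂ)) := by
    simp only [Complex.ofReal_mul, Complex.ofReal_sub, Complex.ofReal_intCast]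
  have i2 : ((freq e L m - 2 * Real.pi / L : ℝ) : ℂ) =
      ((freq e L m : ℝ) : ℂ) - ((2 * Real.pi / L : ℝ) : ℂ) := Complex.ofReal_sub _ _
  rw [i1, i2]
  linear_combination (-((freq e L m : ℝ) : ℂ)) * hc + heisNum e hL x y m (-1) * f1 -
    heis e hL x y (mixL m) (-1) * f2

end Heisenberg

/-! ### The zero point energy and the diagonalized Hamiltonian -/

lemma numOp_eq_zero {N : ℕ} {v : Fin𝓕} (hv : IsHom N v) {m : ℤ} (hm : (N : ℤ) < m) :
    numOp m v = 0 := by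
  have h : ∀ σ, dens σ (-m) v = 0 := fun σ =>
    (hv.dens σ (m := -m) (by omega)).eq_zero_of_neg (by omega)
  simp [numOp, h]

/-- The positive integers up to `N`. -/
def pnUpTo (N : ℕ) : Finset PN := (Finset.Icc 1 (N : ℤ)).subtype _

lemma hasSum_numOp {N : ℕ} {v : Fin𝓕} (hv : IsHom N v) (g : PN → ℂ) (x : ℋ₀) :
    HasSum (fun m : PN => g m * ⟪x, numL m (toℋ₀ (energyOne v))⟫_ℂ)
      ⟪x, toℋ₀ (∑ m ∈ pnUpTo N, g m • numOp m v)⟫_ℂ := by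
  rw [map_sum, inner_sum]
  simp only [map_smul, inner_smul_right]
  have h := hasSum_sum_of_ne_finset_zero (L := .unconditional PN) (s := pnUpTo N)
    (f := fun m : PN => g m * ⟪x, toℋ₀ (numOp m v)⟫_ℂ) (fun m hm => by
      have hlt : (N : ℤ) < m := by
        by_contra hle
        exact hm (Finset.mem_subtype.2 (Finset.mem_Icc.2 ⟨m.2, not_lt.1 hle⟩))
      rw [numOp_eq_zero hv hlt, map_zero, inner_zero_right, mul_zero])
  refine h.congr_fun fun m => ?_
  rw [numL_energyOne m.2 hv.mem]

lemma isHom_vacuum : IsHom (0 : ℕ) (Ω (∅, ∅)) := by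
  refine ⟨Ω_mem_𝓕₀.2 rfl, ?_⟩
  rw [wtOp_Ω]
  simp [wt]

/-- The zero point energy. -/
def zeroPoint (e L : ℝ) : ℝ := ∑' m : PN, (m : ℤ) * (freq e L m - 2 * Real.pi / L - cpl e L m)

/-- No asymptotics of the frequencies are needed: the convergent total is evaluated in the vacuum,
where the number operators vanish, and only this series is left. -/
lemma hasSum_zeroPoint (e : ℝ) {L : ℝ} (hL : 0 < L) :
    HasSum (fun m : PN => (m : ℤ) * (freq e L m - 2 * Real.pi / L - cpl e L m)) (zeroPoint e L) := by
  refine Summable.hasSum ?_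
  have h := hasSum_heis_total e hL (toℋ₀ (energyOne (Ω (∅, ∅)))) (toℋ₀ (energyOne (Ω (∅, ∅))))
  have h1 := hasSum_numOp isHom_vacuum (fun m : PN => ((freq e L m - 2 * Real.pi / L : ℝ) : ℂ))
    (fockScale.D (toℋ₀ (energyOne (Ω (∅, ∅)))))
  have h2 := (h.sub h1).summable
  simp only [add_sub_cancel_left, fockScale_D_energyOne] at h2
  have h3 : ⟪toℋ₀ (Ω (∅, ∅)), toℋ₀ (Ω (∅, ∅))⟫_ℂ = 1 := by
    rw [inner_toℋ₀ (Ω_mem_𝓕₀.2 rfl), ip_Ω_Ω, if_pos rfl]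
  simp only [h3, mul_one] at h2
  exact Complex.summable_ofReal.1 h2

/-- The diagonalized Hamiltonian on states of energy `N`. -/
def freeHam (e L : ℝ) (N : ℕ) : Module.End ℂ Fin𝓕 :=
  ∑ m ∈ pnUpTo N, ((freq e L m - 2 * Real.pi / L : ℝ) : ℂ) • numOp m +
    ((2 * Real.pi / L * N + zeroPoint e L : ℝ) : ℂ) • 1

/-- The Bogoliubov transformation diagonalizes the Hamiltonian. -/
lemma dressed_eq (e : ℝ) {L : ℝ} (hL : 0 < L) {N : ℕ} {v : Fin𝓕} (hv : IsHom N v) :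
    (((2 * Real.pi / L : ℝ) : ℂ) • (1 - fockScale.D) + coulL e L)
      ((bogRel e hL).evol (-1) (toℋ₀ (energyOne v))) =
      (bogRel e hL).group (-1) (toℋ₀ (freeHam e L N v)) := by
  set A := bogRel e hL
  set T := ((2 * Real.pi / L : ℝ) : ℂ) • (1 - fockScale.D) + coulL e L
  set y := toℋ₀ (energyOne v) with hy
  have key : ∀ x, ⟪A.group (-1) (fockScale.D x), T (A.evol (-1) y)⟫_ℂ =
      ⟪A.group (-1) (fockScale.D x), A.group (-1) (toℋ₀ (freeHam e L N v))⟫_ℂ := by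
    intro x
    have h := hasSum_heis_total e hL x y
    have h1 := hasSum_numOp hv (fun m : PN => ((freq e L m - 2 * Real.pi / L : ℝ) : ℂ))
      (fockScale.D x)
    have h2 := ((Complex.hasSum_ofReal.2 (hasSum_zeroPoint e hL)).mul_right
      ⟪fockScale.D x, fockScale.D y⟫_ℂ)
    have h3 := h.unique (h1.add h2)
    rw [sub_eq_iff_eq_add] at h3
    rw [LinearIsometryEquiv.inner_map_map]
    refine h3.trans ?_
    rw [hy, energyL_energyOne, fockScale_D_energyOne, hv.energy, freeHam]
    simp only [LinearMap.add_apply, LinearMap.sum_apply, LinearMap.smul_apply, map_add, map_smul,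
      inner_add_right, inner_smul_right, Module.End.one_apply]
    push_cast
    ring
  have hdense : DenseRange fun x => A.group (-1) (fockScale.D x) :=
    (A.group (-1)).surjective.denseRange.comp fockScale.denseRange_D (A.group (-1)).continuous
  have c1 : Continuous fun z => ⟪z, T (A.evol (-1) y)⟫_ℂ := by fun_prop
  have c2 : Continuous fun z => ⟪z, A.group (-1) (toℋ₀ (freeHam e L N v))⟫_ℂ := by fun_prop
  have h2 : ∀ z, ⟪z, T (A.evol (-1) y)⟫_ℂ = ⟪z, A.group (-1) (toℋ₀ (freeHam e L N v))⟫_ℂ :=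
    fun z => congrFun (hdense.equalizer c1 c2 (funext key)) z
  exact ext_inner_left ℂ h2

/-! ### Unbounded operators -/

section Operators

variable {E : Type*} [NormedAddCommGroup E] [InnerProductSpace ℂ E]

lemma mem_graph_operatorOnRange {X F : Type*} [AddCommGroup X] [Module ℂ X] [AddCommGroup F]
    [Module ℂ F] {j A : X →ₗ[ℂ] F} (h : ∀ x, j x = 0 → A x = 0) {x y : F} :
    (x, y) ∈ (operatorOnRange j A h).graph ↔ ∃ v, j v = x ∧ A v = y := by
  have key : ∀ v, operatorOnRange j A h ⟨j v, v, rfl⟩ = A v := fun v => by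
    change ((LinearMap.ker j).liftQ A h) (j.quotKerEquivRange.symm ⟨j v, v, rfl⟩) = A v
    have : j.quotKerEquivRange.symm ⟨j v, v, rfl⟩ = (LinearMap.ker j).mkQ v := by
      rw [LinearEquiv.symm_apply_eq]
      rfl
    rw [this]
    exact (LinearMap.ker j).liftQ_apply A v
  rw [LinearPMap.mem_graph_iff]
  constructor
  · rintro ⟨⟨z, v, rfl⟩, h1, h2⟩
    exact ⟨v, h1, (key v).symm.trans h2⟩
  · rintro ⟨v, rfl, rfl⟩
    exact ⟨⟨j v, v, rfl⟩, rfl, key v⟩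

lemma isFormalAdjoint_iff {A : E →ₗ.[ℂ] E} : A.IsFormalAdjoint A ↔
    ∀ x y x' y', (x, y) ∈ A.graph → (x', y') ∈ A.graph → ⟪y, x'⟫_ℂ = ⟪x, y'⟫_ℂ := by
  constructor
  · intro h x y x' y' h1 h2
    obtain ⟨u, rfl, rfl⟩ := (LinearPMap.mem_graph_iff A).1 h1
    obtain ⟨v, rfl, rfl⟩ := (LinearPMap.mem_graph_iff A).1 h2
    exact h u v
  · intro h u v
    exact h _ _ _ _ (A.mem_graph u) (A.mem_graph v)

lemma isFormalAdjoint_of_le {A B : E →ₗ.[ℂ] E} (hB : B.IsFormalAdjoint B) (h : A ≤ B) :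
    A.IsFormalAdjoint A :=
  isFormalAdjoint_iff.2 fun _ _ _ _ h1 h2 => isFormalAdjoint_iff.1 hB _ _ _ _
    (LinearPMap.le_graph_of_le h h1) (LinearPMap.le_graph_of_le h h2)

lemma mem_graph_closure {A : E →ₗ.[ℂ] E} (hA : A.IsClosable) {p : E × E} :
    p ∈ A.closure.graph ↔ p ∈ closure (A.graph : Set (E × E)) := by
  rw [← hA.graph_closure_eq_closure_graph]
  rfl

lemma norm_le_norm_add_I_smul {x y : E} (h : ⟪y, x⟫_ℂ = ⟪x, y⟫_ℂ) :
    ‖x‖ ≤ ‖y + Complex.I • x‖ := by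
  have him : (⟪x, y⟫_ℂ).im = 0 := by
    have h1 := inner_conj_symm (𝕜 := ℂ) x y
    rw [h] at h1
    exact Complex.conj_eq_iff_im.1 h1
  have h2 : ‖y + Complex.I • x‖ ^ 2 = ‖y‖ ^ 2 + ‖x‖ ^ 2 := by
    rw [@norm_add_sq ℂ, inner_smul_right, h, norm_smul, Complex.norm_I, one_mul]
    simp [him]
  exact le_of_sq_le_sq (by rw [h2]; nlinarith [sq_nonneg ‖y‖]) (norm_nonneg _)

lemma mem_graph_conjugate {W : E ≃ₗᵢ[ℂ] E} {A : E →ₗ.[ℂ] E} {x y : E} :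
    (x, y) ∈ (conjugate W A).graph ↔ (W.symm x, W.symm y) ∈ A.graph := by
  rw [LinearPMap.mem_graph_iff, LinearPMap.mem_graph_iff]
  constructor
  · rintro ⟨⟨z, hz⟩, rfl, h⟩
    refine ⟨⟨W.symm z, hz⟩, rfl, ?_⟩
    rw [LinearIsometryEquiv.eq_symm_apply]
    exact h
  · rintro ⟨⟨z, hz⟩, h1, h2⟩
    have h1' : z = W.symm x := h1
    subst h1'
    refine ⟨⟨x, hz⟩, rfl, ?_⟩
    rw [LinearIsometryEquiv.eq_symm_apply] at h2
    exact h2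

lemma mem_graph_domRestrict {A : E →ₗ.[ℂ] E} {S : Submodule ℂ E} {x y : E} :
    (x, y) ∈ (A.domRestrict S).graph ↔ x ∈ S ∧ (x, y) ∈ A.graph := by
  constructor
  · intro h
    exact ⟨(LinearPMap.mem_domain_of_mem_graph h).1,
      LinearPMap.le_graph_of_le LinearPMap.domRestrict_le h⟩
  · rintro ⟨h1, h2⟩
    obtain ⟨z, rfl, rfl⟩ := (LinearPMap.mem_graph_iff A).1 h2
    exact (LinearPMap.mem_graph_iff _).2 ⟨⟨z, h1, z.2⟩, rfl, LinearPMap.domRestrict_apply rfl⟩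

lemma isFormalAdjoint_conjugate {W : E ≃ₗᵢ[ℂ] E} {A : E →ₗ.[ℂ] E} (hA : A.IsFormalAdjoint A) :
    (conjugate W A).IsFormalAdjoint (conjugate W A) := by
  rw [isFormalAdjoint_iff] at hA ⊢
  intro x y x' y' h1 h2
  have := hA _ _ _ _ (mem_graph_conjugate.1 h1) (mem_graph_conjugate.1 h2)
  rwa [LinearIsometryEquiv.inner_map_map, LinearIsometryEquiv.inner_map_map] at this

variable [CompleteSpace E]

lemma isClosable_of_symm {A : E →ₗ.[ℂ] E} (hd : Dense (A.domain : Set E))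
    (hs : A.IsFormalAdjoint A) : A.IsClosable :=
  (LinearPMap.adjoint_isClosed hd).isClosable.leIsClosable (hs.le_adjoint hd)

lemma isFormalAdjoint_closure {A : E →ₗ.[ℂ] E} (hd : Dense (A.domain : Set E))
    (hs : A.IsFormalAdjoint A) : A.closure.IsFormalAdjoint A.closure := by
  have hA := isClosable_of_symm hd hs
  rw [isFormalAdjoint_iff] at hs ⊢
  have c : ∀ q ∈ (A.graph : Set (E × E)), ∀ p ∈ closure (A.graph : Set (E × E)),
      ⟪p.2, q.1⟫_ℂ = ⟪p.1, q.2⟫_ℂ := fun q hq =>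
    closure_minimal (fun p hp => hs _ _ _ _ hp hq) (isClosed_eq (by fun_prop) (by fun_prop))
  intro x y x' y' h1 h2
  rw [mem_graph_closure hA] at h1 h2
  have : closure (A.graph : Set (E × E)) ⊆ {q | ⟪y, q.1⟫_ℂ = ⟪x, q.2⟫_ℂ} :=
    closure_minimal (fun q hq => c q hq _ h1) (isClosed_eq (by fun_prop) (by fun_prop))
  exact this h2

/-- A densely defined symmetric operator whose deficiency spaces vanish is essentially
self-adjoint. -/
lemma isEssentiallySelfAdjoint_of_deficiency {A : E →ₗ.[ℂ] E} (hd : Dense (A.domain : Set E))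
    (hs : A.IsFormalAdjoint A)
    (hdef : ∀ c : ℂ, c = Complex.I ∨ c = -Complex.I → ∀ η : E,
      (∀ x y, (x, y) ∈ A.graph → ⟪η, y + c • x⟫_ℂ = 0) → η = 0) :
    IsEssentiallySelfAdjoint A := by
  refine ⟨hd, hs, ?_⟩
  have hA := isClosable_of_symm hd hs
  have hd' : Dense (A.closure.domain : Set E) := hd.mono A.le_closure.1
  have hs' := isFormalAdjoint_closure hd hs
  have hrange : ∀ z : E, ∃ x y, (x, y) ∈ A.closure.graph ∧ y + Complex.I • x = z := by
    intro z
    let R : Submodule ℂ E := A.graph.map (LinearMap.snd ℂ E E + Complex.I • LinearMap.fst ℂ E E)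
    -- Density of the range comes from the deficiency hypothesis for `i`. Surjectivity for the
    -- closure then follows because a symmetric operator satisfies `‖x‖ ≤ ‖y + i x‖`, which turns
    -- convergence of images into convergence of graph points.
    have hR : R.topologicalClosure = ⊤ := by
      rw [Submodule.topologicalClosure_eq_top_iff, Submodule.eq_bot_iff]
      intro η hη
      refine hdef _ (Or.inl rfl) η fun x y h => ?_
      have h0 : ⟪y + Complex.I • x, η⟫_ℂ = 0 :=
        (Submodule.mem_orthogonal _ _).1 hη _ ⟨(x, y), h, rfl⟩
      rw [← inner_conj_symm, h0, map_zero]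
    have hz : z ∈ closure (R : Set E) := by
      have : z ∈ R.topologicalClosure := by rw [hR]; trivial
      exact this
    obtain ⟨u, hu, hlim⟩ := mem_closure_iff_seq_limit.1 hz
    choose p hp hpu using hu
    have hpu' : ∀ n, (p n).2 + Complex.I • (p n).1 = u n := hpu
    have hcau : CauchySeq fun n => (p n).1 := by
      have hc := hlim.cauchySeq
      rw [Metric.cauchySeq_iff] at hc ⊢
      intro ε hε
      obtain ⟨N, hN⟩ := hc ε hε
      refine ⟨N, fun m hm n hn => lt_of_le_of_lt ?_ (hN m hm n hn)⟩
      have hsub := A.graph.sub_mem (hp m) (hp n)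
      have := norm_le_norm_add_I_smul (isFormalAdjoint_iff.1 hs _ _ _ _ hsub hsub)
      rw [dist_eq_norm, dist_eq_norm, ← hpu', ← hpu']
      refine this.trans (le_of_eq ?_)
      congr 1
      rw [smul_sub]
      abel
    obtain ⟨x, hx⟩ := cauchySeq_tendsto_of_complete hcau
    have hy : Tendsto (fun n => (p n).2) atTop (𝓝 (z - Complex.I • x)) := by
      refine (hlim.sub (hx.const_smul Complex.I)).congr fun n => ?_
      rw [← hpu', add_sub_cancel_right]
    refine ⟨x, z - Complex.I • x, ?_, by abel⟩
    rw [mem_graph_closure hA]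
    exact mem_closure_of_tendsto (hx.prodMk_nhds hy) (Eventually.of_forall hp)
  rw [LinearPMap.isSelfAdjoint_def]
  refine le_antisymm (LinearPMap.le_of_le_graph ?_) (hs'.le_adjoint hd')
  rintro ⟨x, y⟩ hxy
  have hxy' := hxy
  rw [LinearPMap.adjoint_graph_eq_graph_adjoint hd', Submodule.mem_adjoint_iff] at hxy'
  obtain ⟨a, b, hab, h⟩ := hrange (y + Complex.I • x)
  -- `x - a` is mapped by the adjoint to `-i (x - a)`; it is therefore a deficiency vector for `-i`.
  have hz : x - a = 0 := by
    refine hdef _ (Or.inr rfl) _ fun c d hcd => ?_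
    have hcd' : (c, d) ∈ A.closure.graph := LinearPMap.le_graph_of_le A.le_closure hcd
    have h1 := sub_eq_zero.1 (hxy' c d hcd')
    have h2 := isFormalAdjoint_iff.1 hs' _ _ _ _ hcd' hab
    simp only at h1
    have h3 : y - b = -(Complex.I • (x - a)) := by
      rw [smul_sub, neg_sub, sub_eq_sub_iff_add_eq_add, ← h]
      abel
    rw [← inner_conj_symm, inner_add_left, inner_sub_right, h1, h2, ← inner_sub_right, h3,
      inner_smul_left, inner_neg_right, inner_smul_right]
    simp
  have hx : x = a := sub_eq_zero.1 hz
  have hy : y = b := by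
    rw [hx] at h
    exact (add_right_cancel h).symm
  rw [hx, hy]
  exact hab

end Operators

/-! ### The unitary group of the Bogoliubov transformation -/

lemma IsUnitaryGroupGeneratedBy.isUnitaryGroup {A : ℋ₀ →ₗ.[ℂ] ℋ₀} {V : ℝ → ℋ₀ ≃ₗᵢ[ℂ] ℋ₀}
    (h : IsUnitaryGroupGeneratedBy A V) : IsUnitaryGroup V :=
  ⟨fun x => by rw [h.map_zero]; rfl, fun s t x => by rw [h.map_add]; rfl, h.continuous⟩

lemma mem_graph_bogoliubovZ {e L : ℝ} {x y : ℋ₀} : (x, y) ∈ (bogoliubovZ e L).graph ↔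
    ∃ v ∈ 𝓕₀, toℋ₀ v = x ∧ bogoliubovSum e L v = y := by
  rw [bogoliubovZ, mem_graph_operatorOnRange]
  constructor
  · rintro ⟨v, h1, h2⟩
    exact ⟨v, v.2, h1, h2⟩
  · rintro ⟨v, hv, h1, h2⟩
    exact ⟨⟨v, hv⟩, h1, h2⟩

lemma closure_graph_bogoliubovZ (e : ℝ) {L : ℝ} (hL : 0 < L) :
    closure ((bogoliubovZ e L).graph : Set (ℋ₀ × ℋ₀)) =
      closure (Set.range fun ξ => (fockScale.D ξ, (bogRel e hL).Z ξ)) := by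
  have key : ∀ v ∈ 𝓕₀, (fockScale.D (toℋ₀ (energyOne v)), (bogRel e hL).Z (toℋ₀ (energyOne v))) =
      (toℋ₀ v, bogoliubovSum e L v) := fun v hv => by
    rw [fockScale_D_energyOne, bogoliubovSum_eq hL hv]
    rfl
  have hc : Continuous fun ξ => (fockScale.D ξ, (bogRel e hL).Z ξ) := by fun_prop
  refine Set.Subset.antisymm (closure_mono ?_) (closure_minimal ?_ isClosed_closure)
  · rintro ⟨x, y⟩ h
    obtain ⟨v, hv, rfl, rfl⟩ := mem_graph_bogoliubovZ.1 h
    exact ⟨_, key v hv⟩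
  · rintro _ ⟨ξ, rfl⟩
    refine map_mem_closure (f := fun ξ => (fockScale.D ξ, (bogRel e hL).Z ξ)) hc
      (denseRange_energyOne ξ) ?_
    rintro _ ⟨v, rfl⟩
    exact mem_graph_bogoliubovZ.2 ⟨v, v.2, (Prod.ext_iff.1 (key v v.2)).1.symm,
      (Prod.ext_iff.1 (key v v.2)).2.symm⟩

lemma dense_domain_bogoliubovZ (e L : ℝ) : Dense ((bogoliubovZ e L).domain : Set ℋ₀) := by
  refine denseRange_toℋ₀.mono ?_
  rintro _ ⟨v, rfl⟩
  exact LinearPMap.mem_domain_of_mem_graph (mem_graph_bogoliubovZ.2 ⟨v, v.2, rfl, rfl⟩)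

lemma isClosable_bogoliubovZ (e : ℝ) {L : ℝ} (hL : 0 < L) : (bogoliubovZ e L).IsClosable := by
  refine isClosable_of_symm (dense_domain_bogoliubovZ e L) (isFormalAdjoint_iff.2 ?_)
  have hg : ∀ x y, (x, y) ∈ (bogoliubovZ e L).graph → Gen (bogRel e hL).group x y := fun x y h => by
    rw [RelBounded.gen_iff, ← closure_graph_bogoliubovZ e hL]
    exact subset_closure h
  intro x y x' y' h1 h2
  exact ((hg _ _ h1).symm (bogRel e hL).isUnitaryGroup (hg _ _ h2)).symm

lemma mem_graph_bogoliubovZ_closure (e : ℝ) {L : ℝ} (hL : 0 < L) {x y : ℋ₀} :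
    (x, y) ∈ (bogoliubovZ e L).closure.graph ↔ Gen (bogRel e hL).group x y := by
  rw [mem_graph_closure (isClosable_bogoliubovZ e hL), RelBounded.gen_iff,
    closure_graph_bogoliubovZ e hL]

lemma isUnitaryGroupGeneratedBy_group (e : ℝ) {L : ℝ} (hL : 0 < L) :
    IsUnitaryGroupGeneratedBy (bogoliubovZ e L).closure (bogRel e hL).group where
  map_zero := LinearIsometryEquiv.ext fun x => (bogRel e hL).group_zero x
  map_add s t := LinearIsometryEquiv.ext fun x => (bogRel e hL).group_add s t x
  continuous x := (bogRel e hL).continuous_group x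
  generator _ _ := mem_graph_bogoliubovZ_closure e hL

/-- Both groups have the same generator, so orbits through the core agree by `eq_of_gen`, and the
core is dense. -/
lemma eq_group {e L : ℝ} (hL : 0 < L) {V : ℝ → ℋ₀ ≃ₗᵢ[ℂ] ℋ₀}
    (hV : IsUnitaryGroupGeneratedBy (bogoliubovZ e L).closure V) : V = (bogRel e hL).group := by
  have hV' := hV.isUnitaryGroup
  funext t
  refine LinearIsometryEquiv.ext fun x => ?_
  have h : ∀ ξ, V t (fockScale.D ξ) = (bogRel e hL).group t (fockScale.D ξ) := by
    intro ξ
    set Z := (bogRel e hL).Z ξ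
    have hg : Gen V (fockScale.D ξ) Z := by
      refine (hV.generator _ _).1 ((mem_graph_bogoliubovZ_closure e hL).2 ?_)
      exact (RelBounded.gen_iff _).2 (subset_closure ⟨ξ, rfl⟩)
    have := eq_of_gen (bogRel e hL).isUnitaryGroup (u := fun t => V t (fockScale.D ξ))
      (z := fun t => V t Z) (fun t => hg.hasDerivAt hV' t) (fun t =>
        (mem_graph_bogoliubovZ_closure e hL).1 ((hV.generator _ _).2 (hg.map hV' t))) t
    rwa [hV'.map_zero] at this
  exact congrFun (fockScale.denseRange_D.equalizer (V t).continuous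
    ((bogRel e hL).group t).continuous (funext h)) x

/-! ### The harmonic oscillator -/

/-- The operator `-α ∂² + β (x + δ)² - γ`. -/
def osc (α β γ δ : ℝ) (g : ℝ → ℂ) (x : ℝ) : ℂ :=
  -(α : ℂ) * deriv (deriv g) x + ((β * (x + δ) ^ 2 - γ : ℝ) : ℂ) * g x

lemma exp_mul_gaussian_le {b : ℝ} (hb : 0 < b) (s y : ℝ) :
    Real.exp (s * |y|) * Real.exp (-b * y ^ 2) ≤
      Real.exp (s ^ 2 / (2 * b)) * Real.exp (-(b / 2) * y ^ 2) := by
  rw [← Real.exp_add, ← Real.exp_add, Real.exp_le_exp]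
  have h : 0 ≤ (s / b - |y|) ^ 2 * (b / 2) := by positivity
  have h2 : (s / b - |y|) ^ 2 * (b / 2) = s ^ 2 / (2 * b) - s * |y| + b / 2 * y ^ 2 := by
    rw [← sq_abs y]
    field_simp
    ring
  linarith

lemma pow_mul_gaussian_le {b : ℝ} (hb : 0 < b) (n : ℕ) (y : ℝ) :
    |y| ^ n * Real.exp (-b * y ^ 2) ≤
      (n.factorial * Real.exp (1 / (2 * b))) * Real.exp (-(b / 2) * y ^ 2) := by
  have h1 : |y| ^ n ≤ n.factorial * Real.exp (1 * |y|) := by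
    have := Real.pow_div_factorial_le_exp |y| (abs_nonneg y) n
    rw [div_le_iff₀ (by positivity)] at this
    rw [one_mul]
    linarith
  have h2 := exp_mul_gaussian_le hb 1 y
  rw [one_pow] at h2
  calc |y| ^ n * Real.exp (-b * y ^ 2)
      ≤ (n.factorial * Real.exp (1 * |y|)) * Real.exp (-b * y ^ 2) := by gcongr
    _ = n.factorial * (Real.exp (1 * |y|) * Real.exp (-b * y ^ 2)) := by ring
    _ ≤ n.factorial * (Real.exp (1 / (2 * b)) * Real.exp (-(b / 2) * y ^ 2)) := by gcongr
    _ = _ := by ring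

lemma memLp_gaussian {b : ℝ} (hb : 0 < b) (δ : ℝ) :
    MemLp (fun x : ℝ => Real.exp (-b * (x + δ) ^ 2)) 2 := by
  rw [memLp_two_iff_integrable_sq (by fun_prop)]
  have h := (integrable_exp_neg_mul_sq (show (0 : ℝ) < 2 * b by positivity)).comp_add_right δ
  refine h.congr (Eventually.of_forall fun x => ?_)
  simp only
  rw [← Real.exp_nat_mul]
  congr 1
  push_cast
  ring

lemma memLp_of_le_gaussian {b : ℝ} (hb : 0 < b) (δ : ℝ) {f : ℝ → ℂ} (hf : Continuous f) {C : ℝ}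
    (h : ∀ x, ‖f x‖ ≤ C * Real.exp (-b * (x + δ) ^ 2)) : MemLp f 2 :=
  ((memLp_gaussian hb δ).const_mul C).mono' hf.aestronglyMeasurable (Eventually.of_forall h)

/-- A power times a Gaussian. -/
def herm (b δ : ℝ) (n : ℕ) (x : ℝ) : ℂ := (((x + δ) ^ n * Real.exp (-b * (x + δ) ^ 2) : ℝ) : ℂ)

lemma contDiff_herm (b δ : ℝ) (n : ℕ) : ContDiff ℝ ∞ (herm b δ n) := by
  have h : ContDiff ℝ ∞ fun x : ℝ => (x + δ) ^ n * Real.exp (-b * (x + δ) ^ 2) := by fun_prop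
  exact Complex.ofRealCLM.contDiff.comp h

lemma memLp_herm {b : ℝ} (hb : 0 < b) (δ : ℝ) (n : ℕ) : MemLp (herm b δ n) 2 := by
  refine memLp_of_le_gaussian (half_pos hb) δ (contDiff_herm b δ n).continuous
    (C := n.factorial * Real.exp (1 / (2 * b))) fun x => ?_
  rw [herm, Complex.norm_real, Real.norm_eq_abs, abs_mul, abs_pow, Real.abs_exp]
  exact pow_mul_gaussian_le hb n (x + δ)

lemma deriv_herm (b δ : ℝ) (n : ℕ) : deriv (herm b δ n) =
    fun x => n * herm b δ (n - 1) x - 2 * b * herm b δ (n + 1) x := by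
  funext x
  have h0 : HasDerivAt (fun x : ℝ => x + δ) 1 x := (hasDerivAt_id x).add_const δ
  have h1 := ((h0.pow n).mul (((h0.pow 2).const_mul (-b)).exp)).ofReal_comp
  refine h1.deriv.trans ?_
  simp only [herm, Pi.pow_apply]
  push_cast
  ring

/-! ### From compactly supported to rapidly decreasing test functions -/

section Cutoff

variable {α β γ δ : ℝ} {μ : ℂ} {φ : ℝ → ℂ}

lemma contDiff_deriv' {f : ℝ → ℂ} (hf : ContDiff ℝ ∞ f) : ContDiff ℝ ∞ (deriv f) :=
  (contDiff_infty_iff_deriv.1 hf).2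

lemma deriv_deriv_mul {c f : ℝ → ℂ} (hc : ContDiff ℝ ∞ c) (hf : ContDiff ℝ ∞ f) (x : ℝ) :
    deriv (deriv fun x => c x * f x) x =
      deriv (deriv c) x * f x + 2 * (deriv c x * deriv f x) + c x * deriv (deriv f) x := by
  have d : ∀ {u : ℝ → ℂ}, ContDiff ℝ ∞ u → ∀ x, HasDerivAt u (deriv u x) x := fun hu x =>
    (hu.differentiable (by simp) x).hasDerivAt
  have h1 : (deriv fun x => c x * f x) = fun x => deriv c x * f x + c x * deriv f x :=
    funext fun x => ((d hc x).mul (d hf x)).deriv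
  rw [h1]
  refine (((d (contDiff_deriv' hc) x).mul (d hf x)).add
    ((d hc x).mul (d (contDiff_deriv' hf) x))).deriv.trans ?_
  ring

/-- Multiply `f` by dilated bump functions and pass to the limit by dominated convergence. The
integrability assumed of `f` and its derivatives is what dominates each term of the product rule. -/
lemma integral_mul_osc_eq_zero (hφ : MemLp φ 2)
    (horth : ∀ g : ℝ → ℂ, ContDiff ℝ ∞ g → HasCompactSupport g →
      ∫ x, φ x * (osc α β γ δ g x - μ * g x) = 0)
    {f : ℝ → ℂ} (hf : ContDiff ℝ ∞ f) (h0 : MemLp f 2) (h1 : MemLp (deriv f) 2)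
    (h2 : MemLp (deriv (deriv f)) 2) (h3 : MemLp (fun x => (((x + δ) ^ 2 : ℝ) : ℂ) * f x) 2) :
    ∫ x, φ x * (osc α β γ δ f x - μ * f x) = 0 := by
  let χ : ContDiffBump (0 : ℝ) := ⟨1, 2, one_pos, one_lt_two⟩
  let χc : ℝ → ℂ := fun x => ((χ x : ℝ) : ℂ)
  have hχc : ContDiff ℝ ∞ χc := Complex.ofRealCLM.contDiff.comp χ.contDiff
  have hχs : HasCompactSupport χc := χ.hasCompactSupport.comp_left (g := fun r : ℝ => (r : ℂ)) (by simp)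
  obtain ⟨M0, hM0⟩ := hχs.exists_bound_of_continuous hχc.continuous
  obtain ⟨M1, hM1⟩ := hχs.deriv.exists_bound_of_continuous (contDiff_deriv' hχc).continuous
  obtain ⟨M2, hM2⟩ := hχs.deriv.deriv.exists_bound_of_continuous
    (contDiff_deriv' (contDiff_deriv' hχc)).continuous
  set M := max M0 (max M1 M2)
  have hM : 0 ≤ M := (norm_nonneg _).trans ((hM0 0).trans (le_max_left _ _))
  -- The dilation factors stay at most one, so the cutoffs and their first two derivatives share one
  -- bound.
  let s : ℕ → ℝ := fun k => ((k : ℝ) + 1)⁻¹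
  have hs0 : ∀ k, 0 < s k := fun k => by positivity
  have hs1 : ∀ k, s k ≤ 1 := fun k => inv_le_one_of_one_le₀ (by linarith [k.cast_nonneg (α := ℝ)])
  let c : ℕ → ℝ → ℂ := fun k x => χc (s k * x)
  have hc : ∀ k, ContDiff ℝ ∞ (c k) := fun k => hχc.comp (contDiff_const.mul contDiff_id)
  have hcs : ∀ k, HasCompactSupport (c k) := fun k => by
    have := hχs.comp_homeomorph (Homeomorph.mulLeft₀ (s k) (hs0 k).ne')
    exact this
  have d1 : ∀ k, deriv (c k) = fun x => (s k : ℂ) * deriv χc (s k * x) := fun k => funext fun x => by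
    have := deriv_comp_mul_left (s k) χc x
    simpa using this
  have d2 : ∀ k x, deriv (deriv (c k)) x = (s k : ℂ) * ((s k : ℂ) * deriv (deriv χc) (s k * x)) :=
    fun k x => by
      rw [d1, deriv_const_mul_field]
      have := deriv_comp_mul_left (s k) (deriv χc) x
      rw [this]
      simp
  have hsn : ∀ k, ‖(s k : ℂ)‖ ≤ 1 := fun k => by
    rw [Complex.norm_real, Real.norm_of_nonneg (hs0 k).le]
    exact hs1 k
  have b0 : ∀ k x, ‖c k x‖ ≤ M := fun k x => (hM0 _).trans (le_max_left _ _)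
  have b1 : ∀ k x, ‖deriv (c k) x‖ ≤ M := fun k x => by
    rw [d1, norm_mul]
    refine (mul_le_of_le_one_left (norm_nonneg _) (hsn k)).trans ((hM1 _).trans ?_)
    exact (le_max_left _ _).trans (le_max_right _ _)
  have b2 : ∀ k x, ‖deriv (deriv (c k)) x‖ ≤ M := fun k x => by
    rw [d2, norm_mul, norm_mul]
    refine (mul_le_of_le_one_left (by positivity) (hsn k)).trans
      ((mul_le_of_le_one_left (norm_nonneg _) (hsn k)).trans ((hM2 _).trans ?_))
    exact (le_max_right _ _).trans (le_max_right _ _)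
  let B : ℝ → ℝ := fun x => M * (|α| * (‖f x‖ + 2 * ‖deriv f x‖ + ‖deriv (deriv f) x‖) +
    (|β| * ‖(((x + δ) ^ 2 : ℝ) : ℂ) * f x‖ + |γ| * ‖f x‖) + ‖μ‖ * ‖f x‖)
  have hB : MemLp B 2 := by
    refine MemLp.const_mul ?_ M
    refine (((h0.norm.add (h1.norm.const_mul 2)).add h2.norm).const_mul |α|).add
      ((h3.norm.const_mul |β|).add (h0.norm.const_mul |γ|)) |>.add (h0.norm.const_mul ‖μ‖)
  have hlim : Tendsto (fun k : ℕ => ∫ x, φ x * (osc α β γ δ (fun x => c k x * f x) x -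
      μ * (c k x * f x))) atTop (𝓝 (∫ x, φ x * (osc α β γ δ f x - μ * f x))) := by
    refine tendsto_integral_of_dominated_convergence (fun x => ‖φ x‖ * B x) (fun k => ?_) ?_
      (fun k => ?_) ?_
    · refine hφ.1.mul (Continuous.aestronglyMeasurable ?_)
      have hk := (hc k).mul hf
      have e1 := (contDiff_deriv' (contDiff_deriv' hk)).continuous
      have e2 := hk.continuous
      unfold osc
      fun_prop
    · exact hφ.norm.integrable_mul hB
    · refine Eventually.of_forall fun x => ?_
      rw [norm_mul]
      gcongr
      rw [osc, deriv_deriv_mul (hc k) hf]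
      have t1 : ‖-(α : ℂ) * (deriv (deriv (c k)) x * f x + 2 * (deriv (c k) x * deriv f x) +
          c k x * deriv (deriv f) x)‖ ≤
          M * (|α| * (‖f x‖ + 2 * ‖deriv f x‖ + ‖deriv (deriv f) x‖)) := by
        rw [norm_mul, norm_neg, Complex.norm_real, Real.norm_eq_abs, mul_left_comm M]
        gcongr
        refine le_trans norm_add₃_le ?_
        rw [norm_mul, norm_mul, norm_mul, norm_mul]
        have := b0 k x
        have := b1 k x
        have := b2 k x
        calc _ ≤ M * ‖f x‖ + ‖(2 : ℂ)‖ * (M * ‖deriv f x‖) + M * ‖deriv (deriv f) x‖ := by gcongr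
          _ = _ := by
            rw [Complex.norm_ofNat]
            ring
      have t2 : ‖((β * (x + δ) ^ 2 - γ : ℝ) : ℂ) * (c k x * f x)‖ ≤
          M * (|β| * ‖(((x + δ) ^ 2 : ℝ) : ℂ) * f x‖ + |γ| * ‖f x‖) := by
        have e : ((β * (x + δ) ^ 2 - γ : ℝ) : ℂ) * (c k x * f x) = c k x *
            ((β : ℂ) * ((((x + δ) ^ 2 : ℝ) : ℂ) * f x) - (γ : ℂ) * f x) := by
          push_cast
          ring
        rw [e, norm_mul]
        refine mul_le_mul (b0 k x) ?_ (norm_nonneg _) hM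
        refine (norm_sub_le _ _).trans (le_of_eq ?_)
        rw [norm_mul, norm_mul (γ : ℂ), Complex.norm_real, Complex.norm_real, Real.norm_eq_abs,
          Real.norm_eq_abs]
      have t3 : ‖μ * (c k x * f x)‖ ≤ M * (‖μ‖ * ‖f x‖) := by
        rw [norm_mul, norm_mul, mul_left_comm]
        have := b0 k x
        gcongr
      refine (norm_sub_le _ _).trans ((add_le_add (norm_add_le _ _) le_rfl).trans ?_)
      refine (add_le_add (add_le_add t1 t2) t3).trans (le_of_eq ?_)
      simp only [B]
      ring
    · refine Eventually.of_forall fun x => ?_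
      refine tendsto_const_nhds.congr' ?_
      have hsx : Tendsto (fun k => s k * (|x| + 1)) atTop (𝓝 0) := by
        have := (tendsto_one_div_add_atTop_nhds_zero_nat (𝕜 := ℝ)).mul_const (|x| + 1)
        simpa [s] using this
      filter_upwards [hsx.eventually (gt_mem_nhds one_pos)] with k hk
      have hev : (fun x => c k x * f x) =ᶠ[𝓝 x] f := by
        filter_upwards [Metric.ball_mem_nhds x one_pos] with y hy
        have hy' : |y| ≤ |x| + 1 := by
          have h1 : |y - x| < 1 := by simpa [Real.dist_eq] using hy
          have h2 := abs_sub_abs_le_abs_sub y x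
          linarith
        have : χ (s k * y) = 1 := by
          refine χ.one_of_mem_closedBall ?_
          rw [mem_closedBall_zero_iff, norm_mul, Real.norm_of_nonneg (hs0 k).le]
          exact (mul_le_mul_of_nonneg_left hy' (hs0 k).le).trans hk.le
        simp [c, χc, this]
      have e1 := hev.deriv.deriv_eq
      have e0 : c k x * f x = f x := hev.eq_of_nhds
      simp only [osc, e1, e0]
  refine tendsto_nhds_unique hlim ?_
  have : (fun k : ℕ => ∫ x, φ x * (osc α β γ δ (fun x => c k x * f x) x - μ * (c k x * f x))) =
      fun _ => 0 := funext fun k => horth _ ((hc k).mul hf) ((hcs k).mul_right)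
  rw [this]
  exact tendsto_const_nhds

end Cutoff

/-! ### Completeness of the oscillator functions -/

section Completeness

variable {α β γ δ : ℝ} {μ : ℂ} {φ : ℝ → ℂ}

/-- The width is tuned by `4 * α * b ^ 2 = β` so that the term in `herm b δ (n + 2)` cancels,
leaving a triangular action. The factor `n * (n - 1)` makes the truncated subtraction `n - 2`
harmless for `n < 2`. -/
lemma osc_herm {b : ℝ} (hβ : 4 * α * b ^ 2 = β) (n : ℕ) (x : ℝ) :
    osc α β γ δ (herm b δ n) x = ((2 * α * b * (2 * n + 1) - γ : ℝ) : ℂ) * herm b δ n x -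
      ((α * (n * (n - 1)) : ℝ) : ℂ) * herm b δ (n - 2) x := by
  have d : ∀ k x, DifferentiableAt ℝ (herm b δ k) x := fun k x =>
    (contDiff_herm b δ k).differentiable (by simp) x
  have h2 : deriv (deriv (herm b δ n)) x =
      n * deriv (herm b δ (n - 1)) x - 2 * b * deriv (herm b δ (n + 1)) x := by
    conv_lhs => rw [deriv_herm]
    exact (((d _ x).hasDerivAt.const_mul (n : ℂ)).sub
      ((d _ x).hasDerivAt.const_mul (2 * b : ℂ))).deriv
  rw [osc, h2, deriv_herm, deriv_herm, ← hβ]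
  rcases n with _ | _ | n
  · simp [herm]
    ring
  · simp [herm]
    ring
  · simp only [herm, Nat.add_sub_cancel, add_assoc, Nat.reduceAdd]
    simp only [show n + (1 + 1) - 1 = n + 1 by omega,
      show n + 3 - 1 = n + 2 by omega, show n + 1 - 1 = n by omega]
    push_cast
    ring

/-- The action on powers times a Gaussian is triangular with real diagonal entries. As `μ` is not
real, orthogonality propagates upwards by induction. -/
lemma integral_mul_herm_eq_zero {b : ℝ} (hb : 0 < b) (hβ : 4 * α * b ^ 2 = β)
    (hμ : μ.im ≠ 0) (hφ : MemLp φ 2)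
    (horth : ∀ g : ℝ → ℂ, ContDiff ℝ ∞ g → HasCompactSupport g →
      ∫ x, φ x * (osc α β γ δ g x - μ * g x) = 0) (n : ℕ) :
    ∫ x, φ x * herm b δ n x = 0 := by
  induction n using Nat.strong_induction_on with
  | _ n ih =>
    have m := memLp_herm hb δ
    have hd : ∀ k, MemLp (deriv (herm b δ k)) 2 := fun k => by
      rw [deriv_herm]
      exact ((m _).const_mul _).sub ((m _).const_mul _)
    have hdd : MemLp (deriv (deriv (herm b δ n))) 2 := by
      have e : deriv (deriv (herm b δ n)) = fun x =>
          n * deriv (herm b δ (n - 1)) x - 2 * b * deriv (herm b δ (n + 1)) x := by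
        conv_lhs => rw [deriv_herm]
        funext x
        have d : ∀ k x, DifferentiableAt ℝ (herm b δ k) x := fun k x =>
          (contDiff_herm b δ k).differentiable (by simp) x
        exact (((d _ x).hasDerivAt.const_mul (n : ℂ)).sub
          ((d _ x).hasDerivAt.const_mul (2 * b : ℂ))).deriv
      rw [e]
      exact ((hd _).const_mul _).sub ((hd _).const_mul _)
    have h3 : MemLp (fun x => (((x + δ) ^ 2 : ℝ) : ℂ) * herm b δ n x) 2 := by
      refine (memLp_congr_ae (Eventually.of_forall fun x => ?_)).1 (m (n + 2))
      simp only [herm]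
      push_cast
      ring
    have h := integral_mul_osc_eq_zero hφ horth (contDiff_herm b δ n) (m n) (hd n) hdd h3
    have hi : ∀ k, Integrable fun x => φ x * herm b δ k x := fun k => hφ.integrable_mul (m k)
    have e : (fun x => φ x * (osc α β γ δ (herm b δ n) x - μ * herm b δ n x)) = fun x =>
        (((2 * α * b * (2 * n + 1) - γ : ℝ) : ℂ) - μ) * (φ x * herm b δ n x) -
          ((α * (n * (n - 1)) : ℝ) : ℂ) * (φ x * herm b δ (n - 2) x) := by
      funext x
      rw [osc_herm hβ]
      ring
    rw [e, integral_sub ((hi n).const_mul _) ((hi _).const_mul _), integral_const_mul,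
      integral_const_mul] at h
    have hzero : ((α * (n * (n - 1)) : ℝ) : ℂ) * ∫ x, φ x * herm b δ (n - 2) x = 0 := by
      rcases n with _ | _ | n
      · simp
      · simp
      · rw [ih _ (by omega), mul_zero]
    rw [hzero, sub_zero] at h
    refine (mul_eq_zero.1 h).resolve_left fun h0 => hμ ?_
    rw [← sub_eq_zero.1 h0, Complex.ofReal_im]

/-- Expand the exponential into powers and integrate term by term; the series is dominated by `exp
(|t| |x + δ|)` times a Gaussian. -/
lemma integral_mul_cexp_eq_zero {b : ℝ} (hb : 0 < b) (hφ : MemLp φ 2)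
    (h : ∀ n, ∫ x, φ x * herm b δ n x = 0) (t : ℝ) :
    ∫ x, φ x * (Complex.exp ((t * (x + δ) : ℝ) * Complex.I) * herm b δ 0 x) = 0 := by
  have hs := hasSum_integral_of_dominated_convergence (μ := volume)
    (F := fun (n : ℕ) x => (((t : ℂ) * Complex.I) ^ n / n.factorial) * (φ x * herm b δ n x))
    (f := fun x => φ x * (Complex.exp ((t * (x + δ) : ℝ) * Complex.I) * herm b δ 0 x))
    (fun n x => ‖φ x‖ * ((|t| * |x + δ|) ^ n / n.factorial * Real.exp (-b * (x + δ) ^ 2)))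
    (fun n => ((hφ.1.mul (memLp_herm hb δ n).1).const_mul _)) (fun n => ?_) ?_ ?_ ?_
  · have h0 : (fun n : ℕ => ∫ x, (((t : ℂ) * Complex.I) ^ n / n.factorial) * (φ x * herm b δ n x)) =
        fun _ => 0 := funext fun n => by rw [integral_const_mul, h n, mul_zero]
    rw [h0] at hs
    exact hs.unique hasSum_zero
  · refine Eventually.of_forall fun x => le_of_eq ?_
    simp only [herm, norm_mul, norm_div, norm_pow, Complex.norm_real, Complex.norm_I,
      Real.norm_eq_abs, Real.abs_exp, mul_one, Complex.norm_natCast]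
    rw [mul_pow]
    ring
  · refine Eventually.of_forall fun x => ?_
    exact ((Real.summable_pow_div_factorial _).mul_right _).mul_left _
  · have e : (fun x => ∑' n : ℕ, ‖φ x‖ * ((|t| * |x + δ|) ^ n / n.factorial *
        Real.exp (-b * (x + δ) ^ 2))) =
        fun x => ‖φ x‖ * (Real.exp (|t| * |x + δ|) * Real.exp (-b * (x + δ) ^ 2)) := by
      funext x
      rw [tsum_mul_left, tsum_mul_right]
      congr 2
      rw [Real.exp_eq_exp_ℝ]
      exact (NormedSpace.expSeries_div_hasSum_exp (|t| * |x + δ|)).tsum_eq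
    rw [e]
    have hm : MemLp (fun x => Real.exp (|t| * |x + δ|) * Real.exp (-b * (x + δ) ^ 2)) 2 := by
      refine ((memLp_gaussian (half_pos hb) δ).const_mul (Real.exp (|t| ^ 2 / (2 * b)))).mono'
        (by fun_prop) (Eventually.of_forall fun x => ?_)
      rw [Real.norm_of_nonneg (by positivity)]
      exact exp_mul_gaussian_le hb |t| (x + δ)
    exact hφ.norm.integrable_mul hm
  · refine Eventually.of_forall fun x => ?_
    have h1 := (NormedSpace.expSeries_div_hasSum_exp (((t * (x + δ) : ℝ) : ℂ) * Complex.I))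
    rw [← Complex.exp_eq_exp_ℂ] at h1
    have h2 := (h1.mul_right (herm b δ 0 x)).mul_left (φ x)
    refine h2.congr_fun fun n => ?_
    simp only [herm]
    push_cast
    rw [pow_zero, one_mul, mul_pow, mul_pow, mul_pow]
    ring

open FourierTransform SchwartzMap in
/-- An integrable function with vanishing Fourier transform vanishes almost everywhere. -/
lemma ae_eq_zero_of_fourier_eq_zero {ψ : ℝ → ℂ} (hψ : Integrable ψ) (h : ∀ w, 𝓕 ψ w = 0) :
    ∀ᵐ x, ψ x = 0 := by
  refine ae_eq_zero_of_integral_contDiff_smul_eq_zero hψ.locallyIntegrable fun g hg hgs => ?_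
  have hgc : ContDiff ℝ ∞ fun x => ((g x : ℝ) : ℂ) := Complex.ofRealCLM.contDiff.comp hg
  have hgcs : HasCompactSupport fun x => ((g x : ℝ) : ℂ) :=
    hgs.comp_left (g := fun r : ℝ => (r : ℂ)) (by simp)
  let G : 𝓢(ℝ, ℂ) := hgcs.toSchwartzMap hgc
  -- The test function is written as a Fourier transform, so that the transform can be moved onto
  -- `ψ`, where it vanishes.
  have key := VectorFourier.integral_fourierIntegral_smul_eq_flip (L := innerₗ ℝ)
    Real.continuous_fourierChar continuous_inner hψ ((𝓕⁻ G).integrable (μ := volume))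
  have e1 : ∀ w, VectorFourier.fourierIntegral Real.fourierChar volume (innerₗ ℝ) ψ w = 0 := h
  have e2 : ∀ x, VectorFourier.fourierIntegral Real.fourierChar volume (innerₗ ℝ).flip
      ((𝓕⁻ G : 𝓢(ℝ, ℂ)) : ℝ → ℂ) x = ((g x : ℝ) : ℂ) := fun x => by
    have h1 : 𝓕 (𝓕⁻ G : 𝓢(ℝ, ℂ)) = G := fourier_fourierInv_eq G
    have h2 : 𝓕 ((𝓕⁻ G : 𝓢(ℝ, ℂ)) : ℝ → ℂ) x = G x := by
      rw [← fourier_coe, h1]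
    have h3 : G x = ((g x : ℝ) : ℂ) := rfl
    rw [← h3, ← h2, Real.fourier_eq, VectorFourier.fourierIntegral]
    simp only [LinearMap.flip_apply, innerₗ_apply_apply, real_inner_comm]
  simp only [e1, e2, zero_smul, integral_zero] at key
  rw [key]
  refine integral_congr_ae (Eventually.of_forall fun x => ?_)
  simp [mul_comm]

lemma ae_eq_zero_of_orthogonal_osc (hα : 0 < α) (hβ : 0 < β) (hμ : μ.im ≠ 0) (hφ : MemLp φ 2)
    (horth : ∀ g : ℝ → ℂ, ContDiff ℝ ∞ g → HasCompactSupport g →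
      ∫ x, φ x * (osc α β γ δ g x - μ * g x) = 0) : ∀ᵐ x, φ x = 0 := by
  -- The width of the oscillator ground state, that is, the solution of `4 α b² = β`.
  set b := Real.sqrt (β / α) / 2 with hb
  have hb0 : 0 < b := by positivity
  have hbβ : 4 * α * b ^ 2 = β := by
    rw [hb, div_pow, Real.sq_sqrt (by positivity)]
    field_simp
    norm_num
  have hz := integral_mul_cexp_eq_zero hb0 hφ (integral_mul_herm_eq_zero hb0 hbβ hμ hφ horth)
  have hi : Integrable fun x => φ x * herm b δ 0 x := hφ.integrable_mul (memLp_herm hb0 δ 0)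
  have h := ae_eq_zero_of_fourier_eq_zero hi fun w => by
    rw [Real.fourier_real_eq_integral_exp_smul]
    have e : (fun v : ℝ => Complex.exp (((-2 * Real.pi * v * w : ℝ) : ℂ) * Complex.I) •
        (φ v * herm b δ 0 v)) = fun v => Complex.exp (((2 * Real.pi * w * δ : ℝ) : ℂ) * Complex.I) *
        (φ v * (Complex.exp ((((-2 * Real.pi * w) * (v + δ) : ℝ) : ℂ) * Complex.I) *
          herm b δ 0 v)) := by
      funext v
      have : Complex.exp (((-2 * Real.pi * v * w : ℝ) : ℂ) * Complex.I) =
          Complex.exp (((2 * Real.pi * w * δ : ℝ) : ℂ) * Complex.I) *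
          Complex.exp ((((-2 * Real.pi * w) * (v + δ) : ℝ) : ℂ) * Complex.I) := by
        rw [← Complex.exp_add]
        congr 1
        push_cast
        ring
      rw [this, smul_eq_mul]
      ring
    rw [e, integral_const_mul, hz, mul_zero]
  filter_upwards [h] with x hx
  refine (mul_eq_zero.1 hx).resolve_right ?_
  rw [herm, pow_zero, one_mul]
  exact_mod_cast (Real.exp_pos _).ne'

lemma contDiff_osc {g : ℝ → ℂ} (hg : ContDiff ℝ ∞ g) : ContDiff ℝ ∞ (osc α β γ δ g) := by
  have h1 := contDiff_deriv' (contDiff_deriv' hg)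
  have h0 : ContDiff ℝ ∞ fun x : ℝ => β * (x + δ) ^ 2 - γ := by fun_prop
  have h2 : ContDiff ℝ ∞ fun x : ℝ => ((β * (x + δ) ^ 2 - γ : ℝ) : ℂ) :=
    Complex.ofRealCLM.contDiff.comp h0
  exact (contDiff_const.mul h1).add (h2.mul hg)

lemma hasCompactSupport_osc {g : ℝ → ℂ} (hg : HasCompactSupport g) :
    HasCompactSupport (osc α β γ δ g) :=
  (hg.deriv.deriv.mul_left).add hg.mul_left

/-- The complex test functions on the line. -/
def testFun : Submodule ℂ (ℝ → ℂ) where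
  carrier := {g | ContDiff ℝ ∞ g ∧ HasCompactSupport g}
  zero_mem' := ⟨contDiff_const, HasCompactSupport.zero⟩
  add_mem' h k := ⟨h.1.add k.1, h.2.add k.2⟩
  smul_mem' c _ h := ⟨h.1.const_smul c, h.2.smul_left (f := fun _ => c)⟩

lemma osc_add {g k : ℝ → ℂ} (hg : ContDiff ℝ ∞ g) (hk : ContDiff ℝ ∞ k) :
    osc α β γ δ (g + k) = osc α β γ δ g + osc α β γ δ k := by
  have d : ∀ {u : ℝ → ℂ}, ContDiff ℝ ∞ u → Differentiable ℝ u := fun hu =>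
    hu.differentiable (by simp)
  have e : deriv (g + k) = deriv g + deriv k := funext fun x => deriv_add (d hg x) (d hk x)
  funext x
  simp only [osc, e, Pi.add_apply, deriv_add (d (contDiff_deriv' hg) x) (d (contDiff_deriv' hk) x)]
  ring

lemma osc_smul (c : ℂ) (g : ℝ → ℂ) : osc α β γ δ (c • g) = c • osc α β γ δ g := by
  have e : ∀ u : ℝ → ℂ, deriv (c • u) = c • deriv u := fun u =>
    funext fun x => deriv_const_smul_field c u
  funext x
  simp only [osc, e, Pi.smul_apply, smul_eq_mul]
  ring

variable (α β γ δ μ) in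
lemma memLp_osc (g : testFun) : MemLp (osc α β γ δ g - μ • (g : ℝ → ℂ)) 2 :=
  ((contDiff_osc g.2.1).continuous.sub (g.2.1.continuous.const_smul μ)).memLp_of_hasCompactSupport
    ((hasCompactSupport_osc g.2.2).sub (g.2.2.smul_left (f := fun _ => μ)))

variable (α β γ δ μ) in
/-- The harmonic oscillator minus a number, on test functions. -/
def oscL : testFun →ₗ[ℂ] Lp ℂ 2 (volume : Measure ℝ) where
  toFun g := (memLp_osc α β γ δ μ g).toLp
  map_add' g k := by
    rw [← MemLp.toLp_add]
    congr 1
    rw [Submodule.coe_add, osc_add g.2.1 k.2.1, smul_add]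
    abel
  map_smul' c g := by
    rw [RingHom.id_apply, ← MemLp.toLp_const_smul]
    congr 1
    rw [Submodule.coe_smul, osc_smul, smul_sub, smul_comm c μ]

lemma dense_range_oscL (hα : 0 < α) (hβ : 0 < β) (hμ : μ.im ≠ 0) :
    (LinearMap.range (oscL α β γ δ μ)).topologicalClosure = ⊤ := by
  rw [Submodule.topologicalClosure_eq_top_iff, Submodule.eq_bot_iff]
  intro η hη
  have hφ : MemLp (fun x => (starRingEnd ℂ) (η x)) 2 := (Lp.memLp η).star
  have := ae_eq_zero_of_orthogonal_osc (γ := γ) (δ := δ) hα hβ hμ hφ fun g hg hgs => by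
    have h1 := (Submodule.mem_orthogonal' _ _).1 hη _ ⟨⟨g, hg, hgs⟩, rfl⟩
    rw [L2.inner_def] at h1
    rw [← h1]
    refine integral_congr_ae ?_
    filter_upwards [(memLp_osc α β γ δ μ ⟨g, hg, hgs⟩).coeFn_toLp] with x hx
    have hx' : (oscL α β γ δ μ ⟨g, hg, hgs⟩ : ℝ → ℂ) x = osc α β γ δ g x - μ * g x := hx
    rw [hx', RCLike.inner_apply, mul_comm]
  refine Lp.ext ?_
  filter_upwards [this, Lp.coeFn_zero ℂ 2 (volume : Measure ℝ)] with x hx h0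
  rw [h0, Pi.zero_apply]
  simpa using hx

lemma norm_toLp_sq {f : ℝ → ℂ} (hf : MemLp f 2) : ‖hf.toLp‖ ^ 2 = ∫ x, ‖f x‖ ^ 2 := by
  have h1 := @inner_self_eq_norm_sq ℂ _ _ _ _ hf.toLp
  have h2 : ∫ x, ⟪(hf.toLp : Lp ℂ 2 (volume : Measure ℝ)) x, (hf.toLp : Lp ℂ 2 volume) x⟫_ℂ =
      ((∫ x, ‖f x‖ ^ 2 : ℝ) : ℂ) := by
    rw [← integral_complex_ofReal]
    refine integral_congr_ae ?_
    filter_upwards [hf.coeFn_toLp] with x hx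
    rw [hx, inner_self_eq_norm_sq_to_K]
    simp
  rw [L2.inner_def, h2] at h1
  rw [← h1]
  simp

/-- The harmonic oscillator minus a nonreal number maps the test functions onto a dense
subspace. -/
lemma exists_osc_sub_close (hα : 0 < α) (hβ : 0 < β) (hμ : μ.im ≠ 0) (f : testFun) {ε : ℝ}
    (hε : 0 < ε) : ∃ g : testFun,
      ∫ x, ‖(f : ℝ → ℂ) x - (osc α β γ δ g x - μ * (g : ℝ → ℂ) x)‖ ^ 2 < ε := by
  have hfm : MemLp (f : ℝ → ℂ) 2 := f.2.1.continuous.memLp_of_hasCompactSupport f.2.2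
  have hmem : hfm.toLp ∈ closure
      (LinearMap.range (oscL α β γ δ μ) : Set (Lp ℂ 2 (volume : Measure ℝ))) := by
    have : hfm.toLp ∈ (LinearMap.range (oscL α β γ δ μ)).topologicalClosure := by
      rw [dense_range_oscL hα hβ hμ]
      trivial
    exact this
  obtain ⟨_, ⟨g, rfl⟩, hd⟩ := Metric.mem_closure_iff.1 hmem (Real.sqrt ε) (by positivity)
  refine ⟨g, ?_⟩
  have e : oscL α β γ δ μ g = (memLp_osc α β γ δ μ g).toLp := rfl
  rw [dist_eq_norm, e, ← MemLp.toLp_sub] at hd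
  have h3 := norm_toLp_sq (hfm.sub (memLp_osc α β γ δ μ g))
  simp only [Pi.sub_apply, Pi.smul_apply, smul_eq_mul] at h3
  rw [← h3]
  calc _ < Real.sqrt ε ^ 2 := by gcongr
    _ = ε := Real.sq_sqrt hε.le

end Completeness

/-! ### Gauge transformations on the Fock space -/

lemma gauge_mem_𝓕₀ {v : Fin𝓕} (hv : v ∈ 𝓕₀) : gauge v ∈ 𝓕₀ := by
  rw [mem_𝓕₀_iff] at hv ⊢
  rw [charge_gauge, hv, map_zero]

lemma gaugeEquiv_symm_mem_𝓕₀ {v : Fin𝓕} (hv : v ∈ 𝓕₀) : gaugeEquiv.symm v ∈ 𝓕₀ := by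
  rw [mem_𝓕₀_iff] at hv ⊢
  refine gauge_injective ?_
  rw [← charge_gauge, ← gaugeEquiv_apply, LinearEquiv.apply_symm_apply, hv, map_zero]

lemma norm_toℋ₀_gauge {v : Fin𝓕} (hv : v ∈ 𝓕₀) : ‖toℋ₀ (gauge v)‖ = ‖toℋ₀ v‖ := by
  have h : ‖toℋ₀ (gauge v)‖ ^ 2 = ‖toℋ₀ v‖ ^ 2 := by
    have := (norm_sq_toℋ₀ (gauge_mem_𝓕₀ hv)).trans ((ip_gauge v v).trans (norm_sq_toℋ₀ hv).symm)
    exact_mod_cast this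
  exact (sq_eq_sq₀ (norm_nonneg _) (norm_nonneg _)).1 h

lemma norm_toℋ₀_gaugeEquiv_symm {v : Fin𝓕} (hv : v ∈ 𝓕₀) :
    ‖toℋ₀ (gaugeEquiv.symm v)‖ = ‖toℋ₀ v‖ := by
  have := norm_toℋ₀_gauge (gaugeEquiv_symm_mem_𝓕₀ hv)
  rwa [← gaugeEquiv_apply, LinearEquiv.apply_symm_apply, eq_comm] at this

lemma exists_gaugeH : ∃ T : ℋ₀ ≃ₗᵢ[ℂ] ℋ₀, ∀ v ∈ 𝓕₀, T (toℋ₀ v) = toℋ₀ (gauge v) := by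
  obtain ⟨T, hT, -⟩ := exists_extension 𝓕₀ toℋ₀ (toℋ₀ ∘ₗ gauge) denseRange_toℋ₀ zero_le_one
    (fun v hv => by rw [one_mul]; exact (norm_toℋ₀_gauge hv).le)
  obtain ⟨T', hT', -⟩ := exists_extension 𝓕₀ toℋ₀ (toℋ₀ ∘ₗ gaugeEquiv.symm.toLinearMap)
    denseRange_toℋ₀ zero_le_one
    (fun v hv => by rw [one_mul]; exact (norm_toℋ₀_gaugeEquiv_symm hv).le)
  have hT1 : ∀ v ∈ 𝓕₀, T (toℋ₀ v) = toℋ₀ (gauge v) := hT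
  have hT2 : ∀ v ∈ 𝓕₀, T' (toℋ₀ v) = toℋ₀ (gaugeEquiv.symm v) := hT'
  have h1 : ∀ x, T (T' x) = x := ext_toℋ₀ (by fun_prop) continuous_id fun v hv => by
    rw [hT2 v hv, hT1 _ (gaugeEquiv_symm_mem_𝓕₀ hv), ← gaugeEquiv_apply,
      LinearEquiv.apply_symm_apply]
  have h2 : ∀ x, T' (T x) = x := ext_toℋ₀ (by fun_prop) continuous_id fun v hv => by
    rw [hT1 v hv, hT2 _ (gauge_mem_𝓕₀ hv), ← gaugeEquiv_apply, LinearEquiv.symm_apply_apply]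
  have hn : ∀ x, ‖T x‖ = ‖x‖ := ext_toℋ₀ (by fun_prop) continuous_norm fun v hv => by
    rw [hT1 v hv, norm_toℋ₀_gauge hv]
  refine ⟨⟨LinearEquiv.ofLinearMap (T : ℋ₀ →ₗ[ℂ] ℋ₀) (T' : ℋ₀ →ₗ[ℂ] ℋ₀) (LinearMap.ext h1)
    (LinearMap.ext h2), hn⟩, hT1⟩

/-- The gauge transformation as a unitary operator on `ℋ₀`. -/
def gaugeH : ℋ₀ ≃ₗᵢ[ℂ] ℋ₀ := exists_gaugeH.choose

lemma gaugeH_toℋ₀ {v : Fin𝓕} (hv : v ∈ 𝓕₀) : gaugeH (toℋ₀ v) = toℋ₀ (gauge v) :=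
  exists_gaugeH.choose_spec v hv

lemma zpow_mem_𝓕₀ (j : ℤ) {v : Fin𝓕} (hv : v ∈ 𝓕₀) : (gaugeEquiv ^ j) v ∈ 𝓕₀ := by
  induction j with
  | zero => exact hv
  | succ j ih =>
    rw [add_comm, zpow_add, zpow_one]
    exact gauge_mem_𝓕₀ ih
  | pred j ih =>
    rw [sub_eq_add_neg, add_comm, zpow_add, zpow_neg_one]
    exact gaugeEquiv_symm_mem_𝓕₀ ih

/-- An operator which commutes with the gauge transformation commutes with its powers. -/
lemma map_zpow_gauge {A : Fin𝓕 →ₗ[ℂ] ℋ₀} (h : ∀ v ∈ 𝓕₀, A (gauge v) = gaugeH (A v)) (j : ℤ)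
    {v : Fin𝓕} (hv : v ∈ 𝓕₀) : A ((gaugeEquiv ^ j) v) = (gaugeH ^ j) (A v) := by
  have h' : ∀ v ∈ 𝓕₀, A (gaugeEquiv.symm v) = gaugeH.symm (A v) := fun v hv => by
    rw [LinearIsometryEquiv.eq_symm_apply, ← h _ (gaugeEquiv_symm_mem_𝓕₀ hv), ← gaugeEquiv_apply,
      LinearEquiv.apply_symm_apply]
  induction j with
  | zero => rfl
  | succ j ih =>
    rw [add_comm, zpow_add, zpow_add, zpow_one, zpow_one, LinearIsometryEquiv.coe_mul,
      Function.comp_apply, ← ih]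
    exact h _ (zpow_mem_𝓕₀ _ hv)
  | pred j ih =>
    rw [sub_eq_add_neg, add_comm, zpow_add, zpow_add, zpow_neg_one, zpow_neg_one,
      LinearIsometryEquiv.coe_mul,
      Function.comp_apply, ← ih]
    exact h' _ (zpow_mem_𝓕₀ _ hv)

lemma toℋ₀_zpow_gauge (j : ℤ) {v : Fin𝓕} (hv : v ∈ 𝓕₀) :
    toℋ₀ ((gaugeEquiv ^ j) v) = (gaugeH ^ j) (toℋ₀ v) :=
  map_zpow_gauge (fun _ hv => (gaugeH_toℋ₀ hv).symm) j hv

lemma gauge_pairOp {a : ℤ} (ha : a ≠ 0) (v : Fin𝓕) : gauge (pairOp a v) = pairOp a (gauge v) := by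
  simp only [pairOp, Module.End.mul_apply, gauge_dens _ ha]

lemma gauge_mixOp {a : ℤ} (ha : a ≠ 0) (v : Fin𝓕) : gauge (mixOp a v) = mixOp a (gauge v) := by
  simp only [mixOp, LinearMap.add_apply, map_add, gauge_pairOp ha, gauge_pairOp (neg_ne_zero.2 ha)]

lemma gauge_numOp {a : ℤ} (ha : a ≠ 0) (v : Fin𝓕) : gauge (numOp a v) = numOp a (gauge v) := by
  simp only [numOp, LinearMap.add_apply, map_add, Module.End.mul_apply, gauge_dens _ ha,
    gauge_dens _ (neg_ne_zero.2 ha)]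

lemma shifts_pairOp_axial {a : ℤ} (ha : a ≠ 0) : Shifts axialWt (pairOp a) 0 :=
  (shifts_dens_axial true ha).mul_of_eq (shifts_dens_axial false ha) (add_zero 0)

lemma shifts_numOp_axial {a : ℤ} (ha : a ≠ 0) : Shifts axialWt (numOp a) 0 :=
  ((shifts_dens_axial true ha).mul_of_eq (shifts_dens_axial true (neg_ne_zero.2 ha))
    (add_zero 0)).add ((shifts_dens_axial false ha).mul_of_eq
    (shifts_dens_axial false (neg_ne_zero.2 ha)) (add_zero 0))

/-- A mode of charge `±1` has energy at least one, apart from the two zero modes, which account for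
the `2`. -/
lemma abs_wt_axialWt_le (s : Occ) : |wt axialWt s| ≤ wt energyWt s + 2 := by
  have key : ∀ (t : Finset ℤ) (f : ℤ → ℤ), (∀ n, |f n| ≤ 1) → |∑ n ∈ t, f n| ≤ ∑ n ∈ t, |n| + 1 := by
    intro t f hf
    have h1 : ∀ n : ℤ, |f n| ≤ |n| + if n = 0 then 1 else 0 := fun n => by
      split_ifs with h
      · exact (hf n).trans (by linarith [abs_nonneg n])
      · exact (hf n).trans (by simpa using Int.one_le_abs h)
    refine (Finset.abs_sum_le_sum_abs _ _).trans ((Finset.sum_le_sum fun n _ => h1 n).trans ?_)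
    rw [Finset.sum_add_distrib, Finset.sum_ite_eq']
    split_ifs <;> simp
  have h1 := key s.1 (fun n => axialWt (.inl n)) fun n => by simp only [axialWt]; split_ifs <;> simp
  have h2 := key s.2 (fun n => axialWt (.inr n)) fun n => by simp only [axialWt]; split_ifs <;> simp
  have h3 := abs_add_le (∑ n ∈ s.1, axialWt (.inl n)) (∑ n ∈ s.2, axialWt (.inr n))
  simp only [wt, energyWt]
  linarith

/-- `Γ` preserves the domain of the energy, because it changes the energy only by the axial charge
and a constant, and the axial charge is bounded by the energy. The constant `5` bounds `(E - Q⁵ + 3)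
/ (E + 1)`. -/
lemma relBdd_energyOne_gauge : RelBdd (toℋ₀ ∘ₗ energyOne ∘ₗ gauge) 5 := by
  intro v hv
  let A : Module.End ℂ Fin𝓕 := wtOp energyWt - wtOp axialWt + (3 : ℂ) • 1
  have h1 : energyOne (gauge v) = gauge (A v) := by
    simp only [A, energyOne, LinearMap.add_apply, LinearMap.sub_apply, LinearMap.smul_apply,
      Module.End.one_apply, energy_gauge, map_add, map_sub, map_smul]
    module
  have hA : A v ∈ 𝓕₀ := 𝓕₀.add_mem (𝓕₀.sub_mem (diagOp_mem_𝓕₀ _ hv) (diagOp_mem_𝓕₀ _ hv))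
    (𝓕₀.smul_mem _ hv)
  have hw : ∀ s : Neutral, |(nrg s - wt axialWt s + 3) / (nrg s + 1)| ≤ 5 := fun s => by
    have h2 : |((wt axialWt (s : Occ) : ℤ) : ℝ)| ≤ nrg s + 2 := by
      rw [nrg]
      exact_mod_cast abs_wt_axialWt_le s
    have h3 := nrg_nonneg (s : Occ)
    rw [abs_le] at h2
    rw [abs_div, abs_of_pos (show 0 < nrg (s : Occ) + 1 by linarith), div_le_iff₀ (by linarith),
      abs_le]
    constructor <;> linarith
  have h2 : toℋ₀ (A v) = diagL _ 5 hw (toℋ₀ (energyOne v)) := by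
    refine lp.ext <| funext fun s => ?_
    have h1 : (nrg s : ℂ) + 1 ≠ 0 := by
      exact_mod_cast (by linarith [nrg_nonneg s] : (0 : ℝ) < nrg s + 1).ne'
    rw [diagL_apply, toℋ₀_apply, toℋ₀_apply, energyOne_apply]
    simp only [A, LinearMap.add_apply, LinearMap.sub_apply, LinearMap.smul_apply,
      Module.End.one_apply, Finsupp.add_apply, Finsupp.sub_apply, Finsupp.smul_apply, wtOp_apply,
      smul_eq_mul]
    push_cast
    field_simp
    rw [nrg]
    push_cast
    ring
  have h3 : (toℋ₀ ∘ₗ energyOne ∘ₗ gauge) v = toℋ₀ (gauge (A v)) := congrArg toℋ₀ h1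
  rw [h3, norm_toℋ₀_gauge hA, h2]
  exact norm_diagL_le _ hw (by norm_num)

/-- An operator which intertwines the pair operators commutes with the Bogoliubov group. -/
lemma commute_bog_group (e : ℝ) {L : ℝ} (hL : 0 < L) {T T' : ℋ₀ →L[ℂ] ℋ₀}
    (hD : ∀ x, T (fockScale.D x) = fockScale.D (T' x))
    (hP : ∀ a : NZ, ∀ x, T (pairL a x) = pairL a (T' x)) (t : ℝ) (x : ℋ₀) :
    T ((bogRel e hL).group t x) = (bogRel e hL).group t (T x) := by
  refine (bogRel e hL).commute_group hD (fun x => ?_) t x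
  have h1 := ((sqSummable_bogCoef (e := e) hL).hasSum_apply x).mapL T
  have h2 := (sqSummable_bogCoef (e := e) hL).hasSum_apply (T' x)
  refine h1.unique (h2.congr_fun fun a => ?_)
  rw [map_smul, hP]

/-- `Γ` commutes with each pair operator because it commutes with the densities; its conjugate by
the energy is bounded, so the general commutation criterion applies. -/
lemma gaugeH_group (e : ℝ) {L : ℝ} (hL : 0 < L) (t : ℝ) (x : ℋ₀) :
    gaugeH ((bogRel e hL).group t x) = (bogRel e hL).group t (gaugeH x) := by
  have hR : ∀ v ∈ 𝓕₀, relL (toℋ₀ ∘ₗ energyOne ∘ₗ gauge) (toℋ₀ (energyOne v)) =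
      toℋ₀ (energyOne (gauge v)) := fun v hv => relL_energyOne relBdd_energyOne_gauge (by norm_num) hv
  let T : ℋ₀ →L[ℂ] ℋ₀ := (gaugeH.toContinuousLinearEquiv : ℋ₀ →L[ℂ] ℋ₀)
  have hT : ∀ v ∈ 𝓕₀, T (toℋ₀ v) = toℋ₀ (gauge v) := fun v hv => gaugeH_toℋ₀ hv
  refine commute_bog_group e hL (T := T) (T' := relL (toℋ₀ ∘ₗ energyOne ∘ₗ gauge)) ?_ ?_ t x
  · refine ext_energyOne (by fun_prop) (by fun_prop) fun v hv => ?_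
    rw [hR v hv, fockScale_D_energyOne, fockScale_D_energyOne, hT v hv]
  · intro a
    refine ext_energyOne (by fun_prop) (by fun_prop) fun v hv => ?_
    rw [hR v hv, pairL_energyOne a.2 hv, pairL_energyOne a.2 (gauge_mem_𝓕₀ hv),
      hT _ ((isNice_pairOp a.2).left.map_𝓕₀ hv), gauge_pairOp a.2]

lemma zpow_gaugeH_group (e : ℝ) {L : ℝ} (hL : 0 < L) (t : ℝ) (j : ℤ) (x : ℋ₀) :
    (gaugeH ^ j) ((bogRel e hL).group t x) = (bogRel e hL).group t ((gaugeH ^ j) x) := by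
  have h : Commute gaugeH ((bogRel e hL).group t) :=
    LinearIsometryEquiv.ext fun x => gaugeH_group e hL t x
  exact congrArg (fun T : ℋ₀ ≃ₗᵢ[ℂ] ℋ₀ => T x) (h.zpow_left j)

/-! ### The sector of vanishing axial charge -/

/-- The projection of finite particle states onto vanishing axial charge. -/
def axialProj : Module.End ℂ Fin𝓕 := diagOp fun s => if wt axialWt s = 0 then 1 else 0

lemma axialProj_comm {A : Module.End ℂ Fin𝓕} (hA : Shifts axialWt A 0) (v : Fin𝓕) :
    axialProj (A v) = A (axialProj v) := by
  induction v using induction_Ω with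
  | h0 => simp
  | hadd f g hf hg => simp [hf, hg]
  | hsmul c f hf => simp [hf]
  | hΩ s =>
    have h := hA (Ω s)
    rw [Int.cast_zero, zero_smul, add_zero, wtOp_Ω, map_smul] at h
    have h' : ∀ t, A (Ω s) t ≠ 0 → wt axialWt t = wt axialWt s := fun t ht => by
      have := congrArg (fun u : Fin𝓕 => u t) h
      simp only [wtOp_apply, Finsupp.smul_apply, smul_eq_mul] at this
      exact_mod_cast mul_right_cancel₀ ht this
    ext t
    rw [axialProj, diagOp_apply, diagOp_Ω, map_smul, Finsupp.smul_apply, smul_eq_mul]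
    by_cases ht : A (Ω s) t = 0
    · rw [ht, mul_zero, mul_zero]
    · rw [h' t ht]

lemma abs_axial_cutoff_le (s : Neutral) : |(if wt axialWt (s : Occ) = 0 then (1 : ℝ) else 0)| ≤ 1 := by
  split_ifs <;> simp

/-- The projection of `ℋ₀` onto vanishing axial charge. -/
def axialProjL : ℋ₀ →L[ℂ] ℋ₀ := diagL (fun s => if wt axialWt (s : Occ) = 0 then 1 else 0) 1
  abs_axial_cutoff_le

lemma axialProjL_toℋ₀ (v : Fin𝓕) : axialProjL (toℋ₀ v) = toℋ₀ (axialProj v) := by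
  refine lp.ext <| funext fun s => ?_
  rw [axialProjL, diagL_apply, toℋ₀_apply, toℋ₀_apply, axialProj, diagOp_apply]
  split_ifs <;> simp

lemma diagL_comm {w w' : Neutral → ℝ} {C C' : ℝ} {hw : ∀ s, |w s| ≤ C} {hw' : ∀ s, |w' s| ≤ C'}
    (x : ℋ₀) : diagL w C hw (diagL w' C' hw' x) = diagL w' C' hw' (diagL w C hw x) := by
  refine lp.ext <| funext fun s => ?_
  simp only [diagL_apply]
  ring

lemma axialProj_energyOne (v : Fin𝓕) : axialProj (energyOne v) = energyOne (axialProj v) := by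
  ext s
  rw [axialProj, diagOp_apply, energyOne_apply, energyOne_apply, diagOp_apply]
  ring

lemma axialProjL_group (e : ℝ) {L : ℝ} (hL : 0 < L) (t : ℝ) (x : ℋ₀) :
    axialProjL ((bogRel e hL).group t x) = (bogRel e hL).group t (axialProjL x) := by
  refine commute_bog_group e hL (T := axialProjL) (T' := axialProjL)
    (fun x => diagL_comm (hw' := abs_inv_nrg_le) x) (fun a => ?_) t x
  refine ext_energyOne (by fun_prop) (by fun_prop) fun v hv => ?_
  rw [pairL_energyOne a.2 hv, axialProjL_toℋ₀, axialProjL_toℋ₀, axialProj_energyOne,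
    pairL_energyOne a.2 (v := axialProj v) (diagOp_mem_𝓕₀ _ hv), axialProj_comm (shifts_pairOp_axial a.2)]

/-- The neutral states of vanishing axial charge. -/
def F00 : Submodule ℂ Fin𝓕 := 𝓕₀ ⊓ LinearMap.ker (wtOp axialWt)

lemma mem_F00 {v : Fin𝓕} : v ∈ F00 ↔ v ∈ 𝓕₀ ∧ wtOp axialWt v = 0 := Iff.rfl

lemma axialProj_eq_self_iff {v : Fin𝓕} : axialProj v = v ↔ wtOp axialWt v = 0 := by
  constructor <;> intro h <;> ext s <;> have hs := congrArg (fun u : Fin𝓕 => u s) h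
  · simp only [axialProj, diagOp_apply] at hs
    rw [wtOp_apply, Finsupp.zero_apply]
    split_ifs at hs with h0
    · rw [h0, Int.cast_zero, zero_mul]
    · rw [← hs, zero_mul, mul_zero]
  · rw [wtOp_apply, Finsupp.zero_apply] at hs
    rw [axialProj, diagOp_apply]
    split_ifs with h0
    · rw [one_mul]
    · rw [(mul_eq_zero.1 hs).resolve_left (by exact_mod_cast h0), mul_zero]

lemma Shifts.map_F00 {A : Module.End ℂ Fin𝓕} (h : Shifts chargeWt A 0) (h' : Shifts axialWt A 0)
    {v : Fin𝓕} (hv : v ∈ F00) : A v ∈ F00 := by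
  refine ⟨h.map_𝓕₀ hv.1, ?_⟩
  have h1 := h' v
  have h2 : wtOp axialWt v = 0 := hv.2
  rwa [h2, map_zero, Int.cast_zero, zero_smul, add_zero] at h1

lemma axial_zpow_gauge (j : ℤ) (v : Fin𝓕) : wtOp axialWt ((gaugeEquiv ^ j) v) =
    (gaugeEquiv ^ j) (wtOp axialWt v) - (2 * j : ℂ) • (gaugeEquiv ^ j) v := by
  induction j with
  | zero => simp
  | succ j ih =>
    rw [add_comm, zpow_add, zpow_one, LinearEquiv.mul_apply, LinearEquiv.mul_apply,
      gaugeEquiv_apply, gaugeEquiv_apply, axial_gauge, ih, map_sub, map_smul]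
    push_cast
    module
  | pred j ih =>
    rw [sub_eq_add_neg, add_comm, zpow_add, zpow_neg_one, LinearEquiv.mul_apply,
      LinearEquiv.mul_apply]
    set u := (gaugeEquiv ^ (-(j : ℤ))) v
    have h : ∀ u, gauge ((gaugeEquiv⁻¹ : Fin𝓕 ≃ₗ[ℂ] Fin𝓕) u) = u := gaugeEquiv.apply_symm_apply
    refine gauge_injective ?_
    have h1 := axial_gauge ((gaugeEquiv⁻¹ : Fin𝓕 ≃ₗ[ℂ] Fin𝓕) u)
    rw [h, ih] at h1
    rw [map_sub, map_smul, h, h, sub_eq_iff_eq_add.1 h1.symm]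
    push_cast
    module

lemma axial_zpow_gauge_of_eq_zero (j : ℤ) {v : Fin𝓕} (hv : wtOp axialWt v = 0) :
    wtOp axialWt ((gaugeEquiv ^ j) v) = (-2 * j : ℂ) • (gaugeEquiv ^ j) v := by
  rw [axial_zpow_gauge, hv, map_zero]
  module

/-- Each step changes the energy by an amount linear in the axial charge, which itself drifts
linearly with `j`. The resulting quadratic growth is the source of the oscillator potential. -/
lemma energy_zpow_gauge (j : ℤ) {v : Fin𝓕} (hv : wtOp axialWt v = 0) :
    wtOp energyWt ((gaugeEquiv ^ j) v) =
      (gaugeEquiv ^ j) (wtOp energyWt v) + (j * (j + 1) : ℂ) • (gaugeEquiv ^ j) v := by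
  induction j with
  | zero => simp
  | succ j ih =>
    have ha := axial_zpow_gauge_of_eq_zero j hv
    rw [add_comm, zpow_add, zpow_one, LinearEquiv.mul_apply, LinearEquiv.mul_apply,
      gaugeEquiv_apply, gaugeEquiv_apply, energy_gauge, ih, ha, map_add, map_smul, map_smul]
    push_cast
    module
  | pred j ih =>
    have ha := axial_zpow_gauge_of_eq_zero (-(j : ℤ) - 1) hv
    rw [sub_eq_add_neg, add_comm, zpow_add, zpow_neg_one, LinearEquiv.mul_apply] at ha ⊢
    rw [LinearEquiv.mul_apply]
    set u := (gaugeEquiv ^ (-(j : ℤ))) v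
    have h : ∀ u, gauge ((gaugeEquiv⁻¹ : Fin𝓕 ≃ₗ[ℂ] Fin𝓕) u) = u := gaugeEquiv.apply_symm_apply
    refine gauge_injective ?_
    have h1 := energy_gauge ((gaugeEquiv⁻¹ : Fin𝓕 ≃ₗ[ℂ] Fin𝓕) u)
    rw [h, ih, ha, map_smul, h] at h1
    rw [map_add, map_smul, h, h]
    have h2 := sub_eq_iff_eq_add.1 (eq_sub_iff_add_eq.2 h1.symm)
    rw [h2]
    push_cast
    module

/-! ### The Coulomb energy -/

lemma hasSum_coulomb {e L : ℝ} (hL : 0 < L) {v : Fin𝓕} (hv : v ∈ 𝓕₀) :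
    HasSum (fun m : PN => ((cpl e L m : ℝ) : ℂ) • (toℋ₀ (numOp m v) + toℋ₀ (mixOp m v)))
      (coulomb e L v) := by
  have h := (hasSum_coulL (e := e) hL).mapL (ContinuousLinearMap.apply ℂ ℋ₀ (toℋ₀ (energyOne v)))
  rw [ContinuousLinearMap.apply_apply, coulL_energyOne hL hv] at h
  refine h.congr_fun fun m => ?_
  rw [ContinuousLinearMap.apply_apply, smul_apply, add_apply, numL_energyOne m.2 hv,
    mixL_energyOne m.2.ne' hv]

lemma coulomb_gauge {e L : ℝ} (hL : 0 < L) {v : Fin𝓕} (hv : v ∈ 𝓕₀) :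
    coulomb e L (gauge v) = gaugeH (coulomb e L v) := by
  have h1 := hasSum_coulomb (e := e) hL (gauge_mem_𝓕₀ hv)
  have h2 := (hasSum_coulomb (e := e) hL hv).mapL (gaugeH.toContinuousLinearEquiv : ℋ₀ →L[ℂ] ℋ₀)
  refine h1.unique (h2.congr_fun fun m => ?_)
  have hm := m.2.ne'
  have e1 := gaugeH_toℋ₀ ((isNice_numOp hm).left.map_𝓕₀ hv)
  have e2 := gaugeH_toℋ₀ ((isNice_mixOp hm).left.map_𝓕₀ hv)
  rw [map_smul, map_add, ← gauge_numOp hm, ← gauge_mixOp hm, ← e1, ← e2]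
  rfl

lemma coulomb_symm {e L : ℝ} (hL : 0 < L) {v w : Fin𝓕} (hv : v ∈ 𝓕₀) (hw : w ∈ 𝓕₀) :
    ⟪coulomb e L v, toℋ₀ w⟫_ℂ = ⟪toℋ₀ v, coulomb e L w⟫_ℂ := by
  have h1 := (hasSum_coulomb (e := e) hL hw).mapL (innerSL ℂ (toℋ₀ v))
  have h2 := ((hasSum_coulomb (e := e) hL hv).mapL (innerSL ℂ (toℋ₀ w))).mapL
    Complex.conjCLE.toContinuousLinearMap
  have e1 : ∀ u, Complex.conjCLE.toContinuousLinearMap (innerSL ℂ (toℋ₀ w) u) = ⟪u, toℋ₀ w⟫_ℂ := by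
    intro u
    rw [innerSL_apply_apply, ← inner_conj_symm u]
    rfl
  rw [e1] at h2
  refine h2.unique (h1.congr_fun fun m => ?_)
  have hm := m.2.ne'
  rw [e1, innerSL_apply_apply, inner_smul_left, inner_smul_right, inner_add_left, inner_add_right,
    Complex.conj_ofReal, (isNice_numOp hm).inner hv, (isNice_mixOp hm).inner hv]

/-! ### Gauge covariant functions -/

lemma exists_cover {L : ℝ} (hL : 0 < L) {g : ℝ → ℂ} (hg : HasCompactSupport g) (R : ℝ) :
    ∃ T : Finset ℤ, ∀ j ∉ T, ∀ x, |x| ≤ R → g (x + j * (2 * Real.pi / L)) = 0 := by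
  have hp : 0 < 2 * Real.pi / L := by have := Real.pi_pos; positivity
  obtain ⟨M, hM⟩ := hg.isCompact.isBounded.subset_closedBall 0
  obtain ⟨N, hN⟩ := exists_nat_gt ((M + R) / (2 * Real.pi / L))
  refine ⟨Finset.Icc (-(N : ℤ)) N, fun j hj x hx => ?_⟩
  by_contra h0
  have h1 := hM (subset_tsupport g h0)
  rw [mem_closedBall_zero_iff, Real.norm_eq_abs] at h1
  have h2 : (N : ℝ) < |(j : ℝ)| := by
    have : (N : ℤ) < |j| := by
      by_contra hle
      exact hj (Finset.mem_Icc.2 (abs_le.1 (not_lt.1 hle)))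
    exact_mod_cast this
  have h3 : |(j : ℝ) * (2 * Real.pi / L)| ≤ M + R := by
    have := abs_sub_abs_le_abs_sub ((j : ℝ) * (2 * Real.pi / L)) (-x)
    rw [abs_neg, sub_neg_eq_add, add_comm _ x] at this
    linarith
  rw [abs_mul, abs_of_pos hp, ← le_div_iff₀ hp] at h3
  linarith

/-- The gauge covariant function which agrees with `g v` in the sector of the axial charge
of `v`. -/
def fold (L : ℝ) (g : ℝ → ℂ) (v : Fin𝓕) (a : ℝ) : Fin𝓕 :=
  ∑ᶠ j : ℤ, g (a + j * (2 * Real.pi / L)) • (gaugeEquiv ^ j) v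

lemma fold_eq_sum {L : ℝ} {g : ℝ → ℂ} {T : Finset ℤ} {a : ℝ}
    (hT : ∀ j ∉ T, g (a + j * (2 * Real.pi / L)) = 0) (v : Fin𝓕) :
    fold L g v a = ∑ j ∈ T, g (a + j * (2 * Real.pi / L)) • (gaugeEquiv ^ j) v := by
  refine finsum_eq_sum_of_support_subset _ fun j hj => ?_
  by_contra h
  exact hj (by simp only; rw [hT j h, zero_smul])

lemma fold_mem {L : ℝ} (hL : 0 < L) {g : ℝ → ℂ} (hg : g ∈ testFun) {v : Fin𝓕} (hv : v ∈ 𝓕₀) :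
    fold L g v ∈ 𝒟 L := by
  classical
  have hloc : ∀ a, ∃ T : Finset ℤ, ∀ᶠ b in 𝓝 a, fold L g v b =
      ∑ j ∈ T, g (b + j * (2 * Real.pi / L)) • (gaugeEquiv ^ j) v := fun a => by
    obtain ⟨T, hT⟩ := exists_cover hL hg.2 (|a| + 1)
    refine ⟨T, ?_⟩
    filter_upwards [Metric.ball_mem_nhds a one_pos] with b hb
    have h1 : |b - a| < 1 := by simpa [Real.dist_eq] using hb
    have h2 := abs_sub_abs_le_abs_sub b a
    exact fold_eq_sum (fun j hj => hT j hj b (by linarith)) v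
  refine ⟨⟨fun a => ?_, fun a => ?_, fun s => ?_⟩, fun a => ?_⟩
  · obtain ⟨T, hT⟩ := hloc a
    rw [hT.self_of_nhds]
    exact 𝓕₀.sum_mem fun j _ => 𝓕₀.smul_mem _ (zpow_mem_𝓕₀ j hv)
  · obtain ⟨T, hT⟩ := hloc a
    refine ⟨T.biUnion fun j => ((gaugeEquiv ^ j) v).support, ?_⟩
    filter_upwards [hT] with b hb
    rw [hb]
    refine Finsupp.support_finsetSum.trans (Finset.biUnion_mono fun j _ => ?_)
    exact Finsupp.support_smul
  · rw [contDiff_iff_contDiffAt]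
    intro a
    obtain ⟨T, hT⟩ := hloc a
    have h1 : ContDiff ℝ ∞ fun b => ∑ j ∈ T, g (b + j * (2 * Real.pi / L)) *
        ((gaugeEquiv ^ j) v) s :=
      ContDiff.sum fun j _ => (hg.1.comp (contDiff_id.add contDiff_const)).mul contDiff_const
    refine h1.contDiffAt.congr_of_eventuallyEq ?_
    filter_upwards [hT] with b hb
    rw [hb, Finsupp.finsetSum_apply]
    rfl
  · have h1 : gauge (fold L g v (a + 2 * Real.pi / L)) = gaugeEquiv.toAddEquiv
        (∑ᶠ j : ℤ, g (a + 2 * Real.pi / L + j * (2 * Real.pi / L)) • (gaugeEquiv ^ j) v) := rfl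
    -- Translating by a period and applying `Γ` both shift the index of the sum by one.
    rw [h1, AddEquiv.map_finsum, fold,
      ← finsum_comp_equiv (Equiv.addRight (1 : ℤ)) (f := fun j : ℤ =>
        g (a + j * (2 * Real.pi / L)) • (gaugeEquiv ^ j) v)]
    refine finsum_congr fun j => ?_
    have h2 : (gaugeEquiv ^ (j + 1)) v = gaugeEquiv ((gaugeEquiv ^ j) v) := by
      rw [add_comm, zpow_add, zpow_one]
      rfl
    rw [Equiv.coe_addRight, h2]
    push_cast
    rw [add_mul, one_mul, add_assoc, add_comm (2 * Real.pi / L)]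
    exact map_smul gaugeEquiv _ _

lemma gauge_covariant {L : ℝ} {Ψ : ℝ → Fin𝓕} (hΨ : Ψ ∈ 𝒟 L) (j : ℤ) (a : ℝ) :
    (gaugeEquiv ^ j) (Ψ (a + j * (2 * Real.pi / L))) = Ψ a := by
  induction j generalizing a with
  | zero => simp
  | succ j ih =>
    rw [zpow_add, zpow_one, LinearEquiv.mul_apply, gaugeEquiv_apply]
    have h := hΨ.2 (a + (j : ℤ) * (2 * Real.pi / L))
    have h1 : a + (((j : ℤ) + 1 : ℤ) : ℝ) * (2 * Real.pi / L) =
        a + (j : ℤ) * (2 * Real.pi / L) + 2 * Real.pi / L := by push_cast; ring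
    rw [h1, h, ih a]
  | pred j ih =>
    have h := hΨ.2 (a + ((-(j : ℤ) - 1 : ℤ) : ℝ) * (2 * Real.pi / L))
    rw [sub_eq_add_neg, zpow_add, LinearEquiv.mul_apply, ← sub_eq_add_neg, ← h, zpow_neg_one]
    have h2 : (gaugeEquiv⁻¹ : Fin𝓕 ≃ₗ[ℂ] Fin𝓕) (gauge (Ψ (a + ((-(j : ℤ) - 1 : ℤ) : ℝ) *
        (2 * Real.pi / L) + 2 * Real.pi / L))) = Ψ (a + ((-(j : ℤ) - 1 : ℤ) : ℝ) *
        (2 * Real.pi / L) + 2 * Real.pi / L) := gaugeEquiv.symm_apply_apply _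
    rw [h2]
    refine Eq.trans ?_ (ih a)
    congr 2
    push_cast
    ring

/-- Axial and electric charge of a mode differ by an even number, and the total electric charge is
zero. -/
lemma even_wt_axialWt {s : Occ} (hs : s.1.card = s.2.card) : ∃ j : ℤ, wt axialWt s = -2 * j := by
  have h : (2 : ℤ) ∣ wt axialWt s - wt chargeWt s := by
    have e : wt axialWt s - wt chargeWt s = ∑ n ∈ s.1, (axialWt (.inl n) - chargeWt (.inl n)) +
        ∑ n ∈ s.2, (axialWt (.inr n) - chargeWt (.inr n)) := by
      simp only [wt, Finset.sum_sub_distrib]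
      ring
    rw [e]
    refine dvd_add (Finset.dvd_sum fun n _ => ?_) (Finset.dvd_sum fun n _ => ?_) <;>
      simp only [axialWt, chargeWt] <;> split_ifs <;> norm_num
  rw [wt_chargeWt, hs, sub_self, sub_zero] at h
  obtain ⟨k, hk⟩ := h
  exact ⟨-k, by rw [hk]; ring⟩

lemma axialProj_zpow_Ω {s : Occ} {k : ℤ} (hs : wt axialWt s = -2 * k) (j : ℤ) :
    axialProj ((gaugeEquiv ^ (-j)) (Ω s)) = if j = k then (gaugeEquiv ^ (-j)) (Ω s) else 0 := by
  have h := axial_zpow_gauge (-j) (Ω s)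
  rw [wtOp_Ω, map_smul, hs, ← sub_smul] at h
  have h' : ∀ t, (wt axialWt t : ℂ) * ((gaugeEquiv ^ (-j)) (Ω s)) t =
      (2 * (j - k) : ℂ) * ((gaugeEquiv ^ (-j)) (Ω s)) t := fun t => by
    have := congrArg (fun u : Fin𝓕 => u t) h
    simp only [wtOp_apply, Finsupp.smul_apply, smul_eq_mul] at this
    rw [this]
    push_cast
    ring
  split_ifs with hjk
  · refine axialProj_eq_self_iff.2 ?_
    ext t
    rw [wtOp_apply, h' t, hjk, sub_self, mul_zero, zero_mul, Finsupp.zero_apply]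
  · ext t
    rw [axialProj, diagOp_apply, Finsupp.zero_apply]
    split_ifs with h0
    · have h1 := h' t
      rw [h0, Int.cast_zero, zero_mul, eq_comm] at h1
      rw [one_mul]
      refine (mul_eq_zero.1 h1).resolve_left (mul_ne_zero two_ne_zero ?_)
      exact_mod_cast sub_ne_zero.2 hjk
    · rw [zero_mul]

/-- Every neutral state is the sum of its components of fixed axial charge. -/
lemma exists_axial_decomposition {S : Finset Occ} (hS : ∀ s ∈ S, s.1.card = s.2.card) :
    ∃ T : Finset ℤ, ∀ u : Fin𝓕, u.support ⊆ S →
      (∀ T' : Finset ℤ, T ⊆ T' → ∑ j ∈ T', (gaugeEquiv ^ j) (axialProj ((gaugeEquiv ^ (-j)) u)) = u) ∧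
      ∀ j ∉ T, axialProj ((gaugeEquiv ^ (-j)) u) = 0 := by
  classical
  -- The power of `Γ` that brings a state of axial charge zero to the charge of `s`; the division is
  -- exact by parity.
  let k : Occ → ℤ := fun s => -(wt axialWt s / 2)
  have hk : ∀ s ∈ S, wt axialWt s = -2 * k s := fun s hs => by
    obtain ⟨j, hj⟩ := even_wt_axialWt (hS s hs)
    simp only [k]
    omega
  refine ⟨S.image k, fun u hu => ?_⟩
  have hu' : u = ∑ s ∈ S, u s • Ω s := by
    conv_lhs => rw [← Finsupp.sum_single u, Finsupp.sum_of_support_subset _ hu _ (by simp)]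
    refine Finset.sum_congr rfl fun s _ => ?_
    rw [Ω, Finsupp.smul_single, smul_eq_mul, mul_one]
  have hp : ∀ j, axialProj ((gaugeEquiv ^ (-j)) u) =
      ∑ s ∈ S, if j = k s then u s • (gaugeEquiv ^ (-j)) (Ω s) else 0 := fun j => by
    conv_lhs => rw [hu', map_sum, map_sum]
    refine Finset.sum_congr rfl fun s hs => ?_
    rw [map_smul, map_smul, axialProj_zpow_Ω (hk s hs)]
    split_ifs <;> simp
  refine ⟨fun T' hT' => ?_, fun j hj => ?_⟩
  · have h1 : ∀ j ∈ T', (gaugeEquiv ^ j) (axialProj ((gaugeEquiv ^ (-j)) u)) =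
        ∑ s ∈ S, if j = k s then u s • Ω s else 0 := fun j _ => by
      rw [hp j, map_sum]
      refine Finset.sum_congr rfl fun s _ => ?_
      split_ifs
      · rw [map_smul, ← LinearEquiv.mul_apply, ← zpow_add, add_neg_cancel]
        rfl
      · rw [map_zero]
    rw [Finset.sum_congr rfl h1, Finset.sum_comm]
    conv_rhs => rw [hu']
    refine Finset.sum_congr rfl fun s hs => ?_
    rw [Finset.sum_ite_eq', if_pos (hT' (Finset.mem_image_of_mem k hs))]
  · rw [hp j]
    refine Finset.sum_eq_zero fun s hs => if_neg fun h => hj ?_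
    rw [h]
    exact Finset.mem_image_of_mem k hs

lemma exists_support_bound {Ψ : ℝ → Fin𝓕} (hΨ : IsSmooth Ψ) {K : Set ℝ} (hK : IsCompact K) :
    ∃ S : Finset Occ, (∀ s ∈ S, s.1.card = s.2.card) ∧ ∀ a ∈ K, (Ψ a).support ⊆ S := by
  classical
  have h : ∃ S : Finset Occ, ∀ a ∈ K, (Ψ a).support ⊆ S := by
    refine hK.induction_on ⟨∅, by simp⟩ ?_ ?_ ?_
    · rintro s t hst ⟨S, hS⟩
      exact ⟨S, fun a ha => hS a (hst ha)⟩
    · rintro s t ⟨S, hS⟩ ⟨R, hR⟩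
      refine ⟨S ∪ R, fun a ha => ?_⟩
      rcases ha with ha | ha
      · exact (hS a ha).trans Finset.subset_union_left
      · exact (hR a ha).trans Finset.subset_union_right
    · intro a _
      obtain ⟨S, hS⟩ := hΨ.locally_finite a
      exact ⟨_, mem_nhdsWithin_of_mem_nhds hS, S, fun b hb => hb⟩
  obtain ⟨S, hS⟩ := h
  refine ⟨S.filter fun s => s.1.card = s.2.card, fun s hs => (Finset.mem_filter.1 hs).2,
    fun a ha s hs => Finset.mem_filter.2 ⟨hS a ha hs, ?_⟩⟩
  exact (Finsupp.mem_supported ℂ _).1 (hΨ.mem a) hs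

/-- Every gauge covariant function is a finite sum of elementary ones. -/
lemma exists_eq_sum_fold {L : ℝ} (hL : 0 < L) {Ψ : ℝ → Fin𝓕} (hΨ : Ψ ∈ 𝒟 L) :
    ∃ S : Finset Occ, (∀ s ∈ S, Ω s ∈ F00 ∧ (fun a => Ψ a s) ∈ testFun) ∧
      Ψ = ∑ s ∈ S, fold L (fun a => Ψ a s) (Ω s) := by
  classical
  have hp : 0 < 2 * Real.pi / L := by have := Real.pi_pos; positivity
  -- By compactness only finitely many basis states, hence finitely many axial charges, occur over
  -- one period.
  obtain ⟨S0, hS0, hsupp⟩ := exists_support_bound hΨ.1 (isCompact_Icc (a := 0) (b := 2 * Real.pi / L))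
  obtain ⟨T, hT⟩ := exists_axial_decomposition hS0
  have hbase : ∀ x : ℝ, ∃ j : ℤ, ∃ a ∈ Set.Icc 0 (2 * Real.pi / L), x = a + j * (2 * Real.pi / L) ∧
      Ψ x = (gaugeEquiv ^ (-j)) (Ψ a) := fun x => by
    refine ⟨⌊x / (2 * Real.pi / L)⌋, x - ⌊x / (2 * Real.pi / L)⌋ * (2 * Real.pi / L), ⟨?_, ?_⟩, by ring, ?_⟩
    · have := Int.floor_le (x / (2 * Real.pi / L))
      rw [le_div_iff₀ hp] at this
      linarith
    · have := (Int.lt_floor_add_one (x / (2 * Real.pi / L))).le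
      rw [div_le_iff₀ hp] at this
      linarith
    · have := gauge_covariant hΨ ⌊x / (2 * Real.pi / L)⌋
        (x - ⌊x / (2 * Real.pi / L)⌋ * (2 * Real.pi / L))
      rw [sub_add_cancel] at this
      rw [← this, ← LinearEquiv.mul_apply, ← zpow_add, neg_add_cancel]
      rfl
  let S1 : Finset Occ := T.biUnion fun j => S0.biUnion fun s => ((gaugeEquiv ^ (-j)) (Ω s)).support
  -- The value at `x` is a power of `Γ` applied to a value in the base period. If it has a component
  -- without axial charge, that power is one of finitely many, so these components are compactly
  -- supported on the line.
  have hvan : ∀ x : ℝ, ∀ s, wt axialWt s = 0 → Ψ x s ≠ 0 →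
      s ∈ S1 ∧ s.1.card = s.2.card ∧ ∃ j ∈ T, x ∈ (fun a => a + j * (2 * Real.pi / L)) ''
        Set.Icc 0 (2 * Real.pi / L) := by
    intro x s hs hx
    obtain ⟨j, a, ha, hxa, hΨx⟩ := hbase x
    have hj : j ∈ T := by
      by_contra hj
      have h1 := congrArg (fun u : Fin𝓕 => u s) ((hT (Ψ a) (hsupp a ha)).2 j hj)
      simp only [axialProj, diagOp_apply, hs, if_true, one_mul, ← hΨx, Finsupp.zero_apply] at h1
      exact hx h1
    refine ⟨Finset.mem_biUnion.2 ⟨j, hj, ?_⟩, (Finsupp.mem_supported ℂ _).1 (hΨ.1.mem x)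
      (Finsupp.mem_support_iff.2 hx), j, hj, a, ha, hxa.symm⟩
    have hu' : Ψ a = ∑ s ∈ S0, Ψ a s • Ω s := by
      conv_lhs => rw [← Finsupp.sum_single (Ψ a),
        Finsupp.sum_of_support_subset _ (hsupp a ha) _ (by simp)]
      refine Finset.sum_congr rfl fun s _ => ?_
      rw [Ω, Finsupp.smul_single, smul_eq_mul, mul_one]
    rw [hΨx, hu', map_sum, Finsupp.finsetSum_apply] at hx
    obtain ⟨t, ht, hne⟩ := Finset.exists_ne_zero_of_sum_ne_zero hx
    refine Finset.mem_biUnion.2 ⟨t, ht, Finsupp.mem_support_iff.2 fun h0 => hne ?_⟩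
    rw [map_smul, Finsupp.smul_apply, h0, smul_zero]
  refine ⟨S1.filter fun s => wt axialWt s = 0 ∧ s.1.card = s.2.card, fun s hs => ⟨⟨?_, ?_⟩, ?_, ?_⟩,
    funext fun a => ?_⟩
  · exact Ω_mem_𝓕₀.2 (Finset.mem_filter.1 hs).2.2
  · rw [SetLike.mem_coe, LinearMap.mem_ker, wtOp_Ω, (Finset.mem_filter.1 hs).2.1, Int.cast_zero,
      zero_smul]
  · exact hΨ.1.contDiff s
  · refine HasCompactSupport.of_support_subset_isCompact (K := ⋃ j ∈ T,
      (fun a : ℝ => a + j * (2 * Real.pi / L)) '' Set.Icc 0 (2 * Real.pi / L))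
      (T.isCompact_biUnion fun j _ => isCompact_Icc.image (by fun_prop)) fun x hx => ?_
    obtain ⟨-, -, j, hj, hxj⟩ := hvan x s (Finset.mem_filter.1 hs).2.1 hx
    exact Set.mem_biUnion hj hxj
  · set S := S1.filter fun s => wt axialWt s = 0 ∧ s.1.card = s.2.card with hSdef
    have hcs : ∀ s ∈ S, HasCompactSupport fun a => Ψ a s := fun s hs => by
      refine HasCompactSupport.of_support_subset_isCompact (K := ⋃ j ∈ T,
        (fun a : ℝ => a + j * (2 * Real.pi / L)) '' Set.Icc 0 (2 * Real.pi / L))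
        (T.isCompact_biUnion fun j _ => isCompact_Icc.image (by fun_prop)) fun x hx => ?_
      obtain ⟨-, -, j, hj, hxj⟩ := hvan x s (Finset.mem_filter.1 hs).2.1 hx
      exact Set.mem_biUnion hj hxj
    have hTs : ∀ s, ∃ T' : Finset ℤ, s ∈ S → ∀ j ∉ T', Ψ (a + j * (2 * Real.pi / L)) s = 0 := fun s => by
      by_cases hs : s ∈ S
      · obtain ⟨T', hT'⟩ := exists_cover hL (hcs s hs) |a|
        exact ⟨T', fun _ j hj => hT' j hj a le_rfl⟩
      · exact ⟨∅, fun h => absurd h hs⟩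
    choose T' hT' using hTs
    obtain ⟨S2, hS2, hsupp2⟩ := exists_support_bound hΨ.1 (isCompact_singleton (x := a))
    obtain ⟨T2, hT2⟩ := exists_axial_decomposition hS2
    have h2 := (hT2 (Ψ a) (hsupp2 a rfl)).1 (T2 ∪ S.biUnion T') Finset.subset_union_left
    rw [Finset.sum_apply]
    have h3 : ∀ s ∈ S, fold L (fun a => Ψ a s) (Ω s) a = ∑ j ∈ T2 ∪ S.biUnion T',
        Ψ (a + j * (2 * Real.pi / L)) s • (gaugeEquiv ^ j) (Ω s) := fun s hs =>
      fold_eq_sum (fun j hj => hT' s hs j fun hj' => hj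
        (Finset.mem_union_right _ (Finset.mem_biUnion.2 ⟨s, hs, hj'⟩))) _
    rw [Finset.sum_congr rfl h3, Finset.sum_comm]
    conv_lhs => rw [← h2]
    refine Finset.sum_congr rfl fun j _ => ?_
    have h4 : (gaugeEquiv ^ (-j)) (Ψ a) = Ψ (a + j * (2 * Real.pi / L)) := by
      rw [← gauge_covariant hΨ j a, ← LinearEquiv.mul_apply, ← zpow_add, neg_add_cancel]
      rfl
    simp only [← map_smul]
    rw [h4, ← map_sum]
    congr 1
    ext t
    rw [axialProj, diagOp_apply, Finsupp.finsetSum_apply]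
    simp only [Ω, Finsupp.smul_single, smul_eq_mul, mul_one, Finsupp.single_apply]
    rw [Finset.sum_ite_eq' S t]
    by_cases ht : t ∈ S
    · rw [if_pos (Finset.mem_filter.1 ht).2.1, if_pos ht, one_mul]
    · rw [if_neg ht]
      split_ifs with h0
      · rw [one_mul]
        by_contra hne
        obtain ⟨h5, h6, -⟩ := hvan _ t h0 hne
        exact ht (Finset.mem_filter.2 ⟨h5, h0, h6⟩)
      · rw [zero_mul]

/-! ### Gauge covariant functions in `𝒦` -/

/-- The translates of `g` by the periods outside `T` vanish near `[0, 2π/L]`. -/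
def Covers (L : ℝ) (T : Finset ℤ) (g : ℝ → ℂ) : Prop :=
  ∀ j ∉ T, ∀ x, |x| ≤ 2 * Real.pi / L + 1 → g (x + j * (2 * Real.pi / L)) = 0

lemma Covers.mono {L : ℝ} {T T' : Finset ℤ} {g : ℝ → ℂ} (h : Covers L T g) (hT : T ⊆ T') :
    Covers L T' g := fun j hj => h j fun hj' => hj (hT hj')

lemma exists_covers {L : ℝ} (hL : 0 < L) {g : ℝ → ℂ} (hg : g ∈ testFun) :
    ∃ T, Covers L T g := exists_cover hL hg.2 _

/-- The sum `∑ g(a + 2πj/L) Γ^j x` over `j ∈ T`. -/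
def foldFun (L : ℝ) (T : Finset ℤ) (g : ℝ → ℂ) (x : ℋ₀) (a : ℝ) : ℋ₀ :=
  ∑ j ∈ T, g (a + j * (2 * Real.pi / L)) • (gaugeH ^ j) x

lemma continuous_foldFun (L : ℝ) (T : Finset ℤ) {g : ℝ → ℂ} (hg : Continuous g) (x : ℋ₀) :
    Continuous (foldFun L T g x) :=
  continuous_finsetSum _ fun j _ => (hg.comp (by fun_prop)).smul continuous_const

lemma exists_foldFun_bound (L : ℝ) (T : Finset ℤ) {g : ℝ → ℂ} (hg : Continuous g) :
    ∃ C, 0 ≤ C ∧ ∀ a ∈ Set.Icc 0 (2 * Real.pi / L), ∀ x, ‖foldFun L T g x a‖ ≤ C * ‖x‖ := by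
  have hc : Continuous fun a => ∑ j ∈ T, ‖g (a + j * (2 * Real.pi / L))‖ :=
    continuous_finsetSum _ fun j _ => (hg.comp (by fun_prop)).norm
  obtain ⟨C, hC⟩ := isCompact_Icc.exists_bound_of_continuousOn
    (s := Set.Icc 0 (2 * Real.pi / L)) hc.continuousOn
  refine ⟨max C 0, le_max_right _ _, fun a ha x => (norm_sum_le _ _).trans ?_⟩
  simp only [norm_smul, LinearIsometryEquiv.norm_map]
  rw [← Finset.sum_mul]
  refine mul_le_mul_of_nonneg_right ?_ (norm_nonneg _)
  exact (Real.le_norm_self _).trans ((hC a ha).trans (le_max_left _ _))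

/-- The element of `𝒦` given by `foldFun`. -/
def foldL (L : ℝ) (T : Finset ℤ) {g : ℝ → ℂ} (hg : Continuous g) : ℋ₀ →L[ℂ] 𝒦 L :=
  LinearMap.mkContinuousOfExistsBound
    { toFun := fun x => (memLp_of_continuous L (continuous_foldFun L T hg x)).toLp
      map_add' := fun x y => by
        rw [← MemLp.toLp_add]
        congr 1
        funext a
        simp [foldFun, Finset.sum_add_distrib]
      map_smul' := fun c x => by
        rw [RingHom.id_apply, ← MemLp.toLp_const_smul]
        congr 1
        funext a
        simp [foldFun, Finset.smul_sum, smul_comm c] } (by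
    obtain ⟨C, hC, h⟩ := exists_foldFun_bound L T hg
    refine ⟨_, fun x => (Lp.norm_le_of_ae_bound (C := C * ‖x‖) (by positivity) ?_).trans_eq
      (mul_assoc _ _ _).symm⟩
    filter_upwards [(memLp_of_continuous L (continuous_foldFun L T hg x)).coeFn_toLp,
      ae_restrict_mem measurableSet_Icc] with a ha ha'
    exact (congrArg norm ha).trans_le (h a ha' x))

lemma coeFn_foldL (L : ℝ) (T : Finset ℤ) {g : ℝ → ℂ} (hg : Continuous g) (x : ℋ₀) :
    foldL L T hg x =ᵐ[circleMeasure L] foldFun L T g x :=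
  (memLp_of_continuous L (continuous_foldFun L T hg x)).coeFn_toLp

lemma toLp_eq_foldL (L : ℝ) (T : Finset ℤ) {g : ℝ → ℂ} (hg : Continuous g) (x : ℋ₀) :
    (memLp_of_continuous L (continuous_foldFun L T hg x)).toLp = foldL L T hg x := rfl

lemma toℋ₀_fold {L : ℝ} {T : Finset ℤ} {g : ℝ → ℂ} (hT : Covers L T g) {v : Fin𝓕} (hv : v ∈ 𝓕₀)
    {a : ℝ} (ha : |a| ≤ 2 * Real.pi / L + 1) :
    toℋ₀ (fold L g v a) = foldFun L T g (toℋ₀ v) a := by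
  rw [fold_eq_sum (fun j hj => hT j hj a ha), map_sum]
  refine Finset.sum_congr rfl fun j _ => ?_
  rw [map_smul, toℋ₀_zpow_gauge j hv]

lemma incl_fold {L : ℝ} (hL : 0 < L) {T : Finset ℤ} {g : ℝ → ℂ} (hg : g ∈ testFun)
    (hT : Covers L T g) {v : Fin𝓕} (hv : v ∈ 𝓕₀) :
    incl L ⟨fold L g v, fold_mem hL hg hv⟩ = foldL L T hg.1.continuous (toℋ₀ v) := by
  refine MemLp.toLp_congr (memLp_of_continuous L ((fold_mem hL hg hv).1.contDiff_comp
    toℋ₀).continuous) (memLp_of_continuous L (continuous_foldFun L T hg.1.continuous _)) ?_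
  filter_upwards [ae_restrict_mem measurableSet_Icc] with a ha
  exact toℋ₀_fold hT hv (by rw [abs_of_nonneg ha.1]; linarith [ha.2])

lemma deriv_foldFun (L : ℝ) (T : Finset ℤ) {g : ℝ → ℂ} (hg : Differentiable ℝ g) (x : ℋ₀) :
    deriv (foldFun L T g x) = foldFun L T (deriv g) x := by
  funext a
  refine HasDerivAt.deriv (HasDerivAt.fun_sum fun j _ => HasDerivAt.smul_const ?_ _)
  exact HasDerivAt.comp_add_const a _ (hg _).hasDerivAt

/-- The part of the Hamiltonian which does not depend on `a`, on the states without axial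
charge. -/
def fockHam (e L : ℝ) : Fin𝓕 →ₗ[ℂ] ℋ₀ :=
  ((2 * Real.pi / L : ℝ) : ℂ) • toℋ₀ ∘ₗ wtOp energyWt + coulomb e L

/-- The energy shift `j * (j + 1)`, the axial charge `-2 * j` and the explicit terms in `a` complete
a square in `a + 2πj/L + π/L`. The index `j` enters only through the translated variable, so the
sectors glue to one oscillator on the line. -/
lemma potential_zpow_gauge (e : ℝ) {L : ℝ} (hL : 0 < L) {v : Fin𝓕} (hv : v ∈ F00) (j : ℤ) (a : ℝ) :
    potential e L a ((gaugeEquiv ^ j) v) = (gaugeH ^ j) (fockHam e L v) +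
      ((L / (2 * Real.pi) * (a + j * (2 * Real.pi / L) + Real.pi / L) ^ 2 - Real.pi / (2 * L) : ℝ) : ℂ)
        • (gaugeH ^ j) (toℋ₀ v) := by
  have hpi := Real.pi_pos
  have h0 : wtOp energyWt v ∈ 𝓕₀ := (isNice_wtOp energyWt).left.map_𝓕₀ hv.1
  rw [potential, fockHam, diracHam_eq hL, axialChargeReg, axialCharge_eq]
  simp only [LinearMap.add_apply, LinearMap.comp_apply, LinearMap.sub_apply, LinearMap.smul_apply,
    map_sub, map_smul, map_add, Module.End.one_apply, energy_zpow_gauge j hv.2,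
    axial_zpow_gauge_of_eq_zero j hv.2, map_zpow_gauge (fun v hv => coulomb_gauge hL hv) j hv.1,
    toℋ₀_zpow_gauge j hv.1, toℋ₀_zpow_gauge j h0]
  have key : ((L / (2 * Real.pi) * (a + j * (2 * Real.pi / L) + Real.pi / L) ^ 2
      - Real.pi / (2 * L) : ℝ) : ℂ) = ((2 * Real.pi / L : ℝ) : ℂ) * (j * (j + 1))
        - ((a ^ 2 * L / (2 * Real.pi) : ℝ) : ℂ) - a * (-2 * j - ((a * L / Real.pi + 1 : ℝ) : ℂ)) := by
    have hpi' : (Real.pi : ℂ) ≠ 0 := by exact_mod_cast hpi.ne'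
    have hL' : (L : ℂ) ≠ 0 := by exact_mod_cast hL.ne'
    push_cast
    field_simp
    ring
  rw [key]
  module

lemma hamFun_fold (e : ℝ) {L : ℝ} (hL : 0 < L) {T : Finset ℤ} {g : ℝ → ℂ} (hg : g ∈ testFun)
    (hT : Covers L T g) {v : Fin𝓕} (hv : v ∈ F00) {a : ℝ} (ha : |a| < 2 * Real.pi / L + 1) :
    hamFun e L (fold L g v) a =
      foldFun L T (osc (e ^ 2 / (2 * L)) (L / (2 * Real.pi)) (Real.pi / (2 * L)) (Real.pi / L) g)
        (toℋ₀ v) a + foldFun L T g (fockHam e L v) a := by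
  have hev : (fun b => toℋ₀ (fold L g v b)) =ᶠ[𝓝 a] foldFun L T g (toℋ₀ v) := by
    have : ∀ᶠ b in 𝓝 a, |b| < 2 * Real.pi / L + 1 := continuousAt_id.abs.eventually_lt_const ha
    filter_upwards [this] with b hb using toℋ₀_fold hT hv.1 hb.le
  have hd : Differentiable ℝ (deriv g) := (contDiff_deriv' hg.1).differentiable (by simp)
  rw [hamFun, hev.iteratedDeriv_eq, iteratedDeriv_succ, iteratedDeriv_one,
    deriv_foldFun L T (hg.1.differentiable (by simp)), deriv_foldFun L T hd,
    fold_eq_sum (fun j hj => hT j hj a ha.le), map_sum]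
  simp only [foldFun, Finset.smul_sum, ← Finset.sum_neg_distrib, ← Finset.sum_add_distrib]
  refine Finset.sum_congr rfl fun j _ => ?_
  rw [map_smul, potential_zpow_gauge e hL hv, osc]
  push_cast
  module

lemma osc_mem {α β γ δ : ℝ} {g : ℝ → ℂ} (hg : g ∈ testFun) : osc α β γ δ g ∈ testFun :=
  ⟨contDiff_osc hg.1, hasCompactSupport_osc hg.2⟩

lemma hamMap_fold (e : ℝ) {L : ℝ} (hL : 0 < L) {T : Finset ℤ} {g : ℝ → ℂ} (hg : g ∈ testFun)
    (hT : Covers L T g) {v : Fin𝓕} (hv : v ∈ F00) :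
    hamMap e L ⟨fold L g v, fold_mem hL hg hv.1⟩ = foldL L T (osc_mem (α := e ^ 2 / (2 * L))
        (β := L / (2 * Real.pi)) (γ := Real.pi / (2 * L)) (δ := Real.pi / L) hg).1.continuous (toℋ₀ v)
      + foldL L T hg.1.continuous (fockHam e L v) := by
  rw [← toLp_eq_foldL, ← toLp_eq_foldL, ← MemLp.toLp_add]
  refine MemLp.toLp_congr (memLp_of_continuous L (continuous_hamFun e L
    (fold_mem hL hg hv.1).1)) _ ?_
  filter_upwards [ae_restrict_mem measurableSet_Icc] with a ha
  exact hamFun_fold e hL hg hT hv (by rw [abs_of_nonneg ha.1]; linarith [ha.2])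

lemma pointwise_foldL {L : ℝ} (T : Finset ℤ) {g : ℝ → ℂ} (hg : Continuous g) {U : ℋ₀ ≃ₗᵢ[ℂ] ℋ₀}
    (hU : ∀ (j : ℤ) x, (gaugeH ^ j) (U x) = U ((gaugeH ^ j) x)) (x : ℋ₀) :
    pointwise L U (foldL L T hg x) = foldL L T hg (U x) := by
  refine Lp.ext ?_
  have h1 := (U.toContinuousLinearEquiv : ℋ₀ →L[ℂ] ℋ₀).coeFn_compLpL (foldL L T hg x)
  filter_upwards [h1, coeFn_foldL L T hg x, coeFn_foldL L T hg (U x)] with a e1 e2 e3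
  refine e1.trans ?_
  rw [e2, e3]
  simp [foldFun, hU]

lemma inner_wtOp_eq_zero {f : Mode → ℤ} {u v : Fin𝓕} {c d : ℝ} (hu : u ∈ 𝓕₀)
    (h : wtOp f u = (c : ℂ) • u) (h' : wtOp f v = (d : ℂ) • v) (hcd : c ≠ d) :
    ⟪toℋ₀ u, toℋ₀ v⟫_ℂ = 0 := by
  have := (isNice_wtOp f).inner hu v
  rw [h, h', map_smul, map_smul, inner_smul_left, inner_smul_right, Complex.conj_ofReal,
    ← sub_eq_zero, ← sub_mul] at this
  refine (mul_eq_zero.1 this).resolve_left ?_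
  exact_mod_cast sub_ne_zero.2 hcd

lemma inner_zpow_gaugeH {v : Fin𝓕} (hv : v ∈ F00) {i j : ℤ} (hij : i ≠ j) :
    ⟪(gaugeH ^ i) (toℋ₀ v), (gaugeH ^ j) (toℋ₀ v)⟫_ℂ = 0 := by
  rw [← toℋ₀_zpow_gauge i hv.1, ← toℋ₀_zpow_gauge j hv.1]
  refine inner_wtOp_eq_zero (f := axialWt) (c := -2 * i) (d := -2 * j) (zpow_mem_𝓕₀ i hv.1) ?_ ?_ ?_
  · rw [axial_zpow_gauge_of_eq_zero i hv.2]
    push_cast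
    rfl
  · rw [axial_zpow_gauge_of_eq_zero j hv.2]
    push_cast
    rfl
  · intro h
    exact hij (by exact_mod_cast mul_left_cancel₀ (by norm_num) h)

lemma norm_sq_foldFun {L : ℝ} (T : Finset ℤ) (g : ℝ → ℂ) {v : Fin𝓕} (hv : v ∈ F00) (a : ℝ) :
    ‖foldFun L T g (toℋ₀ v) a‖ ^ 2 =
      ∑ j ∈ T, ‖g (a + j * (2 * Real.pi / L))‖ ^ 2 * ‖toℋ₀ v‖ ^ 2 := by
  classical
  have h : ((‖foldFun L T g (toℋ₀ v) a‖ ^ 2 : ℝ) : ℂ) =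
      ((∑ j ∈ T, ‖g (a + j * (2 * Real.pi / L))‖ ^ 2 * ‖toℋ₀ v‖ ^ 2 : ℝ) : ℂ) := by
    have h1 := inner_self_eq_norm_sq_to_K (𝕜 := ℂ) (foldFun L T g (toℋ₀ v) a)
    push_cast
    refine h1.symm.trans ?_
    rw [foldFun, sum_inner]
    refine Finset.sum_congr rfl fun i hi => ?_
    rw [inner_sum, Finset.sum_eq_single i]
    · rw [inner_smul_left, inner_smul_right, LinearIsometryEquiv.inner_map_map,
        inner_self_eq_norm_sq_to_K, ← mul_assoc, Complex.conj_mul']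
      rfl
    · intro j _ hj
      rw [inner_smul_left, inner_smul_right, inner_zpow_gaugeH hv hj.symm, mul_zero, mul_zero]
    · exact fun h => absurd hi h
  exact_mod_cast h

lemma norm_sq_eq_integral {L : ℝ} (η : 𝒦 L) :
    ‖η‖ ^ 2 = ∫ a in Set.Icc 0 (2 * Real.pi / L), ‖η a‖ ^ 2 := by
  have h1 := inner_self_eq_norm_sq_to_K (𝕜 := ℂ) η
  rw [L2.inner_def] at h1
  simp only [inner_self_eq_norm_sq_to_K] at h1
  have h2 : ((∫ a in Set.Icc 0 (2 * Real.pi / L), ‖η a‖ ^ 2 : ℝ) : ℂ) = ((‖η‖ ^ 2 : ℝ) : ℂ) := by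
    rw [← integral_complex_ofReal]
    push_cast
    exact h1
  exact (by exact_mod_cast h2.symm)

lemma sum_integral_le {L : ℝ} (hL : 0 < L) (T : Finset ℤ) {f : ℝ → ℝ} (hf : Integrable f)
    (h0 : ∀ x, 0 ≤ f x) :
    ∑ j ∈ T, ∫ a in Set.Icc 0 (2 * Real.pi / L), f (a + j * (2 * Real.pi / L)) ≤ ∫ x, f x := by
  have hp : 0 ≤ 2 * Real.pi / L := by have := Real.pi_pos; positivity
  have h1 : ∀ j : ℤ, ∫ a in Set.Icc 0 (2 * Real.pi / L), f (a + j * (2 * Real.pi / L)) =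
      ∫ x in Set.Ioc (0 + j • (2 * Real.pi / L)) (0 + (j + 1) • (2 * Real.pi / L)), f x := fun j => by
    rw [integral_Icc_eq_integral_Ioc, ← intervalIntegral.integral_of_le hp,
      intervalIntegral.integral_comp_add_right,
      intervalIntegral.integral_of_le (by linarith)]
    congr 3
    · simp
    · simp
      ring
  simp only [h1]
  rw [← integral_biUnion_finset T (fun j _ => measurableSet_Ioc)
    ((Set.pairwise_disjoint_Ioc_add_zsmul 0 (2 * Real.pi / L)).set_pairwise _)
    (fun j _ => hf.integrableOn)]
  exact setIntegral_le_integral hf (ae_of_all _ h0)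

/-- The vectors `Γ^j v` are mutually orthogonal, having different axial charges, and the translated
periods are disjoint. The norm over one period is therefore at most the norm over the line. -/
lemma norm_sq_foldL_le {L : ℝ} (hL : 0 < L) (T : Finset ℤ) {g : ℝ → ℂ} (hg : g ∈ testFun)
    {v : Fin𝓕} (hv : v ∈ F00) :
    ‖foldL L T hg.1.continuous (toℋ₀ v)‖ ^ 2 ≤ (∫ x, ‖g x‖ ^ 2) * ‖toℋ₀ v‖ ^ 2 := by
  have hc : HasCompactSupport g := hg.2
  have hc' : HasCompactSupport fun x => ‖g x‖ ^ 2 := by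
    refine hc.mono fun x hx h0 => hx ?_
    simp only [h0, norm_zero]
    norm_num
  have hi : Integrable fun x => ‖g x‖ ^ 2 :=
    Continuous.integrable_of_hasCompactSupport (hg.1.continuous.norm.pow 2) hc'
  have h1 : ∫ a in Set.Icc 0 (2 * Real.pi / L), ‖foldL L T hg.1.continuous (toℋ₀ v) a‖ ^ 2 =
      ∫ a in Set.Icc 0 (2 * Real.pi / L),
        ∑ j ∈ T, ‖g (a + j * (2 * Real.pi / L))‖ ^ 2 * ‖toℋ₀ v‖ ^ 2 := by
    refine integral_congr_ae ?_
    filter_upwards [coeFn_foldL L T hg.1.continuous (toℋ₀ v)] with a ha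
    rw [ha, norm_sq_foldFun T g hv]
  rw [norm_sq_eq_integral, h1, integral_finsetSum _ fun j _ =>
    ((hi.comp_add_right _).mul_const _).integrableOn]
  simp only [integral_mul_const]
  rw [← Finset.sum_mul]
  exact mul_le_mul_of_nonneg_right (sum_integral_le hL T hi fun x => by positivity) (by positivity)

/-! ### Totality of the elementary covariant functions -/

lemma foldFun_eq_of_mem {L : ℝ} {T : Finset ℤ} {f : ℝ → ℂ}
    (hf : ∀ x, x ∉ Set.Ioo 0 (2 * Real.pi / L) → f x = 0) {j : ℤ} (hj : j ∈ T) (x : ℋ₀) {a : ℝ}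
    (ha : a ∈ Set.Icc 0 (2 * Real.pi / L)) :
    foldFun L T (fun b => f (b - j * (2 * Real.pi / L))) x a = f a • (gaugeH ^ j) x := by
  rw [foldFun, Finset.sum_eq_single j, add_sub_cancel_right]
  · intro i _ hij
    rw [hf, zero_smul]
    rintro ⟨h1, h2⟩
    have hp : 0 ≤ 2 * Real.pi / L := ha.1.trans ha.2
    rcases lt_or_gt_of_ne hij with h | h
    · have : (i : ℝ) + 1 ≤ j := by exact_mod_cast h
      nlinarith [mul_le_mul_of_nonneg_right this hp, ha.2]
    · have : (j : ℝ) + 1 ≤ i := by exact_mod_cast h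
      nlinarith [mul_le_mul_of_nonneg_right this hp, ha.1]
  · exact fun h => absurd hj h

lemma exists_zpow_eq_Ω {s : Occ} (hs : s.1.card = s.2.card) :
    ∃ j : ℤ, ∃ v ∈ F00, (gaugeEquiv ^ j) v = Ω s := by
  obtain ⟨k, hk⟩ := even_wt_axialWt hs
  refine ⟨k, (gaugeEquiv ^ (-k)) (Ω s), ⟨zpow_mem_𝓕₀ _ (Ω_mem_𝓕₀.2 hs), ?_⟩, ?_⟩
  · rw [SetLike.mem_coe, LinearMap.mem_ker, ← axialProj_eq_self_iff, axialProj_zpow_Ω hk, if_pos rfl]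
  · rw [← LinearEquiv.mul_apply, ← zpow_add, add_neg_cancel]
    rfl

lemma eq_zero_of_inner_toℋ₀ {x : ℋ₀} (h : ∀ s : Neutral, ⟪x, toℋ₀ (Ω s)⟫_ℂ = 0) : x = 0 := by
  ext s
  have h1 := h s
  rw [toℋ₀_Ω_of_neutral s.2, lp.inner_single_right] at h1
  simpa using h1

/-- The elementary covariant functions are total. -/
lemma eq_zero_of_inner_incl {L : ℝ} (hL : 0 < L) {η : 𝒦 L}
    (h : ∀ (g : ℝ → ℂ) (hg : g ∈ testFun) (T : Finset ℤ), Covers L T g → ∀ v ∈ F00,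
      ⟪η, foldL L T hg.1.continuous (toℋ₀ v)⟫_ℂ = 0) : η = 0 := by
  have hs : ∀ s : Neutral, ∀ᵐ a, a ∈ Set.Ioo 0 (2 * Real.pi / L) → ⟪η a, toℋ₀ (Ω s)⟫_ℂ = 0 := by
    intro s
    -- A bump inside the base period, moved by `j` periods and folded with `v`, is within that
    -- period the bump times `Ω s`. Such functions detect every component of `η`.
    obtain ⟨j, v, hv, hvs⟩ := exists_zpow_eq_Ω s.2
    have hint : Integrable (fun a => ⟪η a, toℋ₀ (Ω s)⟫_ℂ) (circleMeasure L) :=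
      (memLp_one_iff_integrable.1 ((Lp.memLp η).mono_exponent (by norm_num))).inner_const _
    refine isOpen_Ioo.ae_eq_zero_of_integral_contDiff_smul_eq_zero
      (IntegrableOn.mono_set hint Set.Ioo_subset_Icc_self).locallyIntegrableOn
      fun f hf hfc hfs => ?_
    have hf0 : ∀ x, x ∉ Set.Ioo 0 (2 * Real.pi / L) → (f x : ℂ) = 0 := fun x hx => by
      rw [image_eq_zero_of_notMem_tsupport fun h => hx (hfs h), Complex.ofReal_zero]
    have hsub : ContDiff ℝ ∞ fun b : ℝ => f (b - j * (2 * Real.pi / L)) :=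
      hf.comp (contDiff_id.sub contDiff_const)
    have hg : (fun b => (f (b - j * (2 * Real.pi / L)) : ℂ)) ∈ testFun := by
      refine ⟨Complex.ofRealCLM.contDiff.comp hsub, ?_⟩
      have h1 := hfc.comp_homeomorph (Homeomorph.subRight ((j : ℝ) * (2 * Real.pi / L)))
      exact h1.comp_left (g := Complex.ofReal) rfl
    obtain ⟨T, hT⟩ := exists_covers hL hg
    have h2 := h _ hg _ (hT.mono (Finset.subset_insert j T)) v hv
    rw [L2.inner_def] at h2
    have h3 : ∫ a, ⟪η a, foldL L (insert j T) hg.1.continuous (toℋ₀ v) a⟫_ℂ ∂circleMeasure L =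
        ∫ a in Set.Icc 0 (2 * Real.pi / L), f a • ⟪η a, toℋ₀ (Ω s)⟫_ℂ := by
      refine integral_congr_ae ?_
      filter_upwards [coeFn_foldL L (insert j T) hg.1.continuous (toℋ₀ v),
        ae_restrict_mem measurableSet_Icc] with a ha ha'
      rw [ha, foldFun_eq_of_mem (f := fun x => (f x : ℂ)) hf0 (Finset.mem_insert_self j T) _ ha',
        ← toℋ₀_zpow_gauge j hv.1, hvs, inner_smul_right, Complex.real_smul]
    rw [h3] at h2
    rw [← h2, eq_comm]
    refine setIntegral_eq_integral_of_forall_compl_eq_zero fun a ha => ?_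
    have : f a = 0 := by exact_mod_cast hf0 a fun h => ha (Set.Ioo_subset_Icc_self h)
    rw [this, zero_smul]
  refine Lp.ext ?_
  have h1 : ∀ᵐ a, ∀ s : Neutral, a ∈ Set.Ioo 0 (2 * Real.pi / L) → ⟪η a, toℋ₀ (Ω s)⟫_ℂ = 0 :=
    ae_all_iff.2 hs
  have h0 : ∀ f : ℝ → ℋ₀, (∀ᵐ a, a ∈ Set.Ioo 0 (2 * Real.pi / L) → f a = 0) →
      ∀ᵐ a ∂circleMeasure L, f a = 0 := fun f hf => by
    rwa [circleMeasure, ← restrict_Ioo_eq_restrict_Icc, ae_restrict_iff' measurableSet_Ioo]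
  have h2 : ∀ᵐ a ∂circleMeasure L, η a = 0 := h0 η <| by
    filter_upwards [h1] with a ha ha'
    exact eq_zero_of_inner_toℋ₀ fun s => ha s ha'
  filter_upwards [h2, Lp.coeFn_zero ℋ₀ 2 (circleMeasure L)] with a ha ha'
  rw [ha, ha']
  rfl

lemma dense_range_incl {L : ℝ} (hL : 0 < L) : Dense (LinearMap.range (incl L) : Set (𝒦 L)) := by
  rw [Submodule.dense_iff_topologicalClosure_eq_top, Submodule.topologicalClosure_eq_top_iff,
    Submodule.eq_bot_iff]
  intro η hη
  refine eq_zero_of_inner_incl hL fun g hg T hT v hv => ?_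
  rw [← incl_fold hL hg hT hv.1]
  exact Submodule.inner_left_of_mem_orthogonal (LinearMap.mem_range_self _ _) hη

/-! ### Symmetry of the Hamiltonian -/

lemma toℋ₀_periodic {L : ℝ} {Ψ : ℝ → Fin𝓕} (hΨ : Ψ ∈ 𝒟 L) (a : ℝ) :
    gaugeH (toℋ₀ (Ψ (a + 2 * Real.pi / L))) = toℋ₀ (Ψ a) := by
  rw [gaugeH_toℋ₀ (hΨ.1.mem _), hΨ.2]

lemma deriv_toℋ₀_periodic {L : ℝ} {Ψ : ℝ → Fin𝓕} (hΨ : Ψ ∈ 𝒟 L) (a : ℝ) :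
    gaugeH (deriv (fun b => toℋ₀ (Ψ b)) (a + 2 * Real.pi / L)) = deriv (fun b => toℋ₀ (Ψ b)) a := by
  have hd : Differentiable ℝ fun b => toℋ₀ (Ψ b) := (hΨ.1.contDiff_comp toℋ₀).differentiable (by simp)
  have h1 := (hd (a + 2 * Real.pi / L)).hasDerivAt.comp_add_const a (2 * Real.pi / L)
  have h2 := ((gaugeH.toContinuousLinearEquiv : ℋ₀ →L[ℂ] ℋ₀).restrictScalars ℝ).hasFDerivAt.comp_hasDerivAt a h1
  refine (HasDerivAt.deriv (h2.congr_of_eventuallyEq (Eventually.of_forall fun b => ?_))).symm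
  exact (toℋ₀_periodic hΨ b).symm

lemma inner_potential (e : ℝ) {L : ℝ} (hL : 0 < L) (a : ℝ) {v w : Fin𝓕} (hv : v ∈ 𝓕₀) (hw : w ∈ 𝓕₀) :
    ⟪potential e L a v, toℋ₀ w⟫_ℂ = ⟪toℋ₀ v, potential e L a w⟫_ℂ := by
  have h1 := (isNice_wtOp energyWt).inner hv w
  have h2 := (isNice_wtOp axialWt).inner hv w
  have h3 := coulomb_symm (e := e) hL hv hw
  rw [potential, diracHam_eq hL, axialChargeReg, axialCharge_eq]
  simp only [LinearMap.add_apply, LinearMap.comp_apply, LinearMap.sub_apply, LinearMap.smul_apply,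
    map_sub, map_smul, Module.End.one_apply, inner_add_left, inner_add_right, inner_sub_left,
    inner_sub_right, inner_smul_left, inner_smul_right, Complex.conj_ofReal, h1, h2, h3]

/-- Integration by parts: the difference is the integral of the derivative of the Wronskian. Values
and derivatives at the two endpoints are related by the same unitary `gaugeH`, so the boundary terms
cancel. -/
lemma inner_hamMap (e : ℝ) {L : ℝ} (hL : 0 < L) (Ψ Φ : 𝒟 L) :
    ⟪hamMap e L Ψ, incl L Φ⟫_ℂ = ⟪incl L Ψ, hamMap e L Φ⟫_ℂ := by
  have hp : 0 ≤ 2 * Real.pi / L := by have := Real.pi_pos; positivity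
  set ψ : ℝ → ℋ₀ := fun b => toℋ₀ (Ψ.1 b) with hψ
  set φ : ℝ → ℋ₀ := fun b => toℋ₀ (Φ.1 b) with hφ
  have cψ : ContDiff ℝ ∞ ψ := Ψ.2.1.contDiff_comp toℋ₀
  have cφ : ContDiff ℝ ∞ φ := Φ.2.1.contDiff_comp toℋ₀
  have cψ' : ContDiff ℝ ∞ (deriv ψ) := (contDiff_infty_iff_deriv.1 cψ).2
  have cφ' : ContDiff ℝ ∞ (deriv φ) := (contDiff_infty_iff_deriv.1 cφ).2
  have cψ'' : ContDiff ℝ ∞ (deriv (deriv ψ)) := (contDiff_infty_iff_deriv.1 cψ').2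
  have cφ'' : ContDiff ℝ ∞ (deriv (deriv φ)) := (contDiff_infty_iff_deriv.1 cφ').2
  have e1 : ⟪hamMap e L Ψ, incl L Φ⟫_ℂ =
      ∫ a in Set.Icc 0 (2 * Real.pi / L), ⟪hamFun e L Ψ.1 a, φ a⟫_ℂ := by
    rw [L2.inner_def]
    refine integral_congr_ae ?_
    filter_upwards [(memLp_of_continuous L (continuous_hamFun e L Ψ.2.1)).coeFn_toLp,
      (memLp_of_continuous L cφ.continuous).coeFn_toLp] with a h1 h2
    exact congrArg₂ (inner ℂ) h1 h2
  have e2 : ⟪incl L Ψ, hamMap e L Φ⟫_ℂ =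
      ∫ a in Set.Icc 0 (2 * Real.pi / L), ⟪ψ a, hamFun e L Φ.1 a⟫_ℂ := by
    rw [L2.inner_def]
    refine integral_congr_ae ?_
    filter_upwards [(memLp_of_continuous L (continuous_hamFun e L Φ.2.1)).coeFn_toLp,
      (memLp_of_continuous L cψ.continuous).coeFn_toLp] with a h1 h2
    exact congrArg₂ (inner ℂ) h2 h1
  have c1 : Continuous fun a => ⟪hamFun e L Ψ.1 a, φ a⟫_ℂ :=
    (continuous_hamFun e L Ψ.2.1).inner cφ.continuous
  have c2 : Continuous fun a => ⟪ψ a, hamFun e L Φ.1 a⟫_ℂ :=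
    cψ.continuous.inner (continuous_hamFun e L Φ.2.1)
  have key : ∀ a, HasDerivAt (fun a => ((e ^ 2 / (2 * L) : ℝ) : ℂ) *
      (⟪ψ a, deriv φ a⟫_ℂ - ⟪deriv ψ a, φ a⟫_ℂ))
      (⟪hamFun e L Ψ.1 a, φ a⟫_ℂ - ⟪ψ a, hamFun e L Φ.1 a⟫_ℂ) a := fun a => by
    have d1 := (cψ.differentiable (by simp) a).hasDerivAt
    have d2 := (cφ.differentiable (by simp) a).hasDerivAt
    have d3 := (cψ'.differentiable (by simp) a).hasDerivAt
    have d4 := (cφ'.differentiable (by simp) a).hasDerivAt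
    refine (((d1.inner ℂ d4).sub (d3.inner ℂ d2)).const_mul _).congr_deriv ?_
    have h := inner_potential e hL a (Ψ.2.1.mem a) (Φ.2.1.mem a)
    simp only [hamFun, iteratedDeriv_succ, iteratedDeriv_zero, inner_add_left, inner_add_right,
      inner_neg_left, inner_neg_right, inner_smul_left, inner_smul_right, Complex.conj_ofReal]
    change _ = -(_ * ⟪deriv (deriv ψ) a, φ a⟫_ℂ) + _ - (-(_ * ⟪ψ a, deriv (deriv φ) a⟫_ℂ) + _)
    rw [h]
    ring
  have hint := intervalIntegral.integral_eq_sub_of_hasDerivAt (fun a _ => key a)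
    ((c1.sub c2).intervalIntegrable 0 (2 * Real.pi / L))
  have hψ0 := toℋ₀_periodic Ψ.2 0
  have hφ0 := toℋ₀_periodic Φ.2 0
  have hψ1 := deriv_toℋ₀_periodic Ψ.2 0
  have hφ1 := deriv_toℋ₀_periodic Φ.2 0
  rw [zero_add] at hψ0 hφ0 hψ1 hφ1
  have b1 : ⟪ψ (2 * Real.pi / L), deriv φ (2 * Real.pi / L)⟫_ℂ = ⟪ψ 0, deriv φ 0⟫_ℂ := by
    rw [← gaugeH.inner_map_map]
    exact congrArg₂ (inner ℂ) hψ0 hφ1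
  have b2 : ⟪deriv ψ (2 * Real.pi / L), φ (2 * Real.pi / L)⟫_ℂ = ⟪deriv ψ 0, φ 0⟫_ℂ := by
    rw [← gaugeH.inner_map_map]
    exact congrArg₂ (inner ℂ) hψ1 hφ0
  rw [b1, b2, sub_self, intervalIntegral.integral_sub (c1.intervalIntegrable _ _)
    (c2.intervalIntegrable _ _), sub_eq_zero, intervalIntegral.integral_of_le hp,
    intervalIntegral.integral_of_le hp, ← integral_Icc_eq_integral_Ioc,
    ← integral_Icc_eq_integral_Ioc] at hint
  rw [e1, e2, hint]

lemma isFormalAdjoint_hamiltonian (e : ℝ) {L : ℝ} (hL : 0 < L) :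
    (hamiltonian e L).IsFormalAdjoint (hamiltonian e L) := by
  rw [isFormalAdjoint_iff]
  intro x y x' y' h h'
  obtain ⟨Ψ, rfl, rfl⟩ := (mem_graph_operatorOnRange _).1 h
  obtain ⟨Φ, rfl, rfl⟩ := (mem_graph_operatorOnRange _).1 h'
  exact inner_hamMap e hL Ψ Φ

/-! ### The dressed Hamiltonian on elementary covariant functions -/

lemma isClosable_hamiltonian (e : ℝ) {L : ℝ} (hL : 0 < L) : (hamiltonian e L).IsClosable :=
  isClosable_of_symm (dense_range_incl hL) (isFormalAdjoint_hamiltonian e hL)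

lemma foldL_mem_graph_hamiltonian (e : ℝ) {L : ℝ} (hL : 0 < L) {T : Finset ℤ} {g : ℝ → ℂ}
    (hg : g ∈ testFun) (hT : Covers L T g) {v : Fin𝓕} (hv : v ∈ F00) :
    (foldL L T hg.1.continuous (toℋ₀ v), foldL L T (osc_mem (α := e ^ 2 / (2 * L))
        (β := L / (2 * Real.pi)) (γ := Real.pi / (2 * L)) (δ := Real.pi / L) hg).1.continuous (toℋ₀ v)
      + foldL L T hg.1.continuous (fockHam e L v)) ∈ (hamiltonian e L).graph :=
  (mem_graph_operatorOnRange _).2 ⟨_, incl_fold hL hg hT hv.1, hamMap_fold e hL hg hT hv⟩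

/-- The vectors of the Bogoliubov transformed Fock space are approximated by finite particle
states, together with their images under `fockHam`. -/
lemma exists_seq_fockHam (e : ℝ) {L : ℝ} (hL : 0 < L) {N : ℕ} {v : Fin𝓕} (hv : v ∈ F00)
    (hN : IsHom N v) :
    ∃ u : ℕ → Fin𝓕, (∀ n, u n ∈ F00) ∧
      Tendsto (fun n => toℋ₀ (u n)) atTop (𝓝 ((bogRel e hL).group (-1) (toℋ₀ v))) ∧
      Tendsto (fun n => fockHam e L (u n)) atTop
        (𝓝 ((bogRel e hL).group (-1) (toℋ₀ (freeHam e L N v)))) := by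
  set χ := (bogRel e hL).evol (-1) (toℋ₀ (energyOne v)) with hχ
  have hD : fockScale.D χ = (bogRel e hL).group (-1) (toℋ₀ v) := by
    rw [hχ, RelBounded.D_evol, fockScale_D_energyOne]
  have cD : ∀ x, axialProjL (fockScale.D x) = fockScale.D (axialProjL x) :=
    fun x => diagL_comm (hw' := abs_inv_nrg_le) x
  have cP : ∀ n x, axialProjL (fockScale.P n x) = fockScale.P n (axialProjL x) :=
    fun n x => diagL_comm (C' := 1) (hw' := fun s => by split_ifs <;> simp) x
  -- The group preserves the axial charge, and so do the energy cutoffs; the approximants therefore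
  -- stay in the sector.
  have hax : axialProjL χ = χ := by
    refine fockScale.D_injective ?_
    rw [← cD, hD, axialProjL_group, axialProjL_toℋ₀, axialProj_eq_self_iff.2 hv.2]
  choose y hy hPy using fun n => exists_fockScale_P n χ
  have hu : ∀ n, toℋ₀ (energyOneInv (y n)) = fockScale.D (fockScale.P n χ) := fun n => by
    rw [← fockScale_D_energyOne, energyOne_energyOneInv, hPy]
  have hu0 : ∀ n, energyOneInv (y n) ∈ 𝓕₀ := fun n => diagOp_mem_𝓕₀ _ (hy n)
  -- The approximants are `D (P n χ)`, with `χ` equal to `D⁻¹ U⁻¹ v`. As `fockHam` is bounded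
  -- relative to the energy, convergence of the cutoffs of `χ` gives convergence of the images as
  -- well.
  refine ⟨fun n => energyOneInv (y n), fun n => ⟨hu0 n, ?_⟩, ?_, ?_⟩
  · rw [SetLike.mem_coe, LinearMap.mem_ker, ← axialProj_eq_self_iff, ← sub_eq_zero]
    refine eq_zero_of_toℋ₀ (𝓕₀.sub_mem (diagOp_mem_𝓕₀ _ (hu0 n)) (hu0 n)) ?_
    rw [map_sub, ← axialProjL_toℋ₀, hu, cD, cP, hax, sub_self]
  · simp only [hu]
    rw [← hD]
    exact (fockScale.D.continuous.tendsto χ).comp (fockScale.tendsto_P χ)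
  · have h1 : ∀ n, fockHam e L (energyOneInv (y n)) =
        (((2 * Real.pi / L : ℝ) : ℂ) • (1 - fockScale.D) + coulL e L) (fockScale.P n χ) := fun n => by
      rw [hPy, ← energyOne_energyOneInv (y n), add_apply, smul_apply, energyL_energyOne,
        coulL_energyOne hL (hu0 n), energyOne_energyOneInv]
      rfl
    simp only [h1]
    rw [← dressed_eq e hL hN]
    exact ((((2 * Real.pi / L : ℝ) : ℂ) • (1 - fockScale.D) + coulL e L).continuous.tendsto χ).comp
      (fockScale.tendsto_P χ)

lemma group_one_symm (e : ℝ) {L : ℝ} (hL : 0 < L) (x : ℋ₀) :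
    (bogRel e hL).group 1 ((bogRel e hL).group (-1) x) = x := by
  rw [← RelBounded.group_add, add_neg_cancel, RelBounded.group_zero]

lemma pointwise_symm_foldL (e : ℝ) {L : ℝ} (hL : 0 < L) (T : Finset ℤ) {g : ℝ → ℂ}
    (hg : Continuous g) (x : ℋ₀) :
    (pointwise L ((bogRel e hL).group 1)).symm (foldL L T hg x) =
      foldL L T hg ((bogRel e hL).group (-1) x) := by
  rw [LinearIsometryEquiv.symm_apply_eq, pointwise_foldL T hg fun j x => zpow_gaugeH_group e hL 1 j x,
    group_one_symm]

/-- The undressed vector is only a limit of finite particle states, so the closure of `H` is used.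
`foldL` is continuous in its Fock space argument, which turns the approximation on `ℋ₀` into
convergence of graph points. -/
lemma foldL_mem_graph_dressed (e : ℝ) {L : ℝ} (hL : 0 < L) {T : Finset ℤ} {g : ℝ → ℂ}
    (hg : g ∈ testFun) (hT : Covers L T g) {N : ℕ} {v : Fin𝓕} (hv : v ∈ F00) (hN : IsHom N v) :
    (foldL L T hg.1.continuous (toℋ₀ v), foldL L T (osc_mem (α := e ^ 2 / (2 * L))
        (β := L / (2 * Real.pi)) (γ := Real.pi / (2 * L)) (δ := Real.pi / L) hg).1.continuous (toℋ₀ v)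
      + foldL L T hg.1.continuous (toℋ₀ (freeHam e L N v))) ∈
      (dressed e L ((bogRel e hL).group 1)).graph := by
  rw [dressed, mem_graph_conjugate, map_add, pointwise_symm_foldL, pointwise_symm_foldL,
    pointwise_symm_foldL, mem_graph_closure (isClosable_hamiltonian e hL)]
  obtain ⟨u, hu, h1, h2⟩ := exists_seq_fockHam e hL hv hN
  refine mem_closure_of_tendsto (((ContinuousLinearMap.continuous _).tendsto _).comp h1 |>.prodMk_nhds
    ((((ContinuousLinearMap.continuous _).tendsto _).comp h1).add
      (((ContinuousLinearMap.continuous _).tendsto _).comp h2)))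
    (Eventually.of_forall fun n => foldL_mem_graph_hamiltonian e hL hg hT (hu n))

lemma isHom_Ω {s : Occ} (hs : s.1.card = s.2.card) : IsHom (wt energyWt s).toNat (Ω s) := by
  refine ⟨Ω_mem_𝓕₀.2 hs, ?_⟩
  have h := nrg_nonneg s
  rw [nrg] at h
  rw [wtOp_Ω, Int.toNat_of_nonneg (by exact_mod_cast h)]

/-- Covariant functions are finite sums of elementary ones built on basis states, each of which has
a definite energy. -/
lemma range_incl_le_domain (e : ℝ) {L : ℝ} (hL : 0 < L) :
    LinearMap.range (incl L) ≤ (dressed e L ((bogRel e hL).group 1)).domain := by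
  rintro _ ⟨Ψ, rfl⟩
  obtain ⟨S, hS, hΨ⟩ := exists_eq_sum_fold hL Ψ.2
  have h1 : Ψ = ∑ s ∈ S.attach,
      ⟨fold L (fun a => Ψ.1 a s) (Ω s), fold_mem hL (hS s s.2).2 (hS s s.2).1.1⟩ := by
    refine Subtype.ext ?_
    rw [AddSubmonoidClass.coe_finsetSum]
    exact hΨ.trans (Finset.sum_attach S fun s => fold L (fun a => Ψ.1 a s) (Ω s)).symm
  rw [h1, map_sum]
  refine Submodule.sum_mem _ fun s _ => ?_
  obtain ⟨hs, hg⟩ := hS s s.2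
  obtain ⟨T, hT⟩ := exists_covers hL hg
  rw [incl_fold hL hg hT hs.1]
  exact LinearPMap.mem_domain_of_mem_graph
    (foldL_mem_graph_dressed e hL hg hT hs (isHom_Ω (Ω_mem_𝓕₀.1 hs.1)))

/-! ### Diagonalization at fixed energy -/

/-- A symmetric operator on a finite-dimensional space of finite particle states is
diagonalizable. -/
lemma mem_span_eigenvectors {V : Submodule ℂ Fin𝓕} [FiniteDimensional ℂ V] (hV : V ≤ 𝓕₀)
    {A : Module.End ℂ Fin𝓕} (hA : ∀ v ∈ V, A v ∈ V)
    (hs : ∀ v ∈ V, ∀ w ∈ V, ⟪toℋ₀ (A v), toℋ₀ w⟫_ℂ = ⟪toℋ₀ v, toℋ₀ (A w)⟫_ℂ) {v : Fin𝓕} (hv : v ∈ V) :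
    v ∈ Submodule.span ℂ {u | u ∈ V ∧ ∃ r : ℝ, A u = (r : ℂ) • u} := by
  have hinj : Function.Injective (toℋ₀ ∘ₗ V.subtype) := by
    rw [injective_iff_map_eq_zero]
    intro u hu
    exact Subtype.ext (eq_zero_of_toℋ₀ (hV u.2) hu)
  let E := LinearEquiv.ofInjective (toℋ₀ ∘ₗ V.subtype) hinj
  let B := E.toLinearMap ∘ₗ A.restrict hA ∘ₗ E.symm.toLinearMap
  have hB : B.IsSymmetric := fun x y => by
    obtain ⟨x, rfl⟩ := E.surjective x
    obtain ⟨y, rfl⟩ := E.surjective y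
    simp only [B, LinearMap.comp_apply, LinearEquiv.coe_coe, LinearEquiv.symm_apply_apply]
    exact hs x x.2 y y.2
  have : FiniteDimensional ℂ (LinearMap.range (toℋ₀ ∘ₗ V.subtype)) :=
    inferInstance
  have h := (hB.eigenvectorBasis rfl).sum_repr (E ⟨v, hv⟩)
  have h' := congrArg (fun x => (E.symm x : Fin𝓕)) h
  simp only [map_sum, map_smul, LinearEquiv.symm_apply_apply, AddSubmonoidClass.coe_finsetSum,
    SetLike.val_smul] at h'
  rw [← h']
  refine Submodule.sum_mem _ fun i _ => Submodule.smul_mem _ _ (Submodule.subset_span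
    ⟨Subtype.mem _, hB.eigenvalues rfl i, ?_⟩)
  have h2 := congrArg (fun x => (E.symm x : Fin𝓕)) (hB.apply_eigenvectorBasis rfl i)
  simp only [B, LinearMap.comp_apply, LinearEquiv.coe_coe, LinearEquiv.symm_apply_apply, map_smul] at h2
  exact h2

/-- The states of energy `N` without axial charge. -/
def energySpace (N : ℕ) : Submodule ℂ Fin𝓕 := F00 ⊓ LinearMap.ker (wtOp energyWt - (N : ℂ) • 1)

lemma mem_energySpace {N : ℕ} {v : Fin𝓕} : v ∈ energySpace N ↔ v ∈ F00 ∧ IsHom N v := by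
  rw [energySpace, Submodule.mem_inf, LinearMap.mem_ker, LinearMap.sub_apply, sub_eq_zero]
  constructor
  · rintro ⟨h1, h2⟩
    exact ⟨h1, h1.1, by simpa using h2⟩
  · rintro ⟨h1, h2⟩
    exact ⟨h1, by simpa using h2.energy⟩

lemma finiteDimensional_energySpace (N : ℕ) : FiniteDimensional ℂ (energySpace N) := by
  classical
  let S : Finset Occ := (Finset.Icc (-(N : ℤ)) N).powerset ×ˢ (Finset.Icc (-(N : ℤ)) N).powerset
  have hle : energySpace N ≤ Finsupp.supported ℂ ℂ (S : Set Occ) := by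
    intro v hv
    rw [Finsupp.mem_supported]
    intro s hs
    refine mem_Icc_of_nrg_le ?_
    have h := congrArg (fun u : Fin𝓕 => u s) (mem_energySpace.1 hv).2.energy
    simp only [wtOp_apply, Finsupp.smul_apply, smul_eq_mul] at h
    have h1 := mul_right_cancel₀ (Finsupp.mem_support_iff.1 hs) h
    have h2 : wt energyWt s = N := by exact_mod_cast h1
    rw [nrg, h2]
    simp
  have hfin : FiniteDimensional ℂ (Finsupp.supported ℂ ℂ (S : Set Occ)) := by
    rw [Finsupp.supported_eq_span_single]
    exact FiniteDimensional.span_of_finite ℂ (S.finite_toSet.image _)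
  exact Submodule.finiteDimensional_of_le hle

lemma freeHam_apply (e L : ℝ) (N : ℕ) (v : Fin𝓕) : freeHam e L N v =
    ∑ m ∈ pnUpTo N, ((freq e L m - 2 * Real.pi / L : ℝ) : ℂ) • numOp m v +
      ((2 * Real.pi / L * N + zeroPoint e L : ℝ) : ℂ) • v := by
  rw [freeHam, LinearMap.add_apply, LinearMap.sum_apply]
  rfl

lemma freeHam_mem_energySpace (e L : ℝ) {N : ℕ} {v : Fin𝓕} (hv : v ∈ energySpace N) :
    freeHam e L N v ∈ energySpace N := by
  rw [freeHam_apply]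
  refine Submodule.add_mem _ (Submodule.sum_mem _ fun m _ => Submodule.smul_mem _ _ ?_)
    (Submodule.smul_mem _ _ hv)
  rw [mem_energySpace] at hv ⊢
  have hm : (m : ℤ) ≠ 0 := m.2.ne'
  refine ⟨(isNice_numOp hm).left.map_F00 (shifts_numOp_axial hm) hv.1, ?_⟩
  have := hv.2.map (shifts_numOp hm) (isNice_numOp hm).left
  rwa [add_zero] at this

lemma inner_freeHam (e L : ℝ) {N : ℕ} {v w : Fin𝓕} (hv : v ∈ 𝓕₀) :
    ⟪toℋ₀ (freeHam e L N v), toℋ₀ w⟫_ℂ = ⟪toℋ₀ v, toℋ₀ (freeHam e L N w)⟫_ℂ := by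
  rw [freeHam_apply, freeHam_apply, map_add, map_add, map_sum, map_sum, inner_add_left,
    inner_add_right, sum_inner, inner_sum]
  congr 1
  · refine Finset.sum_congr rfl fun m _ => ?_
    rw [map_smul, map_smul, inner_smul_left, inner_smul_right, Complex.conj_ofReal,
      (isNice_numOp m.2.ne').inner hv]
  · rw [map_smul, map_smul, inner_smul_left, inner_smul_right, Complex.conj_ofReal]

lemma comp_mem_energySpace {v : Fin𝓕} (hv : v ∈ F00) (n : ℕ) : comp n v ∈ energySpace n := by
  refine mem_energySpace.2 ⟨⟨(isHom_comp n hv.1).mem, ?_⟩, isHom_comp n hv.1⟩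
  rw [SetLike.mem_coe, LinearMap.mem_ker]
  ext s
  have h := congrArg (fun u : Fin𝓕 => u s) (mem_F00.1 hv).2
  simp only [wtOp_apply, Finsupp.zero_apply] at h
  rw [wtOp_apply, comp, diagOp_apply, mul_left_comm, h, mul_zero, Finsupp.zero_apply]

/-- The states without axial charge are spanned by the eigenvectors of the dressed Hamiltonian. -/
lemma F00_le_span_eigenvectors (e L : ℝ) : F00 ≤ Submodule.span ℂ
    {u | u ∈ F00 ∧ ∃ N : ℕ, IsHom N u ∧ ∃ r : ℝ, freeHam e L N u = (r : ℂ) • u} := by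
  intro v hv
  obtain ⟨M, hM⟩ := exists_sum_comp v
  rw [hM]
  refine Submodule.sum_mem _ fun n _ => ?_
  have := finiteDimensional_energySpace n
  have h := mem_span_eigenvectors (V := energySpace n) (fun v hv => hv.1.1)
    (fun v hv => freeHam_mem_energySpace e L hv) (fun v hv w _ => inner_freeHam e L hv.1.1)
    (comp_mem_energySpace hv n)
  refine Submodule.span_mono ?_ h
  rintro u ⟨hu, r, hr⟩
  rw [mem_energySpace] at hu
  exact ⟨hu.1, n, hu.2, r, hr⟩

/-! ### Essential self-adjointness -/

lemma foldL_add (L : ℝ) (T : Finset ℤ) {g h k : ℝ → ℂ} (hg : Continuous g) (hh : Continuous h)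
    (hk : Continuous k) {c : ℂ} (hc : ∀ x, k x = g x + c * h x) (x : ℋ₀) :
    foldL L T hg x + c • foldL L T hh x = foldL L T hk x := by
  rw [← toLp_eq_foldL, ← toLp_eq_foldL, ← toLp_eq_foldL, ← MemLp.toLp_const_smul, ← MemLp.toLp_add]
  congr 1
  funext a
  simp only [foldFun, Pi.add_apply, Pi.smul_apply, Finset.smul_sum, ← Finset.sum_add_distrib, hc,
    add_smul, mul_smul]

/-- A deficiency vector is orthogonal to the elementary covariant functions built from an
eigenvector. -/
lemma inner_foldL_eq_zero {e L : ℝ} (he : 0 < e) (hL : 0 < L) {c : ℂ} (hc : c.im ≠ 0) {η : 𝒦 L}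
    (hη : ∀ x y, x ∈ LinearMap.range (incl L) →
      (x, y) ∈ (dressed e L ((bogRel e hL).group 1)).graph → ⟪η, y + c • x⟫_ℂ = 0)
    {N : ℕ} {u : Fin𝓕} (hu : u ∈ F00) (hN : IsHom N u) {r : ℝ}
    (hr : freeHam e L N u = (r : ℂ) • u) {f : ℝ → ℂ} (hf : f ∈ testFun) {T : Finset ℤ}
    (hT : Covers L T f) : ⟪η, foldL L T hf.1.continuous (toℋ₀ u)⟫_ℂ = 0 := by
  have hpi := Real.pi_pos
  have key : ∀ ε : ℝ, 0 < ε →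
      ‖⟪η, foldL L T hf.1.continuous (toℋ₀ u)⟫_ℂ‖ ^ 2 ≤ ‖η‖ ^ 2 * (ε * ‖toℋ₀ u‖ ^ 2) := fun ε hε => by
    -- The eigenvalue `r` is absorbed in the constant of the oscillator, and `μ = -c` is nonreal, so
    -- `f` is approximated by images of the dressed operator plus `c`.
    obtain ⟨g, hg⟩ := exists_osc_sub_close (α := e ^ 2 / (2 * L)) (β := L / (2 * Real.pi))
      (γ := Real.pi / (2 * L) - r) (δ := Real.pi / L) (μ := -c) (by positivity) (by positivity)
      (by simpa using hc) ⟨f, hf⟩ hε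
    obtain ⟨T', hT'⟩ := exists_covers hL g.2
    have hx := hη _ _ ⟨_, incl_fold hL g.2 (hT'.mono Finset.subset_union_right) hu.1⟩
      (foldL_mem_graph_dressed e hL g.2 (hT'.mono (Finset.subset_union_right (s₁ := T))) hu hN)
    have hk : (fun x => f x - (osc (e ^ 2 / (2 * L)) (L / (2 * Real.pi)) (Real.pi / (2 * L) - r)
        (Real.pi / L) g x - -c * g.1 x)) ∈ testFun :=
      testFun.sub_mem hf (testFun.sub_mem (osc_mem g.2) (testFun.smul_mem (-c) g.2))
    have hk' : (fun x => osc (e ^ 2 / (2 * L)) (L / (2 * Real.pi)) (Real.pi / (2 * L))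
        (Real.pi / L) g x + (r + c) * g.1 x) ∈ testFun :=
      testFun.add_mem (osc_mem g.2) (testFun.smul_mem ((r : ℂ) + c) g.2)
    rw [hr, map_smul, map_smul, add_assoc, ← add_smul, foldL_add L (T ∪ T') _ _ hk'.1.continuous
      (fun x => rfl)] at hx
    have hsum := foldL_add L (T ∪ T') hf.1.continuous hk'.1.continuous hk.1.continuous (c := -1)
      (fun x => by simp only [osc]; push_cast; ring) (toℋ₀ u)
    -- Two different covers give the same element of `𝒦`, so `f` and `g` may be folded over a common
    -- one.
    have hTT : foldL L T hf.1.continuous (toℋ₀ u) = foldL L (T ∪ T') hf.1.continuous (toℋ₀ u) :=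
      (incl_fold hL hf hT hu.1).symm.trans (incl_fold hL hf (hT.mono Finset.subset_union_left) hu.1)
    have h1 : ⟪η, foldL L T hf.1.continuous (toℋ₀ u)⟫_ℂ =
        ⟪η, foldL L (T ∪ T') hk.1.continuous (toℋ₀ u)⟫_ℂ := by
      rw [hTT, ← hsum, inner_add_right, inner_smul_right, hx, mul_zero, add_zero]
    rw [h1]
    have h2 := norm_inner_le_norm (𝕜 := ℂ) η (foldL L (T ∪ T') hk.1.continuous (toℋ₀ u))
    have h3 := norm_sq_foldL_le hL (T ∪ T') hk hu
    refine (pow_le_pow_left₀ (norm_nonneg _) h2 2).trans ?_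
    rw [mul_pow]
    refine mul_le_mul_of_nonneg_left (h3.trans ?_) (by positivity)
    exact mul_le_mul_of_nonneg_right hg.le (by positivity)
  by_contra h0
  have hpos : 0 < ‖⟪η, foldL L T hf.1.continuous (toℋ₀ u)⟫_ℂ‖ ^ 2 := by
    have := norm_pos_iff.2 h0
    positivity
  set A := ‖⟪η, foldL L T hf.1.continuous (toℋ₀ u)⟫_ℂ‖ ^ 2 with hA
  set B := ‖η‖ ^ 2 * ‖toℋ₀ u‖ ^ 2 with hB
  have hB0 : 0 ≤ B := by positivity
  have h1 := key (A / (2 * (B + 1))) (by positivity)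
  have h2 : ‖η‖ ^ 2 * (A / (2 * (B + 1)) * ‖toℋ₀ u‖ ^ 2) = A * (B / (2 * (B + 1))) := by
    rw [hB]
    ring
  rw [h2] at h1
  have h3 : B / (2 * (B + 1)) < 1 := by
    rw [div_lt_one (by positivity)]
    linarith
  nlinarith

/-- For fixed test function, pairing a deficiency vector with the elementary covariant functions is
linear in the Fock vector. It vanishes on the eigenvectors of `freeHam`, whose span contains `F00`,
and totality concludes. -/
theorem isEssentiallySelfAdjoint_dressed {e L : ℝ} (he : 0 < e) (hL : 0 < L) :
    IsEssentiallySelfAdjoint ((dressed e L ((bogRel e hL).group 1)).domRestrict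
      (LinearMap.range (incl L))) := by
  refine isEssentiallySelfAdjoint_of_deficiency ?_ ?_ fun c hc η hη => ?_
  · exact (dense_range_incl hL).mono fun x hx => ⟨hx, range_incl_le_domain e hL hx⟩
  · exact isFormalAdjoint_of_le (isFormalAdjoint_conjugate (isFormalAdjoint_closure
      (dense_range_incl hL) (isFormalAdjoint_hamiltonian e hL))) LinearPMap.domRestrict_le
  · refine eq_zero_of_inner_incl hL fun f hf T hT v hv => ?_
    let F : Fin𝓕 →ₗ[ℂ] ℂ := (innerSL ℂ η).toLinearMap ∘ₗ
      (foldL L T hf.1.continuous).toLinearMap ∘ₗ toℋ₀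
    have h : Submodule.span ℂ {u | u ∈ F00 ∧ ∃ N : ℕ, IsHom N u ∧ ∃ r : ℝ,
        freeHam e L N u = (r : ℂ) • u} ≤ LinearMap.ker F := by
      refine Submodule.span_le.2 ?_
      rintro u ⟨hu, N, hN, r, hr⟩
      refine inner_foldL_eq_zero he hL (c := c) ?_ (fun x y hx hxy => hη x y
        (mem_graph_domRestrict.2 ⟨hx, hxy⟩)) hu hN hr hf hT
      rcases hc with rfl | rfl <;> simp
    exact h (F00_le_span_eigenvectors e L hv)

end Schwinger

end

theorem theorem8 (e L : ℝ) (he : 0 < e) (hL : 0 < L) :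
    (∃! V : ℝ → Schwinger.ℋ₀ ≃ₗᵢ[ℂ] Schwinger.ℋ₀,
      Schwinger.IsUnitaryGroupGeneratedBy (Schwinger.bogoliubovZ e L).closure V) ∧
    ∀ V : ℝ → Schwinger.ℋ₀ ≃ₗᵢ[ℂ] Schwinger.ℋ₀,
      Schwinger.IsUnitaryGroupGeneratedBy (Schwinger.bogoliubovZ e L).closure V →
        LinearMap.range (Schwinger.incl L) ≤ (Schwinger.dressed e L (V 1)).domain ∧
        Schwinger.IsEssentiallySelfAdjoint
          ((Schwinger.dressed e L (V 1)).domRestrict (LinearMap.range (Schwinger.incl L))) := by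
  have hgen := Schwinger.isUnitaryGroupGeneratedBy_group e hL
  refine ⟨⟨(Schwinger.bogRel e hL).group, hgen, fun V hV => Schwinger.eq_group hL hV⟩, fun V hV => ?_⟩
  rw [Schwinger.eq_group hL hV]
  exact ⟨Schwinger.range_incl_le_domain e hL, Schwinger.isEssentiallySelfAdjoint_dressed he hL⟩
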